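/- Setting. Let $N\ge 1$, let $f:\mathbb{Z}^N\to\mathbb{C}$ be rapidly decreasing with $f[-z]=\overline{f[z]}$, and put $h_0(\xi)=\sum_{z\in\mathbb{Z}^N}e^{-iz\cdot\xi}f[z]$ (a real, smooth, $2\pi\mathbb{Z}^N$-periodic function on $\mathbb{R}^N$), $v=\nabla h_0$, $A={}^t\nabla\nabla h_0$, $\mathbb{T}^N=[-\pi,\pi)^N$. Assume that $\{h_0(\xi): v(\xi)=0\}$ has no interior points and that $\{\xi: v(\xi)\ne0,\ \det A(\xi)\neq 0\}$ is dense. Let $0<\varepsilon<1$ and let $V\in C^\infty(\mathbb{R}^N;\mathbb{R})$ satisfy $|\partial^\alpha V(x)|\le C_\alpha\langle x\rangle^{-|\alpha|-\varepsilon}$ for all $x$ and all multi-indices $\alpha$, where $\langle x\rangle=(1+|x|^2)^{1/2}$. For functions $u$ on $\mathbb{Z}^N$ put $H_0u[x]=\sum_{y}f[y]u[x-y]$ and $Hu[x]=H_0u[x]+V(x)u[x]$, and let $h(x,\xi)=h_0(\xi)+V(x)$. Let $\chi\in C^\infty(\mathbb{R}^N;\mathbb{R})$ with $\chi=0$ on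 $\{|x|\le1\}$ and $\chi=1$ on $\{|x|\ge2\}$. Write $\cos(x,w)=x\cdot w/(|x||w|)$, and $|M|=(\sum_{j,k}|M_{jk}|^2)^{1/2}$ for matrices. Proposition. There is a real-valued $\varphi\in C^\infty(\mathbb{R}^N\times(\mathbb{R}^N\setminus v^{-1}(0)))$ such that the following holds for every $a>0$. (0) There is $R_a$ such that $h(x,\nabla_x\varphi(x,\xi))=h_0(\xi)$ whenever $|x|\ge R_a$, $|v(\xi)|\ge a$ and $|\cos(x,v(\xi))|\ge\frac12$. (1) The function $\varphi_a(x,\xi)=(\varphi(x,\xi)-x\cdot\xi)\,\chi(v(\xi)/a)+x\cdot\xi$ (equal to $x\cdot\xi$ where $v(\xi)=0$) is in $C^\infty(\mathbb{R}^N\times\mathbb{R}^N)$, and $\varphi_a(x,\xi+2\pi m)=\varphi_a(x,\xi)+2\pi x\cdot m$ for $m\in\mathbb{Z}^N$. (2) For all multi-indices $\alpha,\beta$ there is $C_{\alpha\beta,a}$ such that on $\mathbb{R}^N\times\mathbb{R}^N$ $$|\partial_x^\alpha\partial_\xi^\beta[\varphi_a(x,\xi)-x\cdot\xi]|\le C_{\alpha\beta,a}\langle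 x\rangle^{1-\varepsilon-|\alpha|},\qquad |{}^t\nabla_x\nabla_\xi\varphi_a(x,\xi)-I|<\tfrac12 .$$ (3) Let, for $x,\xi\in\mathbb{R}^N$, $$s_a(x,\xi)=\sum_{z\in\mathbb{Z}^N}f[z]e^{i(\varphi_a(x-z,\xi)-\varphi_a(x,\xi))}+V(x)-h_0(\xi),$$ so that $s_a(x,\xi)=e^{-i\varphi_a(x,\xi)}H(e^{i\varphi_a(\cdot,\xi)})[x]-h_0(\xi)$ for $x\in\mathbb{Z}^N$. With $$J_au[x]=(2\pi)^{-N}\int_{\mathbb{T}^N}\sum_{y\in\mathbb{Z}^N}e^{i(\varphi_a(x,\xi)-y\cdot\xi)}u[y]\,d\xi ,$$ one has, for all $u\in\ell^2(\mathbb{Z}^N)$ and $x\in\mathbb{Z}^N$, $$(HJ_a-J_aH_0)u[x]=(2\pi)^{-N}\int_{\mathbb{T}^N}\sum_{y\in\mathbb{Z}^N}e^{i(\varphi_a(x,\xi)-y\cdot\xi)}s_a(x,\xi)u[y]\,d\xi,$$ where the sums over $y$ converge in $L^2(\mathbb{T}^N)$ and the sum over the lattice that defines $HJ_au[x]$ converges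 absolutely. (4) The function $s_a(x,\cdot)$ is smooth for each $x$, and for every $\beta$ there is $C_{\beta,a}$ such that for all $x,\xi\in\mathbb{R}^N$ with $|x|\ge1$ $$|\partial_\xi^\beta s_a(x,\xi)|\le\begin{cases}C_{\beta,a}\langle x\rangle^{-1-\varepsilon}, & |v(\xi)|\ge 2a,\ |\cos(x,v(\xi))|\ge\frac12,\\ C_{\beta,a}\langle x\rangle^{-\varepsilon}, & |v(\xi)|\ge a.\end{cases}$$ -/

import Mathlib

open scoped ContDiff

noncomputable section

namespace LatticeScattering

open MeasureTheory

/-- Euclidean space `ℝ^N`. -/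
abbrev E (N : ℕ) : Type := EuclideanSpace ℝ (Fin N)

/-- The lattice `ℤ^N`. -/
abbrev Lattice (N : ℕ) : Type := Fin N → ℤ

variable {N : ℕ}

/-- The inclusion `ℤ^N ⊂ ℝ^N`. -/
def lat (z : Lattice N) : E N := WithLp.toLp 2 (fun j => (z j : ℝ))

/-- The Japanese bracket `⟨x⟩ = (1 + |x|²)^{1/2}`. -/
def bracket (x : E N) : ℝ := Real.sqrt (1 + ‖x‖ ^ 2)

/-- The scalar product `x · ξ`. -/
def dot (x ξ : E N) : ℝ := inner ℝ x ξ

/-- The cosine `cos(x, w) = x · w / (|x| |w|)` of the angle between two nonzero vectors. -/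
def cosAngle (x w : E N) : ℝ := dot x w / (‖x‖ * ‖w‖)

/-- The partial derivative `∂_j g`. -/
def partialDeriv {F : Type*} [NormedAddCommGroup F] [NormedSpace ℝ F]
    (j : Fin N) (g : E N → F) : E N → F :=
  fun x => fderiv ℝ g x (EuclideanSpace.single j 1)

/-- The derivative `∂^α g = ∂_1^{α_1} ⋯ ∂_N^{α_N} g` with a multi-index `α`. -/
def multiDeriv {F : Type*} [NormedAddCommGroup F] [NormedSpace ℝ F]
    (α : Fin N → ℕ) (g : E N → F) : E N → F :=
  (List.finRange N).foldr (fun j G => (partialDeriv j)^[α j] G) g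

/-- The mixed derivative `∂_x^α ∂_ξ^β ψ (x, ξ)`. -/
def mixedDeriv (α β : Fin N → ℕ) (ψ : E N → E N → ℝ) (x ξ : E N) : ℝ :=
  multiDeriv α (fun x' => multiDeriv β (ψ x') ξ) x

/-- The matrix `ᵗ∇_x ∇_ξ ψ (x, ξ)`, with entries `∂_{x_j} ∂_{ξ_k} ψ (x, ξ)`. -/
def mixedHessian (ψ : E N → E N → ℝ) (x ξ : E N) : Matrix (Fin N) (Fin N) ℝ :=
  Matrix.of fun j k => partialDeriv j (fun x' => partialDeriv k (ψ x') ξ) x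

/-- The Hilbert-Schmidt norm `|M| = (∑_{j,k} |M_{jk}|²)^{1/2}` of a matrix. -/
def hsNorm (M : Matrix (Fin N) (Fin N) ℝ) : ℝ :=
  Real.sqrt (∑ j, ∑ k, (M j k) ^ 2)

/-! ### The free operator -/

/-- `f` is rapidly decreasing and `f[-z]` is the complex conjugate of `f[z]`. -/
structure IsHoppingFunction (f : Lattice N → ℂ) : Prop where
  rapid : ∀ k : ℕ, ∃ C : ℝ, ∀ z, bracket (lat z) ^ k * ‖f z‖ ≤ C
  symm : ∀ z, f (-z) = star (f z)

/-- The function `h₀(ξ) = ∑_z e^{-i z · ξ} f[z]`. It is real-valued when `f[-z]` is the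
conjugate of `f[z]` (see `h0_ofReal`), and is taken here as a `2π`-periodic real function on
`ℝ^N`. -/
def h0 (f : Lattice N → ℂ) (ξ : E N) : ℝ :=
  (∑' z, Complex.exp (-(Complex.I * (dot (lat z) ξ : ℝ))) * f z).re

theorem lat_neg (z : Lattice N) : lat (-z) = -lat z := by
  ext j
  simp [lat]

theorem h0_ofReal {f : Lattice N → ℂ} (hf : IsHoppingFunction f) (ξ : E N) :
    ((h0 f ξ : ℝ) : ℂ) = ∑' z, Complex.exp (-(Complex.I * (dot (lat z) ξ : ℝ))) * f z := by
  rw [h0, ← Complex.conj_eq_iff_re, Complex.conj_tsum]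
  rw [← (Equiv.neg (Lattice N)).tsum_eq]
  refine tsum_congr fun z => ?_
  simp only [Equiv.neg_apply, hf.symm, map_mul, ← Complex.exp_conj, lat_neg, dot, inner_neg_left]
  simp

/-- The velocity `v(ξ) = ∇_ξ h₀(ξ)`. -/
def velocity (f : Lattice N → ℂ) (ξ : E N) : E N := gradient (h0 f) ξ

/-- The Hessian matrix `A(ξ)` of `h₀`. -/
def hessian (f : Lattice N → ℂ) (ξ : E N) : Matrix (Fin N) (Fin N) ℝ :=
  Matrix.of fun j k => partialDeriv j (partialDeriv k (h0 f)) ξ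

/-- The fundamental domain `[-π, π)^N` of the torus `𝕋^N`. -/
def cell (N : ℕ) : Set (E N) := {ξ | ∀ j, -Real.pi ≤ ξ j ∧ ξ j < Real.pi}

/-- The set of threshold energies. -/
def thresholds (f : Lattice N → ℂ) : Set ℝ := h0 f '' {ξ | ξ ∈ cell N ∧ velocity f ξ = 0}

/-- The assumption on the free operator. Density in the torus is density in `ℝ^N` of the
`2π`-periodic set of representatives. -/
structure FreeAssumption (f : Lattice N → ℂ) : Prop where
  hopping : IsHoppingFunction f
  thresholds_interior : interior (thresholds f) = ∅
  dense : Dense {ξ : E N | velocity f ξ ≠ 0 ∧ (hessian f ξ).det ≠ 0}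

/-! ### The potential -/

/-- The function `V` on `ℝ^N` is smooth and `∂^α V = O(⟨x⟩^{-|α|-ε})` for every `α`. -/
structure IsLongRange (ε : ℝ) (V : E N → ℝ) : Prop where
  smooth : ContDiff ℝ ∞ V
  decay : ∀ α : Fin N → ℕ, ∃ C : ℝ, ∀ x,
    |multiDeriv α V x| ≤ C * bracket x ^ (-((∑ j, α j : ℕ) : ℝ) - ε)

/-- `H₀ u[x] = ∑_y f[y] u[x - y]`. -/
def freeOp (f : Lattice N → ℂ) (u : Lattice N → ℂ) (x : Lattice N) : ℂ :=
  ∑' y, f y * u (x - y)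

/-- `H u[x] = H₀ u[x] + V[x] u[x]`, where `V[x]` is the value of `V` at a lattice point. -/
def fullOp (f : Lattice N → ℂ) (V : E N → ℝ) (u : Lattice N → ℂ) (x : Lattice N) : ℂ :=
  freeOp f u x + (V (lat x) : ℂ) * u x

/-! ### Oscillatory integral operators -/

/-- Lebesgue measure on `[-π, π)^N`. -/
def torusMeasure (N : ℕ) : Measure (E N) := volume.restrict (cell N)

instance : IsFiniteMeasure (torusMeasure N) := by
  unfold torusMeasure
  rw [isFiniteMeasure_restrict]
  have hb : Bornology.IsBounded (cell N) := by
    refine (Metric.isBounded_iff_subset_closedBall 0).2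
      ⟨Real.sqrt (∑ _j : Fin N, Real.pi ^ 2), fun ξ hξ => ?_⟩
    rw [mem_closedBall_zero_iff, EuclideanSpace.norm_eq]
    refine Real.sqrt_le_sqrt (Finset.sum_le_sum fun j _ => ?_)
    rw [Real.norm_eq_abs]
    exact pow_le_pow_left₀ (abs_nonneg _) (abs_le.2 ⟨(hξ j).1, (hξ j).2.le⟩) 2
  exact hb.measure_lt_top.ne

theorem memLp_char (y : Lattice N) :
    MemLp (fun ξ : E N => Complex.exp (-(Complex.I * (dot (lat y) ξ : ℝ)))) 2
      (torusMeasure N) := by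
  refine MemLp.of_bound (C := 1) (Continuous.aestronglyMeasurable ?_) ?_
  · unfold dot
    fun_prop
  · refine Filter.Eventually.of_forall fun ξ => ?_
    simp [Complex.norm_exp]

/-- The function `ξ ↦ e^{-i y · ξ}` in `L²(𝕋^N)`. -/
def char (y : Lattice N) : Lp ℂ 2 (torusMeasure N) := (memLp_char y).toLp _

/-- The Fourier series `∑_y e^{-i y · ξ} u[y]` of `u ∈ ℓ²(ℤ^N)`, convergent in `L²(𝕋^N)`. -/
def fourierSum (u : Lattice N → ℂ) : Lp ℂ 2 (torusMeasure N) := ∑' y, u y • char y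

/-- The operator
`u ↦ (2π)^{-N} ∫_{𝕋^N} ∑_y e^{i (ϕ(x, ξ) - y · ξ)} s(x, ξ) u[y] dξ`
with phase `ϕ` and symbol `s`; the series converges in `L²(𝕋^N)`. -/
def oscOp (ϕ : E N → E N → ℝ) (s : E N → E N → ℂ) (u : Lattice N → ℂ) (x : Lattice N) : ℂ :=
  (((2 * Real.pi) ^ N)⁻¹ : ℝ) *
    ∫ ξ, Complex.exp (Complex.I * (ϕ (lat x) ξ : ℝ)) * s (lat x) ξ * fourierSum u ξ
      ∂(torusMeasure N)

/-- The cut-off phase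
`φ_a(x, ξ) = (φ(x, ξ) - x · ξ) χ(v(ξ) / a) + x · ξ`. -/
def cutPhase (f : Lattice N → ℂ) (χ : E N → ℝ) (φ : E N → E N → ℝ) (a : ℝ) (x ξ : E N) : ℝ :=
  (φ x ξ - dot x ξ) * χ (a⁻¹ • velocity f ξ) + dot x ξ

/-- The symbol
`s(x, ξ) = ∑_z f[z] e^{i (ϕ(x - z, ξ) - ϕ(x, ξ))} + V(x) - h₀(ξ)`, for all `x ∈ ℝ^N`. -/
def symbol (f : Lattice N → ℂ) (V : E N → ℝ) (ϕ : E N → E N → ℝ) (x ξ : E N) : ℂ :=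
  (∑' z, f z * Complex.exp (Complex.I * ((ϕ (x - lat z) ξ - ϕ x ξ : ℝ) : ℂ)))
    + (V x : ℂ) - (h0 f ξ : ℂ)

end LatticeScattering

end

/-! The phase comes from the classical mechanics of `h = h₀ + V`. If `x` does not move against
`v(ξ)`, there is a trajectory that starts at `x` and whose momentum tends to `ξ` at infinite time.
Its momentum `ξ + Q(τ)` solves `Q(τ) = ∫_τ^∞ ∇V(x + ∫_0^s v(ξ + Q)) ds`. Once `V` is cut off far
enough out, this is a contraction (`exists_fixed`).

All derivatives must be bounded uniformly in `(x, ξ)`. To this end the equation is solved for all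
starting points at once, in the bounded continuous functions on `I × ℝ` with `I` a discrete set of
starting points, and the implicit function theorem is applied to the displaced points `(x + ⟨x⟩ δ₁,
ξ + δ₂)`. One smooth Banach-space-valued map of `δ` then bounds every derivative for every starting
point, and because `δ₁` is scaled by `⟨x⟩` these bounds are symbol estimates, of order `-ε` for `Q`
(`exists_trajField`).

The symplectic form of two variations of a trajectory is conserved and vanishes at infinity, so `∂_x
Q(0)` is symmetric (`IsLinTraj.symm`). Hence `Q(0) = ∇_x ψ` for a function `ψ` of order `1 - ε`
(`jetBdd_genPhase`, `hasGradientAt_genPhase`), and conservation of energy is the eikonal equation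
for `x · ξ + ψ` (`energy_conservation`). Incoming regions are outgoing regions for `(-h₀, -V)`,
which has the same eikonal equation.

This construction needs `|v| > b`. The pieces for `b = 2^{-(k+1)}` are glued by a dyadic partition
of unity in `|v|` and cut off at radii `R_k` so large that their derivatives are of size `4^{-k}`.
Far out the pieces have equal gradients, by uniqueness of trajectories, so gluing preserves the
eikonal equation, while the smallness controls the mixed Hessian uniformly in `a`
(`ScatteringHyp.exists_isCorrection`).

For the symbol, the exponent `φ_a(x - z, ξ) - φ_a(x, ξ)` is compared with `-z · ξ`, which gives
`⟨x⟩^{-ε}`, or with `-z · ∇_x φ_a`, which gives `⟨x⟩^{-1-ε}` up to the eikonal error `h₀(∇_x φ_a) +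
V - h₀(ξ)`. That error vanishes to infinite order at the points far out in the outgoing and incoming
regions (`ScatteringHyp.iteratedFDeriv_eikonal_eq_zero`). The rapid decay of `f` absorbs all powers
of `⟨z⟩`. The commutation formula is Fourier analysis on the torus (`fullOp_oscOp_sub`). -/

set_option linter.unusedSectionVars false

open scoped ContDiff

noncomputable section

namespace LatticeScattering

open MeasureTheory

/-! ### Germs of smooth functions with weighted derivative bounds -/

section Jets

variable {J J' X Y F F' F'' : Type*}
  [NormedAddCommGroup X] [NormedSpace ℝ X] [NormedAddCommGroup Y] [NormedSpace ℝ Y]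
  [NormedAddCommGroup F] [NormedSpace ℝ F] [NormedAddCommGroup F'] [NormedSpace ℝ F']
  [NormedAddCommGroup F''] [NormedSpace ℝ F'']

/-- Smoothness at a point gives, for each finite order, a neighbourhood that may shrink with the
order. This is enough to carry estimates for `iteratedFDerivWithin` on open sets over to germs. -/
theorem exists_isOpen_contDiffOn {f : X → F} {x : X} (hf : ContDiffAt ℝ ∞ f x) (n : ℕ) :
    ∃ u, IsOpen u ∧ x ∈ u ∧ ContDiffOn ℝ n f u := by
  have h : ContDiffAt ℝ n f x := hf.of_le (by exact_mod_cast le_top)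
  obtain ⟨u, hu, hfu⟩ := h.contDiffOn (m := n) le_rfl (by simp)
  obtain ⟨w, hwu, hw, hxw⟩ := mem_nhds_iff.1 (by simpa using hu)
  exact ⟨w, hw, hxw, hfu.mono hwu⟩

theorem norm_iteratedFDeriv_bilin_le (B : F →L[ℝ] F' →L[ℝ] F'') {f : X → F} {g : X → F'} {x : X}
    (hf : ContDiffAt ℝ ∞ f x) (hg : ContDiffAt ℝ ∞ g x) (n : ℕ) :
    ‖iteratedFDeriv ℝ n (fun y => B (f y) (g y)) x‖ ≤ ‖B‖ * ∑ i ∈ Finset.range (n + 1),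
      (n.choose i : ℝ) * ‖iteratedFDeriv ℝ i f x‖ * ‖iteratedFDeriv ℝ (n - i) g x‖ := by
  obtain ⟨u, hu, hxu, hfu⟩ := exists_isOpen_contDiffOn hf n
  obtain ⟨w, hw, hxw, hgw⟩ := exists_isOpen_contDiffOn hg n
  have hs := hu.inter hw
  have hx : x ∈ u ∩ w := ⟨hxu, hxw⟩
  have := B.norm_iteratedFDerivWithin_le_of_bilinear (hfu.mono Set.inter_subset_left)
    (hgw.mono Set.inter_subset_right) hs.uniqueDiffOn hx le_rfl
  simpa only [iteratedFDerivWithin_of_isOpen _ hs hx] using this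

theorem exists_norm_iteratedFDeriv_bilin_le (B : F →L[ℝ] F' →L[ℝ] F'') :
    ∃ K, 0 ≤ K ∧ ∀ (f : X → F) (g : X → F') (x : X), ContDiffAt ℝ ∞ f x → ContDiffAt ℝ ∞ g x →
      ∀ n : ℕ, ‖iteratedFDeriv ℝ n (fun y => B (f y) (g y)) x‖ ≤
        K * ∑ i ∈ Finset.range (n + 1),
          (n.choose i : ℝ) * ‖iteratedFDeriv ℝ i f x‖ * ‖iteratedFDeriv ℝ (n - i) g x‖ :=
  ⟨‖B‖, B.opNorm_nonneg, fun _ _ _ hf hg n => norm_iteratedFDeriv_bilin_le B hf hg n⟩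

theorem norm_iteratedFDeriv_comp_le_at {g : F → F'} {f : X → F} {x : X}
    (hg : ContDiffAt ℝ ∞ g (f x)) (hf : ContDiffAt ℝ ∞ f x) (n : ℕ) {C D : ℝ}
    (hC : ∀ i, i ≤ n → ‖iteratedFDeriv ℝ i g (f x)‖ ≤ C)
    (hD : ∀ i, 1 ≤ i → i ≤ n → ‖iteratedFDeriv ℝ i f x‖ ≤ D ^ i) :
    ‖iteratedFDeriv ℝ n (fun y => g (f y)) x‖ ≤ n.factorial * C * D ^ n := by
  obtain ⟨w, hw, hxw, hgw⟩ := exists_isOpen_contDiffOn hg n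
  obtain ⟨u, hu, hxu, hfu⟩ := exists_isOpen_contDiffOn hf n
  have hs : IsOpen (u ∩ f ⁻¹' w) := hfu.continuousOn.isOpen_inter_preimage hu hw
  have hx : x ∈ u ∩ f ⁻¹' w := ⟨hxu, hxw⟩
  have := norm_iteratedFDerivWithin_comp_le hgw (hfu.mono Set.inter_subset_left) le_rfl
    hw.uniqueDiffOn hs.uniqueDiffOn (fun y hy => hy.2) hx (C := C) (D := D)
    (fun i hi => by simpa only [iteratedFDerivWithin_of_isOpen _ hw hxw] using hC i hi)
    (fun i h1 hi => by simpa only [iteratedFDerivWithin_of_isOpen _ hs hx] using hD i h1 hi)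
  rwa [iteratedFDerivWithin_of_isOpen _ hs hx] at this

theorem iteratedFDeriv_comp_clm {f : Y → F} (T : X →L[ℝ] Y) {x : X}
    (hf : ContDiffAt ℝ ∞ f (T x)) (n : ℕ) :
    iteratedFDeriv ℝ n (fun y => f (T y)) x =
      (iteratedFDeriv ℝ n f (T x)).compContinuousLinearMap fun _ => T := by
  obtain ⟨w, hw, hxw, hgw⟩ := exists_isOpen_contDiffOn hf n
  have hs : IsOpen (T ⁻¹' w) := hw.preimage T.continuous
  have := T.iteratedFDerivWithin_comp_right hgw hw.uniqueDiffOn hs.uniqueDiffOn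
    (x := x) hxw le_rfl
  rwa [iteratedFDerivWithin_of_isOpen _ hs hxw, iteratedFDerivWithin_of_isOpen _ hw hxw] at this

theorem norm_iteratedFDeriv_comp_clm_le {f : Y → F} (T : X →L[ℝ] Y) {x : X}
    (hf : ContDiffAt ℝ ∞ f (T x)) (n : ℕ) :
    ‖iteratedFDeriv ℝ n (fun y => f (T y)) x‖ ≤ ‖iteratedFDeriv ℝ n f (T x)‖ * ‖T‖ ^ n := by
  rw [iteratedFDeriv_comp_clm T hf]
  refine (ContinuousMultilinearMap.norm_compContinuousLinearMap_le _ _).trans ?_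
  simp

/-- A family of germs at `0` of smooth functions, with derivatives of each order bounded
by a multiple of the weight `m`. -/
structure JetBdd (m : J → ℝ) (G : J → X → F) : Prop where
  smooth : ∀ j, ContDiffAt ℝ ∞ (G j) 0
  bound : ∀ n, ∃ C, 0 ≤ C ∧ ∀ j, ‖iteratedFDeriv ℝ n (G j) 0‖ ≤ C * m j

namespace JetBdd

variable {m m₁ m₂ : J → ℝ} {G : J → X → F} {H : J → X → F'}

theorem le_bound (h : JetBdd m G) : ∃ C, 0 ≤ C ∧ ∀ j, ‖G j 0‖ ≤ C * m j := by
  simpa using h.bound 0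

theorem of_eventuallyEq {G' : J → X → F} (h : JetBdd m G) (hG : ∀ j, G' j =ᶠ[nhds 0] G j) :
    JetBdd m G' :=
  ⟨fun j => (h.smooth j).congr_of_eventuallyEq (hG j), fun n => by
    obtain ⟨C, hC, hb⟩ := h.bound n
    exact ⟨C, hC, fun j => by 
      rw [((hG j).iteratedFDeriv ℝ n).eq_of_nhds]; exact hb j⟩⟩

theorem mono (h : JetBdd m₁ G) {c : ℝ} (hc : 0 ≤ c) (hm : ∀ j, m₁ j ≤ c * m₂ j) :
    JetBdd m₂ G :=
  ⟨h.smooth, fun n => by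
    obtain ⟨C, hC, hb⟩ := h.bound n
    refine ⟨C * c, by positivity, fun j => (hb j).trans ?_⟩
    rw [mul_assoc]
    exact mul_le_mul_of_nonneg_left (hm j) hC⟩

theorem reindex (h : JetBdd m G) (k : J' → J) : JetBdd (fun j => m (k j)) (fun j => G (k j)) :=
  ⟨fun j => h.smooth _, fun n => by
    obtain ⟨C, hC, hb⟩ := h.bound n
    exact ⟨C, hC, fun j => hb _⟩⟩

theorem const {c : J → F} (hc : ∀ j, ‖c j‖ ≤ m j) : JetBdd m (fun j (_ : X) => c j) := by
  refine ⟨fun j => contDiffAt_const, fun n => ⟨1, zero_le_one, fun j => ?_⟩⟩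
  rw [one_mul]
  rcases Nat.eq_zero_or_pos n with rfl | hn
  · simpa using hc j
  · rw [iteratedFDeriv_const_of_ne hn.ne']
    simpa using (norm_nonneg _).trans (hc j)

theorem single {f : X → F} (hf : ContDiffAt ℝ ∞ f 0) : JetBdd (fun _ : J => 1) (fun _ => f) :=
  ⟨fun _ => hf, fun n => ⟨‖iteratedFDeriv ℝ n f 0‖, norm_nonneg _, fun _ => by simp⟩⟩

theorem bilin (B : F →L[ℝ] F' →L[ℝ] F'') (hG : JetBdd m₁ G) (hH : JetBdd m₂ H) :
    JetBdd (fun j => m₁ j * m₂ j) (fun j x => B (G j x) (H j x)) := by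
  refine ⟨fun j => B.isBoundedBilinearMap.contDiff.contDiffAt.comp₂ (hG.smooth j) (hH.smooth j),
    fun n => ?_⟩
  choose C hC hCb using hG.bound
  choose D hD hDb using hH.bound
  refine ⟨‖B‖ * ∑ i ∈ Finset.range (n + 1), (n.choose i : ℝ) * C i * D (n - i), ?_, fun j => ?_⟩
  · exact mul_nonneg B.opNorm_nonneg (Finset.sum_nonneg fun i _ =>
      mul_nonneg (mul_nonneg (Nat.cast_nonneg _) (hC i)) (hD _))
  refine (norm_iteratedFDeriv_bilin_le B (hG.smooth j) (hH.smooth j) n).trans ?_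
  rw [mul_assoc]
  refine mul_le_mul_of_nonneg_left ?_ B.opNorm_nonneg
  rw [Finset.sum_mul]
  refine Finset.sum_le_sum fun i _ => ?_
  have h1 := hCb i j
  have h2 := hDb (n - i) j
  calc (n.choose i : ℝ) * ‖iteratedFDeriv ℝ i (G j) 0‖ * ‖iteratedFDeriv ℝ (n - i) (H j) 0‖
      ≤ (n.choose i : ℝ) * (C i * m₁ j) * (D (n - i) * m₂ j) := by
        have := (norm_nonneg _).trans h1
        gcongr
    _ = _ := by ring

theorem clm {w : J → ℝ} (L : J → F →L[ℝ] F') (hL : ∀ j, ‖L j‖ ≤ w j) (hG : JetBdd m G) :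
    JetBdd (fun j => w j * m j) (fun j x => L j (G j x)) := by
  refine ⟨fun j => (L j).contDiff.contDiffAt.comp _ (hG.smooth j), fun n => ?_⟩
  obtain ⟨C, hC, hb⟩ := hG.bound n
  refine ⟨C, hC, fun j => ?_⟩
  refine ((L j).norm_iteratedFDeriv_comp_left (hG.smooth j) (by exact_mod_cast le_top)).trans ?_
  calc _ ≤ w j * (C * m j) :=
        mul_le_mul (hL j) (hb j) (norm_nonneg _) ((norm_nonneg _).trans (hL j))
    _ = _ := by ring

theorem clm_const (L : F →L[ℝ] F') (hG : JetBdd m G) : JetBdd m (fun j x => L (G j x)) :=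
  (hG.clm (w := fun _ => ‖L‖) (fun _ => L) (fun _ => le_rfl)).mono (norm_nonneg L)
    (fun _ => le_rfl)

theorem smul_weight (c : J → ℝ) (hG : JetBdd m G) :
    JetBdd (fun j => |c j| * m j) (fun j x => c j • G j x) :=
  hG.clm (fun j => c j • ContinuousLinearMap.id ℝ F) fun j => by
    rw [norm_smul, Real.norm_eq_abs]
    exact mul_le_of_le_one_right (abs_nonneg _) ContinuousLinearMap.norm_id_le

theorem add {G' : J → X → F} (hG : JetBdd m G) (hH : JetBdd m G') :
    JetBdd m (fun j x => G j x + G' j x) := by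
  refine ⟨fun j => (hG.smooth j).add (hH.smooth j), fun n => ?_⟩
  obtain ⟨C, hC, hb⟩ := hG.bound n
  obtain ⟨D, hD, hd⟩ := hH.bound n
  refine ⟨C + D, by positivity, fun j => ?_⟩
  have h1 : ContDiffAt ℝ n (G j) 0 := (hG.smooth j).of_le (by exact_mod_cast le_top)
  have h2 : ContDiffAt ℝ n (G' j) 0 := (hH.smooth j).of_le (by exact_mod_cast le_top)
  have := iteratedFDeriv_add_apply h1 h2
  change ‖iteratedFDeriv ℝ n (G j + G' j) 0‖ ≤ _
  rw [this, add_mul]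
  exact (norm_add_le _ _).trans (add_le_add (hb j) (hd j))

theorem sum {ι : Type*} (s : Finset ι) {g : ι → J → X → F} (hm : ∀ j, 0 ≤ m j)
    (h : ∀ i ∈ s, JetBdd m (g i)) : JetBdd m (fun j x => ∑ i ∈ s, g i j x) := by
  classical
  induction s using Finset.induction_on with
  | empty => simpa using JetBdd.const (X := X) (c := fun _ => (0 : F)) (by simpa using hm)
  | insert a s ha ih =>
    simp only [Finset.sum_insert ha]
    exact (h a (by simp)).add (ih fun i hi => h i (by simp [hi]))

theorem comp_right {D : ℝ} (T : J → Y →L[ℝ] X) (hT : ∀ j, ‖T j‖ ≤ D) (hG : JetBdd m G) :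
    JetBdd m (fun j y => G j (T j y)) := by
  have hs : ∀ j, ContDiffAt ℝ ∞ (G j) (T j 0) := fun j => by simpa using hG.smooth j
  refine ⟨fun j => (hs j).comp _ (T j).contDiff.contDiffAt, fun n => ?_⟩
  obtain ⟨C, hC, hb⟩ := hG.bound n
  refine ⟨C * |D| ^ n, by positivity, fun j => ?_⟩
  refine (norm_iteratedFDeriv_comp_clm_le (T j) (hs j) n).trans ?_
  have h1 := hb j
  rw [map_zero]
  calc _ ≤ (C * m j) * |D| ^ n := by
        have := (norm_nonneg _).trans h1
        gcongr
        exact (hT j).trans (le_abs_self _)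
    _ = _ := by ring

/-- Composition with outer functions whose derivatives are bounded along the family. -/
theorem comp' {K : J → F → F'} (hs : ∀ j, ContDiffAt ℝ ∞ (G j) 0)
    (hG : ∀ n, 1 ≤ n → ∃ C, ∀ j, ‖iteratedFDeriv ℝ n (G j) 0‖ ≤ C)
    (hKs : ∀ j, ContDiffAt ℝ ∞ (K j) (G j 0))
    (hK : ∀ n, ∃ C, 0 ≤ C ∧ ∀ j, ‖iteratedFDeriv ℝ n (K j) (G j 0)‖ ≤ C * m j)
    (hm : ∀ j, 0 ≤ m j) :
    JetBdd m (fun j x => K j (G j x)) := by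
  refine ⟨fun j => (hKs j).comp _ (hs j), fun n => ?_⟩
  choose C hC hCb using hK
  choose! D hD using hG
  -- The composition estimate wants bounds of the form `D' ^ i`. With `D' ≥ 1` larger than every `|D
  -- i|`, one has `D i ≤ D' ≤ D' ^ i` for `i ≥ 1`.
  set D' : ℝ := 1 + ∑ i ∈ Finset.range (n + 1), |D i|
  have hD1 : 1 ≤ D' := le_add_of_nonneg_right (Finset.sum_nonneg fun _ _ => abs_nonneg _)
  set C' : ℝ := ∑ i ∈ Finset.range (n + 1), C i
  have hC' : 0 ≤ C' := Finset.sum_nonneg fun _ _ => hC _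
  refine ⟨n.factorial * C' * D' ^ n, by positivity, fun j => ?_⟩
  have := norm_iteratedFDeriv_comp_le_at (hKs j) (hs j) n (C := C' * m j) (D := D') ?_ ?_
  · exact this.trans (le_of_eq (by ring))
  · intro i hi
    refine (hCb i j).trans (mul_le_mul_of_nonneg_right ?_ (hm j))
    exact Finset.single_le_sum (f := C) (fun _ _ => hC _) (Finset.mem_range.2 (by omega))
  · intro i h1 hi
    have h2 : |D i| ≤ ∑ i ∈ Finset.range (n + 1), |D i| :=
      Finset.single_le_sum (f := fun i => |D i|) (fun _ _ => abs_nonneg _)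
        (Finset.mem_range.2 (by omega))
    calc _ ≤ D i := hD i h1 j
      _ ≤ D' := by linarith [le_abs_self (D i)]
      _ ≤ D' ^ i := le_self_pow₀ hD1 (by omega)

theorem comp {K : F → F'} (hG : JetBdd (fun _ => 1) G) (hKs : ∀ j, ContDiffAt ℝ ∞ K (G j 0))
    (hK : ∀ n, ∃ C, ∀ j, ‖iteratedFDeriv ℝ n K (G j 0)‖ ≤ C) :
    JetBdd (fun _ => 1) (fun j x => K (G j x)) :=
  comp' hG.smooth (fun n _ => by
      obtain ⟨C, -, hb⟩ := hG.bound n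
      exact ⟨C, fun j => by simpa using hb j⟩) hKs
    (fun n => by
      obtain ⟨C, hb⟩ := hK n
      exact ⟨|C|, abs_nonneg _, fun j => (hb j).trans (by simpa using le_abs_self C)⟩)
    (fun _ => zero_le_one)

/-- Each derivative of `K` is continuous on the compact set, hence bounded there. This serves outer
functions, such as the cosine of an angle, that are singular elsewhere. -/
theorem comp_compact {K : F → F'} {S : Set F} (hS : IsCompact S)
    (hK : ∀ y ∈ S, ContDiffAt ℝ ∞ K y) (hG : JetBdd (fun _ => 1) G) (hGS : ∀ j, G j 0 ∈ S) :
    JetBdd (fun _ => 1) (fun j x => K (G j x)) := by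
  refine hG.comp (fun j => hK _ (hGS j)) fun n => ?_
  have hc : ContinuousOn (iteratedFDeriv ℝ n K) S := fun y hy =>
    ((hK y hy).iteratedFDeriv_right (m := 0) (i := n)
      (by simpa using mod_cast le_top)).continuousAt.continuousWithinAt
  obtain ⟨C, hC⟩ := hS.exists_bound_of_continuousOn hc
  exact ⟨C, fun j => hC _ (hGS j)⟩

theorem prodMk (hG : JetBdd m G) (hH : JetBdd m H) : JetBdd m (fun j x => (G j x, H j x)) := by
  have := (hG.clm_const (ContinuousLinearMap.inl ℝ F F')).add
    (hH.clm_const (ContinuousLinearMap.inr ℝ F F'))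
  simpa using this

theorem fderiv (hG : JetBdd m G) : JetBdd m (fun j => fderiv ℝ (G j)) :=
  ⟨fun j => (hG.smooth j).fderiv_right (by simp), fun n => by
    obtain ⟨C, hC, hb⟩ := hG.bound (n + 1)
    exact ⟨C, hC, fun j => by rw [norm_iteratedFDeriv_fderiv]; exact hb j⟩⟩

section CompSub

variable {J : Type*} {X F : Type} [NormedAddCommGroup X] [NormedSpace ℝ X]
  [NormedAddCommGroup F] [NormedSpace ℝ F] {m : J → ℝ} {G₁ G₂ : J → X → F}

/-- Induction on the order through `D(K∘G₁ - K∘G₂) = DK(G₁) ∘ D(G₁ - G₂) + (DK(G₁) - DK(G₂)) ∘ DG₂`.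
The last difference has the same shape with `DK` in place of `K`, so the target space varies in the
induction. Only derivatives of order at least one of `G₁` and `G₂` are assumed bounded, because the
phases to which this is applied are themselves unbounded. -/
theorem comp_sub_aux (hs₁ : ∀ j, ContDiffAt ℝ ∞ (G₁ j) 0) (hs₂ : ∀ j, ContDiffAt ℝ ∞ (G₂ j) 0)
    (hG₁ : ∀ n, 1 ≤ n → ∃ C, ∀ j, ‖iteratedFDeriv ℝ n (G₁ j) 0‖ ≤ C)
    (hG₂ : ∀ n, 1 ≤ n → ∃ C, ∀ j, ‖iteratedFDeriv ℝ n (G₂ j) 0‖ ≤ C)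
    (hD : JetBdd m (fun j x => G₁ j x - G₂ j x)) (n : ℕ) :
    ∀ (F' : Type) [NormedAddCommGroup F'] [NormedSpace ℝ F'] (K : F → F'), ContDiff ℝ ∞ K →
      (∀ n, ∃ C, ∀ y, ‖iteratedFDeriv ℝ n K y‖ ≤ C) →
      ∃ C, 0 ≤ C ∧ ∀ j, ‖iteratedFDeriv ℝ n (fun x => K (G₁ j x) - K (G₂ j x)) 0‖ ≤ C * m j := by
  induction n using Nat.strong_induction_on with
  | _ n ih =>
    intro F' _ _ K hK hb
    have hb' : ∀ n, ∃ C, ∀ y, ‖iteratedFDeriv ℝ n (_root_.fderiv ℝ K) y‖ ≤ C := fun n => by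
      simpa only [norm_iteratedFDeriv_fderiv] using hb (n + 1)
    have hK' : ContDiff ℝ ∞ (_root_.fderiv ℝ K) := hK.fderiv_right (by simp)
    have hdK : Differentiable ℝ K := hK.differentiable (by simp)
    cases n with
    | zero =>
      obtain ⟨C, hC⟩ := hb 1
      obtain ⟨D, hD0, hDb⟩ := hD.le_bound
      have hC0 : 0 ≤ C := (norm_nonneg _).trans (hC 0)
      refine ⟨C * D, by positivity, fun j => ?_⟩
      have h1 := Convex.norm_image_sub_le_of_norm_fderiv_le (𝕜 := ℝ) (f := K) (s := Set.univ)
        (C := C) (fun x _ => hdK x) (fun x _ => by simpa using hC x) convex_univ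
        (Set.mem_univ (G₂ j 0)) (Set.mem_univ (G₁ j 0))
      simp only [norm_iteratedFDeriv_zero]
      refine h1.trans ?_
      rw [mul_assoc]
      exact mul_le_mul_of_nonneg_left (hDb j) hC0
    | succ n =>
      have e : ∀ j, _root_.fderiv ℝ (fun x => K (G₁ j x) - K (G₂ j x)) =ᶠ[nhds 0] fun x =>
          ContinuousLinearMap.compL ℝ X F F' (_root_.fderiv ℝ K (G₁ j x))
            (_root_.fderiv ℝ (fun x => G₁ j x - G₂ j x) x)
          + ContinuousLinearMap.compL ℝ X F F'
            (_root_.fderiv ℝ K (G₁ j x) - _root_.fderiv ℝ K (G₂ j x)) (_root_.fderiv ℝ (G₂ j) x) := by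
        intro j
        filter_upwards [((hs₁ j).of_le (m := 1) (by simp)).eventually (by simp),
          ((hs₂ j).of_le (m := 1) (by simp)).eventually (by simp)] with x h1 h2
        have d1 := h1.differentiableAt (by simp)
        have d2 := h2.differentiableAt (by simp)
        have e1 := (hdK (G₁ j x)).hasFDerivAt.comp x d1.hasFDerivAt
        have e2 := (hdK (G₂ j x)).hasFDerivAt.comp x d2.hasFDerivAt
        refine (e1.fun_sub e2).fderiv.trans ?_
        rw [fderiv_fun_sub d1 d2]
        ext y
        simp
      have t1 : JetBdd m (fun j x =>
          ContinuousLinearMap.compL ℝ X F F' (_root_.fderiv ℝ K (G₁ j x))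
            (_root_.fderiv ℝ (fun x => G₁ j x - G₂ j x) x)) := by
        have a : JetBdd (fun _ => 1) (fun j x => _root_.fderiv ℝ K (G₁ j x)) := by
          refine comp' hs₁ hG₁ (fun j => hK'.contDiffAt) (fun n => ?_) (fun _ => zero_le_one)
          obtain ⟨C, hC⟩ := hb' n
          exact ⟨|C|, abs_nonneg _, fun j => (hC _).trans (by simpa using le_abs_self C)⟩
        simpa using JetBdd.bilin (ContinuousLinearMap.compL ℝ X F F') a hD.fderiv
      obtain ⟨C₁, hC₁, hb₁⟩ := t1.bound n
      have ih' : ∀ i, i ≤ n → ∃ C, 0 ≤ C ∧ ∀ j, ‖iteratedFDeriv ℝ i (fun x =>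
          _root_.fderiv ℝ K (G₁ j x) - _root_.fderiv ℝ K (G₂ j x)) 0‖ ≤ C * m j :=
        fun i hi => ih i (by omega) (F →L[ℝ] F') (_root_.fderiv ℝ K) hK' hb'
      choose! A hA hAb using ih'
      choose! B hB using hG₂
      obtain ⟨κ, hκ, hκb⟩ :=
        exists_norm_iteratedFDeriv_bilin_le (X := X) (ContinuousLinearMap.compL ℝ X F F')
      refine ⟨C₁ + κ * ∑ i ∈ Finset.range (n + 1), (n.choose i : ℝ) * |A i| * |B (n - i + 1)|,
        ?_, fun j => ?_⟩
      · refine add_nonneg hC₁ (mul_nonneg hκ (Finset.sum_nonneg fun i _ => ?_))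
        positivity
      have s3 : ContDiffAt ℝ ∞ (fun x => _root_.fderiv ℝ K (G₁ j x) - _root_.fderiv ℝ K (G₂ j x)) 0 :=
        (hK'.contDiffAt.comp _ (hs₁ j)).sub (hK'.contDiffAt.comp _ (hs₂ j))
      have s4 : ContDiffAt ℝ ∞ (_root_.fderiv ℝ (G₂ j)) 0 := (hs₂ j).fderiv_right (by simp)
      have s5 := (ContinuousLinearMap.compL ℝ X F F').isBoundedBilinearMap.contDiff.contDiffAt.comp₂
        s3 s4 (n := ∞)
      rw [← norm_iteratedFDeriv_fderiv, ((e j).iteratedFDeriv ℝ n).eq_of_nhds]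
      have := iteratedFDeriv_add_apply (x := (0 : X)) ((t1.smooth j).of_le (m := n) (by exact_mod_cast le_top))
        (s5.of_le (m := n) (by exact_mod_cast le_top))
      refine (congrArg norm this).trans_le ((norm_add_le _ _).trans ?_)
      rw [add_mul]
      refine add_le_add (hb₁ j) ((hκb _ _ _ s3 s4 n).trans ?_)
      rw [mul_assoc]
      refine mul_le_mul_of_nonneg_left ?_ hκ
      rw [Finset.sum_mul]
      refine Finset.sum_le_sum fun i hi => ?_
      have hi' : i ≤ n := by simpa [Nat.lt_succ_iff] using hi
      have h1 := hAb i hi' j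
      have h2 := hB (n - i + 1) (by omega) j
      rw [← norm_iteratedFDeriv_fderiv] at h2
      rw [abs_of_nonneg (hA i hi')]
      calc _ ≤ (n.choose i : ℝ) * (A i * m j) * |B (n - i + 1)| := by
            have := (norm_nonneg _).trans h1
            gcongr
            exact h2.trans (le_abs_self _)
        _ = _ := by ring

/-- The difference of two compositions is controlled by the difference of the inner functions. -/
theorem comp_sub {F' : Type} [NormedAddCommGroup F'] [NormedSpace ℝ F']
    (hs₁ : ∀ j, ContDiffAt ℝ ∞ (G₁ j) 0) (hs₂ : ∀ j, ContDiffAt ℝ ∞ (G₂ j) 0)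
    (hG₁ : ∀ n, 1 ≤ n → ∃ C, ∀ j, ‖iteratedFDeriv ℝ n (G₁ j) 0‖ ≤ C)
    (hG₂ : ∀ n, 1 ≤ n → ∃ C, ∀ j, ‖iteratedFDeriv ℝ n (G₂ j) 0‖ ≤ C)
    (hD : JetBdd m (fun j x => G₁ j x - G₂ j x)) {K : F → F'} (hK : ContDiff ℝ ∞ K)
    (hb : ∀ n, ∃ C, ∀ y, ‖iteratedFDeriv ℝ n K y‖ ≤ C) :
    JetBdd m (fun j x => K (G₁ j x) - K (G₂ j x)) :=
  ⟨fun j => (hK.contDiffAt.comp _ (hs₁ j)).sub (hK.contDiffAt.comp _ (hs₂ j)), fun n =>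
    comp_sub_aux hs₁ hs₂ hG₁ hG₂ hD n F' K hK hb⟩

end CompSub

end JetBdd

end Jets

/-! ### Superposition operators on bounded continuous functions -/

section Nemytskii

open scoped BoundedContinuousFunction
open BoundedContinuousFunction

open Classical in
/-- The bounded continuous function with the given values, and `0` if there is none. -/
def bcfOf {T F : Type} [TopologicalSpace T] [NormedAddCommGroup F] (f : T → F) : T →ᵇ F :=
  if h : Continuous f ∧ ∃ C, ∀ t, ‖f t‖ ≤ C then
    ofNormedAddCommGroup f h.1 h.2.choose h.2.choose_spec else 0

theorem bcfOf_apply {T F : Type} [TopologicalSpace T] [NormedAddCommGroup F] {f : T → F} (hf : Continuous f) {C : ℝ} (hC : ∀ t, ‖f t‖ ≤ C) (t : T) :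
    bcfOf f t = f t := by
  have h : Continuous f ∧ ∃ C, ∀ t, ‖f t‖ ≤ C := ⟨hf, C, hC⟩
  rw [bcfOf, dif_pos h]
  rfl

variable {T X F F' : Type} [TopologicalSpace T]
  [NormedAddCommGroup X] [NormedSpace ℝ X]
  [NormedAddCommGroup F] [NormedSpace ℝ F] [NormedAddCommGroup F'] [NormedSpace ℝ F']

/-- Pointwise application of a bounded continuous family of operators. -/
def bcfApply : (T →ᵇ (X →L[ℝ] F)) →L[ℝ] (T →ᵇ X) →L[ℝ] (T →ᵇ F) :=
  LinearMap.mkContinuous₂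
    (LinearMap.mk₂ ℝ
      (fun (A : T →ᵇ (X →L[ℝ] F)) (h : T →ᵇ X) =>
        ofNormedAddCommGroup (fun t => A t (h t)) (A.continuous.clm_apply h.continuous)
          (‖A‖ * ‖h‖) fun t => (A t).le_of_opNorm_le_of_le (A.norm_coe_le_norm t)
            (h.norm_coe_le_norm t))
      (fun _ _ _ => by ext; simp) (fun _ _ _ => by ext; simp) (fun _ _ _ => by ext; simp)
      (fun _ _ _ => by ext; simp))
    1 fun A h => by
      rw [one_mul]
      exact norm_ofNormedAddCommGroup_le (A.continuous.clm_apply h.continuous) (by positivity)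
        fun t => (A t).le_of_opNorm_le_of_le (A.norm_coe_le_norm t) (h.norm_coe_le_norm t)

@[simp]
theorem bcfApply_apply (A : T →ᵇ (X →L[ℝ] F)) (h : T →ᵇ X) (t : T) :
    bcfApply A h t = A t (h t) := rfl

/-- The superposition operator `u ↦ (t ↦ G t (u t))`. -/
def nem (G : T → X → F) (u : T →ᵇ X) : T →ᵇ F := bcfOf fun t => G t (u t)

/-- A family of smooth functions on the ball of radius `r`, jointly continuous and bounded
together with the derivatives of each order. -/
structure NemFamily (r : ℝ) (G : T → X → F) : Prop where
  smooth : ∀ t u, ‖u‖ < r → ContDiffAt ℝ ∞ (G t) u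
  bound : ∀ n, ∃ C, ∀ t u, ‖u‖ < r → ‖iteratedFDeriv ℝ n (G t) u‖ ≤ C
  cont : ∀ n, ContinuousOn (fun p : T × X => iteratedFDeriv ℝ n (G p.1) p.2) {p | ‖p.2‖ < r}

namespace NemFamily

variable {r : ℝ} {G : T → X → F}

theorem fderiv (h : NemFamily r G) : NemFamily r fun t => fderiv ℝ (G t) where
  smooth t u hu := (h.smooth t u hu).fderiv_right (by simp)
  bound n := by
    obtain ⟨C, hC⟩ := h.bound (n + 1)
    exact ⟨C, fun t u hu => by rw [norm_iteratedFDeriv_fderiv]; exact hC t u hu⟩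
  cont n := by
    have := (continuousMultilinearCurryRightEquiv' ℝ n X F).continuous.comp_continuousOn
      (h.cont (n + 1))
    refine this.congr fun p _ => ?_
    simp only [Function.comp_apply]
    rw [iteratedFDeriv_succ_eq_comp_right]
    simp

theorem continuousOn (h : NemFamily r G) :
    ContinuousOn (fun p : T × X => G p.1 p.2) {p | ‖p.2‖ < r} := by
  refine ((continuousMultilinearCurryFin0 ℝ X F).continuous.comp_continuousOn (h.cont 0)).congr
    fun p _ => ?_
  simp

theorem exists_bound (h : NemFamily r G) : ∃ C, ∀ t u, ‖u‖ < r → ‖G t u‖ ≤ C := by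
  simpa using h.bound 0

theorem nem_apply (h : NemFamily r G) {u : T →ᵇ X} (hu : ‖u‖ < r) (t : T) :
    nem G u t = G t (u t) := by
  have hu' : ∀ t, ‖u t‖ < r := fun t => (u.norm_coe_le_norm t).trans_lt hu
  obtain ⟨C, hC⟩ := h.exists_bound
  refine bcfOf_apply (f := fun t => G t (u t)) ?_ (fun t => hC t _ (hu' t)) t
  exact h.continuousOn.comp_continuous (f := fun t => (t, u t))
    (continuous_id.prodMk u.continuous) fun t => hu' t

theorem nem_lipschitz (h : NemFamily r G) {L : ℝ} (hL0 : 0 ≤ L)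
    (hL : ∀ t u, ‖u‖ < r → ‖_root_.fderiv ℝ (G t) u‖ ≤ L) {u w : T →ᵇ X} (hu : ‖u‖ < r)
    (hw : ‖w‖ < r) : ‖nem G u - nem G w‖ ≤ L * ‖u - w‖ := by
  refine (norm_le (by positivity)).2 fun t => ?_
  have hu' : ‖u t‖ < r := (u.norm_coe_le_norm t).trans_lt hu
  have hw' : ‖w t‖ < r := (w.norm_coe_le_norm t).trans_lt hw
  rw [BoundedContinuousFunction.sub_apply, h.nem_apply hu, h.nem_apply hw]
  have := Convex.norm_image_sub_le_of_norm_fderiv_le (𝕜 := ℝ) (f := G t) (s := Metric.ball 0 r)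
    (C := L) (fun x hx => ((h.smooth t x (by simpa using hx)).differentiableAt (by simp)))
    (fun x hx => hL t x (by simpa using hx)) (convex_ball 0 r) (x := w t) (y := u t)
    (by simpa using hw') (by simpa using hu')
  refine this.trans (mul_le_mul_of_nonneg_left ?_ hL0)
  exact (u - w).norm_coe_le_norm t

/-- At every `t` the first-order Taylor remainder is at most a bound of the second derivative times
`‖w - u‖ ^ 2`. The bound is uniform in `t`, so the remainder is quadratic in the supremum norm. -/
theorem hasFDerivAt_nem (h : NemFamily r G) {u : T →ᵇ X} (hu : ‖u‖ < r) :
    HasFDerivAt (nem G) (bcfApply (nem (fun t => _root_.fderiv ℝ (G t)) u)) u := by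
  obtain ⟨C, hC⟩ := h.bound 2
  set C' := |C|
  have hL : ∀ t x, ‖x‖ < r → ‖_root_.fderiv ℝ (_root_.fderiv ℝ (G t)) x‖ ≤ C' := fun t x hx => by
    rw [← norm_iteratedFDeriv_one, norm_iteratedFDeriv_fderiv]
    exact (hC t x hx).trans (le_abs_self _)
  have key : ∀ᶠ w in nhds u, ‖nem G w - nem G u -
      bcfApply (nem (fun t => _root_.fderiv ℝ (G t)) u) (w - u)‖ ≤ C' * ‖w - u‖ ^ 2 := by
    have hball : ∀ᶠ w in nhds u, ‖w‖ < r := continuous_norm.continuousAt.eventually_lt_const hu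
    filter_upwards [hball] with w hw
    refine (norm_le (by positivity)).2 fun t => ?_
    have hu' : ‖u t‖ < r := (u.norm_coe_le_norm t).trans_lt hu
    have hw' : ‖w t‖ < r := (w.norm_coe_le_norm t).trans_lt hw
    have hle : ‖w t - u t‖ ≤ ‖w - u‖ := (w - u).norm_coe_le_norm t
    rw [BoundedContinuousFunction.sub_apply, BoundedContinuousFunction.sub_apply, bcfApply_apply,
      h.nem_apply hu, h.nem_apply hw,
      h.fderiv.nem_apply hu, BoundedContinuousFunction.sub_apply]
    have hd : ∀ x ∈ segment ℝ (u t) (w t), ‖x‖ < r := fun x hx => by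
      have := (convex_ball (0 : X) r).segment_subset (x := u t) (y := w t)
        (by simpa using hu') (by simpa using hw') hx
      simpa using this
    have := (convex_segment (u t) (w t)).norm_image_sub_le_of_norm_hasFDerivWithin_le'
      (f := G t) (f' := fun x => _root_.fderiv ℝ (G t) x) (C := C' * ‖w t - u t‖)
      (φ := _root_.fderiv ℝ (G t) (u t)) (x := u t) (y := w t)
      (fun x hx => (((h.smooth t x (hd x hx)).differentiableAt
        (by simp)).hasFDerivAt).hasFDerivWithinAt)
      (fun x hx => by
        have h2 := (convex_segment (u t) (w t)).norm_image_sub_le_of_norm_fderiv_le (𝕜 := ℝ)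
          (f := _root_.fderiv ℝ (G t)) (C := C') (x := u t) (y := x)
          (fun y hy => (h.fderiv.smooth t y (hd y hy)).differentiableAt (by simp))
          (fun y hy => hL t y (hd y hy)) (left_mem_segment ℝ _ _) hx
        refine h2.trans (mul_le_mul_of_nonneg_left ?_ (abs_nonneg _))
        obtain ⟨a, b, ha, hb, hab, rfl⟩ := hx
        have : a • u t + b • w t - u t = b • (w t - u t) := by
          rw [show a = 1 - b by linarith, sub_smul, one_smul, smul_sub]; abel
        rw [this, norm_smul, Real.norm_of_nonneg hb]
        exact mul_le_of_le_one_left (norm_nonneg _) (by linarith))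
      (left_mem_segment ℝ _ _) (right_mem_segment ℝ _ _)
    calc _ ≤ C' * ‖w t - u t‖ * ‖w t - u t‖ := this
      _ = C' * ‖w t - u t‖ ^ 2 := by ring
      _ ≤ _ := by gcongr
  rw [hasFDerivAt_iff_isLittleO]
  refine Asymptotics.IsBigO.trans_isLittleO (g := fun w => ‖w - u‖ ^ 2) ?_ ?_
  · refine Asymptotics.IsBigO.of_bound C' ?_
    filter_upwards [key] with w hw
    simpa using hw
  · have : (fun w => ‖w - u‖ ^ 2) = (fun x : T →ᵇ X => ‖x‖ ^ 2) ∘ fun w => w - u := rfl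
    rw [this, show (fun w => w - u) = id ∘ (fun w => w - u) from rfl]
    refine (Asymptotics.isLittleO_norm_pow_id one_lt_two).comp_tendsto ?_
    have : Filter.Tendsto (fun w : T →ᵇ X => w - u) (nhds u) (nhds (u - u)) :=
      (continuous_id.sub continuous_const).tendsto u
    simpa using this

/-- The derivative of a superposition operator is the superposition operator of `fderiv ℝ (G t)`
followed by the linear map `bcfApply`, so the order rises by induction over all target spaces. -/
theorem contDiffOn_nem_nat (n : ℕ) : ∀ (F : Type) [NormedAddCommGroup F] [NormedSpace ℝ F]
    (G : T → X → F), NemFamily r G → ContDiffOn ℝ n (nem G) {u : T →ᵇ X | ‖u‖ < r} := by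
  induction n with
  | zero =>
    intro F _ _ G h
    refine contDiffOn_zero.2 fun u hu => (h.hasFDerivAt_nem hu).continuousAt.continuousWithinAt
  | succ n ih =>
    intro F _ _ G h
    have ho : IsOpen {u : T →ᵇ X | ‖u‖ < r} := isOpen_lt continuous_norm continuous_const
    rw [show ((n + 1 : ℕ) : ℕ∞ω) = (n : ℕ∞ω) + 1 by norm_cast, contDiffOn_succ_iff_fderiv_of_isOpen ho]
    refine ⟨fun u hu => (h.hasFDerivAt_nem hu).differentiableAt.differentiableWithinAt,
      by simp, ?_⟩
    refine ((bcfApply (T := T) (X := X) (F := F)).contDiff.comp_contDiffOn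
      (ih (X →L[ℝ] F) _ h.fderiv)).congr fun u hu => ?_
    exact (h.hasFDerivAt_nem hu).fderiv

theorem contDiffAt_nem (h : NemFamily r G) {u : T →ᵇ X} (hu : ‖u‖ < r) :
    ContDiffAt ℝ ∞ (nem G) u := by
  rw [contDiffAt_infty]
  intro n
  have ho : IsOpen {u : T →ᵇ X | ‖u‖ < r} := isOpen_lt continuous_norm continuous_const
  exact (contDiffOn_nem_nat n F G h).contDiffAt (ho.mem_nhds hu)

end NemFamily

/-- Evaluation at a point. -/
def bcfEval (t : T) : (T →ᵇ F) →L[ℝ] F := BoundedContinuousFunction.evalCLM ℝ t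

@[simp] theorem bcfEval_apply (t : T) (f : T →ᵇ F) : bcfEval t f = f t := rfl

theorem norm_bcfEval_le (t : T) : ‖bcfEval (F := F) t‖ ≤ 1 :=
  ContinuousLinearMap.opNorm_le_bound _ zero_le_one fun f => by
    simpa using f.norm_coe_le_norm t

/-- The components of a smooth map into bounded continuous functions are uniformly smooth. -/
theorem JetBdd.of_bcf {Φ : X → (T →ᵇ F)} (hΦ : ContDiffAt ℝ ∞ Φ 0) :
    JetBdd (fun _ : T => 1) (fun t x => Φ x t) := by
  have h1 := JetBdd.single (J := T) hΦ
  have h2 := h1.clm (F' := F) (w := fun _ => 1) (fun t => bcfEval t) (fun t => norm_bcfEval_le t)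
  simp only [mul_one] at h2
  exact h2

end Nemytskii

/-! ### The Japanese bracket -/

section Bracket

variable {N : ℕ}

theorem one_le_bracket (x : E N) : 1 ≤ bracket x := by
  rw [bracket, Real.one_le_sqrt]
  nlinarith [sq_nonneg ‖x‖]

theorem bracket_pos (x : E N) : 0 < bracket x := zero_lt_one.trans_le (one_le_bracket x)

theorem bracket_sq (x : E N) : bracket x ^ 2 = 1 + ‖x‖ ^ 2 :=
  Real.sq_sqrt (by positivity)

theorem norm_le_bracket (x : E N) : ‖x‖ ≤ bracket x :=
  Real.le_sqrt_of_sq_le (by linarith)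

theorem bracket_le (x : E N) : bracket x ≤ 1 + ‖x‖ := by
  rw [bracket, Real.sqrt_le_left (by positivity)]
  nlinarith [norm_nonneg x]

theorem bracket_mono {x y : E N} (h : ‖x‖ ≤ ‖y‖) : bracket x ≤ bracket y :=
  Real.sqrt_le_sqrt (by gcongr)

theorem bracket_add_le (x y : E N) : bracket (x + y) ≤ bracket x + ‖y‖ := by
  refine Real.sqrt_le_iff.2 ⟨by have := bracket_pos x; positivity, ?_⟩
  have h1 := norm_add_le x y
  have h2 := norm_le_bracket x
  have h3 := bracket_sq x
  nlinarith [norm_nonneg (x + y), norm_nonneg x, norm_nonneg y]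

theorem le_bracket_add (x y : E N) : bracket x - ‖y‖ ≤ bracket (x + y) := by
  have := bracket_add_le (x + y) (-y)
  simp only [add_neg_cancel_right, norm_neg] at this
  linarith

/-- A form of Peetre's inequality. -/
theorem bracket_le_mul (x z : E N) : bracket x ≤ 2 * bracket (x - z) * bracket z := by
  have h := bracket_add_le (x - z) z
  rw [sub_add_cancel] at h
  have h1 := one_le_bracket (x - z)
  have h2 := one_le_bracket z
  have h3 := norm_le_bracket z
  nlinarith

theorem continuous_bracket : Continuous (bracket (N := N)) := by
  unfold bracket
  fun_prop

end Bracket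

/-! ### Integral operators on the half-line -/

section HalfLine

variable {F : Type} [NormedAddCommGroup F] [NormedSpace ℝ F]

theorem integrableOn_add_rpow {l β τ : ℝ} (hl : 0 < l) (hβ : 0 < β) (hτ : 0 ≤ τ) :
    IntegrableOn (fun s : ℝ => (l + s) ^ (-1 - β)) (Set.Ioi τ) := by
  simpa only [add_comm] using
    integrableOn_add_rpow_Ioi_of_lt (a := -1 - β) (m := l) (c := τ) (by linarith) (by linarith)

theorem integral_add_rpow {l β τ : ℝ} (hl : 0 < l) (hβ : 0 < β) (hτ : 0 ≤ τ) :
    ∫ s in Set.Ioi τ, (l + s) ^ (-1 - β) = (l + τ) ^ (-β) / β := by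
  have h1 : ∀ x ∈ Set.Ici τ, HasDerivAt (fun s : ℝ => -((l + s) ^ (-β) / β))
      ((l + x) ^ (-1 - β)) x := fun x hx => by
    have hx' : 0 < l + x := by linarith [Set.mem_Ici.1 hx]
    have := (((hasDerivAt_id x).const_add l).rpow_const (p := -β) (Or.inl hx'.ne')).div_const β
    refine this.neg.congr_deriv ?_
    rw [show -1 - β = -β - 1 by ring]
    field_simp
    simp
  have h2 : Filter.Tendsto (fun s : ℝ => -((l + s) ^ (-β) / β)) Filter.atTop (nhds 0) := by
    have := ((tendsto_rpow_neg_atTop hβ).comp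
      (Filter.tendsto_atTop_add_const_left Filter.atTop l Filter.tendsto_id)).div_const β
    simpa using this.neg
  rw [integral_Ioi_of_hasDerivAt_of_tendsto' h1 (integrableOn_add_rpow hl hβ hτ) h2]
  ring

theorem integrableOn_Ioi_of_le_rpow {l β τ C : ℝ} (hl : 0 < l) (hβ : 0 < β) (hτ : 0 ≤ τ)
    {f : ℝ → F} (hf : Continuous f) (hb : ∀ s, τ ≤ s → ‖f s‖ ≤ C * (l + s) ^ (-1 - β)) :
    IntegrableOn f (Set.Ioi τ) := by
  refine Integrable.mono' ((integrableOn_add_rpow hl hβ hτ).const_mul C)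
    hf.aestronglyMeasurable ?_
  filter_upwards [ae_restrict_mem measurableSet_Ioi] with s hs
  exact hb s (le_of_lt hs)

theorem norm_integral_Ioi_le_of_le_rpow {l β τ C : ℝ} (hl : 0 < l) (hβ : 0 < β) (hτ : 0 ≤ τ)
    {f : ℝ → F} (hb : ∀ s, τ ≤ s → ‖f s‖ ≤ C * (l + s) ^ (-1 - β)) :
    ‖∫ s in Set.Ioi τ, f s‖ ≤ C * ((l + τ) ^ (-β) / β) := by
  rw [← integral_add_rpow hl hβ hτ, ← integral_const_mul]
  refine norm_integral_le_of_norm_le ((integrableOn_add_rpow hl hβ hτ).const_mul C) ?_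
  filter_upwards [ae_restrict_mem measurableSet_Ioi] with s hs
  exact hb s (le_of_lt hs)

theorem integral_Ioi_eq_sub {f : ℝ → F} (hf : IntegrableOn f (Set.Ioi 0)) {τ : ℝ} (hτ : 0 ≤ τ) :
    ∫ s in Set.Ioi τ, f s = (∫ s in Set.Ioi 0, f s) - ∫ s in (0 : ℝ)..τ, f s := by
  rw [← intervalIntegral.integral_Ioi_sub_Ioi hf hτ, sub_sub_cancel]

theorem continuous_integral_Ioi_max {f : ℝ → F} (hc : Continuous f)
    (hf : IntegrableOn f (Set.Ioi 0)) :
    Continuous fun τ : ℝ => ∫ s in Set.Ioi (max τ 0), f s := by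
  simp_rw [fun τ : ℝ => integral_Ioi_eq_sub hf (le_max_right τ 0)]
  exact continuous_const.sub ((intervalIntegral.continuous_primitive
    (fun a b => hc.intervalIntegrable a b) 0).comp (continuous_id.max continuous_const))

open scoped BoundedContinuousFunction

variable {I : Type} [TopologicalSpace I] [DiscreteTopology I] {lam : I → ℝ}

/-- The index set of starting points is discrete, so continuity is required in time only and no
regularity in the starting point is presupposed. -/
theorem continuous_discrete_prod {G : Type*} [TopologicalSpace G] {f : I × ℝ → G}
    (h : ∀ i, Continuous fun τ => f (i, τ)) : Continuous f :=
  continuous_prod_of_discrete_left.2 h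

theorem continuous_slice (w : (I × ℝ) →ᵇ F) (i : I) : Continuous fun s => w (i, s) :=
  w.continuous.comp (continuous_const.prodMk continuous_id)

/-- The integral `∫_0^τ w`, divided by `λ + τ`. -/
def avgFun (lam : I → ℝ) (w : (I × ℝ) →ᵇ F) (t : I × ℝ) : F :=
  (lam t.1 + max t.2 0)⁻¹ • ∫ s in (0 : ℝ)..max t.2 0, w (t.1, s)

/-- Dividing by `λ + τ ≥ τ` turns the linear growth of the integral into a bound by `‖w‖`. Negative
times are read as `0` by means of `max`. -/
theorem norm_avgFun_le (hlam : ∀ i, 1 ≤ lam i) (w : (I × ℝ) →ᵇ F) (t : I × ℝ) :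
    ‖avgFun lam w t‖ ≤ 1 * ‖w‖ := by
  have h0 : 0 ≤ max t.2 0 := le_max_right _ _
  have h1 := hlam t.1
  have := intervalIntegral.norm_integral_le_of_norm_le_const (a := 0) (b := max t.2 0)
    (f := fun s => w (t.1, s)) (C := ‖w‖) fun s _ => w.norm_coe_le_norm _
  rw [sub_zero, abs_of_nonneg h0] at this
  rw [avgFun, norm_smul, norm_inv, Real.norm_of_nonneg (by linarith), inv_mul_le_iff₀ (by linarith),
    one_mul]
  refine this.trans ?_
  rw [mul_comm]
  exact mul_le_mul_of_nonneg_right (by linarith) (norm_nonneg _)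

theorem continuous_avgFun (hlam : ∀ i, 1 ≤ lam i) (w : (I × ℝ) →ᵇ F) :
    Continuous (avgFun lam w) := by
  refine continuous_discrete_prod fun i => ?_
  have hm : Continuous fun τ : ℝ => max τ 0 := continuous_id.max continuous_const
  refine Continuous.smul (Continuous.inv₀ (f := fun τ => lam i + max τ 0)
      (continuous_const.add hm) fun τ => ?_)
    ((intervalIntegral.continuous_primitive
    (fun a b => (continuous_slice w i).intervalIntegrable a b) 0).comp hm)
  have := hlam i
  have := le_max_right τ 0
  linarith

/-- The operator `avgFun` on bounded continuous functions. -/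
def avgOp (lam : I → ℝ) (hlam : ∀ i, 1 ≤ lam i) : ((I × ℝ) →ᵇ F) →L[ℝ] ((I × ℝ) →ᵇ F) :=
  LinearMap.mkContinuous
    { toFun := fun w => bcfOf (avgFun lam w)
      map_add' := fun u w => by
        ext t
        simp only [BoundedContinuousFunction.add_apply,
          bcfOf_apply (continuous_avgFun hlam _) (norm_avgFun_le hlam _)]
        simp only [avgFun, BoundedContinuousFunction.add_apply]
        rw [intervalIntegral.integral_add ((continuous_slice u _).intervalIntegrable _ _)
          ((continuous_slice w _).intervalIntegrable _ _), smul_add]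
      map_smul' := fun c w => by
        ext t
        simp only [BoundedContinuousFunction.coe_smul, RingHom.id_apply,
          bcfOf_apply (continuous_avgFun hlam _) (norm_avgFun_le hlam _)]
        simp only [avgFun, BoundedContinuousFunction.coe_smul]
        rw [intervalIntegral.integral_smul, smul_comm] }
    1 fun w => (BoundedContinuousFunction.norm_le (by positivity)).2 fun t => by
      change ‖bcfOf (avgFun lam w) t‖ ≤ _
      rw [bcfOf_apply (continuous_avgFun hlam _) (norm_avgFun_le hlam _)]
      exact norm_avgFun_le hlam w t

theorem avgOp_apply (hlam : ∀ i, 1 ≤ lam i) (w : (I × ℝ) →ᵇ F) (t : I × ℝ) :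
    avgOp lam hlam w t = (lam t.1 + max t.2 0)⁻¹ • ∫ s in (0 : ℝ)..max t.2 0, w (t.1, s) :=
  bcfOf_apply (continuous_avgFun hlam _) (norm_avgFun_le hlam _) t

theorem norm_avgOp_apply_le (hlam : ∀ i, 1 ≤ lam i) (w : (I × ℝ) →ᵇ F) :
    ‖avgOp lam hlam w‖ ≤ ‖w‖ := by
  refine (BoundedContinuousFunction.norm_le (norm_nonneg _)).2 fun t => ?_
  simpa [avgOp_apply, avgFun] using norm_avgFun_le hlam w t

/-- The weight in `tailFun`. -/
def tailWeight (l β s : ℝ) : ℝ := l ^ β * (l + max s 0) ^ (-1 - β)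

theorem continuous_tailWeight {l : ℝ} (hl : 1 ≤ l) (β : ℝ) : Continuous (tailWeight l β) := by
  refine continuous_const.mul (Continuous.rpow_const
    (continuous_const.add (continuous_id.max continuous_const)) fun s => Or.inl ?_)
  have : 0 < l + max s 0 := by linarith [le_max_right s 0]
  exact this.ne'

theorem tailWeight_nonneg {l : ℝ} (hl : 1 ≤ l) (β s : ℝ) : 0 ≤ tailWeight l β s := by
  have := le_max_right s 0
  unfold tailWeight
  positivity

/-- The weighted integral of `g` over `(τ, ∞)`. -/
def tailFun (lam : I → ℝ) (β : ℝ) (g : (I × ℝ) →ᵇ F) (t : I × ℝ) : F :=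
  ∫ s in Set.Ioi (max t.2 0), tailWeight (lam t.1) β s • g (t.1, s)

theorem tail_integrand_le (hlam : ∀ i, 1 ≤ lam i) (β : ℝ) (g : (I × ℝ) →ᵇ F) (i : I) {s : ℝ}
    (hs : 0 ≤ s) :
    ‖tailWeight (lam i) β s • g (i, s)‖ ≤ (lam i ^ β * ‖g‖) * (lam i + s) ^ (-1 - β) := by
  have h1 := hlam i
  rw [norm_smul, Real.norm_of_nonneg (tailWeight_nonneg h1 _ _), tailWeight, max_eq_left hs]
  have := g.norm_coe_le_norm (i, s)
  calc _ ≤ lam i ^ β * (lam i + s) ^ (-1 - β) * ‖g‖ := by gcongr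
    _ = _ := by ring

theorem continuous_tail_integrand (hlam : ∀ i, 1 ≤ lam i) (β : ℝ) (g : (I × ℝ) →ᵇ F) (i : I) :
    Continuous fun s => tailWeight (lam i) β s • g (i, s) :=
  (continuous_tailWeight (hlam i) β).smul (continuous_slice g i)

theorem integrableOn_tail (hlam : ∀ i, 1 ≤ lam i) {β : ℝ} (hβ : 0 < β) (g : (I × ℝ) →ᵇ F) (i : I)
    {τ : ℝ} (hτ : 0 ≤ τ) :
    IntegrableOn (fun s => tailWeight (lam i) β s • g (i, s)) (Set.Ioi τ) :=
  integrableOn_Ioi_of_le_rpow (by linarith [hlam i]) hβ hτ (continuous_tail_integrand hlam β g i)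
    fun _ hs => tail_integrand_le hlam β g i (hτ.trans hs)

/-- The weight integrates to `l ^ β (l + τ) ^ (-β) / β ≤ 1 / β`. The factor `l ^ β` in it is what
makes the operator norm independent of the starting point. -/
theorem norm_tailFun_le (hlam : ∀ i, 1 ≤ lam i) {β : ℝ} (hβ : 0 < β) (g : (I × ℝ) →ᵇ F)
    (t : I × ℝ) : ‖tailFun lam β g t‖ ≤ β⁻¹ * ‖g‖ := by
  have h0 : 0 ≤ max t.2 0 := le_max_right _ _
  have h1 := hlam t.1
  refine (norm_integral_Ioi_le_of_le_rpow (by linarith) hβ h0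
    fun s hs => tail_integrand_le hlam β g t.1 (h0.trans hs)).trans ?_
  have h2 : lam t.1 ^ β * (lam t.1 + max t.2 0) ^ (-β) ≤ 1 := by
    rw [Real.rpow_neg (by positivity), ← div_eq_mul_inv, div_le_one (by positivity)]
    exact Real.rpow_le_rpow (by linarith) (by linarith) hβ.le
  calc _ = (lam t.1 ^ β * (lam t.1 + max t.2 0) ^ (-β)) * (β⁻¹ * ‖g‖) := by ring
    _ ≤ 1 * (β⁻¹ * ‖g‖) := mul_le_mul_of_nonneg_right h2 (by positivity)
    _ = _ := one_mul _

theorem continuous_tailFun (hlam : ∀ i, 1 ≤ lam i) {β : ℝ} (hβ : 0 < β) (g : (I × ℝ) →ᵇ F) :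
    Continuous (tailFun lam β g) :=
  continuous_discrete_prod fun i => continuous_integral_Ioi_max
    (continuous_tail_integrand hlam β g i) (integrableOn_tail hlam hβ g i le_rfl)

/-- The operator `tailFun` on bounded continuous functions. -/
def tailOp (lam : I → ℝ) (hlam : ∀ i, 1 ≤ lam i) (β : ℝ) (hβ : 0 < β) :
    ((I × ℝ) →ᵇ F) →L[ℝ] ((I × ℝ) →ᵇ F) :=
  LinearMap.mkContinuous
    { toFun := fun g => bcfOf (tailFun lam β g)
      map_add' := fun u w => by
        ext t
        simp only [BoundedContinuousFunction.add_apply,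
          bcfOf_apply (continuous_tailFun hlam hβ _) (norm_tailFun_le hlam hβ _)]
        simp only [tailFun, BoundedContinuousFunction.add_apply, smul_add]
        exact integral_add (integrableOn_tail hlam hβ u _ (le_max_right _ _))
          (integrableOn_tail hlam hβ w _ (le_max_right _ _))
      map_smul' := fun c w => by
        ext t
        simp only [BoundedContinuousFunction.coe_smul, RingHom.id_apply,
          bcfOf_apply (continuous_tailFun hlam hβ _) (norm_tailFun_le hlam hβ _)]
        simp only [tailFun, BoundedContinuousFunction.coe_smul]
        rw [← integral_smul]
        simp only [smul_comm c] }
    β⁻¹ fun g => (BoundedContinuousFunction.norm_le (by positivity)).2 fun t => by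
      change ‖bcfOf (tailFun lam β g) t‖ ≤ _
      rw [bcfOf_apply (continuous_tailFun hlam hβ _) (norm_tailFun_le hlam hβ _)]
      exact norm_tailFun_le hlam hβ g t

theorem tailOp_apply (hlam : ∀ i, 1 ≤ lam i) {β : ℝ} (hβ : 0 < β) (g : (I × ℝ) →ᵇ F)
    (t : I × ℝ) : tailOp lam hlam β hβ g t =
      ∫ s in Set.Ioi (max t.2 0), tailWeight (lam t.1) β s • g (t.1, s) :=
  bcfOf_apply (continuous_tailFun hlam hβ _) (norm_tailFun_le hlam hβ _) t

theorem norm_tailOp_apply_le (hlam : ∀ i, 1 ≤ lam i) {β : ℝ} (hβ : 0 < β) (g : (I × ℝ) →ᵇ F) :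
    ‖tailOp lam hlam β hβ g‖ ≤ β⁻¹ * ‖g‖ := by
  refine (BoundedContinuousFunction.norm_le (by positivity)).2 fun t => ?_
  rw [tailOp_apply]
  exact norm_tailFun_le hlam hβ g t

end HalfLine

/-- The curve `Q` is the momentum, relative to its limit `ξ` at infinity, of the trajectory of
the velocity field `v` and the force `-K` that starts at `x`. -/
def IsTraj {N : ℕ} (v K : E N → E N) (x ξ : E N) (Q : ℝ → E N) : Prop :=
  Continuous Q ∧ ∀ τ, Q τ = ∫ s in Set.Ioi (max τ 0), K (x + ∫ σ in (0 : ℝ)..s, v (ξ + Q σ))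

/-- Hypotheses on the velocity field, the force and the constants that make the trajectories
solvable by contraction. -/
structure FlowHyp {N : ℕ} (v K : E N → E N) (ε β c r M η : ℝ) : Prop where
  v_smooth : ContDiff ℝ ∞ v
  v_bdd : ∀ n, ∃ C, ∀ ξ, ‖iteratedFDeriv ℝ n v ξ‖ ≤ C
  v_lip : ∀ ξ, ‖fderiv ℝ v ξ‖ ≤ M
  K_smooth : ContDiff ℝ ∞ K
  K_decay : ∀ n : ℕ, ∃ C, ∀ x, ‖iteratedFDeriv ℝ n K x‖ ≤ C * bracket x ^ (-1 - n - ε)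
  -- The exponent `β` is smaller than the true decay rate `ε`; the surplus decay is what allows a
  -- small constant `η`.
  K_small : ∀ x, ‖K x‖ ≤ η * bracket x ^ (-1 - β)
  dK_small : ∀ x, ‖fderiv ℝ K x‖ ≤ η * bracket x ^ (-2 - β)
  β_pos : 0 < β
  β_le : β ≤ ε
  c_pos : 0 < c
  r_pos : 0 < r
  M_nonneg : 0 ≤ M
  η_nonneg : 0 ≤ η
  -- The next three inequalities keep the normalised deviation below `c / 2`, map the ball of radius
  -- `r` into the ball of radius `r / 2`, and give the Lipschitz constant `1 / 2`.
  small_r : (2 * M + 1) * r < c / 2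
  small_K : β⁻¹ * (η * (c / 2) ^ (-1 - β)) ≤ r / 2
  small_dK : β⁻¹ * (η * (c / 2) ^ (-2 - β) * M) ≤ 1 / 2

/-! ### The normalised velocity and force -/

section Flow

open scoped BoundedContinuousFunction

variable {N : ℕ} {v K : E N → E N} {ε β c r M η : ℝ}
  {I : Type} [TopologicalSpace I] [DiscreteTopology I] {x ξ : I → E N}

/-- Points of the family leave every bounded set linearly under the free flow. -/
def Escapes (v : E N → E N) (c : ℝ) (x ξ : E N) : Prop :=
  ∀ t, 0 ≤ t → c * (bracket x + t) ≤ bracket (x + t • v ξ)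

/-- The deviation of the velocity. -/
def velFam (v : E N → E N) (ξ : I → E N) (t : I × ℝ) (u : E N) : E N :=
  v (ξ t.1 + u) - v (ξ t.1)

/-- The normalised force. -/
def forceFam (v K : E N → E N) (w β : ℝ) (x ξ : I → E N) (t : I × ℝ) (u : E N) : E N :=
  -- Here `u` is the deviation from the free motion divided by `⟨x⟩ + t`. The prefactor times
  -- `tailWeight` is `⟨x⟩ ^ w`: with `w = 0` one gets the trajectory equation, with `w = ε` the same
  -- integral weighted to exhibit its decay in `x`.
  (bracket (x t.1) ^ (w - β) * (bracket (x t.1) + max t.2 0) ^ (1 + β)) •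
    K (x t.1 + max t.2 0 • v (ξ t.1) + (bracket (x t.1) + max t.2 0) • u)

theorem iteratedFDeriv_comp_add_smul {G : Type*} [NormedAddCommGroup G] [NormedSpace ℝ G]
    {f : E N → G} (hf : ContDiff ℝ ∞ f) (a : E N) (ρ : ℝ) (n : ℕ) (u : E N) :
    iteratedFDeriv ℝ n (fun u => f (a + ρ • u)) u = ρ ^ n • iteratedFDeriv ℝ n f (a + ρ • u) := by
  have h := iteratedFDeriv_comp_clm (ρ • ContinuousLinearMap.id ℝ (E N)) (x := u)
    (f := fun y => f (a + y)) (hf.comp (contDiff_const.add contDiff_id)).contDiffAt n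
  have e : (fun u => f (a + ρ • u)) =
      fun y => (fun y => f (a + y)) ((ρ • ContinuousLinearMap.id ℝ (E N)) y) := by
    ext y; simp
  rw [e, h, iteratedFDeriv_comp_add_left]
  ext m
  simp only [ContinuousMultilinearMap.compContinuousLinearMap_apply,
    smul_apply, ContinuousLinearMap.id_apply]
  rw [ContinuousMultilinearMap.map_smul_univ]
  simp

theorem continuous_iteratedFDeriv_inf {X G : Type*} [NormedAddCommGroup X] [NormedSpace ℝ X]
    [NormedAddCommGroup G] [NormedSpace ℝ G] {f : X → G} (hf : ContDiff ℝ ∞ f) (n : ℕ) :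
    Continuous (iteratedFDeriv ℝ n f) :=
  hf.continuous_iteratedFDeriv (by exact_mod_cast le_top)

theorem fderiv_velFam (t : I × ℝ) (u : E N) :
    fderiv ℝ (velFam v ξ t) u = fderiv ℝ v (ξ t.1 + u) := by
  unfold velFam
  rw [fderiv_sub_const, fderiv_comp_add_left]

theorem iteratedFDeriv_velFam_succ (t : I × ℝ) (n : ℕ) (u : E N) :
    iteratedFDeriv ℝ (n + 1) (velFam v ξ t) u = iteratedFDeriv ℝ (n + 1) v (ξ t.1 + u) := by
  rw [← iteratedFDeriv_comp_add_left, iteratedFDeriv_succ_eq_comp_right,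
    iteratedFDeriv_succ_eq_comp_right]
  simp only [fderiv_velFam, fderiv_comp_add_left]

theorem nemFamily_velFam (h : FlowHyp v K ε β c r M η) (ρ : ℝ) :
    NemFamily ρ (velFam v ξ) where
  smooth t u _ := ((h.v_smooth.comp (contDiff_const.add contDiff_id)).sub contDiff_const).contDiffAt
  bound n := by
    cases n with
    | zero =>
      refine ⟨M * |ρ|, fun t u hu => ?_⟩
      have := Convex.norm_image_sub_le_of_norm_fderiv_le (𝕜 := ℝ) (f := v) (s := Set.univ)
        (C := M) (fun x _ => h.v_smooth.differentiable (by simp) x) (fun x _ => h.v_lip x)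
        convex_univ (Set.mem_univ (ξ t.1)) (Set.mem_univ (ξ t.1 + u))
      rw [add_sub_cancel_left] at this
      rw [norm_iteratedFDeriv_zero]
      exact this.trans (mul_le_mul_of_nonneg_left (hu.le.trans (le_abs_self _)) h.M_nonneg)
    | succ n =>
      obtain ⟨C, hC⟩ := h.v_bdd (n + 1)
      refine ⟨C, fun t u _ => ?_⟩
      rw [iteratedFDeriv_velFam_succ]
      exact hC _
  cont n := by
    refine Continuous.continuousOn ?_
    cases n with
    | zero =>
      have : Continuous fun p : (I × ℝ) × E N => velFam v ξ p.1 p.2 := by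
        have hξ : Continuous ξ := continuous_of_discreteTopology
        have hv := h.v_smooth.continuous
        unfold velFam
        fun_prop
      refine ((continuousMultilinearCurryFin0 ℝ (E N) (E N)).symm.continuous.comp this).congr
        fun p => ?_
      simp [iteratedFDeriv_zero_eq_comp]
    | succ n =>
      have hξ : Continuous ξ := continuous_of_discreteTopology
      have hv := continuous_iteratedFDeriv_inf h.v_smooth (n + 1)
      have : Continuous fun p : (I × ℝ) × E N => iteratedFDeriv ℝ (n + 1) v (ξ p.1.1 + p.2) := by
        fun_prop
      exact this.congr fun p => (iteratedFDeriv_velFam_succ _ _ _).symm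

/-- A deviation of relative size `c / 2` uses up at most half of the escape rate `c`. -/
theorem le_bracket_of_escapes {x ξ : E N} (hx : Escapes v c x ξ) {t : ℝ} (ht : 0 ≤ t) {u : E N}
    (hu : ‖u‖ ≤ c / 2) :
    c / 2 * (bracket x + t) ≤ bracket (x + t • v ξ + (bracket x + t) • u) := by
  have h0 : 0 ≤ bracket x + t := by linarith [bracket_pos x]
  have h1 := le_bracket_add (x + t • v ξ) ((bracket x + t) • u)
  rw [norm_smul, Real.norm_of_nonneg h0] at h1
  have h2 := hx t ht
  nlinarith

/-- The decay rate `γ` cancels the growth `γ` in `⟨x⟩ + t`. The remaining power `b ≤ 0` of `⟨x⟩ + t`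
is at most `⟨x⟩ ^ b`, and `⟨x⟩ ^ (a + b) ≤ 1`. -/
theorem forceFam_bound (hc : 0 < c) {x ξ : E N} (hx : Escapes v c x ξ) {t a b γ C : ℝ}
    (ht : 0 ≤ t) {u : E N} (hu : ‖u‖ ≤ c / 2) (hγ : 0 ≤ γ) (hab : a + b ≤ 0) (hb : b ≤ 0)
    (hC : 0 ≤ C) :
    bracket x ^ a * (bracket x + t) ^ (γ + b) *
      (C * bracket (x + t • v ξ + (bracket x + t) • u) ^ (-γ)) ≤ C * (c / 2) ^ (-γ) := by
  have h1 := one_le_bracket x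
  have h2 := le_bracket_of_escapes hx ht hu
  have h3 : bracket (x + t • v ξ + (bracket x + t) • u) ^ (-γ) ≤
      (c / 2) ^ (-γ) * (bracket x + t) ^ (-γ) := by
    rw [← Real.mul_rpow (by positivity) (by linarith)]
    exact Real.rpow_le_rpow_of_nonpos (by positivity) h2 (by linarith)
  have h4 : (bracket x + t) ^ (γ + b) * (bracket x + t) ^ (-γ) ≤ bracket x ^ b := by
    rw [← Real.rpow_add (by linarith), show γ + b + -γ = b by ring]
    exact Real.rpow_le_rpow_of_nonpos (by linarith) (by linarith) hb
  have h5 : bracket x ^ a * bracket x ^ b ≤ 1 := by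
    rw [← Real.rpow_add (by linarith)]
    exact Real.rpow_le_one_of_one_le_of_nonpos h1 hab
  have p1 : 0 ≤ bracket x ^ a := Real.rpow_nonneg (by linarith) _
  have p2 : 0 ≤ (bracket x + t) ^ (γ + b) := Real.rpow_nonneg (by linarith) _
  calc _ ≤ bracket x ^ a * (bracket x + t) ^ (γ + b) *
        (C * ((c / 2) ^ (-γ) * (bracket x + t) ^ (-γ))) := by gcongr
    _ = bracket x ^ a * ((bracket x + t) ^ (γ + b) * (bracket x + t) ^ (-γ)) *
        (C * (c / 2) ^ (-γ)) := by ring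
    _ ≤ bracket x ^ a * bracket x ^ b * (C * (c / 2) ^ (-γ)) := by gcongr
    _ ≤ 1 * (C * (c / 2) ^ (-γ)) := by gcongr
    _ = _ := one_mul _

theorem contDiff_comp_add_smul {G : Type*} [NormedAddCommGroup G] [NormedSpace ℝ G]
    {f : E N → G} (hf : ContDiff ℝ ∞ f) (a : E N) (ρ : ℝ) :
    ContDiff ℝ ∞ fun u => f (a + ρ • u) :=
  hf.comp (f := fun u => a + ρ • u) (by fun_prop)

theorem iteratedFDeriv_forceFam (h : FlowHyp v K ε β c r M η) (w : ℝ) (t : I × ℝ) (n : ℕ)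
    (u : E N) :
    iteratedFDeriv ℝ n (forceFam v K w β x ξ t) u =
      (bracket (x t.1) ^ (w - β) * (bracket (x t.1) + max t.2 0) ^ (1 + β) *
        (bracket (x t.1) + max t.2 0) ^ n) • iteratedFDeriv ℝ n K
        (x t.1 + max t.2 0 • v (ξ t.1) + (bracket (x t.1) + max t.2 0) • u) := by
  unfold forceFam
  have hs : ContDiffAt ℝ ∞ (fun u => K (x t.1 + max t.2 0 • v (ξ t.1) +
      (bracket (x t.1) + max t.2 0) • u)) u :=
    (contDiff_comp_add_smul h.K_smooth _ _).contDiffAt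
  have := iteratedFDeriv_const_smul_apply (a := bracket (x t.1) ^ (w - β) *
    (bracket (x t.1) + max t.2 0) ^ (1 + β)) (hs.of_le (m := n) (by exact_mod_cast le_top))
  rw [mul_smul, ← iteratedFDeriv_comp_add_smul h.K_smooth]
  exact this

/-- The `n`-th derivative in `u` produces `(⟨x⟩ + t) ^ n`, which the decay `1 + n + ε` of the `n`-th
derivative of `K` absorbs. The condition `w ≤ ε` is exactly `a + b ≤ 0` in `forceFam_bound` with `a
= w - β` and `b = β - ε`. -/
theorem nemFamily_forceFam (h : FlowHyp v K ε β c r M η)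
    (hesc : ∀ i, Escapes v c (x i) (ξ i)) {w : ℝ} (hw : w ≤ ε) :
    NemFamily (c / 2) (forceFam v K w β x ξ) where
  smooth t u _ := (contDiff_comp_add_smul h.K_smooth _ _).contDiffAt.const_smul _
  bound n := by
    obtain ⟨C, hC⟩ := h.K_decay n
    refine ⟨|C| * (c / 2) ^ (-(1 + n + ε)), fun t u hu => ?_⟩
    have h1 := one_le_bracket (x t.1)
    have ht : 0 ≤ max t.2 0 := le_max_right _ _
    rw [iteratedFDeriv_forceFam h, norm_smul]
    have hε : 0 ≤ ε := h.β_pos.le.trans h.β_le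
    have := forceFam_bound h.c_pos (hesc t.1) ht hu.le (a := w - β) (b := β - ε)
      (γ := 1 + n + ε) (C := |C|) (by positivity) (by linarith) (by linarith [h.β_le])
      (abs_nonneg _)
    refine le_trans ?_ this
    rw [Real.norm_of_nonneg (by positivity), mul_assoc (bracket (x t.1) ^ (w - β)),
      ← Real.rpow_natCast, ← Real.rpow_add (by linarith),
      show 1 + (n : ℝ) + ε + (β - ε) = 1 + β + n by ring]
    refine mul_le_mul_of_nonneg_left ?_ (by positivity)
    refine (hC _).trans ?_
    rw [show -(1 + (n : ℝ) + ε) = -1 - n - ε by ring]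
    exact mul_le_mul_of_nonneg_right (le_abs_self _) (Real.rpow_nonneg (bracket_pos _).le _)
  cont n := by
    refine Continuous.continuousOn ?_
    simp_rw [iteratedFDeriv_forceFam h]
    have hξ : Continuous ξ := continuous_of_discreteTopology
    have hv := h.v_smooth.continuous
    have hx : Continuous x := continuous_of_discreteTopology
    have hl := continuous_bracket (N := N)
    have hp : Continuous fun i => bracket (x i) ^ (w - β) := continuous_of_discreteTopology
    have hK := continuous_iteratedFDeriv_inf h.K_smooth n
    have hm : Continuous fun p : (I × ℝ) × E N => max p.1.2 0 := by fun_prop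
    have hr : Continuous fun p : (I × ℝ) × E N =>
        (bracket (x p.1.1) + max p.1.2 0) ^ (1 + β) := by
      refine Continuous.rpow_const (by fun_prop) fun p => Or.inl ?_
      have := one_le_bracket (x p.1.1)
      have := le_max_right p.1.2 0
      linarith
    have h1 : Continuous fun p : (I × ℝ) × E N => bracket (x p.1.1) ^ (w - β) :=
      hp.comp (continuous_fst.comp continuous_fst)
    have h2 : Continuous fun p : (I × ℝ) × E N => bracket (x p.1.1) + max p.1.2 0 := by fun_prop
    have h3 : Continuous fun p : (I × ℝ) × E N => x p.1.1 + max p.1.2 0 • v (ξ p.1.1) +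
      (bracket (x p.1.1) + max p.1.2 0) • p.2 := by fun_prop
    exact ((h1.mul hr).mul (h2.pow n)).smul (hK.comp h3)

theorem fderiv_forceFam (h : FlowHyp v K ε β c r M η) (w : ℝ) (t : I × ℝ) (u : E N) :
    fderiv ℝ (forceFam v K w β x ξ t) u =
      (bracket (x t.1) ^ (w - β) * (bracket (x t.1) + max t.2 0) ^ (1 + β) *
        (bracket (x t.1) + max t.2 0)) • fderiv ℝ K
        (x t.1 + max t.2 0 • v (ξ t.1) + (bracket (x t.1) + max t.2 0) • u) := by
  have := iteratedFDeriv_forceFam h w t 1 u (x := x) (ξ := ξ)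
  ext1 y
  have := congrArg (fun f => f (fun _ => y)) this
  simpa using this

theorem norm_forceFam_le (h : FlowHyp v K ε β c r M η)
    (hesc : ∀ i, Escapes v c (x i) (ξ i)) (t : I × ℝ) {u : E N} (hu : ‖u‖ ≤ c / 2) :
    ‖forceFam v K 0 β x ξ t u‖ ≤ η * (c / 2) ^ (-1 - β) := by
  have h1 := one_le_bracket (x t.1)
  have ht : 0 ≤ max t.2 0 := le_max_right _ _
  have hβ := h.β_pos
  have := forceFam_bound h.c_pos (hesc t.1) ht hu (a := 0 - β) (b := 0)
      (γ := 1 + β) (C := η) (by positivity) (by linarith) le_rfl h.η_nonneg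
  rw [show -1 - β = -(1 + β) by ring]
  refine le_trans ?_ this
  rw [forceFam, norm_smul, Real.norm_of_nonneg (by positivity), add_zero]
  refine mul_le_mul_of_nonneg_left ?_ (by positivity)
  rw [show -(1 + β) = -1 - β by ring]
  exact h.K_small _

theorem norm_fderiv_forceFam_le (h : FlowHyp v K ε β c r M η)
    (hesc : ∀ i, Escapes v c (x i) (ξ i)) (t : I × ℝ) {u : E N} (hu : ‖u‖ ≤ c / 2) :
    ‖fderiv ℝ (forceFam v K 0 β x ξ t) u‖ ≤ η * (c / 2) ^ (-2 - β) := by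
  have h1 := one_le_bracket (x t.1)
  have ht : 0 ≤ max t.2 0 := le_max_right _ _
  have hβ := h.β_pos
  have := forceFam_bound h.c_pos (hesc t.1) ht hu (a := 0 - β) (b := 0)
      (γ := 2 + β) (C := η) (by positivity) (by linarith) le_rfl h.η_nonneg
  rw [show -2 - β = -(2 + β) by ring]
  refine le_trans ?_ this
  rw [fderiv_forceFam h, norm_smul, Real.norm_of_nonneg (by positivity), add_zero, mul_assoc (bracket (x t.1) ^ (0 - β)),
    ← Real.rpow_add_one (by positivity), show 1 + β + 1 = 2 + β by ring, mul_assoc, mul_assoc]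
  refine mul_le_mul_of_nonneg_left ?_ (by positivity)
  refine mul_le_mul_of_nonneg_left ?_ (by positivity)
  rw [show -(2 + β) = -2 - β by ring]
  exact h.dK_small _

end Flow

/-! ### Trajectories as fixed points of a contraction -/

section FixedPoint

open scoped BoundedContinuousFunction

variable {N : ℕ} {v K : E N → E N} {ε β c r M η : ℝ}
  {I : Type} [TopologicalSpace I] [DiscreteTopology I] {x ξ : I → E N}

/-- Constants as bounded continuous functions. -/
def bcfConst (T : Type) [TopologicalSpace T] (F : Type) [NormedAddCommGroup F] [NormedSpace ℝ F] :
    F →L[ℝ] (T →ᵇ F) :=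
  LinearMap.mkContinuous
    { toFun := fun a => BoundedContinuousFunction.const T a
      map_add' := fun _ _ => rfl
      map_smul' := fun _ _ => rfl } 1 fun a => by
      rw [one_mul]; exact BoundedContinuousFunction.norm_const_le a

@[simp] theorem bcfConst_apply {T F : Type} [TopologicalSpace T] [NormedAddCommGroup F]
    [NormedSpace ℝ F] (a : F) (t : T) : bcfConst T F a t = a := rfl

theorem norm_bcfConst_le {T F : Type} [TopologicalSpace T] [NormedAddCommGroup F]
    [NormedSpace ℝ F] (a : F) : ‖bcfConst T F a‖ ≤ ‖a‖ := BoundedContinuousFunction.norm_const_le a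

/-- The effect of a displacement of the starting point on the normalised deviation. -/
def startFun (x : I → E N) (a : E N) (t : I × ℝ) : E N :=
  (bracket (x t.1) / (bracket (x t.1) + max t.2 0)) • a

theorem continuous_startFun (a : E N) : Continuous (startFun x a) := by
  refine continuous_discrete_prod fun i => ?_
  have h : Continuous fun τ => bracket (x i) / (bracket (x i) + max τ 0) := by
    refine continuous_const.div (by fun_prop) fun τ => ?_
    have := one_le_bracket (x i)
    have := le_max_right τ 0
    linarith
  exact h.smul continuous_const

theorem norm_startFun_le (a : E N) (t : I × ℝ) : ‖startFun x a t‖ ≤ 1 * ‖a‖ := by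
  have h1 := one_le_bracket (x t.1)
  have h2 := le_max_right t.2 0
  rw [startFun, norm_smul, Real.norm_of_nonneg (by positivity)]
  refine mul_le_mul_of_nonneg_right ?_ (norm_nonneg _)
  rw [div_le_one (by linarith)]
  linarith

/-- The operator `startFun`. -/
def startOp (x : I → E N) : E N →L[ℝ] ((I × ℝ) →ᵇ E N) :=
  LinearMap.mkContinuous
    { toFun := fun a => bcfOf (startFun x a)
      map_add' := fun a b => by
        ext1 t
        simp only [BoundedContinuousFunction.add_apply,
          bcfOf_apply (continuous_startFun _) (norm_startFun_le _), startFun, smul_add]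
      map_smul' := fun k a => by
        ext1 t
        simp only [BoundedContinuousFunction.coe_smul, RingHom.id_apply,
          bcfOf_apply (continuous_startFun _) (norm_startFun_le _), startFun, smul_comm k] }
    1 fun a => (BoundedContinuousFunction.norm_le (by positivity)).2 fun t => by
      change ‖bcfOf (startFun x a) t‖ ≤ _
      rw [bcfOf_apply (continuous_startFun _) (norm_startFun_le _)]
      exact norm_startFun_le a t

theorem startOp_apply (a : E N) (t : I × ℝ) : startOp x a t =
    (bracket (x t.1) / (bracket (x t.1) + max t.2 0)) • a :=
  bcfOf_apply (continuous_startFun _) (norm_startFun_le _) t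

theorem norm_startOp_apply_le (a : E N) : ‖startOp x a‖ ≤ ‖a‖ := by
  refine (BoundedContinuousFunction.norm_le (norm_nonneg _)).2 fun t => ?_
  simpa [startOp_apply, startFun] using norm_startFun_le (x := x) a t

theorem one_le_bracket_comp (x : I → E N) (i : I) : 1 ≤ bracket (x i) := one_le_bracket _

/-- The normalised deviation of the trajectory from the free one. -/
def devMap (v : E N → E N) (x ξ : I → E N) (p : (E N × E N) × ((I × ℝ) →ᵇ E N)) :
    (I × ℝ) →ᵇ E N :=
  avgOp (fun i => bracket (x i)) (one_le_bracket_comp x)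
    (nem (velFam v ξ) (bcfConst _ _ p.1.2 + p.2)) + startOp x p.1.1

/-- The map whose fixed points are the trajectories. -/
def flowMap (v K : E N → E N) (w β : ℝ) (hβ : 0 < β) (x ξ : I → E N)
    (p : (E N × E N) × ((I × ℝ) →ᵇ E N)) : (I × ℝ) →ᵇ E N :=
  tailOp (fun i => bracket (x i)) (one_le_bracket_comp x) β hβ
    (nem (forceFam v K w β x ξ) (devMap v x ξ p))

theorem norm_velocity_arg (h : FlowHyp v K ε β c r M η) {p : (E N × E N) × ((I × ℝ) →ᵇ E N)}
    (h1 : ‖p.1‖ < r) (h2 : ‖p.2‖ ≤ r) :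
    ‖bcfConst (I × ℝ) (E N) p.1.2 + p.2‖ < 3 * r := by
  have := norm_add_le (bcfConst (I × ℝ) (E N) p.1.2) p.2
  have a := norm_bcfConst_le (T := I × ℝ) p.1.2
  have b := (norm_snd_le p.1)
  have := h.r_pos
  linarith

theorem nem_velFam_lipschitz (h : FlowHyp v K ε β c r M η) {u w : (I × ℝ) →ᵇ E N}
    (hu : ‖u‖ < 3 * r) (hw : ‖w‖ < 3 * r) :
    ‖nem (velFam v ξ) u - nem (velFam v ξ) w‖ ≤ M * ‖u - w‖ :=
  (nemFamily_velFam h (3 * r)).nem_lipschitz h.M_nonneg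
    (fun t u _ => by rw [fderiv_velFam]; exact h.v_lip _) hu hw

/-- The velocity contributes at most `M * (2 * r)` and the displaced starting point less than `r`;
together this is bounded by the left side of `small_r`. -/
theorem norm_devMap_lt (h : FlowHyp v K ε β c r M η) {p : (E N × E N) × ((I × ℝ) →ᵇ E N)}
    (h1 : ‖p.1‖ < r) (h2 : ‖p.2‖ ≤ r) : ‖devMap v x ξ p‖ < c / 2 := by
  have hr := h.r_pos
  have a := norm_velocity_arg h h1 h2
  have hz : ‖(0 : (I × ℝ) →ᵇ E N)‖ < 3 * r := by rw [norm_zero]; positivity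
  have b := nem_velFam_lipschitz (ξ := ξ) h a hz
  have e : nem (velFam v ξ) (0 : (I × ℝ) →ᵇ E N) = 0 := by
    ext1 t
    rw [(nemFamily_velFam h (3 * r)).nem_apply hz]
    simp [velFam]
  rw [e, sub_zero, sub_zero] at b
  have a' : ‖bcfConst (I × ℝ) (E N) p.1.2 + p.2‖ ≤ 2 * r := by
    have := norm_add_le (bcfConst (I × ℝ) (E N) p.1.2) p.2
    have a := norm_bcfConst_le (T := I × ℝ) p.1.2
    have b := (norm_snd_le p.1)
    linarith
  have c1 := norm_avgOp_apply_le (one_le_bracket_comp x)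
    (nem (velFam v ξ) (bcfConst (I × ℝ) (E N) p.1.2 + p.2))
  have c2 := norm_startOp_apply_le (x := x) p.1.1
  have c3 := norm_fst_le p.1
  have c4 := norm_add_le (avgOp (fun i => bracket (x i)) (one_le_bracket_comp x)
    (nem (velFam v ξ) (bcfConst _ _ p.1.2 + p.2))) (startOp x p.1.1)
  have c5 := mul_le_mul_of_nonneg_left a' h.M_nonneg
  have := h.small_r
  unfold devMap
  linarith

theorem contDiffAt_devMap (h : FlowHyp v K ε β c r M η) {p : (E N × E N) × ((I × ℝ) →ᵇ E N)}
    (h1 : ‖p.1‖ < r) (h2 : ‖p.2‖ ≤ r) : ContDiffAt ℝ ∞ (devMap v x ξ) p := by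
  have a := norm_velocity_arg h h1 h2
  have s1 : ContDiffAt ℝ ∞ (fun p : (E N × E N) × ((I × ℝ) →ᵇ E N) =>
      bcfConst (I × ℝ) (E N) p.1.2 + p.2) p :=
    (((bcfConst (I × ℝ) (E N)).contDiff.comp (contDiff_snd.comp contDiff_fst)).add
      contDiff_snd).contDiffAt
  have s2 := ((nemFamily_velFam (ξ := ξ) h (3 * r)).contDiffAt_nem a).comp p s1
  exact ((avgOp (fun i => bracket (x i)) (one_le_bracket_comp x)).contDiff.contDiffAt.comp p s2).add
    ((startOp x).contDiff.comp (contDiff_fst.comp contDiff_fst)).contDiffAt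

theorem contDiffAt_flowMap (h : FlowHyp v K ε β c r M η)
    (hesc : ∀ i, Escapes v c (x i) (ξ i)) {w : ℝ} (hw : w ≤ ε)
    {p : (E N × E N) × ((I × ℝ) →ᵇ E N)}
    (h1 : ‖p.1‖ < r) (h2 : ‖p.2‖ ≤ r) : ContDiffAt ℝ ∞ (flowMap v K w β h.β_pos x ξ) p := by
  have s2 := ((nemFamily_forceFam h hesc hw).contDiffAt_nem
    (norm_devMap_lt (x := x) (ξ := ξ) h h1 h2)).comp p (contDiffAt_devMap h h1 h2)
  exact (tailOp (fun i => bracket (x i)) (one_le_bracket_comp x) β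
    h.β_pos).contDiff.contDiffAt.comp p s2

theorem norm_flowMap_le (h : FlowHyp v K ε β c r M η)
    (hesc : ∀ i, Escapes v c (x i) (ξ i)) {p : (E N × E N) × ((I × ℝ) →ᵇ E N)}
    (h1 : ‖p.1‖ < r) (h2 : ‖p.2‖ ≤ r) : ‖flowMap v K 0 β h.β_pos x ξ p‖ ≤ r / 2 := by
  have hβ := h.β_pos
  have hc := h.c_pos
  have hd := norm_devMap_lt (x := x) (ξ := ξ) h h1 h2
  refine (norm_tailOp_apply_le _ _ _).trans (le_trans ?_ h.small_K)
  refine mul_le_mul_of_nonneg_left ?_ (by positivity)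
  have hη := h.η_nonneg
  refine (BoundedContinuousFunction.norm_le (by positivity)).2 fun t => ?_
  rw [(nemFamily_forceFam h hesc (hβ.le.trans h.β_le)).nem_apply hd]
  exact norm_forceFam_le h hesc t (((devMap v x ξ p).norm_coe_le_norm t).trans hd.le)

theorem flowMap_lipschitz (h : FlowHyp v K ε β c r M η)
    (hesc : ∀ i, Escapes v c (x i) (ξ i)) {δ : E N × E N} {q₁ q₂ : (I × ℝ) →ᵇ E N}
    (h0 : ‖δ‖ < r) (h1 : ‖q₁‖ ≤ r) (h2 : ‖q₂‖ ≤ r) :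
    ‖flowMap v K 0 β h.β_pos x ξ (δ, q₁) - flowMap v K 0 β h.β_pos x ξ (δ, q₂)‖ ≤
      1 / 2 * ‖q₁ - q₂‖ := by
  have hβ := h.β_pos
  have hc := h.c_pos
  have hη := h.η_nonneg
  have d1 := norm_devMap_lt (x := x) (ξ := ξ) h (p := (δ, q₁)) h0 h1
  have d2 := norm_devMap_lt (x := x) (ξ := ξ) h (p := (δ, q₂)) h0 h2
  have a1 := norm_velocity_arg h (p := (δ, q₁)) h0 h1
  have a2 := norm_velocity_arg h (p := (δ, q₂)) h0 h2
  have e1 := (nemFamily_forceFam h hesc (hβ.le.trans h.β_le)).nem_lipschitz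
    (L := η * (c / 2) ^ (-2 - β)) (by positivity)
    (fun t u hu => norm_fderiv_forceFam_le h hesc t hu.le) d1 d2
  have e2 := nem_velFam_lipschitz (ξ := ξ) h a1 a2
  have e3 : devMap v x ξ (δ, q₁) - devMap v x ξ (δ, q₂) =
      avgOp (fun i => bracket (x i)) (one_le_bracket_comp x)
        (nem (velFam v ξ) (bcfConst _ _ δ.2 + q₁) - nem (velFam v ξ) (bcfConst _ _ δ.2 + q₂)) := by
    rw [map_sub]
    unfold devMap
    abel
  have e4 : ‖devMap v x ξ (δ, q₁) - devMap v x ξ (δ, q₂)‖ ≤ M * ‖q₁ - q₂‖ := by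
    rw [e3]
    refine (norm_avgOp_apply_le _ _).trans (e2.trans_eq ?_)
    simp
  unfold flowMap
  rw [← map_sub]
  refine (norm_tailOp_apply_le _ _ _).trans ?_
  calc _ ≤ β⁻¹ * (η * (c / 2) ^ (-2 - β) * (M * ‖q₁ - q₂‖)) := by
        refine mul_le_mul_of_nonneg_left (e1.trans ?_) (by positivity)
        exact mul_le_mul_of_nonneg_left e4 (by positivity)
    _ = β⁻¹ * (η * (c / 2) ^ (-2 - β) * M) * ‖q₁ - q₂‖ := by ring
    _ ≤ _ := mul_le_mul_of_nonneg_right h.small_dK (norm_nonneg _)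

/-- Undoes the normalisation: the argument of `K` in `forceFam` is the actual position of the
trajectory with displaced starting data. -/
theorem position_devMap (h : FlowHyp v K ε β c r M η) {δ : E N × E N} {q : (I × ℝ) →ᵇ E N}
    (h1 : ‖δ‖ < r) (h2 : ‖q‖ ≤ r) (i : I) {s : ℝ} (hs : 0 ≤ s) :
    x i + s • v (ξ i) + (bracket (x i) + s) • devMap v x ξ (δ, q) (i, s) =
      x i + bracket (x i) • δ.1 + ∫ σ in (0 : ℝ)..s, v (ξ i + δ.2 + q (i, σ)) := by
  have hb : bracket (x i) + s ≠ 0 := by linarith [one_le_bracket (x i)]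
  have a := norm_velocity_arg h (p := (δ, q)) h1 h2
  have hv := h.v_smooth.continuous
  have hq := continuous_slice q i
  unfold devMap
  rw [BoundedContinuousFunction.add_apply, avgOp_apply, startOp_apply, max_eq_left hs, smul_add,
    smul_smul, smul_smul, mul_inv_cancel₀ hb, one_smul, mul_div_cancel₀ _ hb]
  have e : ∀ σ, nem (velFam v ξ) (bcfConst (I × ℝ) (E N) δ.2 + q) (i, σ) =
      v (ξ i + δ.2 + q (i, σ)) - v (ξ i) := fun σ => by
    rw [(nemFamily_velFam h (3 * r)).nem_apply a]
    simp [velFam, add_assoc]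
  simp only [e]
  rw [intervalIntegral.integral_sub (Continuous.intervalIntegrable (by fun_prop) _ _)
    (Continuous.intervalIntegrable (by fun_prop) _ _), intervalIntegral.integral_const, sub_zero]
  abel

theorem tailWeight_mul (l w β : ℝ) {s : ℝ} (hl : 1 ≤ l) (hs : 0 ≤ s) :
    tailWeight l β s * (l ^ (w - β) * (l + max s 0) ^ (1 + β)) = l ^ w := by
  rw [tailWeight, max_eq_left hs]
  have h1 : l ^ β * l ^ (w - β) = l ^ w := by
    rw [← Real.rpow_add (by linarith)]; congr 1; ring
  have h2 : (l + s) ^ (-1 - β) * (l + s) ^ (1 + β) = 1 := by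
    rw [← Real.rpow_add (by linarith), show -1 - β + (1 + β) = 0 by ring, Real.rpow_zero]
  calc _ = (l ^ β * l ^ (w - β)) * ((l + s) ^ (-1 - β) * (l + s) ^ (1 + β)) := by ring
    _ = _ := by rw [h1, h2, mul_one]

/-- The parameter `w` enters only through the factor `⟨x⟩ ^ w`. A fixed point for `w = 0`, inserted
into the map for `w = ε`, therefore yields itself times `⟨x⟩ ^ ε`, still bounded. This is the source
of the decay `⟨x⟩ ^ (-ε)`. -/
theorem flowMap_apply (h : FlowHyp v K ε β c r M η)
    (hesc : ∀ i, Escapes v c (x i) (ξ i)) {w : ℝ} (hw : w ≤ ε) {δ : E N × E N}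
    {q : (I × ℝ) →ᵇ E N} (h1 : ‖δ‖ < r) (h2 : ‖q‖ ≤ r) (i : I) (τ : ℝ) :
    flowMap v K w β h.β_pos x ξ (δ, q) (i, τ) = bracket (x i) ^ w •
      ∫ s in Set.Ioi (max τ 0), K (x i + bracket (x i) • δ.1 +
        ∫ σ in (0 : ℝ)..s, v (ξ i + δ.2 + q (i, σ))) := by
  have hd := norm_devMap_lt (x := x) (ξ := ξ) h (p := (δ, q)) h1 h2
  unfold flowMap
  rw [tailOp_apply, ← integral_smul]
  refine setIntegral_congr_fun measurableSet_Ioi fun s hs => ?_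
  have hs0 : 0 ≤ s := (le_max_right τ 0).trans (le_of_lt hs)
  simp only
  rw [(nemFamily_forceFam h hesc hw).nem_apply hd, forceFam, smul_smul,
    tailWeight_mul _ _ _ (one_le_bracket _) hs0, max_eq_left hs0, position_devMap h h1 h2 i hs0]

theorem isTraj_of_fixed (h : FlowHyp v K ε β c r M η)
    (hesc : ∀ i, Escapes v c (x i) (ξ i)) {δ : E N × E N}
    {q : (I × ℝ) →ᵇ E N} (h1 : ‖δ‖ < r) (h2 : ‖q‖ ≤ r)
    (hq : flowMap v K 0 β h.β_pos x ξ (δ, q) = q) (i : I) :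
    IsTraj v K (x i + bracket (x i) • δ.1) (ξ i + δ.2) fun τ => q (i, τ) := by
  refine ⟨continuous_slice q i, fun τ => ?_⟩
  have := flowMap_apply h hesc (h.β_pos.le.trans h.β_le) h1 h2 i τ
  rwa [hq, Real.rpow_zero, one_smul] at this

/-- Small trajectories are unique. -/
theorem IsTraj.unique (h : FlowHyp v K ε β c r M η) {x ξ : E N} (hesc : Escapes v c x ξ)
    {Q₁ Q₂ : ℝ → E N} (h1 : IsTraj v K x ξ Q₁) (h2 : IsTraj v K x ξ Q₂)
    (hb1 : ∀ τ, ‖Q₁ τ‖ ≤ r) (hb2 : ∀ τ, ‖Q₂ τ‖ ≤ r) : Q₁ = Q₂ := by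
  have hr := h.r_pos
  -- A single small trajectory is a fixed point for the one-point index set, so uniqueness is that
  -- of the contraction.
  have key : ∀ Q : ℝ → E N, IsTraj v K x ξ Q → (∀ τ, ‖Q τ‖ ≤ r) →
      ∃ q : (Unit × ℝ) →ᵇ E N, ‖q‖ ≤ r ∧ (∀ τ, q ((), τ) = Q τ) ∧
        flowMap v K 0 β h.β_pos (fun _ : Unit => x) (fun _ => ξ) (0, q) = q := by
    intro Q hQ hb
    refine ⟨BoundedContinuousFunction.ofNormedAddCommGroup (fun t : Unit × ℝ => Q t.2)
      (hQ.1.comp continuous_snd) r fun t => hb _,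
      BoundedContinuousFunction.norm_ofNormedAddCommGroup_le (hQ.1.comp continuous_snd) hr.le
        (fun t => hb _), fun τ => rfl, ?_⟩
    ext1 ⟨i, τ⟩
    rw [flowMap_apply h (fun _ => hesc) (h.β_pos.le.trans h.β_le) (by simpa using hr)
      (BoundedContinuousFunction.norm_ofNormedAddCommGroup_le _ hr.le (fun t => hb _)),
      Real.rpow_zero, one_smul]
    simpa using (hQ.2 τ).symm
  obtain ⟨q₁, n1, e1, f1⟩ := key Q₁ h1 hb1
  obtain ⟨q₂, n2, e2, f2⟩ := key Q₂ h2 hb2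
  have := flowMap_lipschitz h (fun _ : Unit => hesc) (δ := 0) (by simpa using hr) n1 n2
  rw [f1, f2] at this
  have h0 : ‖q₁ - q₂‖ = 0 := by linarith [norm_nonneg (q₁ - q₂)]
  rw [norm_sub_eq_zero_iff] at h0
  ext1 τ
  rw [← e1, ← e2, h0]

/-- The fixed point is found in the ball of radius `r / 2`, which leaves an open neighbourhood
inside the radius `r` for the implicit function theorem. -/
theorem exists_fixed (h : FlowHyp v K ε β c r M η) (hesc : ∀ i, Escapes v c (x i) (ξ i)) :
    ∃ q : (I × ℝ) →ᵇ E N, ‖q‖ ≤ r / 2 ∧ flowMap v K 0 β h.β_pos x ξ (0, q) = q := by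
  have hr := h.r_pos
  have h0 : ‖(0 : E N × E N)‖ < r := by simpa using hr
  set f : ((I × ℝ) →ᵇ E N) → ((I × ℝ) →ᵇ E N) := fun q => flowMap v K 0 β h.β_pos x ξ (0, q)
  set s : Set ((I × ℝ) →ᵇ E N) := Metric.closedBall 0 (r / 2)
  have hs : ∀ q ∈ s, ‖q‖ ≤ r := fun q hq => by
    have : ‖q‖ ≤ r / 2 := by simpa [s] using hq
    linarith
  have hm : Set.MapsTo f s s := fun q hq => by
    simpa [s] using norm_flowMap_le (x := x) (ξ := ξ) h hesc (p := (0, q)) h0 (hs q hq)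
  have hcon : ContractingWith (1 / 2) (hm.restrict f s s) := by
    refine ⟨by norm_num, LipschitzWith.of_dist_le_mul fun a b => ?_⟩
    rw [Subtype.dist_eq, Subtype.dist_eq, dist_eq_norm, dist_eq_norm]
    simpa using flowMap_lipschitz (x := x) (ξ := ξ) h hesc h0 (hs _ a.2) (hs _ b.2)
  obtain ⟨q, hqs, hq, -⟩ := hcon.exists_fixedPoint' Metric.isClosed_closedBall.isComplete hm
    (x := 0) (by simpa [s] using by positivity) (edist_ne_top _ _)
  exact ⟨q, by simpa [s] using hqs, hq⟩

end FixedPoint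

/-! ### Smooth dependence on the starting point -/

section Local

open scoped BoundedContinuousFunction

variable {N : ℕ} {v K : E N → E N} {ε β c r M η : ℝ}
  {I : Type} [TopologicalSpace I] [DiscreteTopology I] {x ξ : I → E N}

theorem isInvertible_id_sub {B : Type*} [NormedAddCommGroup B] [NormedSpace ℝ B] [CompleteSpace B]
    (A : B →L[ℝ] B) (hA : ‖A‖ < 1) : (ContinuousLinearMap.id ℝ B - A).IsInvertible :=
  ⟨ContinuousLinearEquiv.ofUnit (Units.oneSub A hA), rfl⟩

theorem norm_fderiv_flowMap_le (h : FlowHyp v K ε β c r M η)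
    (hesc : ∀ i, Escapes v c (x i) (ξ i)) {q : (I × ℝ) →ᵇ E N} (hq : ‖q‖ < r) :
    ‖fderiv ℝ (flowMap v K 0 β h.β_pos x ξ) (0, q) ∘L
      ContinuousLinearMap.inr ℝ (E N × E N) ((I × ℝ) →ᵇ E N)‖ ≤ 1 / 2 := by
  have h0 : ‖(0 : E N × E N)‖ < r := by simpa using h.r_pos
  have hd : HasFDerivAt (fun p => flowMap v K 0 β h.β_pos x ξ (0, p))
      (fderiv ℝ (flowMap v K 0 β h.β_pos x ξ) (0, q) ∘L
        ContinuousLinearMap.inr ℝ (E N × E N) ((I × ℝ) →ᵇ E N)) q := by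
    have h1 := ((contDiffAt_flowMap (x := x) (ξ := ξ) h hesc (h.β_pos.le.trans h.β_le)
      (p := (0, q)) h0 hq.le).differentiableAt (by simp)).hasFDerivAt
    exact h1.comp q (hasFDerivAt_prodMk_right (0 : E N × E N) q)
  have := hd.le_of_lipschitzOn (s := {p | ‖p‖ < r}) (C := 1 / 2)
    ((isOpen_lt continuous_norm continuous_const).mem_nhds hq)
    (LipschitzOnWith.of_dist_le_mul fun a ha b hb => by
      rw [dist_eq_norm, dist_eq_norm]
      simpa using flowMap_lipschitz (x := x) (ξ := ξ) h hesc h0 (le_of_lt ha) (le_of_lt hb))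
  simpa using this

/-- The implicit function theorem is applied to `q - F(δ, q)`, whose derivative in `q` is the
identity minus an operator of norm at most `1 / 2`. One neighbourhood of `δ = 0` serves all starting
points simultaneously, which makes the resulting derivative bounds uniform. The map `Φ` is the
solution in the weight `ε`. -/
theorem exists_local_solution (h : FlowHyp v K ε β c r M η)
    (hesc : ∀ i, Escapes v c (x i) (ξ i)) :
    ∃ q Φ : E N × E N → ((I × ℝ) →ᵇ E N), ContDiffAt ℝ ∞ q 0 ∧ ContDiffAt ℝ ∞ Φ 0 ∧
      ∀ᶠ δ in nhds 0, ‖δ‖ < r ∧ ‖q δ‖ ≤ r ∧ flowMap v K 0 β h.β_pos x ξ (δ, q δ) = q δ ∧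
        ∀ i τ, Φ δ (i, τ) = bracket (x i) ^ ε • q δ (i, τ) := by
  obtain ⟨q₀, hq₀, hfix⟩ := exists_fixed h hesc
  have hr := h.r_pos
  have hε := h.β_pos.le.trans h.β_le
  have h0 : ‖(0 : E N × E N)‖ < r := by simpa using hr
  have hq₀' : ‖q₀‖ < r := by linarith
  have hF := contDiffAt_flowMap (x := x) (ξ := ξ) h hesc hε (p := (0, q₀)) h0 hq₀'.le
  set f : (E N × E N) × ((I × ℝ) →ᵇ E N) → ((I × ℝ) →ᵇ E N) :=
    fun p => p.2 - flowMap v K 0 β h.β_pos x ξ p with hf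
  have cdf : ContDiffAt ℝ ∞ f (0, q₀) := contDiffAt_snd.sub hF
  have hinv : (fderiv ℝ f (0, q₀) ∘L
      ContinuousLinearMap.inr ℝ (E N × E N) ((I × ℝ) →ᵇ E N)).IsInvertible := by
    have e : fderiv ℝ f (0, q₀) = ContinuousLinearMap.snd ℝ _ _ -
        fderiv ℝ (flowMap v K 0 β h.β_pos x ξ) (0, q₀) :=
      (hasFDerivAt_snd.sub (hF.differentiableAt (by simp)).hasFDerivAt).fderiv
    rw [e, ContinuousLinearMap.sub_comp, ContinuousLinearMap.snd_comp_inr]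
    exact isInvertible_id_sub _ ((norm_fderiv_flowMap_le h hesc hq₀').trans_lt (by norm_num))
  set q := cdf.implicitFunction (by simp) hinv with hq
  have hqs : ContDiffAt ℝ ∞ q 0 := cdf.contDiffAt_implicitFunction (by simp) hinv
  have hq0 : q 0 = q₀ := cdf.implicitFunction_apply_self (by simp) hinv
  have hev : ∀ᶠ δ in nhds 0, f (δ, q δ) = f (0, q₀) :=
    cdf.eventually_apply_implicitFunction (by simp) hinv
  have hqn : ∀ᶠ δ in nhds 0, ‖q δ‖ < r :=
    hqs.continuousAt.norm.eventually_lt_const (by simpa only [hq0] using hq₀')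
  have hδn : ∀ᶠ δ in nhds (0 : E N × E N), ‖δ‖ < r :=
    continuous_norm.continuousAt.eventually_lt_const h0
  refine ⟨q, fun δ => flowMap v K ε β h.β_pos x ξ (δ, q δ), hqs, ?_, ?_⟩
  · have h2 := contDiffAt_flowMap (x := x) (ξ := ξ) h hesc le_rfl (p := (0, q 0)) h0
      (by rw [hq0]; exact hq₀'.le)
    exact h2.comp (f := fun δ => (δ, q δ)) 0 (contDiffAt_id.prodMk hqs)
  · filter_upwards [hev, hqn, hδn] with δ h1 h2 h3
    have h4 : flowMap v K 0 β h.β_pos x ξ (δ, q δ) = q δ := by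
      have : q δ - flowMap v K 0 β h.β_pos x ξ (δ, q δ) =
        q₀ - flowMap v K 0 β h.β_pos x ξ (0, q₀) := h1
      rw [hfix, sub_self, sub_eq_zero] at this
      exact this.symm
    refine ⟨h3, h2.le, h4, fun i τ => ?_⟩
    have e1 := flowMap_apply h hesc hε h3 h2.le i τ
    rw [h4, Real.rpow_zero, one_smul] at e1
    rw [flowMap_apply h hesc le_rfl h3 h2.le, e1]

/-- The linearised trajectory equation. -/
theorem linearized (h : FlowHyp v K ε β c r M η)
    (hesc : ∀ i, Escapes v c (x i) (ξ i)) {q : E N × E N → ((I × ℝ) →ᵇ E N)}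
    (hqs : ContDiffAt ℝ ∞ q 0)
    (hev : ∀ᶠ δ in nhds 0, ‖δ‖ < r ∧ ‖q δ‖ ≤ r ∧ flowMap v K 0 β h.β_pos x ξ (δ, q δ) = q δ)
    (a : E N) (i : I) (τ : ℝ) :
    fderiv ℝ q 0 (a, 0) (i, τ) = ∫ s in Set.Ioi (max τ 0),
      fderiv ℝ K (x i + ∫ σ in (0 : ℝ)..s, v (ξ i + q 0 (i, σ)))
        (bracket (x i) • a + ∫ σ in (0 : ℝ)..s,
          fderiv ℝ v (ξ i + q 0 (i, σ)) (fderiv ℝ q 0 (a, 0) (i, σ))) := by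
  obtain ⟨h0, hq0, -⟩ := hev.self_of_nhds
  have hε := h.β_pos.le.trans h.β_le
  have hd := norm_devMap_lt (x := x) (ξ := ξ) h (p := (0, q 0)) h0 hq0
  have ha := norm_velocity_arg h (p := (0, q 0)) h0 hq0
  set q' := fderiv ℝ q 0
  have hq' : HasFDerivAt q q' 0 := (hqs.differentiableAt (by simp)).hasFDerivAt
  have d1 : HasFDerivAt (fun δ : E N × E N => bcfConst (I × ℝ) (E N) δ.2 + q δ)
      (bcfConst (I × ℝ) (E N) ∘L ContinuousLinearMap.snd ℝ _ _ + q') 0 :=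
    ((bcfConst (I × ℝ) (E N)).hasFDerivAt.comp (f := fun δ : E N × E N => δ.2) 0
      hasFDerivAt_snd).add hq'
  have d2 := ((nemFamily_velFam (ξ := ξ) h (3 * r)).hasFDerivAt_nem ha).comp
    (f := fun δ : E N × E N => bcfConst (I × ℝ) (E N) δ.2 + q δ) 0 d1
  have d3 := (avgOp (F := E N) (fun i => bracket (x i)) (one_le_bracket_comp x)).hasFDerivAt.comp
    (f := nem (velFam v ξ) ∘ fun δ : E N × E N => bcfConst (I × ℝ) (E N) δ.2 + q δ) 0 d2
  have d4 := d3.add ((startOp x).hasFDerivAt.comp (f := fun δ : E N × E N => δ.1) 0 hasFDerivAt_fst)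
  have d5 := ((nemFamily_forceFam h hesc hε).hasFDerivAt_nem hd).comp
    (f := fun δ => devMap v x ξ (δ, q δ)) 0 d4
  have d6 := (tailOp (F := E N) (fun i => bracket (x i)) (one_le_bracket_comp x) β
    h.β_pos).hasFDerivAt.comp
    (f := nem (forceFam v K 0 β x ξ) ∘ fun δ => devMap v x ξ (δ, q δ)) 0 d5
  have d7 : q =ᶠ[nhds 0] (tailOp (F := E N) (fun i => bracket (x i)) (one_le_bracket_comp x) β
      h.β_pos) ∘ (nem (forceFam v K 0 β x ξ) ∘ fun δ => devMap v x ξ (δ, q δ)) := by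
    filter_upwards [hev] with δ hδ
    exact hδ.2.2.symm
  -- The fixed-point equation holds near `δ = 0`, so its two sides have the same derivative.
  -- Evaluated on `(a, 0)`, this is the claimed integral equation.
  have d8 := hq'.unique (d6.congr_of_eventuallyEq d7)
  have hv := (h.v_smooth.fderiv_right (m := ∞) (by simp)).continuous
  have hqc := continuous_slice (q 0) i
  have hqc' := continuous_slice (q' (a, 0)) i
  conv_lhs => rw [d8]
  simp only [ContinuousLinearMap.comp_apply]
  rw [tailOp_apply]
  refine setIntegral_congr_fun measurableSet_Ioi fun s hs => ?_
  have hs0 : 0 ≤ s := (le_max_right τ 0).trans (le_of_lt hs)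
  have hl := one_le_bracket (x i)
  simp only
  rw [bcfApply_apply, (nemFamily_forceFam h hesc hε).fderiv.nem_apply hd, fderiv_forceFam h]
  simp only [max_eq_left hs0]
  rw [position_devMap h h0 hq0 i hs0]
  simp only [add_apply, ContinuousLinearMap.comp_apply,
    BoundedContinuousFunction.add_apply]
  rw [avgOp_apply, startOp_apply]
  simp only [max_eq_left hs0, bcfApply_apply,
    (nemFamily_velFam (ξ := ξ) h (3 * r)).fderiv.nem_apply ha, fderiv_velFam]
  simp only [ContinuousLinearMap.coe_fst', ContinuousLinearMap.coe_snd', map_zero, zero_add,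
    Prod.fst_zero, Prod.snd_zero, smul_zero, add_zero, smul_apply]
  have e := tailWeight_mul (bracket (x i)) 0 β hl hs0
  rw [max_eq_left hs0, Real.rpow_zero] at e
  rw [smul_smul, ← mul_assoc, e, one_mul, ← map_smul, smul_add, smul_smul, smul_smul,
    mul_inv_cancel₀ (by linarith), one_smul, mul_div_cancel₀ _ (by linarith)]
  exact congrArg _ (add_comm _ _)

/-- The phase space point `(x + ⟨x⟩ δ₁, ξ + δ₂)`. -/
def shift (p δ : E N × E N) : E N × E N := (p.1 + bracket p.1 • δ.1, p.2 + δ.2)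

theorem shift_zero (p : E N × E N) : shift p 0 = p := by simp [shift]

theorem contDiff_shift (p : E N × E N) : ContDiff ℝ ∞ (shift p) := by
  unfold shift
  fun_prop

theorem eventually_shift_mem {Ω : Set (E N × E N)} (hΩ : IsOpen Ω) {p : E N × E N} (hp : p ∈ Ω) :
    ∀ᶠ δ in nhds 0, shift p δ ∈ Ω :=
  (contDiff_shift p).continuous.continuousAt.eventually
    (by rw [shift_zero]; exact hΩ.mem_nhds hp)

/-- The trajectories starting from an open set of escaping points form a smooth family. -/
theorem exists_trajField (h : FlowHyp v K ε β c r M η) {Ω : Set (E N × E N)} (hΩ : IsOpen Ω)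
    (hesc : ∀ p ∈ Ω, Escapes v c p.1 p.2) :
    ∃ Q : E N × E N → ℝ → E N, (∀ p ∈ Ω, IsTraj v K p.1 p.2 (Q p) ∧ ∀ τ, ‖Q p τ‖ ≤ r) ∧
      JetBdd (fun j : Ω × ℝ => bracket (j.1 : E N × E N).1 ^ (-ε))
        (fun j δ => Q (shift (j.1 : E N × E N) δ) j.2) ∧
      ∀ p ∈ Ω, ∃ L : E N →L[ℝ] E N, HasFDerivAt (fun y => Q (y, p.2) 0) L p.1 ∧
        ∀ a, ∃ π : ℝ → E N, Continuous π ∧ (∃ C, ∀ τ, ‖π τ‖ ≤ C) ∧ π 0 = L a ∧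
          ∀ τ, π τ = ∫ s in Set.Ioi (max τ 0),
            fderiv ℝ K (p.1 + ∫ σ in (0 : ℝ)..s, v (p.2 + Q p σ))
              (a + ∫ σ in (0 : ℝ)..s, fderiv ℝ v (p.2 + Q p σ) (π σ)) := by
  classical
  -- The points of `Ω` serve as indices only, so the subspace topology is replaced by the discrete
  -- one.
  let _ : TopologicalSpace Ω := ⊥
  have _ : DiscreteTopology Ω := ⟨rfl⟩
  obtain ⟨q, Φ, hq, hΦ, hev⟩ := exists_local_solution (I := Ω) (x := fun i => i.1.1)
    (ξ := fun i => i.1.2) h (fun i => hesc i.1 i.2)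
  have hr := h.r_pos
  set Q : E N × E N → ℝ → E N := fun p τ => if hp : p ∈ Ω then q 0 (⟨p, hp⟩, τ) else 0 with hQ
  have hQ0 : ∀ i : Ω, Q i.1 = fun τ => q 0 (i, τ) := fun i => by
    ext1 τ
    simp only [hQ, dif_pos i.2]
  have htraj : ∀ p ∈ Ω, IsTraj v K p.1 p.2 (Q p) ∧ ∀ τ, ‖Q p τ‖ ≤ r := by
    intro p hp
    obtain ⟨h0, h1, h2, -⟩ := hev.self_of_nhds
    rw [hQ0 ⟨p, hp⟩]
    refine ⟨?_, fun τ => ((q 0).norm_coe_le_norm _).trans h1⟩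
    simpa using isTraj_of_fixed (I := Ω) (x := fun i => i.1.1) (ξ := fun i => i.1.2) h
      (fun i => hesc i.1 i.2) h0 h1 h2 ⟨p, hp⟩
  -- By uniqueness, the local solution with displacement `δ` at the index `i` is the trajectory that
  -- the field `Q` assigns to the displaced point. Thus the derivatives of `Q` at all points of `Ω`
  -- are read off from one germ at `δ = 0`.
  have hloc : ∀ i : Ω, ∀ᶠ δ in nhds 0, ∀ τ, Q (shift i.1 δ) τ = q δ (i, τ) := by
    intro i
    filter_upwards [hev, eventually_shift_mem hΩ i.2] with δ ⟨h0, h1, h2, _⟩ h3 τ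
    have t1 := isTraj_of_fixed (I := Ω) (x := fun i => i.1.1) (ξ := fun i => i.1.2) h
      (fun i => hesc i.1 i.2) h0 h1 h2 i
    have t2 := htraj _ h3
    exact congrFun (IsTraj.unique h (hesc _ h3) t2.1 t1 t2.2
      (fun τ => ((q δ).norm_coe_le_norm _).trans h1)) τ
  refine ⟨Q, htraj, ?_, ?_⟩
  · have j1 := (JetBdd.of_bcf hΦ).smul_weight (fun j => bracket (j.1 : E N × E N).1 ^ (-ε))
    have j2 : JetBdd (fun j : Ω × ℝ => bracket (j.1 : E N × E N).1 ^ (-ε))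
        (fun j δ => bracket (j.1 : E N × E N).1 ^ (-ε) • Φ δ j) :=
      j1.mono zero_le_one fun j => by
        rw [abs_of_nonneg (Real.rpow_nonneg (bracket_pos _).le _)]
        simp
    refine j2.of_eventuallyEq fun j => ?_
    filter_upwards [hev, hloc j.1] with δ h1 h2
    rw [h2, h1.2.2.2 j.1 j.2, smul_smul, ← Real.rpow_add (bracket_pos _)]
    simp
  · intro p hp
    set i : Ω := ⟨p, hp⟩ with hi
    have hb : bracket p.1 ≠ 0 := (bracket_pos _).ne'
    -- A displacement `y - x` of the position corresponds to `δ₁ = ⟨x⟩⁻¹ (y - x)`.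
    set T : E N →L[ℝ] E N × E N :=
      (bracket p.1)⁻¹ • ContinuousLinearMap.inl ℝ (E N) (E N) with hT
    refine ⟨bcfEval (i, 0) ∘L fderiv ℝ q 0 ∘L T, ?_, fun a => ?_⟩
    · have hqd : HasFDerivAt q (fderiv ℝ q 0) (T (p.1 - p.1)) := by
        rw [sub_self, map_zero]
        exact (hq.differentiableAt (by simp)).hasFDerivAt
      have d1 : HasFDerivAt (fun y => T (y - p.1)) T p.1 :=
        T.hasFDerivAt.comp p.1 (hasFDerivAt_sub_const p.1)
      have d2 := (bcfEval (F := E N) (i, (0 : ℝ))).hasFDerivAt.comp p.1 (hqd.comp p.1 d1)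
      refine d2.congr_of_eventuallyEq ?_
      have ht : Filter.Tendsto (fun y => T (y - p.1)) (nhds p.1) (nhds 0) := by
        have := d1.continuousAt
        rw [ContinuousAt, sub_self, map_zero] at this
        exact this
      filter_upwards [ht.eventually (hloc i)] with y hy
      have := hy 0
      simp only [Function.comp_apply, bcfEval_apply]
      rw [← this]
      simp [hT, shift, hi, smul_smul, mul_inv_cancel₀ hb]
    · refine ⟨fun τ => fderiv ℝ q 0 (T a) (i, τ), continuous_slice _ i,
        ⟨‖fderiv ℝ q 0 (T a)‖, fun τ => BoundedContinuousFunction.norm_coe_le_norm _ _⟩, rfl,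
        fun τ => ?_⟩
      have e : T a = ((bracket p.1)⁻¹ • a, 0) := by simp [hT]
      have := linearized (I := Ω) (x := fun i => i.1.1) (ξ := fun i => i.1.2) h
        (fun i => hesc i.1 i.2) hq (hev.mono fun δ hδ => ⟨hδ.1, hδ.2.1, hδ.2.2.1⟩)
        ((bracket p.1)⁻¹ • a) i τ
      simp only
      rw [e, this]
      simp only [hi, smul_smul, mul_inv_cancel₀ hb, one_smul, hQ0 ⟨p, hp⟩]

end Local

/-! ### Conservation of energy and of the symplectic form -/

section Conservation

open scoped RealInnerProductSpace

variable {N : ℕ} {v K : E N → E N} {ε β c r M η : ℝ} {x ξ : E N} {Q : ℝ → E N}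

/-- The position along a trajectory. -/
def trajPos (v : E N → E N) (x ξ : E N) (Q : ℝ → E N) (s : ℝ) : E N :=
  x + ∫ σ in (0 : ℝ)..s, v (ξ + Q σ)

theorem hasDerivAt_trajPos (hv : Continuous v) (hQ : Continuous Q) (s : ℝ) :
    HasDerivAt (trajPos v x ξ Q) (v (ξ + Q s)) s := by
  have hc : Continuous fun σ => v (ξ + Q σ) := by fun_prop
  exact (intervalIntegral.integral_hasDerivAt_right (hc.intervalIntegrable _ _)
    hc.stronglyMeasurable.stronglyMeasurableAtFilter hc.continuousAt).const_add x

theorem continuous_trajPos (hv : Continuous v) (hQ : Continuous Q) :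
    Continuous (trajPos v x ξ Q) :=
  continuous_iff_continuousAt.2 fun s => (hasDerivAt_trajPos hv hQ s).continuousAt

theorem trajPos_escape (h : FlowHyp v K ε β c r M η) (hesc : Escapes v c x ξ)
    (hQ : Continuous Q) (hb : ∀ τ, ‖Q τ‖ ≤ r) {s : ℝ} (hs : 0 ≤ s) :
    c / 2 * (bracket x + s) ≤ bracket (trajPos v x ξ Q s) := by
  have hv := h.v_smooth.continuous
  have e : trajPos v x ξ Q s = x + s • v ξ + ∫ σ in (0 : ℝ)..s, (v (ξ + Q σ) - v ξ) := by
    rw [intervalIntegral.integral_sub (Continuous.intervalIntegrable (by fun_prop) _ _)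
      (Continuous.intervalIntegrable (by fun_prop) _ _), intervalIntegral.integral_const, sub_zero,
      trajPos]
    abel
  have h1 : ‖∫ σ in (0 : ℝ)..s, (v (ξ + Q σ) - v ξ)‖ ≤ M * r * |s - 0| := by
    refine intervalIntegral.norm_integral_le_of_norm_le_const fun σ _ => ?_
    have := Convex.norm_image_sub_le_of_norm_fderiv_le (𝕜 := ℝ) (f := v) (s := Set.univ)
        (C := M) (fun x _ => h.v_smooth.differentiable (by simp) x) (fun x _ => h.v_lip x)
        convex_univ (Set.mem_univ ξ) (Set.mem_univ (ξ + Q σ))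
    rw [add_sub_cancel_left] at this
    exact this.trans (mul_le_mul_of_nonneg_left (hb σ) h.M_nonneg)
  rw [sub_zero, abs_of_nonneg hs] at h1
  have h2 := le_bracket_add (x + s • v ξ) (∫ σ in (0 : ℝ)..s, (v (ξ + Q σ) - v ξ))
  have h3 := hesc s hs
  have h4 : M * r ≤ c / 2 := by nlinarith [h.small_r, h.r_pos, h.M_nonneg]
  have h5 := mul_le_mul_of_nonneg_right h4 hs
  have h6 := mul_pos h.c_pos (bracket_pos x)
  rw [e]
  linarith

theorem norm_force_le (h : FlowHyp v K ε β c r M η) (hesc : Escapes v c x ξ)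
    (hQ : Continuous Q) (hb : ∀ τ, ‖Q τ‖ ≤ r) {s : ℝ} (hs : 0 ≤ s) {γ : ℝ} (hγ : 0 ≤ γ) :
    bracket (trajPos v x ξ Q s) ^ (-γ) ≤ (c / 2) ^ (-γ) * (bracket x + s) ^ (-γ) := by
  have hc := h.c_pos
  have hx := bracket_pos x
  rw [← Real.mul_rpow (by positivity) (by linarith)]
  exact Real.rpow_le_rpow_of_nonpos (by positivity) (trajPos_escape h hesc hQ hb hs) (by linarith)

/-- A curve given by a tail integral, continued to a differentiable curve. -/
def tailCurve (f : ℝ → E N) (τ : ℝ) : E N := (∫ s in Set.Ioi 0, f s) - ∫ s in (0 : ℝ)..τ, f s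

/-- A trajectory `Q` is constant for `τ ≤ 0` and need not have a two-sided derivative at `0`. The
curve `tailCurve` agrees with it for `τ ≥ 0` and is differentiable everywhere. -/
theorem hasDerivAt_tailCurve {f : ℝ → E N} (hf : Continuous f) (τ : ℝ) :
    HasDerivAt (tailCurve f) (-f τ) τ :=
  (intervalIntegral.integral_hasDerivAt_right (hf.intervalIntegrable _ _)
    hf.stronglyMeasurable.stronglyMeasurableAtFilter hf.continuousAt).const_sub _

theorem tendsto_rpow_neg {l γ : ℝ} (hγ : 0 < γ) :
    Filter.Tendsto (fun s : ℝ => (l + s) ^ (-γ)) Filter.atTop (nhds 0) :=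
  (tendsto_rpow_neg_atTop hγ).comp
    (Filter.tendsto_atTop_add_const_left Filter.atTop l Filter.tendsto_id)

theorem eq_zero_of_hasDerivAt_zero {g : ℝ → ℝ} (hg : ∀ τ, 0 ≤ τ → HasDerivAt g 0 τ) {l : ℝ}
    (hl : Filter.Tendsto g Filter.atTop (nhds l)) : g 0 = l := by
  refine tendsto_nhds_unique (Filter.Tendsto.congr' ?_ tendsto_const_nhds) hl
  filter_upwards [Filter.eventually_ge_atTop 0] with T hT
  exact (constant_of_has_deriv_right_zero
    (fun τ hτ => (hg τ hτ.1).continuousAt.continuousWithinAt)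
    (fun τ hτ => (hg τ hτ.1).hasDerivWithinAt) T (Set.right_mem_Icc.2 hT)).symm

theorem force_bound (h : FlowHyp v K ε β c r M η) (hesc : Escapes v c x ξ)
    (hQ : Continuous Q) (hb : ∀ τ, ‖Q τ‖ ≤ r) {s : ℝ} (hs : 0 ≤ s) :
    ‖K (trajPos v x ξ Q s)‖ ≤ η * (c / 2) ^ (-1 - β) * (bracket x + s) ^ (-1 - β) := by
  have h1 := norm_force_le h hesc hQ hb hs (γ := 1 + β) (by linarith [h.β_pos])
  rw [show -(1 + β) = -1 - β by ring] at h1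
  refine (h.K_small _).trans ?_
  rw [mul_assoc]
  exact mul_le_mul_of_nonneg_left h1 h.η_nonneg

theorem traj_eq_tailCurve (h : FlowHyp v K ε β c r M η) (hesc : Escapes v c x ξ)
    (hQ : IsTraj v K x ξ Q) (hb : ∀ τ, ‖Q τ‖ ≤ r) {τ : ℝ} (hτ : 0 ≤ τ) :
    Q τ = tailCurve (fun s => K (trajPos v x ξ Q s)) τ := by
  have hc : Continuous fun s => K (trajPos v x ξ Q s) :=
    h.K_smooth.continuous.comp (continuous_trajPos h.v_smooth.continuous hQ.1)
  rw [hQ.2 τ, max_eq_left hτ, tailCurve]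
  exact integral_Ioi_eq_sub (integrableOn_Ioi_of_le_rpow (bracket_pos x) h.β_pos le_rfl hc
    fun s hs => force_bound h hesc hQ.1 hb hs) hτ

theorem traj_tendsto (h : FlowHyp v K ε β c r M η) (hesc : Escapes v c x ξ)
    (hQ : IsTraj v K x ξ Q) (hb : ∀ τ, ‖Q τ‖ ≤ r) :
    Filter.Tendsto Q Filter.atTop (nhds 0) := by
  have ht : Filter.Tendsto (fun τ => η * (c / 2) ^ (-1 - β) * ((bracket x + τ) ^ (-β) / β))
      Filter.atTop (nhds 0) := by
    simpa using ((tendsto_rpow_neg (l := bracket x) h.β_pos).div_const β).const_mul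
      (η * (c / 2) ^ (-1 - β))
  refine squeeze_zero_norm' ?_ ht
  filter_upwards [Filter.eventually_ge_atTop 0] with τ hτ
  rw [hQ.2 τ, max_eq_left hτ]
  exact norm_integral_Ioi_le_of_le_rpow (bracket_pos x) h.β_pos hτ
    fun s hs => force_bound h hesc hQ.1 hb (hτ.trans hs)

/-- Conservation of energy along a trajectory. -/
theorem energy_conservation (h : FlowHyp v K ε β c r M η) (hesc : Escapes v c x ξ)
    (hQ : IsTraj v K x ξ Q) (hb : ∀ τ, ‖Q τ‖ ≤ r) {g W : E N → ℝ}
    (hg : ∀ y, HasGradientAt g (v y) y) (hW : ∀ y, HasGradientAt W (K y) y) {C γ : ℝ}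
    (hγ : 0 < γ) (hWd : ∀ y, |W y| ≤ C * bracket y ^ (-γ)) : g (ξ + Q 0) + W x = g ξ := by
  have hvc := h.v_smooth.continuous
  have hc : Continuous fun s => K (trajPos v x ξ Q s) :=
    h.K_smooth.continuous.comp (continuous_trajPos hvc hQ.1)
  set G := tailCurve (fun s => K (trajPos v x ξ Q s))
  have hQG : ∀ τ, 0 ≤ τ → Q τ = G τ := fun τ hτ => traj_eq_tailCurve h hesc hQ hb hτ
  have hy := hasDerivAt_trajPos (x := x) (ξ := ξ) hvc hQ.1
  -- The momentum changes at the rate `-K` and the position at the rate `v`, so the two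
  -- contributions `-⟪v, K⟫` and `⟪K, v⟫` cancel.
  have key : ∀ τ, 0 ≤ τ → HasDerivAt (fun τ => g (ξ + G τ) + W (trajPos v x ξ Q τ)) 0 τ := by
    intro τ hτ
    have d1 := (hg (ξ + G τ)).hasFDerivAt.comp_hasDerivAt τ
      ((hasDerivAt_tailCurve hc τ).const_add ξ)
    have d2 := (hW (trajPos v x ξ Q τ)).hasFDerivAt.comp_hasDerivAt τ (hy τ)
    refine (d1.add d2).congr_deriv ?_
    simp only [InnerProductSpace.toDual_apply_apply, inner_neg_right, ← hQG τ hτ]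
    rw [real_inner_comm]
    ring
  have hlim : Filter.Tendsto (fun τ => g (ξ + G τ) + W (trajPos v x ξ Q τ)) Filter.atTop
      (nhds (g ξ + 0)) := by
    refine Filter.Tendsto.add ?_ ?_
    · have h1 : Filter.Tendsto (fun τ => ξ + Q τ) Filter.atTop (nhds (ξ + 0)) :=
        tendsto_const_nhds.add (traj_tendsto h hesc hQ hb)
      rw [add_zero] at h1
      refine ((hg ξ).hasFDerivAt.continuousAt.tendsto.comp h1).congr' ?_
      filter_upwards [Filter.eventually_ge_atTop 0] with τ hτ
      simp [hQG τ hτ]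
    · have ht : Filter.Tendsto (fun τ => |C| * ((c / 2) ^ (-γ) * (bracket x + τ) ^ (-γ)))
          Filter.atTop (nhds 0) := by
        simpa using ((tendsto_rpow_neg (l := bracket x) hγ).const_mul ((c / 2) ^ (-γ))).const_mul |C|
      refine squeeze_zero_norm' ?_ ht
      filter_upwards [Filter.eventually_ge_atTop 0] with τ hτ
      refine (hWd _).trans ?_
      have h1 := norm_force_le h hesc hQ.1 hb hτ hγ.le
      have h2 : 0 ≤ bracket (trajPos v x ξ Q τ) ^ (-γ) := Real.rpow_nonneg (bracket_pos _).le _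
      exact mul_le_mul (le_abs_self C) h1 h2 (abs_nonneg _)
  have := eq_zero_of_hasDerivAt_zero key hlim
  rw [← hQG 0 le_rfl, add_zero] at this
  simpa [trajPos] using this

/-- A solution of the linearised equation. -/
structure IsLinTraj (v K : E N → E N) (x ξ : E N) (Q : ℝ → E N) (a : E N) (π : ℝ → E N) : Prop where
  cont : Continuous π
  bdd : ∃ C, ∀ τ, ‖π τ‖ ≤ C
  eq : ∀ τ, π τ = ∫ s in Set.Ioi (max τ 0), fderiv ℝ K (trajPos v x ξ Q s)
    (a + ∫ σ in (0 : ℝ)..s, fderiv ℝ v (ξ + Q σ) (π σ))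

/-- The variation of the position. -/
def linPos (v : E N → E N) (ξ : E N) (Q : ℝ → E N) (a : E N) (π : ℝ → E N) (s : ℝ) : E N :=
  a + ∫ σ in (0 : ℝ)..s, fderiv ℝ v (ξ + Q σ) (π σ)

theorem continuous_lin_velocity (h : FlowHyp v K ε β c r M η) (hQ : Continuous Q) {π : ℝ → E N}
    (hπ : Continuous π) : Continuous fun σ => fderiv ℝ v (ξ + Q σ) (π σ) := by
  have hv := (h.v_smooth.fderiv_right (m := ∞) (by simp)).continuous
  fun_prop

theorem hasDerivAt_linPos (h : FlowHyp v K ε β c r M η) (hQ : Continuous Q) {π : ℝ → E N}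
    (hπ : Continuous π) (a : E N) (s : ℝ) :
    HasDerivAt (linPos v ξ Q a π) (fderiv ℝ v (ξ + Q s) (π s)) s := by
  have hc := continuous_lin_velocity (ξ := ξ) h hQ hπ
  exact (intervalIntegral.integral_hasDerivAt_right (hc.intervalIntegrable _ _)
    hc.stronglyMeasurable.stronglyMeasurableAtFilter hc.continuousAt).const_add a

theorem norm_linPos_le (h : FlowHyp v K ε β c r M η) {π : ℝ → E N} (a : E N) {l b C : ℝ} (hl : 1 ≤ l) (hb1 : b < 1)
    (hC : ∀ s, 0 ≤ s → ‖π s‖ ≤ C * (l + s) ^ (-b)) {s : ℝ} (hs : 0 ≤ s) :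
    ‖linPos v ξ Q a π s‖ ≤ (‖a‖ + M * C / (1 - b)) * (l + s) ^ (1 - b) := by
  have hC0 : 0 ≤ C := by
    have h1 := (norm_nonneg _).trans (hC 0 le_rfl)
    have h2 : 0 < (l + 0) ^ (-b) := Real.rpow_pos_of_pos (by linarith) _
    exact nonneg_of_mul_nonneg_left h1 h2
  have hM := h.M_nonneg
  have hcont : ContinuousOn (fun σ : ℝ => (l + σ) ^ (-b)) (Set.Icc 0 s) := fun σ hσ =>
    ((continuous_const.add continuous_id).continuousAt.rpow_const
      (Or.inl (show l + σ ≠ 0 from (by linarith [hσ.1] : 0 < l + σ).ne'))).continuousWithinAt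
  have h1 : ‖∫ σ in (0 : ℝ)..s, fderiv ℝ v (ξ + Q σ) (π σ)‖ ≤
      ∫ σ in (0 : ℝ)..s, M * C * (l + σ) ^ (-b) := by
    refine intervalIntegral.norm_integral_le_of_norm_le hs
      (Filter.Eventually.of_forall fun σ hσ => ?_) ?_
    · have := (fderiv ℝ v (ξ + Q σ)).le_of_opNorm_le_of_le (h.v_lip _) (hC σ hσ.1.le)
      rwa [← mul_assoc] at this
    · exact (ContinuousOn.intervalIntegrable_of_Icc hs (continuousOn_const.mul hcont))
  have h2 : ∫ σ in (0 : ℝ)..s, M * C * (l + σ) ^ (-b) =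
      M * C * (((l + s) ^ (1 - b) - l ^ (1 - b)) / (1 - b)) := by
    rw [intervalIntegral.integral_const_mul,
      intervalIntegral.integral_comp_add_left (fun σ : ℝ => σ ^ (-b)), integral_rpow]
    · rw [add_zero, show -b + 1 = 1 - b by ring]
    · exact Or.inl (by linarith)
  have h3 : 1 ≤ (l + s) ^ (1 - b) := Real.one_le_rpow (by linarith) (by linarith)
  have h4 : 0 ≤ l ^ (1 - b) := by positivity
  have h5 : ((l + s) ^ (1 - b) - l ^ (1 - b)) / (1 - b) ≤ (l + s) ^ (1 - b) / (1 - b) :=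
    div_le_div_of_nonneg_right (by linarith) (by linarith)
  calc _ ≤ ‖a‖ + ‖∫ σ in (0 : ℝ)..s, fderiv ℝ v (ξ + Q σ) (π σ)‖ := norm_add_le _ _
    _ ≤ ‖a‖ * (l + s) ^ (1 - b) + M * C * ((l + s) ^ (1 - b) / (1 - b)) := by
        refine add_le_add (le_mul_of_one_le_right (norm_nonneg _) h3) (h1.trans ?_)
        rw [h2]
        exact mul_le_mul_of_nonneg_left h5 (by positivity)
    _ = _ := by ring

/-- If `π` decays at the rate `b < 1`, the variation of the position grows at most like the power `1
- b`, and the derivative of the force decays at the rate `2 + β`. The product is integrable, and its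
tail decays at the improved rate `β + b`. -/
theorem lin_integrand_le (h : FlowHyp v K ε β c r M η) (hesc : Escapes v c x ξ)
    (hQ : Continuous Q) (hb : ∀ τ, ‖Q τ‖ ≤ r) {π : ℝ → E N}
    (hπ : Continuous π) (a : E N) {b C : ℝ} (hb1 : b < 1)
    (hC : ∀ s, 0 ≤ s → ‖π s‖ ≤ C * (bracket x + s) ^ (-b)) {s : ℝ} (hs : 0 ≤ s) :
    ‖fderiv ℝ K (trajPos v x ξ Q s) (linPos v ξ Q a π s)‖ ≤
      η * (c / 2) ^ (-2 - β) * (‖a‖ + M * C / (1 - b)) * (bracket x + s) ^ (-1 - (β + b)) := by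
  have hη := h.η_nonneg
  have hc := h.c_pos
  have hx := one_le_bracket x
  have h1 := norm_force_le h hesc hQ hb hs (γ := 2 + β) (by linarith [h.β_pos])
  rw [show -(2 + β) = -2 - β by ring] at h1
  have h2 := norm_linPos_le (ξ := ξ) (Q := Q) h a (one_le_bracket x) hb1 hC hs
  have h3 := (h.dK_small (trajPos v x ξ Q s)).trans (mul_le_mul_of_nonneg_left h1 hη)
  refine ((fderiv ℝ K (trajPos v x ξ Q s)).le_of_opNorm_le_of_le h3 h2).trans_eq ?_
  rw [show -1 - (β + b) = (-2 - β) + (1 - b) by ring, Real.rpow_add (by linarith : 0 < bracket x + s)]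
  ring

theorem continuous_lin_integrand (h : FlowHyp v K ε β c r M η) (hQ : Continuous Q) {π : ℝ → E N}
    (hπ : Continuous π) (a : E N) :
    Continuous fun s => fderiv ℝ K (trajPos v x ξ Q s) (linPos v ξ Q a π s) := by
  have h1 : Continuous (linPos v ξ Q a π) :=
    continuous_iff_continuousAt.2 fun s => (hasDerivAt_linPos h hQ hπ a s).continuousAt
  exact (((h.K_smooth.fderiv_right (m := ∞) (by simp)).continuous).comp
    (continuous_trajPos h.v_smooth.continuous hQ)).clm_apply h1

/-- Bootstrap: starting from boundedness, each substitution into the linearised equation gains a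
power `β`, as long as the exponent reached is below `1`. -/
theorem IsLinTraj.decay (h : FlowHyp v K ε β c r M η) (hesc : Escapes v c x ξ)
    (hQ : Continuous Q) (hb : ∀ τ, ‖Q τ‖ ≤ r) {a : E N} {π : ℝ → E N}
    (hπ : IsLinTraj v K x ξ Q a π) (k : ℕ) (hk : k * β < 1) :
    ∃ C, ∀ s, 0 ≤ s → ‖π s‖ ≤ C * (bracket x + s) ^ (-(k * β)) := by
  induction k with
  | zero =>
    obtain ⟨C, hC⟩ := hπ.bdd
    exact ⟨C, fun s _ => by simpa using hC s⟩
  | succ k ih =>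
    have hβ := h.β_pos
    push_cast at hk ⊢
    obtain ⟨C, hC⟩ := ih (by linarith)
    refine ⟨η * (c / 2) ^ (-2 - β) * (‖a‖ + M * C / (1 - k * β)) / (β + k * β), fun τ hτ => ?_⟩
    rw [hπ.eq τ, max_eq_left hτ]
    refine (norm_integral_Ioi_le_of_le_rpow (bracket_pos x) (β := β + k * β) (by positivity) hτ
      fun s hs => lin_integrand_le h hesc hQ hb hπ.cont a (by linarith) hC
        (hτ.trans hs)).trans_eq ?_
    rw [show -((k + 1) * β) = -(β + k * β) by ring]
    ring

/-- Symmetry of the derivative of the initial momentum with respect to the position. -/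
theorem IsLinTraj.symm (h : FlowHyp v K ε β c r M η) (hβ2 : β < 1 / 2) (hesc : Escapes v c x ξ)
    (hQ : Continuous Q) (hb : ∀ τ, ‖Q τ‖ ≤ r)
    (hvs : ∀ y a b, ⟪fderiv ℝ v y a, b⟫ = ⟪fderiv ℝ v y b, a⟫)
    (hKs : ∀ y a b, ⟪fderiv ℝ K y a, b⟫ = ⟪fderiv ℝ K y b, a⟫)
    {a b : E N} {π ρ : ℝ → E N} (hπ : IsLinTraj v K x ξ Q a π) (hρ : IsLinTraj v K x ξ Q b ρ) :
    ⟪π 0, b⟫ = ⟪ρ 0, a⟫ := by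
  have hβ := h.β_pos
  -- A decay rate above `1 / 2` makes the pairing below vanish at infinity. Since `β < 1 / 2`, the
  -- first multiple of `β` beyond `1 / 2` is still below `1`.
  obtain ⟨k, hk1, hk2⟩ : ∃ k : ℕ, 1 / 2 < k * β ∧ k * β < 1 := by
    refine ⟨⌊1 / (2 * β)⌋₊ + 1, ?_, ?_⟩
    · have := Nat.lt_floor_add_one (1 / (2 * β))
      rw [div_lt_iff₀ (by positivity)] at this
      push_cast
      linarith
    · have := Nat.floor_le (a := 1 / (2 * β)) (by positivity)
      rw [le_div_iff₀ (by positivity)] at this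
      push_cast
      linarith
  obtain ⟨C, hC⟩ := hπ.decay h hesc hQ hb k hk2
  obtain ⟨D, hD⟩ := hρ.decay h hesc hQ hb k hk2
  set f := fun s => fderiv ℝ K (trajPos v x ξ Q s) (linPos v ξ Q a π s)
  set g := fun s => fderiv ℝ K (trajPos v x ξ Q s) (linPos v ξ Q b ρ s)
  have hf : Continuous f := continuous_lin_integrand h hQ hπ.cont a
  have hg : Continuous g := continuous_lin_integrand h hQ hρ.cont b
  have eπ : ∀ τ, 0 ≤ τ → π τ = tailCurve f τ := fun τ hτ => by
    rw [hπ.eq τ, max_eq_left hτ]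
    exact integral_Ioi_eq_sub (integrableOn_Ioi_of_le_rpow (bracket_pos x) (β := β + k * β)
      (by positivity) le_rfl hf
      fun s hs => lin_integrand_le h hesc hQ hb hπ.cont a hk2 hC hs) hτ
  have eρ : ∀ τ, 0 ≤ τ → ρ τ = tailCurve g τ := fun τ hτ => by
    rw [hρ.eq τ, max_eq_left hτ]
    exact integral_Ioi_eq_sub (integrableOn_Ioi_of_le_rpow (bracket_pos x) (β := β + k * β)
      (by positivity) le_rfl hg
      fun s hs => lin_integrand_le h hesc hQ hb hρ.cont b hk2 hD hs) hτ
  -- This is the symplectic form of the two variations. It is constant because the derivatives of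
  -- `K` and of `v` are symmetric, both fields being gradients.
  have key : ∀ τ, 0 ≤ τ → HasDerivAt (fun τ => ⟪tailCurve f τ, linPos v ξ Q b ρ τ⟫ -
      ⟪tailCurve g τ, linPos v ξ Q a π τ⟫) 0 τ := by
    intro τ hτ
    have d1 := (hasDerivAt_tailCurve hf τ).inner ℝ (hasDerivAt_linPos (ξ := ξ) h hQ hρ.cont b τ)
    have d2 := (hasDerivAt_tailCurve hg τ).inner ℝ (hasDerivAt_linPos (ξ := ξ) h hQ hπ.cont a τ)
    refine (d1.sub d2).congr_deriv ?_
    rw [← eπ τ hτ, ← eρ τ hτ, inner_neg_left, inner_neg_left]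
    have e1 : ⟪f τ, linPos v ξ Q b ρ τ⟫ = ⟪g τ, linPos v ξ Q a π τ⟫ := hKs _ _ _
    have e2 := hvs (ξ + Q τ) (π τ) (ρ τ)
    rw [e1, real_inner_comm, ← e2, real_inner_comm (fderiv ℝ v (ξ + Q τ) (π τ))]
    ring
  have hl := one_le_bracket x
  -- The momentum variation decays like the power `-kβ` and the position variation grows like `1 -
  -- kβ`; the total exponent `1 - 2kβ` is negative.
  have small : ∀ (π ρ : ℝ → E N) (b : E N) (C D : ℝ), Continuous ρ →
      (∀ s, 0 ≤ s → ‖π s‖ ≤ C * (bracket x + s) ^ (-(k * β))) →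
      (∀ s, 0 ≤ s → ‖ρ s‖ ≤ D * (bracket x + s) ^ (-(k * β))) →
      Filter.Tendsto (fun τ => ⟪π τ, linPos v ξ Q b ρ τ⟫) Filter.atTop (nhds 0) := by
    intro π ρ b C D hρ hC hD
    have ht : Filter.Tendsto (fun τ => C * (‖b‖ + M * D / (1 - k * β)) *
        (bracket x + τ) ^ (-(2 * (k * β) - 1))) Filter.atTop (nhds 0) := by
      simpa using (tendsto_rpow_neg (l := bracket x) (γ := 2 * (k * β) - 1)
        (by linarith)).const_mul (C * (‖b‖ + M * D / (1 - k * β)))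
    refine squeeze_zero_norm' ?_ ht
    filter_upwards [Filter.eventually_ge_atTop 0] with τ hτ
    have h1 := hC τ hτ
    have h2 := norm_linPos_le (ξ := ξ) (Q := Q) h b hl hk2 hD hτ
    refine (norm_inner_le_norm _ _).trans ((mul_le_mul h1 h2 (norm_nonneg _)
      ((norm_nonneg _).trans h1)).trans_eq ?_)
    rw [show -(2 * (k * β) - 1) = -(k * β) + (1 - k * β) by ring,
      Real.rpow_add (by linarith : 0 < bracket x + τ)]
    ring
  have hlim : Filter.Tendsto (fun τ => ⟪tailCurve f τ, linPos v ξ Q b ρ τ⟫ -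
      ⟪tailCurve g τ, linPos v ξ Q a π τ⟫) Filter.atTop (nhds (0 - 0)) := by
    refine ((small π ρ b C D hρ.cont hC hD).sub (small ρ π a D C hπ.cont hD hC)).congr' ?_
    filter_upwards [Filter.eventually_ge_atTop 0] with τ hτ
    rw [eπ τ hτ, eρ τ hτ]
  have := eq_zero_of_hasDerivAt_zero key hlim
  rw [← eπ 0 le_rfl, ← eρ 0 le_rfl, sub_self, sub_eq_zero] at this
  simpa [linPos] using this

end Conservation

/-! ### Integrals over the unit interval depending on a parameter -/

section Parametric

variable {X : Type*} [NormedAddCommGroup X] [NormedSpace ℝ X]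

/-- The partial derivative in the second variable. -/
def sndDeriv {F : Type*} [NormedAddCommGroup F] [NormedSpace ℝ F] (g : ℝ × X → F) (p : ℝ × X) :
    X →L[ℝ] F :=
  (fderiv ℝ g p).comp (ContinuousLinearMap.inr ℝ ℝ X)

theorem hasFDerivAt_sndDeriv {F : Type*} [NormedAddCommGroup F] [NormedSpace ℝ F]
    {g : ℝ × X → F} {W : Set (ℝ × X)} (hW : IsOpen W) (hg : ContDiffOn ℝ ∞ g W) {σ : ℝ} {y : X}
    (h : (σ, y) ∈ W) : HasFDerivAt (fun y => g (σ, y)) (sndDeriv g (σ, y)) y := by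
  have h1 : HasFDerivAt g (fderiv ℝ g (σ, y)) (σ, y) :=
    ((hg.contDiffAt (hW.mem_nhds h)).differentiableAt (by simp)).hasFDerivAt
  exact h1.comp (f := fun y : X => (σ, y)) y (hasFDerivAt_prodMk_right σ y)

theorem contDiffOn_sndDeriv {F : Type*} [NormedAddCommGroup F] [NormedSpace ℝ F]
    {g : ℝ × X → F} {W : Set (ℝ × X)} (hW : IsOpen W) (hg : ContDiffOn ℝ ∞ g W) :
    ContDiffOn ℝ ∞ (sndDeriv g) W :=
  (hg.fderiv_of_isOpen hW (by simp)).clm_comp contDiffOn_const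

theorem continuousOn_segment {F : Type*} [NormedAddCommGroup F] [NormedSpace ℝ F]
    {g : ℝ × X → F} {W : Set (ℝ × X)} (hg : ContDiffOn ℝ ∞ g W) {y : X}
    (hy : ∀ σ ∈ Set.Icc (0 : ℝ) 1, (σ, y) ∈ W) :
    ContinuousOn (fun σ => g (σ, y)) (Set.Icc 0 1) :=
  hg.continuousOn.comp (by fun_prop) hy

theorem intervalIntegrable_segment {F : Type*} [NormedAddCommGroup F] [NormedSpace ℝ F]
    {g : ℝ × X → F} {W : Set (ℝ × X)} (hg : ContDiffOn ℝ ∞ g W) {y : X}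
    (hy : ∀ σ ∈ Set.Icc (0 : ℝ) 1, (σ, y) ∈ W) :
    IntervalIntegrable (fun σ => g (σ, y)) volume 0 1 :=
  ContinuousOn.intervalIntegrable (by
    rw [Set.uIcc_of_le zero_le_one]; exact continuousOn_segment hg hy)

/-- The integrand is smooth only on an open set containing the segment `[0, 1] × {y}`. The tube
lemma provides a neighbourhood of `y` over which the derivative is bounded by a constant, and
dominated differentiation applies. -/
theorem hasFDerivAt_integral_segment {F : Type*} [NormedAddCommGroup F] [NormedSpace ℝ F]
    {g : ℝ × X → F} {W : Set (ℝ × X)} {U : Set X} (hW : IsOpen W) (hU : IsOpen U)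
    (hWU : ∀ y ∈ U, ∀ σ ∈ Set.Icc (0 : ℝ) 1, (σ, y) ∈ W) (hg : ContDiffOn ℝ ∞ g W) {y : X}
    (hy : y ∈ U) :
    HasFDerivAt (fun y => ∫ σ in (0 : ℝ)..1, g (σ, y)) (∫ σ in (0 : ℝ)..1, sndDeriv g (σ, y)) y := by
  have hd := contDiffOn_sndDeriv hW hg
  obtain ⟨C, hC⟩ := isCompact_Icc.exists_bound_of_continuousOn
    (continuousOn_segment hd (hWU y hy))
  have hopen : IsOpen {p | p ∈ W ∧ ‖sndDeriv g p‖ < C + 1} :=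
    (hd.continuousOn.norm).isOpen_inter_preimage hW isOpen_Iio
  obtain ⟨u, w, hu, hw, hsu, hsw, huw⟩ := generalized_tube_lemma (s := Set.Icc (0 : ℝ) 1)
    (t := {y}) isCompact_Icc isCompact_singleton hopen (by
      rintro ⟨σ, z⟩ ⟨hσ, hz⟩
      obtain rfl : z = y := hz
      exact ⟨hWU z hy σ hσ, (hC σ hσ).trans_lt (lt_add_one C)⟩)
  have hyw : y ∈ w := hsw rfl
  have hIoc : ∀ σ ∈ Set.uIoc (0 : ℝ) 1, σ ∈ Set.Icc (0 : ℝ) 1 := fun σ hσ => by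
    rw [Set.uIoc_of_le zero_le_one] at hσ
    exact ⟨hσ.1.le, hσ.2⟩
  refine (intervalIntegral.hasFDerivAt_integral_of_dominated_of_fderiv_le (s := w)
    (F' := fun z σ => sndDeriv g (σ, z)) (bound := fun _ => C + 1) (hw.mem_nhds hyw)
    ?_ (intervalIntegrable_segment hg (hWU y hy)) ?_ ?_ intervalIntegrable_const ?_)
  · filter_upwards [hU.mem_nhds hy] with z hz
    exact (intervalIntegrable_iff.1 (intervalIntegrable_segment hg (hWU z hz))).aestronglyMeasurable
  · exact (intervalIntegrable_iff.1 (intervalIntegrable_segment hd (hWU y hy))).aestronglyMeasurable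
  · exact Filter.Eventually.of_forall fun σ hσ z hz =>
      (huw (show (σ, z) ∈ u ×ˢ w from ⟨hsu (hIoc σ hσ), hz⟩)).2.le
  · exact Filter.Eventually.of_forall fun σ hσ z hz =>
      hasFDerivAt_sndDeriv hW hg (huw (show (σ, z) ∈ u ×ˢ w from ⟨hsu (hIoc σ hσ), hz⟩)).1

theorem contDiffOn_integral_segment_nat {X : Type} [NormedAddCommGroup X] [NormedSpace ℝ X]
    {W : Set (ℝ × X)} {U : Set X} (hW : IsOpen W) (hU : IsOpen U)
    (hWU : ∀ y ∈ U, ∀ σ ∈ Set.Icc (0 : ℝ) 1, (σ, y) ∈ W) (n : ℕ) :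
    ∀ (F : Type) [NormedAddCommGroup F] [NormedSpace ℝ F] (g : ℝ × X → F), ContDiffOn ℝ ∞ g W →
      ContDiffOn ℝ n (fun y => ∫ σ in (0 : ℝ)..1, g (σ, y)) U := by
  induction n with
  | zero =>
    intro F _ _ g hg
    exact contDiffOn_zero.2 fun y hy =>
      (hasFDerivAt_integral_segment hW hU hWU hg hy).continuousAt.continuousWithinAt
  | succ n ih =>
    intro F _ _ g hg
    have hder := fun y hy => hasFDerivAt_integral_segment hW hU hWU hg (y := y) hy
    rw [show ((n + 1 : ℕ) : ℕ∞ω) = (n : ℕ∞ω) + 1 by norm_cast, contDiffOn_succ_iff_fderiv_of_isOpen hU]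
    refine ⟨fun y hy => (hder y hy).differentiableAt.differentiableWithinAt, by simp, ?_⟩
    exact (ih _ _ (contDiffOn_sndDeriv hW hg)).congr fun y hy => (hder y hy).fderiv

theorem contDiffOn_integral_segment {X F : Type} [NormedAddCommGroup X] [NormedSpace ℝ X]
    [NormedAddCommGroup F] [NormedSpace ℝ F]
    {W : Set (ℝ × X)} {U : Set X} (hW : IsOpen W) (hU : IsOpen U)
    (hWU : ∀ y ∈ U, ∀ σ ∈ Set.Icc (0 : ℝ) 1, (σ, y) ∈ W) {g : ℝ × X → F}
    (hg : ContDiffOn ℝ ∞ g W) :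
    ContDiffOn ℝ ∞ (fun y => ∫ σ in (0 : ℝ)..1, g (σ, y)) U :=
  contDiffOn_infty.2 fun n => contDiffOn_integral_segment_nat hW hU hWU n F g hg

/-- Differentiation passes under the integral at each order, so a pointwise bound at the single
point `y` suffices; the interval has length one. -/
theorem norm_iteratedFDeriv_integral_segment_le {X : Type} [NormedAddCommGroup X] [NormedSpace ℝ X]
    {W : Set (ℝ × X)} {U : Set X} (hW : IsOpen W) (hU : IsOpen U)
    (hWU : ∀ y ∈ U, ∀ σ ∈ Set.Icc (0 : ℝ) 1, (σ, y) ∈ W) (n : ℕ) {B : ℝ} {y : X} (hy : y ∈ U) :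
    ∀ (F : Type) [NormedAddCommGroup F] [NormedSpace ℝ F] (g : ℝ × X → F), ContDiffOn ℝ ∞ g W →
      (∀ σ ∈ Set.Icc (0 : ℝ) 1, ‖iteratedFDeriv ℝ n (fun y => g (σ, y)) y‖ ≤ B) →
      ‖iteratedFDeriv ℝ n (fun y => ∫ σ in (0 : ℝ)..1, g (σ, y)) y‖ ≤ B := by
  induction n with
  | zero =>
    intro F _ _ g hg hB
    simp only [norm_iteratedFDeriv_zero] at hB ⊢
    refine (intervalIntegral.norm_integral_le_of_norm_le_const (C := B) fun σ hσ => ?_).trans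
      (by simp)
    rw [Set.uIoc_of_le zero_le_one] at hσ
    exact hB σ ⟨hσ.1.le, hσ.2⟩
  | succ n ih =>
    intro F _ _ g hg hB
    rw [← norm_iteratedFDeriv_fderiv]
    have h1 : fderiv ℝ (fun y => ∫ σ in (0 : ℝ)..1, g (σ, y)) =ᶠ[nhds y]
        fun y => ∫ σ in (0 : ℝ)..1, sndDeriv g (σ, y) := by
      filter_upwards [hU.mem_nhds hy] with z hz
      exact (hasFDerivAt_integral_segment hW hU hWU hg hz).fderiv
    rw [(h1.iteratedFDeriv ℝ n).eq_of_nhds]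
    refine ih _ _ (contDiffOn_sndDeriv hW hg) fun σ hσ => ?_
    refine le_of_eq_of_le ?_ (hB σ hσ)
    rw [← norm_iteratedFDeriv_fderiv]
    congr 1
    refine Filter.EventuallyEq.eq_of_nhds (Filter.EventuallyEq.iteratedFDeriv ℝ ?_ n)
    filter_upwards [(hW.preimage (Continuous.prodMk_right σ)).mem_nhds (hWU y hy σ hσ)] with z hz
    exact (hasFDerivAt_sndDeriv hW hg hz).fderiv.symm

end Parametric

/-! ### The generating function of a symmetric field -/

section Generating

open scoped RealInnerProductSpace

variable {N : ℕ} {q : E N × E N → E N} {Ω : Set (E N × E N)} {k : ℕ}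

theorem contDiffAt_of_shift {F : Type*} [NormedAddCommGroup F] [NormedSpace ℝ F]
    {g : E N × E N → F} {p : E N × E N} (h : ContDiffAt ℝ ∞ (fun δ => g (shift p δ)) 0) :
    ContDiffAt ℝ ∞ g p := by
  have hl := (bracket_pos p.1).ne'
  let T : E N × E N → E N × E N := fun y => ((bracket p.1)⁻¹ • (y.1 - p.1), y.2 - p.2)
  have hT : ContDiff ℝ ∞ T := by
    show ContDiff ℝ ∞ fun y : E N × E N => ((bracket p.1)⁻¹ • (y.1 - p.1), y.2 - p.2)
    fun_prop
  have hT0 : T p = 0 := by simp [T]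
  have h2 : ContDiffAt ℝ ∞ (fun y => g (shift p (T y))) p :=
    ContDiffAt.comp (g := fun δ => g (shift p δ)) (f := T) p (by rw [hT0]; exact h) hT.contDiffAt
  refine h2.congr_of_eventuallyEq (Filter.Eventually.of_forall fun y => ?_)
  simp [T, shift, smul_smul, mul_inv_cancel₀ hl]

/-- The integrand of the generating function. -/
def genIntegrand (k : ℕ) (q : E N × E N → E N) (t : ℝ × (E N × E N)) : ℝ :=
  (k * t.1 ^ (k - 1)) * ⟪q (t.1 ^ k • t.2.1, t.2.2), t.2.1⟫

/-- The function with gradient `q(·, ξ)` that vanishes at the origin, parametrised so that the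
integrand is bounded. -/
def genPhase (k : ℕ) (q : E N × E N → E N) (p : E N × E N) : ℝ :=
  ∫ σ in (0 : ℝ)..1, genIntegrand k q (σ, p)

/-- The domain of the integrand of the generating function. -/
def genDomain (k : ℕ) (Ω : Set (E N × E N)) : Set (ℝ × (E N × E N)) :=
  {t | (t.1 ^ k • t.2.1, t.2.2) ∈ Ω}

theorem isOpen_genDomain (hΩ : IsOpen Ω) : IsOpen (genDomain k Ω) :=
  hΩ.preimage (f := fun t : ℝ × (E N × E N) => (t.1 ^ k • t.2.1, t.2.2)) (by fun_prop)

theorem genDomain_segment (hstar : ∀ p ∈ Ω, ∀ s ∈ Set.Icc (0 : ℝ) 1, (s • p.1, p.2) ∈ Ω) :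
    ∀ p ∈ Ω, ∀ σ ∈ Set.Icc (0 : ℝ) 1, (σ, p) ∈ genDomain k Ω := fun p hp _ hσ =>
  hstar p hp _ ⟨pow_nonneg hσ.1 _, pow_le_one₀ hσ.1 hσ.2⟩

theorem contDiffOn_genIntegrand (hq : ContDiffOn ℝ ∞ q Ω) :
    ContDiffOn ℝ ∞ (genIntegrand k q) (genDomain k Ω) := by
  have h1 : ContDiff ℝ ∞ fun t : ℝ × (E N × E N) => (t.1 ^ k • t.2.1, t.2.2) := by fun_prop
  have h2 : ContDiffOn ℝ ∞ (fun t : ℝ × (E N × E N) => q (t.1 ^ k • t.2.1, t.2.2))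
      (genDomain k Ω) := hq.comp h1.contDiffOn fun t ht => ht
  exact ContDiffOn.mul (by fun_prop) (h2.inner ℝ (by fun_prop))

theorem contDiffOn_genPhase (hΩ : IsOpen Ω) (hq : ContDiffOn ℝ ∞ q Ω)
    (hstar : ∀ p ∈ Ω, ∀ s ∈ Set.Icc (0 : ℝ) 1, (s • p.1, p.2) ∈ Ω) :
    ContDiffOn ℝ ∞ (genPhase k q) Ω :=
  contDiffOn_integral_segment (isOpen_genDomain hΩ) hΩ (genDomain_segment hstar)
    (contDiffOn_genIntegrand hq)

/-- The weight of the integrand is bounded when the reparametrisation is of high order. -/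
theorem genWeight_le {x : E N} {σ ε : ℝ} (hσ : σ ∈ Set.Icc (0 : ℝ) 1) (hε : 0 ≤ ε)
    (hk : 1 ≤ k) (hkε : k * ε ≤ k - 1) :
    σ ^ (k - 1) * bracket (σ ^ k • x) ^ (-ε) ≤ bracket x ^ (-ε) := by
  have h0 := bracket_pos x
  have h1 := bracket_pos (σ ^ k • x)
  have hs0 : 0 ≤ σ ^ k := pow_nonneg hσ.1 _
  have hs1 : σ ^ k ≤ 1 := pow_le_one₀ hσ.1 hσ.2
  have h2 : σ ^ k * bracket x ≤ bracket (σ ^ k • x) := by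
    refine (sq_le_sq₀ (by positivity) h1.le).1 ?_
    rw [mul_pow, bracket_sq, bracket_sq, norm_smul, mul_pow, Real.norm_of_nonneg hs0, mul_add]
    have : (σ ^ k) ^ 2 ≤ 1 := pow_le_one₀ hs0 hs1
    linarith
  -- Since `σ ≤ 1`, this is the inequality `k * ε ≤ k - 1` between exponents. At `σ = 0` it is
  -- checked separately, and there `k = 1` forces `ε = 0`.
  have h3 : σ ^ (k - 1) ≤ (σ ^ k) ^ ε := by
    rcases hσ.1.eq_or_lt with rfl | hpos
    · rcases Nat.eq_or_lt_of_le hk with rfl | hk2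
      · have : ε = 0 := by push_cast at hkε; linarith
        simp [this]
      · rw [zero_pow (by omega)]
        positivity
    · rw [← Real.rpow_natCast, ← Real.rpow_natCast, ← Real.rpow_mul hσ.1]
      refine Real.rpow_le_rpow_of_exponent_ge hpos hσ.2 ?_
      rw [Nat.cast_sub hk]
      simpa using hkε
  rw [Real.rpow_neg h0.le, Real.rpow_neg h1.le, ← div_eq_mul_inv, ← one_div,
    div_le_div_iff₀ (by positivity) (by positivity), one_mul]
  calc σ ^ (k - 1) * bracket x ^ ε ≤ (σ ^ k) ^ ε * bracket x ^ ε := by gcongr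
    _ = (σ ^ k * bracket x) ^ ε := (Real.mul_rpow hs0 h0.le).symm
    _ ≤ _ := Real.rpow_le_rpow (by positivity) h2 hε

/-- Displacing `x` by `⟨x⟩ δ₁` displaces `σ ^ k x` by `a ⟨σ ^ k x⟩ δ₁` with `|a| ≤ 1`, so the bounds
for `q` in its own scale at `σ ^ k x` pull back to the scale at `x`. The factor `x` of the inner
product contributes `⟨x⟩`, and `genWeight_le` bounds the rest by `⟨x⟩ ^ (-ε)` uniformly in `σ`. -/
theorem jetBdd_genPhase (hΩ : IsOpen Ω) {ε : ℝ} (hε : 0 ≤ ε) (hk : 1 ≤ k) (hkε : k * ε ≤ k - 1)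
    (hstar : ∀ p ∈ Ω, ∀ s ∈ Set.Icc (0 : ℝ) 1, (s • p.1, p.2) ∈ Ω)
    (hq : JetBdd (fun j : Ω => bracket (j : E N × E N).1 ^ (-ε))
      (fun j δ => q (shift (j : E N × E N) δ))) :
    JetBdd (fun j : Ω => bracket (j : E N × E N).1 ^ (1 - ε))
      (fun j δ => genPhase k q (shift (j : E N × E N) δ)) := by
  have hqs : ContDiffOn ℝ ∞ q Ω := fun p hp =>
    (contDiffAt_of_shift (hq.smooth ⟨p, hp⟩)).contDiffWithinAt
  let P : Ω × Set.Icc (0 : ℝ) 1 → Ω := fun j =>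
    ⟨((j.2 : ℝ) ^ k • j.1.1.1, j.1.1.2), genDomain_segment hstar _ j.1.2 _ j.2.2⟩
  let a : Ω × Set.Icc (0 : ℝ) 1 → ℝ := fun j => (j.2 : ℝ) ^ k * bracket j.1.1.1 / bracket (P j).1.1
  have ha : ∀ j, |a j| ≤ 1 := by
    intro j
    have h0 := bracket_pos j.1.1.1
    have h1 := bracket_pos (P j).1.1
    have hs0 : 0 ≤ (j.2 : ℝ) ^ k := pow_nonneg j.2.2.1 _
    rw [abs_of_nonneg (by positivity), div_le_one h1]
    refine (sq_le_sq₀ (by positivity) h1.le).1 ?_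
    have : ((j.2 : ℝ) ^ k) ^ 2 ≤ 1 := pow_le_one₀ hs0 (pow_le_one₀ j.2.2.1 j.2.2.2)
    simp only [P]
    rw [mul_pow, bracket_sq, bracket_sq, norm_smul, mul_pow, Real.norm_of_nonneg hs0, mul_add]
    linarith
  let T : Ω × Set.Icc (0 : ℝ) 1 → (E N × E N) →L[ℝ] (E N × E N) := fun j =>
    (a j • ContinuousLinearMap.fst ℝ (E N) (E N)).prod (ContinuousLinearMap.snd ℝ (E N) (E N))
  have hT : ∀ j, ‖T j‖ ≤ 1 := fun j => by
    refine ContinuousLinearMap.opNorm_le_bound _ zero_le_one fun δ => ?_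
    rw [one_mul]
    refine max_le ?_ (norm_snd_le δ)
    show ‖a j • δ.1‖ ≤ _
    rw [norm_smul]
    exact (mul_le_of_le_one_left (norm_nonneg _) (ha j)).trans (norm_fst_le δ)
  have h1 := (hq.reindex P).comp_right T hT
  have h2 : JetBdd (fun j : Ω × Set.Icc (0 : ℝ) 1 => bracket j.1.1.1)
      (fun j (δ : E N × E N) => j.1.1.1 + bracket j.1.1.1 • δ.1) := by
    refine JetBdd.add (JetBdd.const fun j => norm_le_bracket _) ?_
    have := (JetBdd.single (J := Ω × Set.Icc (0 : ℝ) 1) (X := E N × E N)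
      (f := fun δ : E N × E N => δ.1) contDiffAt_fst).smul_weight (fun j => bracket j.1.1.1)
    exact this.mono zero_le_one fun j => by rw [abs_of_pos (bracket_pos _)]; simp
  have h3 := (h1.bilin (innerSL ℝ) h2).smul_weight (fun j => (k : ℝ) * (j.2 : ℝ) ^ (k - 1))
  have h4 := h3.mono (m₂ := fun j => bracket j.1.1.1 ^ (1 - ε)) (c := k) (by positivity) (by
    intro j
    have h0 := bracket_pos j.1.1.1
    have hs0 : 0 ≤ (j.2 : ℝ) ^ (k - 1) := pow_nonneg j.2.2.1 _
    rw [abs_of_nonneg (by positivity), sub_eq_add_neg, Real.rpow_add h0, Real.rpow_one]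
    calc _ = k * (bracket j.1.1.1 * ((j.2 : ℝ) ^ (k - 1) * bracket (P j).1.1 ^ (-ε))) := by ring
      _ ≤ _ := by
        have := genWeight_le (x := j.1.1.1) j.2.2 hε hk hkε
        gcongr)
  have heq : ∀ (p : Ω) (σ : ℝ) (hσ : σ ∈ Set.Icc (0 : ℝ) 1) (δ : E N × E N),
      genIntegrand k q (σ, shift p.1 δ) = (k * σ ^ (k - 1)) •
        innerSL ℝ (q (shift (P (p, ⟨σ, hσ⟩)) (T (p, ⟨σ, hσ⟩) δ)))
          (p.1.1 + bracket p.1.1 • δ.1) := by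
    intro p σ hσ δ
    simp only [genIntegrand, innerSL_apply_apply, smul_eq_mul]
    congr 3
    have hb := (bracket_pos (P (p, ⟨σ, hσ⟩)).1.1).ne'
    refine Prod.ext ?_ rfl
    show σ ^ k • (p.1.1 + bracket p.1.1 • δ.1) = σ ^ k • p.1.1 +
      bracket (P (p, ⟨σ, hσ⟩)).1.1 • (a (p, ⟨σ, hσ⟩) • δ.1)
    rw [smul_add, smul_smul, smul_smul]
    simp only [a, mul_div_cancel₀ _ hb]
  have hphs := contDiffOn_genPhase (k := k) hΩ hqs hstar
  refine ⟨fun p => ?_, fun n => ?_⟩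
  · refine ContDiffAt.comp (g := genPhase k q) (f := shift p.1) 0 ?_ (contDiff_shift _).contDiffAt
    rw [shift_zero]
    exact hphs.contDiffAt (hΩ.mem_nhds p.2)
  · obtain ⟨C, hC, hb⟩ := h4.bound n
    refine ⟨C, hC, fun p => ?_⟩
    have hsh := (contDiff_shift p.1).continuous
    refine norm_iteratedFDeriv_integral_segment_le
      (g := fun t : ℝ × (E N × E N) => genIntegrand k q (t.1, shift p.1 t.2))
      (W := {t | (t.1, shift p.1 t.2) ∈ genDomain k Ω}) (U := {δ | shift p.1 δ ∈ Ω})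
      ((isOpen_genDomain hΩ).preimage (by fun_prop)) (hΩ.preimage hsh)
      (fun δ hδ σ hσ => genDomain_segment hstar _ hδ σ hσ) n
      (show shift p.1 0 ∈ Ω by rw [shift_zero]; exact p.2) ℝ ?_ fun σ hσ => ?_
    · refine (contDiffOn_genIntegrand hqs).comp (ContDiff.contDiffOn ?_) fun t ht => ht
      exact contDiff_fst.prodMk ((contDiff_shift p.1).comp contDiff_snd)
    · have := hb (p, ⟨σ, hσ⟩)
      simp only [heq p σ hσ]
      exact this

/-- This is the Poincaré lemma on a star-shaped set. By symmetry, the derivative of the integrand in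
the direction `a` is the derivative in `σ` of `σ ^ k ⟪q(σ ^ k x), a⟫`, and the integral is evaluated
at its endpoints. -/
theorem hasGradientAt_genPhase (hΩ : IsOpen Ω) (hq : ContDiffOn ℝ ∞ q Ω) (hk : 1 ≤ k)
    (hstar : ∀ p ∈ Ω, ∀ s ∈ Set.Icc (0 : ℝ) 1, (s • p.1, p.2) ∈ Ω)
    (hsymm : ∀ p ∈ Ω, ∀ a b, ⟪fderiv ℝ (fun y => q (y, p.2)) p.1 a, b⟫ =
      ⟪fderiv ℝ (fun y => q (y, p.2)) p.1 b, a⟫) {p : E N × E N} (hp : p ∈ Ω) :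
    HasGradientAt (fun y => genPhase k q (y, p.2)) (q p) p.1 := by
  set g : ℝ × E N → ℝ := fun t => genIntegrand k q (t.1, (t.2, p.2)) with hg
  set W : Set (ℝ × E N) := {t | (t.1, (t.2, p.2)) ∈ genDomain k Ω} with hWdef
  have hW : IsOpen W := (isOpen_genDomain hΩ).preimage (by fun_prop)
  have hgW : ContDiffOn ℝ ∞ g W :=
    (contDiffOn_genIntegrand hq).comp (ContDiff.contDiffOn (by fun_prop)) fun t ht => ht
  have hU : IsOpen {y : E N | (y, p.2) ∈ Ω} := hΩ.preimage (by fun_prop)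
  have hWU : ∀ y ∈ {y : E N | (y, p.2) ∈ Ω}, ∀ σ ∈ Set.Icc (0 : ℝ) 1, (σ, y) ∈ W :=
    fun y hy σ hσ => genDomain_segment hstar _ hy σ hσ
  have hd := hasFDerivAt_integral_segment hW hU hWU hgW (y := p.1) hp
  rw [hasGradientAt_iff_hasFDerivAt]
  refine hd.congr_fderiv ?_
  ext a
  have hint : IntervalIntegrable (fun σ => sndDeriv g (σ, p.1)) volume 0 1 :=
    intervalIntegrable_segment (contDiffOn_sndDeriv hW hgW) (hWU p.1 hp)
  rw [ContinuousLinearMap.intervalIntegral_apply hint, InnerProductSpace.toDual_apply_apply]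
  have hder : ∀ σ ∈ Set.uIcc (0 : ℝ) 1,
      HasDerivAt (fun σ => σ ^ k * ⟪q (σ ^ k • p.1, p.2), a⟫) (sndDeriv g (σ, p.1) a) σ := by
    intro σ hσ
    rw [Set.uIcc_of_le zero_le_one] at hσ
    have hmem : (σ ^ k • p.1, p.2) ∈ Ω := genDomain_segment hstar _ hp σ hσ
    have hqd : HasFDerivAt (fun y => q (y, p.2)) (fderiv ℝ (fun y => q (y, p.2)) (σ ^ k • p.1))
        (σ ^ k • p.1) := by
      refine DifferentiableAt.hasFDerivAt ?_
      exact ((hq.contDiffAt (hΩ.mem_nhds hmem)).differentiableAt (by simp)).comp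
        (f := fun y : E N => (y, p.2)) _ (by fun_prop)
    set D := fderiv ℝ (fun y => q (y, p.2)) (σ ^ k • p.1) with hD
    have hpow := hasDerivAt_pow k σ
    have h1 := hqd.comp_hasDerivAt σ (hpow.smul_const p.1)
    have h2 := hpow.mul (h1.inner ℝ (hasDerivAt_const σ a))
    have h3 : HasFDerivAt (fun y => g (σ, y)) (((k : ℝ) * σ ^ (k - 1)) •
        ((innerSL ℝ (q (σ ^ k • p.1, p.2))) + (σ ^ k) • (innerSL ℝ p.1).comp D)) p.1 := by
      have h4 : HasFDerivAt (fun y : E N => q (σ ^ k • y, p.2))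
          (D.comp (σ ^ k • ContinuousLinearMap.id ℝ (E N))) p.1 :=
        hqd.comp (f := fun y : E N => σ ^ k • y) p.1 ((hasFDerivAt_id p.1).const_smul (σ ^ k))
      have h5 := (h4.inner ℝ (hasFDerivAt_id p.1)).const_smul ((k : ℝ) * σ ^ (k - 1))
      refine h5.congr_fderiv ?_
      ext b
      simp [real_inner_comm, inner_smul_right]
      ring
    have h6 : sndDeriv g (σ, p.1) = _ :=
      (hasFDerivAt_sndDeriv hW hgW (hWU p.1 hp σ hσ)).unique h3
    refine h2.congr_deriv ?_
    rw [h6]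
    have hs := hsymm _ hmem a p.1
    simp only [← hD] at hs
    simp only [smul_apply, add_apply,
      ContinuousLinearMap.comp_apply, innerSL_apply_apply, smul_eq_mul, inner_zero_right, zero_add,
      Function.comp, map_smul, inner_smul_left, conj_trivial]
    rw [real_inner_comm, real_inner_comm (D a), hs]
    ring
  rw [intervalIntegral.integral_eq_sub_of_hasDerivAt hder
    (intervalIntegrable_segment ((contDiffOn_sndDeriv hW hgW).clm_apply contDiffOn_const)
      (hWU p.1 hp))]
  simp [zero_pow (by omega : k ≠ 0)]

theorem genPhase_congr (hstar : ∀ p ∈ Ω, ∀ s ∈ Set.Icc (0 : ℝ) 1, (s • p.1, p.2) ∈ Ω)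
    {p : E N × E N} (hp : p ∈ Ω) {ξ : E N}
    (h : ∀ p ∈ Ω, q (p.1, p.2 + ξ) = q p) : genPhase k q (p.1, p.2 + ξ) = genPhase k q p := by
  refine intervalIntegral.integral_congr fun σ hσ => ?_
  rw [Set.uIcc_of_le zero_le_one] at hσ
  simp only [genIntegrand]
  rw [← h _ (genDomain_segment (k := k) hstar p hp σ hσ)]

end Generating

/-! ### Multi-indices and full derivatives -/

section MultiIndices

variable {N : ℕ} {F : Type*} [NormedAddCommGroup F] [NormedSpace ℝ F]

theorem contDiff_partialDeriv {g : E N → F} (hg : ContDiff ℝ ∞ g) (j : Fin N) :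
    ContDiff ℝ ∞ (partialDeriv j g) :=
  (hg.fderiv_right (m := ∞) (by simp)).clm_apply contDiff_const

/-- The iterated partial derivative along a list of coordinates. -/
def listDeriv (l : List (Fin N)) (g : E N → F) : E N → F := l.foldr partialDeriv g

theorem contDiff_listDeriv {g : E N → F} (hg : ContDiff ℝ ∞ g) (l : List (Fin N)) :
    ContDiff ℝ ∞ (listDeriv l g) := by
  induction l with
  | nil => exact hg
  | cons j l ih => exact contDiff_partialDeriv ih j

theorem partialDeriv_comm {g : E N → F} (hg : ContDiff ℝ ∞ g) (i j : Fin N) :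
    partialDeriv i (partialDeriv j g) = partialDeriv j (partialDeriv i g) := by
  have h1 : ContDiff ℝ ∞ (fderiv ℝ g) := hg.fderiv_right (by simp)
  have h2 : ∀ (k : Fin N) (x : E N), fderiv ℝ (partialDeriv k g) x =
      (ContinuousLinearMap.apply ℝ F (EuclideanSpace.single k (1 : ℝ))).comp
        (fderiv ℝ (fderiv ℝ g) x) := fun k x =>
    ((ContinuousLinearMap.apply ℝ F (EuclideanSpace.single k (1 : ℝ))).hasFDerivAt.comp x
      ((h1.differentiable (by simp)) x).hasFDerivAt).fderiv
  ext1 x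
  rw [partialDeriv, partialDeriv, h2, h2]
  exact (hg.contDiffAt.isSymmSndFDerivAt (by
    rw [minSmoothness_of_isRCLikeNormedField]
    exact WithTop.coe_le_coe.2 (le_top : (2 : ℕ∞) ≤ ⊤))).eq _ _

theorem listDeriv_perm {l l' : List (Fin N)} (h : l.Perm l') {g : E N → F}
    (hg : ContDiff ℝ ∞ g) : listDeriv l g = listDeriv l' g := by
  induction h with
  | nil => rfl
  | cons j _ ih => exact congrArg (partialDeriv j) ih
  | swap i j l => exact partialDeriv_comm (contDiff_listDeriv hg l) j i
  | trans _ _ h1 h2 => exact h1.trans h2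

theorem multiDeriv_eq_listDeriv (α : Fin N → ℕ) (g : E N → F) :
    multiDeriv α g =
      listDeriv ((List.finRange N).flatMap fun j => List.replicate (α j) j) g := by
  unfold multiDeriv listDeriv
  induction List.finRange N with
  | nil => rfl
  | cons j l ih =>
    rw [List.flatMap_cons, List.foldr_append, ← ih, List.foldr_cons]
    generalize List.foldr _ g l = G
    induction α j with
    | zero => rfl
    | succ n ih => rw [Function.iterate_succ_apply', ih, List.replicate_succ, List.foldr_cons]

theorem listDeriv_eq_multiDeriv (l : List (Fin N)) {g : E N → F} (hg : ContDiff ℝ ∞ g) :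
    listDeriv l g = multiDeriv (fun j => l.count j) g := by
  rw [multiDeriv_eq_listDeriv]
  refine listDeriv_perm (List.perm_iff_count.2 fun j => ?_) hg
  rw [List.count_flatMap]
  have h1 : (List.map (List.count j ∘ fun i => List.replicate (l.count i) i) (List.finRange N)).sum
      = ∑ i, if i = j then l.count i else 0 := by
    rw [← List.ofFn_id, List.map_ofFn, List.sum_ofFn]
    refine Finset.sum_congr rfl fun i _ => ?_
    simp [List.count_replicate]
  rw [h1]
  simp

/-- The derivative is expanded in coordinate functionals of norm at most one; every order costs a
factor `N`. -/
theorem norm_iteratedFDeriv_le_listDeriv (n : ℕ) : ∀ (g : E N → ℝ), ContDiff ℝ ∞ g →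
    ∀ (x : E N) (B : ℝ), (∀ l : List (Fin N), l.length = n → |listDeriv l g x| ≤ B) →
      ‖iteratedFDeriv ℝ n g x‖ ≤ N ^ n * B := by
  induction n with
  | zero =>
    intro g _ x B h
    simpa [listDeriv] using h [] rfl
  | succ n ih =>
    intro g hg x B h
    let c : Fin N → E N →L[ℝ] ℝ := fun j => EuclideanSpace.proj j
    let L : Fin N → ℝ →L[ℝ] (E N →L[ℝ] ℝ) := fun j => ContinuousLinearMap.toSpanSingleton ℝ (c j)
    have hL : ∀ j, ‖L j‖ ≤ 1 := fun j => by
      rw [ContinuousLinearMap.norm_toSpanSingleton]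
      refine ContinuousLinearMap.opNorm_le_bound _ zero_le_one fun y => ?_
      rw [one_mul]
      exact PiLp.norm_apply_le y j
    have h1 : fderiv ℝ g = fun y => ∑ j, L j (partialDeriv j g y) := by
      ext1 y
      refine ContinuousLinearMap.ext fun a => ?_
      simp only [sum_apply, L, c, ContinuousLinearMap.toSpanSingleton_apply,
        smul_apply, EuclideanSpace.coe_proj, partialDeriv, smul_eq_mul]
      conv_lhs => rw [← (EuclideanSpace.basisFun (Fin N) ℝ).sum_repr a]
      rw [map_sum]
      refine Finset.sum_congr rfl fun j _ => ?_
      simp [mul_comm]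
    rw [← norm_iteratedFDeriv_fderiv, h1]
    have hs : ∀ j, ContDiff ℝ ∞ fun y => L j (partialDeriv j g y) := fun j =>
      (L j).contDiff.comp (contDiff_partialDeriv hg j)
    rw [show (fun y => ∑ j, L j (partialDeriv j g y)) = ∑ j, fun y => L j (partialDeriv j g y) by
      ext1 y; simp, iteratedFDeriv_sum_apply (fun j _ => ((hs j).of_le (by exact_mod_cast le_top)).contDiffAt)]
    refine (norm_sum_le _ _).trans ?_
    calc ∑ j, ‖iteratedFDeriv ℝ n (fun y => L j (partialDeriv j g y)) x‖
        ≤ ∑ _j : Fin N, N ^ n * B := by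
          refine Finset.sum_le_sum fun j _ => ?_
          have h2 := (L j).norm_iteratedFDeriv_comp_left (N := ∞) (n := n) (x := x)
            (contDiff_partialDeriv hg j).contDiffAt (by exact_mod_cast le_top)
          refine h2.trans ?_
          refine (mul_le_of_le_one_left (norm_nonneg _) (hL j)).trans ?_
          refine ih _ (contDiff_partialDeriv hg j) x B fun l hl => ?_
          have h3 := h (j :: l) (by simp [hl])
          -- The induction differentiates in the direction `j` first, whereas `listDeriv` applies
          -- the head of the list last; commuting partial derivatives reconcile the two.
          rwa [listDeriv_perm (List.perm_append_singleton j l).symm hg, listDeriv,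
            List.foldr_append] at h3
      _ = N ^ (n + 1) * B := by
          rw [Finset.sum_const, Finset.card_univ, Fintype.card_fin, nsmul_eq_mul]
          ring

theorem IsLongRange.iteratedFDeriv_le {ε : ℝ} {V : E N → ℝ} (hV : IsLongRange ε V) (n : ℕ) :
    ∃ C, ∀ x, ‖iteratedFDeriv ℝ n V x‖ ≤ C * bracket x ^ (-(n : ℝ) - ε) := by
  choose C hC using hV.decay
  -- The multi-indices that occur have entries at most `n`, so finitely many decay constants can be
  -- summed.
  let S : Finset (Fin N → ℕ) := Fintype.piFinset fun _ => Finset.range (n + 1)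
  refine ⟨N ^ n * ∑ α ∈ S, |C α|, fun x => ?_⟩
  rw [mul_assoc]
  refine norm_iteratedFDeriv_le_listDeriv n V hV.smooth x _ fun l hl => ?_
  rw [listDeriv_eq_multiDeriv l hV.smooth]
  refine (hC _ x).trans ?_
  have hsum : ∑ j, l.count j = n := by
    rw [← hl]
    simpa only [Multiset.coe_count, Multiset.coe_card] using
      Multiset.sum_count_eq_card (s := Finset.univ) (m := (l : Multiset (Fin N)))
        fun a _ => Finset.mem_univ a
  have hmem : (fun j => l.count j) ∈ S := by
    simp only [S, Fintype.mem_piFinset, Finset.mem_range]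
    exact fun j => Nat.lt_succ_of_le (hl ▸ List.count_le_length)
  rw [hsum]
  refine mul_le_mul_of_nonneg_right ((le_abs_self _).trans ?_)
    (Real.rpow_nonneg (bracket_pos x).le _)
  exact Finset.single_le_sum (f := fun α => |C α|) (fun _ _ => abs_nonneg _) hmem

end MultiIndices

/-! ### Cutting off the potential near the origin -/

section Truncation

variable {N : ℕ} {χ : E N → ℝ}

theorem iteratedFDeriv_cutoff_eq_zero (hχ1 : ∀ x, 2 ≤ ‖x‖ → χ x = 1) {n : ℕ} (hn : 1 ≤ n) {x : E N}
    (hx : 2 < ‖x‖) : iteratedFDeriv ℝ n χ x = 0 := by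
  have h : χ =ᶠ[nhds x] fun _ => 1 := by
    filter_upwards [(isOpen_lt continuous_const continuous_norm).mem_nhds hx] with y hy
    exact hχ1 y (le_of_lt hy)
  rw [(h.iteratedFDeriv ℝ n).eq_of_nhds, iteratedFDeriv_const_of_ne (by omega)]
  rfl

theorem exists_iteratedFDeriv_cutoff_le (hχ : ContDiff ℝ ∞ χ) (hχ1 : ∀ x, 2 ≤ ‖x‖ → χ x = 1)
    (n : ℕ) : ∃ C, ∀ x, ‖iteratedFDeriv ℝ n χ x‖ ≤ C := by
  obtain ⟨C, hC⟩ := (isCompact_closedBall (0 : E N) 2).exists_bound_of_continuousOn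
    (continuous_iteratedFDeriv_inf hχ n).continuousOn
  refine ⟨max C 1, fun x => ?_⟩
  rcases le_or_gt ‖x‖ 2 with h | h
  · exact (hC x (by simpa using h)).trans (le_max_left _ _)
  · rcases Nat.eq_zero_or_pos n with rfl | hn
    · simp [hχ1 x h.le]
    · rw [iteratedFDeriv_cutoff_eq_zero hχ1 hn h, norm_zero]
      exact zero_le_one.trans (le_max_right _ _)

/-- The bounds are uniform in `R` because where the derivatives of `χ(x / R)` do not vanish one has
`‖x‖ ≤ 2R`, hence `⟨x⟩ / R ≤ 3`. -/
theorem jetBdd_cutoff_scale (hχ : ContDiff ℝ ∞ χ) (hχ1 : ∀ x, 2 ≤ ‖x‖ → χ x = 1) :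
    JetBdd (fun _ : {R : ℝ // 1 ≤ R} × E N => 1)
      (fun j δ => χ ((j.1 : ℝ)⁻¹ • (j.2 + bracket j.2 • δ))) := by
  refine ⟨fun j => ContDiff.contDiffAt (hχ.comp (by fun_prop)), fun n => ?_⟩
  obtain ⟨C, hC⟩ := exists_iteratedFDeriv_cutoff_le hχ hχ1 n
  have hC0 : 0 ≤ C := (norm_nonneg _).trans (hC 0)
  refine ⟨3 ^ n * C, by positivity, fun ⟨⟨R, hR⟩, x⟩ => ?_⟩
  have hb := bracket_pos x
  have h1 : (fun δ => χ (R⁻¹ • (x + bracket x • δ))) =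
      fun δ => χ (R⁻¹ • x + (R⁻¹ * bracket x) • δ) := by
    ext1 δ
    rw [smul_add, smul_smul]
  simp only [h1]
  rw [iteratedFDeriv_comp_add_smul hχ, smul_zero, add_zero, norm_smul, mul_one]
  rcases le_or_gt ‖R⁻¹ • x‖ 2 with h | h
  · refine mul_le_mul ?_ (hC _) (norm_nonneg _) (by positivity)
    rw [norm_pow, Real.norm_of_nonneg (by positivity)]
    refine pow_le_pow_left₀ (by positivity) ?_ n
    rw [norm_smul, Real.norm_of_nonneg (by positivity), inv_mul_le_iff₀ (by linarith)] at h
    rw [inv_mul_le_iff₀ (by linarith)]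
    linarith [bracket_le x]
  · rcases Nat.eq_zero_or_pos n with rfl | hn
    · simpa using hC (R⁻¹ • x)
    · rw [iteratedFDeriv_cutoff_eq_zero hχ1 hn h]
      simp only [norm_zero, mul_zero]
      positivity

/-- The potential cut off near the origin. -/
def cutPot (χ V : E N → ℝ) (R : ℝ) (x : E N) : ℝ := V x * χ (R⁻¹ • x)

theorem contDiff_cutPot {V : E N → ℝ} (hχ : ContDiff ℝ ∞ χ) (hV : ContDiff ℝ ∞ V) (R : ℝ) :
    ContDiff ℝ ∞ (cutPot χ V R) :=
  hV.mul (hχ.comp (by fun_prop))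

/-- Symbol estimates on Euclidean space in terms of rescaled jets. -/
theorem jetBdd_rescale {J : Type*} {m : J → ℝ} {f : J → E N → ℝ} {γ : ℝ} (hs : ∀ j, ContDiff ℝ ∞ (f j)) :
    JetBdd (fun j : J × E N => m j.1 * bracket j.2 ^ γ) (fun j δ => f j.1 (j.2 + bracket j.2 • δ)) ↔
      ∀ n : ℕ, ∃ C, 0 ≤ C ∧ ∀ j x, ‖iteratedFDeriv ℝ n (f j) x‖ ≤ C * m j * bracket x ^ (γ - n) := by
  have key : ∀ (n : ℕ) (j : J) (x : E N), ‖iteratedFDeriv ℝ n (fun δ => f j (x + bracket x • δ)) 0‖ =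
      bracket x ^ n * ‖iteratedFDeriv ℝ n (f j) x‖ := fun n j x => by
    have hb := bracket_pos x
    rw [iteratedFDeriv_comp_add_smul (hs j), smul_zero, add_zero, norm_smul, norm_pow,
      Real.norm_of_nonneg hb.le]
  have hw : ∀ (n : ℕ) (x : E N), bracket x ^ (γ - n) * bracket x ^ n = bracket x ^ γ := fun n x => by
    have hb := bracket_pos x
    rw [← Real.rpow_natCast, ← Real.rpow_add hb, sub_add_cancel]
  constructor
  · intro h n
    obtain ⟨C, hC, hb⟩ := h.bound n
    refine ⟨C, hC, fun j x => ?_⟩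
    have := hb (j, x)
    simp only [key] at this
    have hx := pow_pos (bracket_pos x) n
    refine le_of_mul_le_mul_left (this.trans_eq ?_) hx
    rw [← hw n x]
    ring
  · intro h
    refine ⟨fun j => ContDiff.contDiffAt ((hs j.1).comp (by fun_prop)), fun n => ?_⟩
    obtain ⟨C, hC, hb⟩ := h n
    refine ⟨C, hC, fun ⟨j, x⟩ => ?_⟩
    simp only [key]
    have hx := pow_pos (bracket_pos x) n
    refine (mul_le_mul_of_nonneg_left (hb j x) hx.le).trans_eq ?_
    rw [← hw n x]
    ring

theorem exists_iteratedFDeriv_cutPot_le {V : E N → ℝ} {ε : ℝ} (hχ : ContDiff ℝ ∞ χ)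
    (hχ1 : ∀ x, 2 ≤ ‖x‖ → χ x = 1) (hV : ContDiff ℝ ∞ V)
    (hVd : ∀ n : ℕ, ∃ C, ∀ x, ‖iteratedFDeriv ℝ n V x‖ ≤ C * bracket x ^ (-(n : ℝ) - ε)) (n : ℕ) :
    ∃ C, 0 ≤ C ∧ ∀ R : ℝ, 1 ≤ R → ∀ x,
      ‖iteratedFDeriv ℝ n (cutPot χ V R) x‖ ≤ C * bracket x ^ (-(n : ℝ) - ε) := by
  have h1 : JetBdd (fun j : {R : ℝ // 1 ≤ R} × E N => 1 * bracket j.2 ^ (-ε))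
      (fun j δ => V (j.2 + bracket j.2 • δ)) := by
    refine (jetBdd_rescale (J := {R : ℝ // 1 ≤ R}) (m := fun _ => 1) (f := fun _ => V)
      fun _ => hV).2 fun n => ?_
    obtain ⟨C, hC⟩ := hVd n
    refine ⟨|C|, abs_nonneg _, fun _ x => (hC x).trans ?_⟩
    have : 0 ≤ bracket x ^ (-(n : ℝ) - ε) := Real.rpow_nonneg (bracket_pos x).le _
    rw [mul_one, show -ε - (n : ℝ) = -(n : ℝ) - ε by ring]
    exact mul_le_mul_of_nonneg_right (le_abs_self C) this
  have h2 := (h1.bilin (ContinuousLinearMap.mul ℝ ℝ) (jetBdd_cutoff_scale hχ hχ1)).mono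
    (m₂ := fun j : {R : ℝ // 1 ≤ R} × E N => 1 * bracket j.2 ^ (-ε)) zero_le_one
    (fun j => by simp)
  obtain ⟨C, hC, hb⟩ := (jetBdd_rescale (J := {R : ℝ // 1 ≤ R}) (m := fun _ => 1)
    (f := fun R => cutPot χ V R) fun R => contDiff_cutPot hχ hV R).1 h2 n
  refine ⟨C, hC, fun R hR x => (hb ⟨R, hR⟩ x).trans_eq ?_⟩
  rw [mul_one, show -ε - (n : ℝ) = -(n : ℝ) - ε by ring]

/-- The gradient as a continuous linear image of the derivative. -/
def gradCLM : (E N →L[ℝ] ℝ) →L[ℝ] E N :=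
  LinearMap.mkContinuous
    { toFun := fun L => (InnerProductSpace.toDual ℝ (E N)).symm L
      map_add' := fun L L' => map_add _ L L'
      map_smul' := fun c L => by simp } 1
    fun L => by simp

theorem gradCLM_fderiv (g : E N → ℝ) : (fun x => gradCLM (fderiv ℝ g x)) = gradient g := rfl

theorem norm_gradCLM_le : ‖gradCLM (N := N)‖ ≤ 1 := LinearMap.mkContinuous_norm_le _ zero_le_one _

theorem contDiff_gradient {g : E N → ℝ} (hg : ContDiff ℝ ∞ g) : ContDiff ℝ ∞ (gradient g) :=
  gradCLM.contDiff.comp (hg.fderiv_right (m := ∞) (by simp))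

theorem norm_iteratedFDeriv_gradient_le {g : E N → ℝ} (hg : ContDiff ℝ ∞ g) (n : ℕ) (x : E N) :
    ‖iteratedFDeriv ℝ n (gradient g) x‖ ≤ ‖iteratedFDeriv ℝ (n + 1) g x‖ := by
  have h1 : ContDiff ℝ ∞ (fderiv ℝ g) := hg.fderiv_right (by simp)
  rw [← norm_iteratedFDeriv_fderiv, ← gradCLM_fderiv]
  refine (gradCLM.norm_iteratedFDeriv_comp_left (N := ∞) h1.contDiffAt
    (by exact_mod_cast le_top)).trans ?_
  exact mul_le_of_le_one_left (norm_nonneg _) norm_gradCLM_le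

theorem cutPot_eq_zero {V : E N → ℝ} (hχ0 : ∀ x, ‖x‖ ≤ 1 → χ x = 0) {R : ℝ} (hR : 1 ≤ R) {x : E N}
    (hx : ‖x‖ ≤ R) : cutPot χ V R x = 0 := by
  rw [cutPot, hχ0, mul_zero]
  rw [norm_smul, Real.norm_of_nonneg (by positivity), inv_mul_le_iff₀ (by linarith)]
  linarith

theorem cutPot_eq {V : E N → ℝ} (hχ1 : ∀ x, 2 ≤ ‖x‖ → χ x = 1) {R : ℝ} (hR : 1 ≤ R) {x : E N}
    (hx : 2 * R ≤ ‖x‖) : cutPot χ V R x = V x := by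
  rw [cutPot, hχ1, mul_one]
  rw [norm_smul, Real.norm_of_nonneg (by positivity), le_inv_mul_iff₀ (by linarith)]
  linarith

theorem gradient_cutPot {V : E N → ℝ} (hχ1 : ∀ x, 2 ≤ ‖x‖ → χ x = 1) {R : ℝ} (hR : 1 ≤ R) {x : E N}
    (hx : 2 * R < ‖x‖) : gradient (cutPot χ V R) x = gradient V x := by
  have h : cutPot χ V R =ᶠ[nhds x] V := by
    filter_upwards [(isOpen_lt continuous_const continuous_norm).mem_nhds hx] with y hy
    exact cutPot_eq hχ1 hR (le_of_lt hy)
  rw [← gradCLM_fderiv, ← gradCLM_fderiv]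
  simp only [h.fderiv_eq]

/-- Far out, the truncated potential is as small as one likes in a weaker norm. -/
theorem cutPot_small {V : E N → ℝ} {ε : ℝ} (hε : 0 < ε) (hχ0 : ∀ x, ‖x‖ ≤ 1 → χ x = 0) {n : ℕ} {C : ℝ}
    (hC0 : 0 ≤ C) (hC : ∀ R : ℝ, 1 ≤ R → ∀ x,
      ‖iteratedFDeriv ℝ n (cutPot χ V R) x‖ ≤ C * bracket x ^ (-(n : ℝ) - ε)) {R : ℝ} (hR : 1 ≤ R)
    (x : E N) :
    ‖iteratedFDeriv ℝ n (cutPot χ V R) x‖ ≤ C * R ^ (-(ε / 2)) * bracket x ^ (-(n : ℝ) - ε / 2) := by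
  have hb := bracket_pos x
  have hR0 : 0 < R := by linarith
  rcases lt_or_ge ‖x‖ R with h | h
  · have h0 : cutPot χ V R =ᶠ[nhds x] fun _ => 0 := by
      filter_upwards [(isOpen_lt continuous_norm continuous_const).mem_nhds h] with y hy
      exact cutPot_eq_zero hχ0 hR (le_of_lt hy)
    rw [(h0.iteratedFDeriv ℝ n).eq_of_nhds]
    simp only [iteratedFDeriv_fun_zero, Pi.zero_apply, norm_zero]
    positivity
  · refine (hC R hR x).trans ?_
    -- Half of the decay is spent on the factor `R ^ (-(ε / 2))`, since here `⟨x⟩ ≥ ‖x‖ ≥ R`.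
    rw [mul_assoc, show -(n : ℝ) - ε = -(ε / 2) + (-(n : ℝ) - ε / 2) by ring, Real.rpow_add hb]
    have h1 : bracket x ^ (-(ε / 2)) ≤ R ^ (-(ε / 2)) :=
      Real.rpow_le_rpow_of_nonpos hR0 (h.trans (norm_le_bracket x)) (by linarith)
    have h2 := Real.rpow_nonneg hb.le (-(n : ℝ) - ε / 2)
    gcongr

/-- The force of the potential, cut off sufficiently far out, satisfies the smallness conditions. -/
theorem exists_flowHyp {V : E N → ℝ} {w : E N → E N} {ε M c r : ℝ} (hε : 0 < ε)
    (hχ : ContDiff ℝ ∞ χ) (hχ0 : ∀ x, ‖x‖ ≤ 1 → χ x = 0) (hχ1 : ∀ x, 2 ≤ ‖x‖ → χ x = 1)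
    (hV : ContDiff ℝ ∞ V)
    (hVd : ∀ n : ℕ, ∃ C, ∀ x, ‖iteratedFDeriv ℝ n V x‖ ≤ C * bracket x ^ (-(n : ℝ) - ε))
    (hw : ContDiff ℝ ∞ w) (hwb : ∀ n, ∃ C, ∀ ξ, ‖iteratedFDeriv ℝ n w ξ‖ ≤ C)
    (hwl : ∀ ξ, ‖fderiv ℝ w ξ‖ ≤ M) (hM : 0 ≤ M) (hc : 0 < c) (hr : 0 < r)
    (hrc : (2 * M + 1) * r < c / 2) :
    ∃ R η, 1 ≤ R ∧ FlowHyp w (gradient (cutPot χ V R)) ε (ε / 2) c r M η := by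
  have hbd := exists_iteratedFDeriv_cutPot_le hχ hχ1 hV hVd
  obtain ⟨C₁, hC₁, hb₁⟩ := hbd 1
  obtain ⟨C₂, hC₂, hb₂⟩ := hbd 2
  set C := max C₁ C₂
  have hC : 0 ≤ C := hC₁.trans (le_max_left _ _)
  -- The future constant `η` tends to zero with the cut-off radius, while `c`, `r` and `M` stay
  -- fixed.
  have ht : Filter.Tendsto (fun R : ℝ => C * R ^ (-(ε / 2))) Filter.atTop (nhds (C * 0)) :=
    (tendsto_rpow_neg_atTop (by linarith)).const_mul C
  rw [mul_zero] at ht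
  have h1 : ∀ D s : ℝ, 0 < s → ∀ᶠ R : ℝ in Filter.atTop, (ε / 2)⁻¹ * (C * R ^ (-(ε / 2)) * D) < s :=
    fun D s hs => by
      have := (ht.mul_const D).const_mul (ε / 2)⁻¹
      rw [zero_mul, mul_zero] at this
      exact this.eventually (gt_mem_nhds hs)
  obtain ⟨R, hR1, hRa, hRb⟩ := ((Filter.eventually_ge_atTop 1).and
    ((h1 ((c / 2) ^ (-1 - ε / 2)) (r / 2) (by linarith)).and
      (h1 ((c / 2) ^ (-2 - ε / 2) * M) (1 / 2) (by norm_num)))).exists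
  have hR0 : 0 < R := by linarith
  refine ⟨R, C * R ^ (-(ε / 2)), hR1, ?_⟩
  have hcs := contDiff_cutPot hχ hV R
  have hRp : 0 ≤ R ^ (-(ε / 2)) := by positivity
  exact {
    v_smooth := hw
    v_bdd := hwb
    v_lip := hwl
    K_smooth := contDiff_gradient hcs
    K_decay := fun n => by
      obtain ⟨C', -, hb'⟩ := hbd (n + 1)
      refine ⟨C', fun x => (norm_iteratedFDeriv_gradient_le hcs n x).trans ((hb' R hR1 x).trans_eq ?_)⟩
      congr 2
      push_cast
      ring
    K_small := fun x => by
      have h2 := (norm_iteratedFDeriv_gradient_le hcs 0 x).trans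
        (cutPot_small (V := V) hε hχ0 hC₁ hb₁ hR1 x)
      rw [norm_iteratedFDeriv_zero, Nat.cast_one] at h2
      refine h2.trans ?_
      have := Real.rpow_nonneg (bracket_pos x).le (-1 - ε / 2)
      have := le_max_left C₁ C₂
      gcongr
    dK_small := fun x => by
      have h2 := (norm_iteratedFDeriv_gradient_le hcs 1 x).trans
        (cutPot_small (V := V) hε hχ0 hC₂ hb₂ hR1 x)
      rw [norm_iteratedFDeriv_one, Nat.cast_ofNat] at h2
      refine h2.trans ?_
      have := Real.rpow_nonneg (bracket_pos x).le (-2 - ε / 2)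
      have := le_max_right C₁ C₂
      gcongr
    β_pos := by linarith
    β_le := by linarith
    c_pos := hc
    r_pos := hr
    M_nonneg := hM
    η_nonneg := by positivity
    small_r := hrc
    small_K := hRa.le
    small_dK := by rw [mul_assoc (C * _)]; exact hRb.le }

end Truncation

/-! ### The outgoing phase where the velocity is bounded below -/

section OneSided

open scoped RealInnerProductSpace

variable {N : ℕ} {g V χ : E N → ℝ} {ε b : ℝ}

/-- Hypotheses on the free symbol `g`, the potential `V` and the cut-off function `χ`. -/
structure ScatteringHyp (χ g V : E N → ℝ) (ε : ℝ) : Prop where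
  ε_pos : 0 < ε
  ε_lt : ε < 1
  χ_smooth : ContDiff ℝ ∞ χ
  χ_zero : ∀ x, ‖x‖ ≤ 1 → χ x = 0
  χ_one : ∀ x, 2 ≤ ‖x‖ → χ x = 1
  g_smooth : ContDiff ℝ ∞ g
  g_bdd : ∀ n, ∃ C, ∀ ξ, ‖iteratedFDeriv ℝ n g ξ‖ ≤ C
  V_smooth : ContDiff ℝ ∞ V
  V_decay : ∀ n : ℕ, ∃ C, ∀ x, ‖iteratedFDeriv ℝ n V x‖ ≤ C * bracket x ^ (-(n : ℝ) - ε)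

/-- The phase space region of points that do not move towards the origin. -/
def outRegion (w : E N → E N) (b : ℝ) : Set (E N × E N) :=
  {p | b < ‖w p.2‖ ∧ -(b / 2) < ⟪p.1, w p.2⟫}

theorem isOpen_outRegion {w : E N → E N} (hw : Continuous w) : IsOpen (outRegion w b) :=
  (isOpen_lt (f := fun _ => b) (g := fun p : E N × E N => ‖w p.2‖) (by fun_prop)
    (by fun_prop)).inter (isOpen_lt (f := fun _ => -(b / 2))
      (g := fun p : E N × E N => ⟪p.1, w p.2⟫) (by fun_prop) (by fun_prop))

/-- The threshold `-(b / 2)` is negative, so the region is open and still contains the segment from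
any of its positions to the origin. The generating function integrates along that segment. -/
theorem outRegion_star {w : E N → E N} (hb : 0 < b) :
    ∀ p ∈ outRegion w b, ∀ s ∈ Set.Icc (0 : ℝ) 1, (s • p.1, p.2) ∈ outRegion w b := by
  rintro p ⟨h1, h2⟩ s ⟨hs0, hs1⟩
  refine ⟨h1, ?_⟩
  show -(b / 2) < ⟪s • p.1, w p.2⟫
  rw [real_inner_smul_left]
  rcases le_total 0 ⟪p.1, w p.2⟫ with h | h
  · have := mul_nonneg hs0 h
    linarith
  · have := mul_le_mul_of_nonpos_right hs1 h
    linarith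

/-- Expanding `‖x + t v‖ ^ 2`, the cross term is at least `-t b`. It is absorbed by `(t b - 1) ^ 2 ≥
0`, using half of `t² b²` and the fact that `⟨x⟩ ≥ 1`. -/
theorem escapes_of_mem_outRegion {w : E N → E N} (hb : 0 < b) (hb1 : b ≤ 1) {p : E N × E N}
    (hp : p ∈ outRegion w b) : Escapes w (b / 2) p.1 p.2 := by
  intro t ht
  obtain ⟨h1, h2⟩ := hp
  have hl := one_le_bracket p.1
  refine (sq_le_sq₀ (by positivity) (bracket_pos _).le).1 ?_
  rw [bracket_sq, norm_add_sq_real, real_inner_smul_right, norm_smul, Real.norm_of_nonneg ht]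
  have h3 := bracket_sq p.1
  have h4 : b ^ 2 ≤ ‖w p.2‖ ^ 2 := pow_le_pow_left₀ hb.le h1.le 2
  have h5 : t * -(b / 2) ≤ t * ⟪p.1, w p.2⟫ := mul_le_mul_of_nonneg_left h2.le ht
  have h6 : t ^ 2 * b ^ 2 ≤ t ^ 2 * ‖w p.2‖ ^ 2 := mul_le_mul_of_nonneg_left h4 (sq_nonneg t)
  have h7 : b ^ 2 * bracket p.1 ^ 2 ≤ 1 * bracket p.1 ^ 2 :=
    mul_le_mul_of_nonneg_right (by nlinarith) (sq_nonneg _)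
  have h8 : 0 ≤ b ^ 2 * (bracket p.1 - t) ^ 2 := by positivity
  nlinarith [sq_nonneg (t * b - 1)]

theorem outRegion_add {w : E N → E N} {ζ : E N} (h : ∀ ξ, w (ξ + ζ) = w ξ) {p : E N × E N} :
    (p.1, p.2 + ζ) ∈ outRegion w b ↔ p ∈ outRegion w b := by
  simp [outRegion, h]

theorem ScatteringHyp.gradient_bdd (h : ScatteringHyp χ g V ε) (n : ℕ) :
    ∃ C, ∀ ξ, ‖iteratedFDeriv ℝ n (gradient g) ξ‖ ≤ C := by
  obtain ⟨C, hC⟩ := h.g_bdd (n + 1)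
  exact ⟨C, fun ξ => (norm_iteratedFDeriv_gradient_le h.g_smooth n ξ).trans (hC ξ)⟩

theorem fderiv_gradient_symm {g : E N → ℝ} (hg : ContDiff ℝ ∞ g) (y a b : E N) :
    ⟪fderiv ℝ (gradient g) y a, b⟫ = ⟪fderiv ℝ (gradient g) y b, a⟫ := by
  have h1 : ContDiff ℝ ∞ (fderiv ℝ g) := hg.fderiv_right (by simp)
  have h2 : fderiv ℝ (gradient g) y = gradCLM.comp (fderiv ℝ (fderiv ℝ g) y) := by
    rw [← gradCLM_fderiv]
    exact (gradCLM.hasFDerivAt.comp y ((h1.differentiable (by simp)) y).hasFDerivAt).fderiv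
  have h3 : ∀ (L : E N →L[ℝ] ℝ) c, ⟪gradCLM L, c⟫ = L c := fun L c =>
    InnerProductSpace.toDual_symm_apply
  rw [h2, ContinuousLinearMap.comp_apply, ContinuousLinearMap.comp_apply, h3, h3]
  exact (hg.contDiffAt.isSymmSndFDerivAt (by
    rw [minSmoothness_of_isRCLikeNormedField]
    exact WithTop.coe_le_coe.2 (le_top : (2 : ℕ∞) ≤ ⊤))).eq _ _

theorem hasGradientAt_of_contDiff {g : E N → ℝ} (hg : ContDiff ℝ ∞ g) (y : E N) :
    HasGradientAt g (gradient g y) y :=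
  ((hg.differentiable (by simp)) y).hasGradientAt

/-- A generating function of the outgoing trajectories of the Hamiltonian `g + V`. -/
structure IsPhase (g V : E N → ℝ) (ε b : ℝ) (ψ : E N × E N → ℝ) : Prop where
  smooth : ContDiffOn ℝ ∞ ψ (outRegion (gradient g) b)
  jets : JetBdd (fun j : outRegion (gradient g) b => bracket (j : E N × E N).1 ^ (1 - ε))
    (fun j δ => ψ (shift (j : E N × E N) δ))
  periodic : ∀ p ∈ outRegion (gradient g) b, ∀ ζ,
    (∀ ξ, gradient g (ξ + ζ) = gradient g ξ) → ψ (p.1, p.2 + ζ) = ψ p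
  traj : ∃ (Q : E N × E N → ℝ → E N) (R C : ℝ), ∀ p ∈ outRegion (gradient g) b, R ≤ ‖p.1‖ →
    IsTraj (gradient g) (gradient V) p.1 p.2 (Q p) ∧
      (∀ τ, ‖Q p τ‖ ≤ C * bracket p.1 ^ (-ε)) ∧
      HasGradientAt (fun y => ψ (y, p.2)) (Q p 0) p.1
  eikonal : ∃ R : ℝ, ∀ p ∈ outRegion (gradient g) b, R ≤ ‖p.1‖ →
    g (p.2 + gradient (fun y => ψ (y, p.2)) p.1) + V p.1 = g p.2

theorem isTraj_congr {v K K' : E N → E N} {x ξ : E N} {Q : ℝ → E N}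
    (h : ∀ s, 0 ≤ s → K (trajPos v x ξ Q s) = K' (trajPos v x ξ Q s)) (hQ : IsTraj v K x ξ Q) :
    IsTraj v K' x ξ Q := by
  refine ⟨hQ.1, fun τ => (hQ.2 τ).trans (setIntegral_congr_fun measurableSet_Ioi fun s hs => ?_)⟩
  exact h s ((le_max_right τ 0).trans (le_of_lt hs))

/-- Trajectories from far out do not see the cut-off of the potential. -/
theorem gradient_cutPot_trajPos {v : E N → E N} {β c r M η R : ℝ} (hχ1 : ∀ x, 2 ≤ ‖x‖ → χ x = 1)
    (hR : 1 ≤ R) (h : FlowHyp v (gradient (cutPot χ V R)) ε β c r M η) {x ξ : E N}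
    (hesc : Escapes v c x ξ) {Q : ℝ → E N} (hQ : Continuous Q) (hb : ∀ τ, ‖Q τ‖ ≤ r)
    (hx : (2 * R + 2) * (2 / c) ≤ ‖x‖) (s : ℝ) (hs : 0 ≤ s) :
    gradient (cutPot χ V R) (trajPos v x ξ Q s) = gradient V (trajPos v x ξ Q s) := by
  refine gradient_cutPot hχ1 hR ?_
  have h1 := trajPos_escape h hesc hQ hb hs
  have h2 := bracket_le (trajPos v x ξ Q s)
  have hc := h.c_pos
  have h3 : c / 2 * ‖x‖ ≤ c / 2 * (bracket x + s) :=
    mul_le_mul_of_nonneg_left (by linarith [norm_le_bracket x]) (by positivity)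
  have h4 : c / 2 * ((2 * R + 2) * (2 / c)) ≤ c / 2 * ‖x‖ :=
    mul_le_mul_of_nonneg_left hx (by positivity)
  have h5 : c / 2 * ((2 * R + 2) * (2 / c)) = 2 * R + 2 := by field_simp
  linarith

theorem exists_le_of_rpow_neg (hε : 0 < ε) (C : ℝ) {r : ℝ} (hr : 0 < r) :
    ∃ R : ℝ, ∀ x : E N, R ≤ ‖x‖ → C * bracket x ^ (-ε) ≤ r := by
  have ht : Filter.Tendsto (fun R : ℝ => |C| * R ^ (-ε)) Filter.atTop (nhds (|C| * 0)) :=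
    (tendsto_rpow_neg_atTop hε).const_mul |C|
  rw [mul_zero] at ht
  obtain ⟨R, hR1, hR⟩ := ((Filter.eventually_ge_atTop 1).and
    (ht.eventually (gt_mem_nhds hr))).exists
  refine ⟨R, fun x hx => ?_⟩
  have h1 : bracket x ^ (-ε) ≤ R ^ (-ε) :=
    Real.rpow_le_rpow_of_nonpos (by linarith) (hx.trans (norm_le_bracket x)) (by linarith)
  have h2 := Real.rpow_nonneg (bracket_pos x).le (-ε)
  calc C * bracket x ^ (-ε) ≤ |C| * R ^ (-ε) :=
        mul_le_mul (le_abs_self C) h1 h2 (abs_nonneg C)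
    _ ≤ r := hR.le

theorem ScatteringHyp.exists_flow (h : ScatteringHyp χ g V ε) (hb : 0 < b) :
    ∃ r M R η, 1 ≤ R ∧
      FlowHyp (gradient g) (gradient (cutPot χ V R)) ε (ε / 2) (b / 2) r M η := by
  obtain ⟨M, hM⟩ := h.gradient_bdd 1
  have hM0 : 0 ≤ M := (norm_nonneg _).trans (hM 0)
  -- With the escape rate `b / 2`, this radius gives `(2 * M + 1) * r = b / 8`, strictly below the
  -- required `b / 4`.
  refine ⟨b / (8 * (2 * M + 1)), M, ?_⟩
  refine exists_flowHyp h.ε_pos h.χ_smooth h.χ_zero h.χ_one h.V_smooth h.V_decay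
    (contDiff_gradient h.g_smooth) h.gradient_bdd (fun ξ => ?_) hM0 (by positivity)
    (by positivity) ?_
  · rw [← norm_iteratedFDeriv_one]
    exact hM ξ
  · rw [mul_div_assoc', div_lt_iff₀ (by positivity)]
    nlinarith

/-- The initial momenta of the trajectories form a symmetric field, which is integrated from the
origin. Periodicity follows from uniqueness: the trajectory equation sees `ξ` only through `v(ξ +
·)`. Trajectories from far out stay far out, so there the cut-off of `V` is invisible. -/
theorem ScatteringHyp.exists_isPhase (h : ScatteringHyp χ g V ε) (hb : 0 < b) (hb1 : b ≤ 1) :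
    ∃ ψ, IsPhase g V ε b ψ := by
  obtain ⟨r, M, R, η, hR, hF⟩ := h.exists_flow hb
  have hε := h.ε_pos
  have hvc := contDiff_gradient h.g_smooth
  set Ω := outRegion (gradient g) b with hΩdef
  have hΩ : IsOpen Ω := isOpen_outRegion hvc.continuous
  have hstar := outRegion_star (w := gradient g) hb
  have hesc : ∀ p ∈ Ω, Escapes (gradient g) (b / 2) p.1 p.2 := fun p hp =>
    escapes_of_mem_outRegion hb hb1 hp
  obtain ⟨Q, hQ, hjet, hlin⟩ := exists_trajField hF hΩ hesc
  set q : E N × E N → E N := fun p => Q p 0 with hq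
  have hqj : JetBdd (fun j : Ω => bracket (j : E N × E N).1 ^ (-ε))
      (fun j δ => q (shift (j : E N × E N) δ)) := hjet.reindex (fun j => (j, 0))
  have hqs : ContDiffOn ℝ ∞ q Ω := fun p hp =>
    (contDiffAt_of_shift (hqj.smooth ⟨p, hp⟩)).contDiffWithinAt
  have hcs := contDiff_cutPot h.χ_smooth h.V_smooth R
  have hsymm : ∀ p ∈ Ω, ∀ a b, ⟪fderiv ℝ (fun y => q (y, p.2)) p.1 a, b⟫ =
      ⟪fderiv ℝ (fun y => q (y, p.2)) p.1 b, a⟫ := by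
    intro p hp a b'
    obtain ⟨L, hL, hl⟩ := hlin p hp
    obtain ⟨π, hπc, hπb, hπ0, hπ⟩ := hl a
    obtain ⟨ρ, hρc, hρb, hρ0, hρ⟩ := hl b'
    rw [hL.fderiv, ← hπ0, ← hρ0]
    exact IsLinTraj.symm hF (by linarith [h.ε_lt]) (hesc p hp) (hQ p hp).1.1 (hQ p hp).2
      (fderiv_gradient_symm h.g_smooth) (fderiv_gradient_symm hcs)
      ⟨hπc, hπb, hπ⟩ ⟨hρc, hρb, hρ⟩
  -- The condition is `k ≥ 1 / (1 - ε)`, which can be met because `ε < 1`.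
  obtain ⟨k, hk1, hk2⟩ : ∃ k : ℕ, 1 ≤ k ∧ k * ε ≤ k - 1 := by
    obtain ⟨k, hk⟩ := exists_nat_ge (1 / (1 - ε))
    have h1 : 0 < 1 - ε := by linarith [h.ε_lt]
    rw [div_le_iff₀ h1] at hk
    refine ⟨k, ?_, by linarith⟩
    by_contra hk0
    have : k = 0 := by omega
    simp [this] at hk
    linarith
  have hgrad : ∀ p ∈ Ω, HasGradientAt (fun y => genPhase k q (y, p.2)) (q p) p.1 := fun p hp =>
    hasGradientAt_genPhase hΩ hqs hk1 hstar hsymm hp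
  refine ⟨genPhase k q, ⟨contDiffOn_genPhase hΩ hqs hstar,
    jetBdd_genPhase hΩ hε.le hk1 hk2 hstar hqj, ?_, ?_, ?_⟩⟩
  · intro p hp ζ hζ
    refine genPhase_congr hstar hp fun p' hp' => ?_
    have hp2 : (p'.1, p'.2 + ζ) ∈ Ω := (outRegion_add hζ).2 hp'
    have h1 := (hQ _ hp2).1
    have h2 : IsTraj (gradient g) (gradient (cutPot χ V R)) p'.1 p'.2 (Q (p'.1, p'.2 + ζ)) := by
      refine ⟨h1.1, fun τ => (h1.2 τ).trans ?_⟩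
      have h3 : ∀ y : E N, gradient g (p'.2 + ζ + y) = gradient g (p'.2 + y) := fun y => by
        rw [add_right_comm, hζ]
      simp only [h3]
    exact congrFun (IsTraj.unique hF (hesc p' hp') h2 (hQ p' hp').1 (hQ _ hp2).2 (hQ p' hp').2) 0
  · obtain ⟨C, -, hC⟩ := hjet.le_bound
    refine ⟨Q, (2 * R + 2) * (2 / (b / 2)), C, fun p hp hx => ⟨?_, fun τ => ?_, hgrad p hp⟩⟩
    · exact isTraj_congr (gradient_cutPot_trajPos h.χ_one hR hF (hesc p hp) (hQ p hp).1.1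
        (hQ p hp).2 hx) (hQ p hp).1
    · simpa only [shift_zero] using hC (⟨p, hp⟩, τ)
  · refine ⟨2 * R, fun p hp hx => ?_⟩
    rw [(hgrad p hp).gradient, ← cutPot_eq (V := V) h.χ_one hR hx]
    obtain ⟨C, -, hC⟩ := exists_iteratedFDeriv_cutPot_le h.χ_smooth h.χ_one h.V_smooth h.V_decay 0
    refine energy_conservation hF (hesc p hp) (hQ p hp).1 (hQ p hp).2
      (hasGradientAt_of_contDiff h.g_smooth) (hasGradientAt_of_contDiff hcs) (C := C) hε fun y => ?_
    simpa using hC R hR y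

/-- Two generating functions have the same gradient far out. -/
theorem ScatteringHyp.gradient_eq (h : ScatteringHyp χ g V ε) {b' : ℝ} (hb : 0 < b) (hb1 : b ≤ 1)
    {ψ ψ' : E N × E N → ℝ} (hψ : IsPhase g V ε b ψ) (hψ' : IsPhase g V ε b' ψ') :
    ∃ R : ℝ, ∀ p ∈ outRegion (gradient g) b, p ∈ outRegion (gradient g) b' → R ≤ ‖p.1‖ →
      gradient (fun y => ψ (y, p.2)) p.1 = gradient (fun y => ψ' (y, p.2)) p.1 := by
  obtain ⟨r, M, R, η, hR, hF⟩ := h.exists_flow hb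
  obtain ⟨Q₁, R₁, C₁, h₁⟩ := hψ.traj
  obtain ⟨Q₂, R₂, C₂, h₂⟩ := hψ'.traj
  obtain ⟨R₃, h₃⟩ := exists_le_of_rpow_neg (N := N) h.ε_pos C₁ hF.r_pos
  obtain ⟨R₄, h₄⟩ := exists_le_of_rpow_neg (N := N) h.ε_pos C₂ hF.r_pos
  -- Beyond all these radii both trajectories have size at most `r` and solve the equation of one
  -- and the same truncated potential, to which uniqueness applies.
  refine ⟨max ((2 * R + 2) * (2 / (b / 2))) (max (max R₁ R₂) (max R₃ R₄)), fun p hp hp' hx => ?_⟩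
  simp only [max_le_iff] at hx
  obtain ⟨hx0, ⟨hx1, hx2⟩, hx3, hx4⟩ := hx
  obtain ⟨t₁, b₁, g₁⟩ := h₁ p hp hx1
  obtain ⟨t₂, b₂, g₂⟩ := h₂ p hp' hx2
  have hesc := escapes_of_mem_outRegion hb hb1 hp
  have c₁ := fun τ => (b₁ τ).trans (h₃ p.1 hx3)
  have c₂ := fun τ => (b₂ τ).trans (h₄ p.1 hx4)
  have e₁ := isTraj_congr (fun s hs =>
    (gradient_cutPot_trajPos h.χ_one hR hF hesc t₁.1 c₁ hx0 s hs).symm) t₁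
  have e₂ := isTraj_congr (fun s hs =>
    (gradient_cutPot_trajPos h.χ_one hR hF hesc t₂.1 c₂ hx0 s hs).symm) t₂
  rw [g₁.gradient, g₂.gradient, IsTraj.unique hF hesc e₁ e₂ c₁ c₂]

end OneSided

/-! ### Symbol classes on phase space -/

section Symbols

variable {N : ℕ} {J : Type*}

theorem JetBdd.of_subset {X F : Type*} [NormedAddCommGroup X] [NormedSpace ℝ X]
    [NormedAddCommGroup F] [NormedSpace ℝ F] {m : J → ℝ} {G : J → X → F} (S : Set J)
    (hm : ∀ j, 0 ≤ m j) (hS : JetBdd (fun j : S => m j) (fun j : S => G j))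
    (h0 : ∀ j, j ∉ S → G j =ᶠ[nhds 0] fun _ => 0) : JetBdd m G := by
  refine ⟨fun j => ?_, fun n => ?_⟩
  · by_cases hj : j ∈ S
    · exact hS.smooth ⟨j, hj⟩
    · exact contDiffAt_const.congr_of_eventuallyEq (h0 j hj)
  · obtain ⟨C, hC, hb⟩ := hS.bound n
    refine ⟨C, hC, fun j => ?_⟩
    by_cases hj : j ∈ S
    · exact hb ⟨j, hj⟩
    · rw [((h0 j hj).iteratedFDeriv ℝ n).eq_of_nhds, iteratedFDeriv_fun_zero]
      simpa using mul_nonneg hC (hm j)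

/-- The directional derivative in the position. -/
def dX (a : E N) (Φ : E N × E N → ℝ) (p : E N × E N) : ℝ := fderiv ℝ Φ p (a, 0)

/-- The directional derivative in the momentum. -/
def dXi (a : E N) (Φ : E N × E N → ℝ) (p : E N × E N) : ℝ := fderiv ℝ Φ p (0, a)

theorem contDiff_dX {Φ : E N × E N → ℝ} (h : ContDiff ℝ ∞ Φ) (a : E N) : ContDiff ℝ ∞ (dX a Φ) :=
  (h.fderiv_right (m := ∞) (by simp)).clm_apply contDiff_const

theorem contDiff_dXi {Φ : E N × E N → ℝ} (h : ContDiff ℝ ∞ Φ) (a : E N) : ContDiff ℝ ∞ (dXi a Φ) :=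
  (h.fderiv_right (m := ∞) (by simp)).clm_apply contDiff_const

theorem partialDeriv_snd {Φ : E N × E N → ℝ} (h : ContDiff ℝ ∞ Φ) (k : Fin N) (x ξ : E N) :
    partialDeriv k (fun ξ => Φ (x, ξ)) ξ = dXi (EuclideanSpace.single k 1) Φ (x, ξ) := by
  have h1 := ((h.differentiable (by simp)) (x, ξ)).hasFDerivAt.comp (f := fun ξ : E N => (x, ξ)) ξ
    (hasFDerivAt_prodMk_right x ξ)
  simp only [partialDeriv, dXi]
  rw [show (fun ξ => Φ (x, ξ)) = Φ ∘ fun ξ => (x, ξ) from rfl, h1.fderiv]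
  simp

theorem partialDeriv_fst {Φ : E N × E N → ℝ} (h : ContDiff ℝ ∞ Φ) (k : Fin N) (x ξ : E N) :
    partialDeriv k (fun x => Φ (x, ξ)) x = dX (EuclideanSpace.single k 1) Φ (x, ξ) := by
  have h1 := ((h.differentiable (by simp)) (x, ξ)).hasFDerivAt.comp (f := fun x : E N => (x, ξ)) x
    (hasFDerivAt_prodMk_left x ξ)
  simp only [partialDeriv, dX]
  rw [show (fun x => Φ (x, ξ)) = Φ ∘ fun x => (x, ξ) from rfl, h1.fderiv]
  simp

/-- A family of smooth functions on phase space with symbol estimates of order `γ` in the position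
and constants proportional to `m`. -/
structure Symb (m : J → ℝ) (γ : ℝ) (Φ : J → E N × E N → ℝ) : Prop where
  smooth : ∀ j, ContDiff ℝ ∞ (Φ j)
  jets : JetBdd (fun t : J × (E N × E N) => m t.1 * bracket t.2.1 ^ γ)
    (fun t δ => Φ t.1 (shift t.2 δ))

theorem fderiv_comp_shift {Φ : E N × E N → ℝ} (h : ContDiff ℝ ∞ Φ) (p δ a : E N × E N) :
    fderiv ℝ (fun δ => Φ (shift p δ)) δ a = fderiv ℝ Φ (shift p δ) (bracket p.1 • a.1, a.2) := by
  have h1 : HasFDerivAt (shift p) (((bracket p.1 • ContinuousLinearMap.fst ℝ (E N) (E N))).prod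
      (ContinuousLinearMap.snd ℝ (E N) (E N))) δ :=
    ((hasFDerivAt_fst.fun_const_smul (bracket p.1)).const_add p.1).prodMk (hasFDerivAt_snd.const_add p.2)
  have h2 := ((h.differentiable (by simp)) (shift p δ)).hasFDerivAt.comp δ h1
  rw [show (fun δ => Φ (shift p δ)) = Φ ∘ shift p from rfl, h2.fderiv]
  rfl

theorem Symb.dXi {m : J → ℝ} {γ : ℝ} {Φ : J → E N × E N → ℝ} (h : Symb m γ Φ) (a : E N) :
    Symb m γ (fun j => dXi a (Φ j)) := by
  refine ⟨fun j => contDiff_dXi (h.smooth j) a, ?_⟩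
  refine (h.jets.fderiv.clm_const (ContinuousLinearMap.apply ℝ ℝ ((0 : E N), a))).of_eventuallyEq
    fun t => Filter.Eventually.of_forall fun δ => ?_
  simp only [ContinuousLinearMap.apply_apply]
  rw [fderiv_comp_shift (h.smooth t.1)]
  simp [LatticeScattering.dXi]

/-- Differentiating in `δ₁` is `⟨x⟩ ∂_x`, so dividing by `⟨x⟩` lowers the order by one. -/
theorem Symb.dX {m : J → ℝ} {γ : ℝ} {Φ : J → E N × E N → ℝ} (h : Symb m γ Φ) (a : E N) :
    Symb m (γ - 1) (fun j => dX a (Φ j)) := by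
  refine ⟨fun j => contDiff_dX (h.smooth j) a, ?_⟩
  have h1 := (h.jets.fderiv.clm_const (ContinuousLinearMap.apply ℝ ℝ (a, (0 : E N)))).smul_weight
    (fun t => (bracket t.2.1)⁻¹)
  have h2 : (fun t : J × (E N × E N) => |(bracket t.2.1)⁻¹| * (m t.1 * bracket t.2.1 ^ γ)) =
      fun t => m t.1 * bracket t.2.1 ^ (γ - 1) := by
    ext1 t
    have := bracket_pos t.2.1
    rw [abs_of_pos (by positivity), Real.rpow_sub_one this.ne']
    field_simp
  rw [h2] at h1
  refine h1.of_eventuallyEq fun t => Filter.Eventually.of_forall fun δ => ?_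
  have hb := bracket_pos t.2.1
  simp only [ContinuousLinearMap.apply_apply]
  rw [fderiv_comp_shift (h.smooth t.1)]
  have : (bracket t.2.1 • a, (0 : E N)) = bracket t.2.1 • (a, (0 : E N)) := by simp
  rw [this, map_smul, smul_smul, inv_mul_cancel₀ hb.ne', one_smul]
  rfl

theorem Symb.le_bound {m : J → ℝ} {γ : ℝ} {Φ : J → E N × E N → ℝ} (h : Symb m γ Φ) :
    ∃ C, 0 ≤ C ∧ ∀ j p, |Φ j p| ≤ C * (m j * bracket p.1 ^ γ) := by
  obtain ⟨C, hC, hb⟩ := h.jets.le_bound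
  exact ⟨C, hC, fun j p => by simpa [shift_zero] using hb (j, p)⟩

theorem Symb.add {m : J → ℝ} {γ : ℝ} {Φ Ψ : J → E N × E N → ℝ} (h : Symb m γ Φ)
    (h' : Symb m γ Ψ) : Symb m γ (fun j p => Φ j p + Ψ j p) :=
  ⟨fun j => (h.smooth j).add (h'.smooth j), h.jets.add h'.jets⟩

theorem Symb.sum {ι : Type*} (s : Finset ι) {m : J → ℝ} (hm : ∀ j, 0 ≤ m j) {γ : ℝ}
    {Φ : ι → J → E N × E N → ℝ} (h : ∀ i ∈ s, Symb m γ (Φ i)) :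
    Symb m γ (fun j p => ∑ i ∈ s, Φ i j p) :=
  ⟨fun j => ContDiff.sum fun i hi => (h i hi).smooth j,
    JetBdd.sum s (fun t => mul_nonneg (hm t.1) (Real.rpow_nonneg (bracket_pos _).le _))
      fun i hi => (h i hi).jets⟩

theorem Symb.reindex {J' : Type*} {m : J → ℝ} {γ : ℝ} {Φ : J → E N × E N → ℝ} (h : Symb m γ Φ)
    (k : J' → J) : Symb (fun j => m (k j)) γ (fun j => Φ (k j)) :=
  ⟨fun j => h.smooth (k j), h.jets.reindex (fun t : J' × (E N × E N) => (k t.1, t.2))⟩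

/-- A function of the momentum with bounded derivatives has bounded jets. -/
theorem jetBdd_momentum {F : Type*} [NormedAddCommGroup F] [NormedSpace ℝ F] {μ : E N → F}
    (hμ : ContDiff ℝ ∞ μ) (hb : ∀ n, ∃ C, ∀ ξ, ‖iteratedFDeriv ℝ n μ ξ‖ ≤ C) (ξ : J → E N) :
    JetBdd (fun _ => 1) (fun j (δ : E N × E N) => μ (ξ j + δ.2)) := by
  have h1 : JetBdd (fun _ : J => 1) (fun j (u : E N) => μ (ξ j + u)) := by
    refine ⟨fun j => ContDiff.contDiffAt (hμ.comp (by fun_prop)), fun n => ?_⟩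
    obtain ⟨C, hC⟩ := hb n
    refine ⟨C, (norm_nonneg _).trans (hC 0), fun j => ?_⟩
    rw [iteratedFDeriv_comp_add_left]
    simpa using hC (ξ j + 0)
  exact h1.comp_right (D := 1) (fun _ => ContinuousLinearMap.snd ℝ (E N) (E N))
    (fun _ => ContinuousLinearMap.norm_snd_le ℝ (E N) (E N))

theorem Symb.mul_momentum {m : J → ℝ} {γ : ℝ} {Φ : J → E N × E N → ℝ} (h : Symb m γ Φ)
    {μ : E N → ℝ} (hμ : ContDiff ℝ ∞ μ) (hb : ∀ n, ∃ C, ∀ ξ, ‖iteratedFDeriv ℝ n μ ξ‖ ≤ C) :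
    Symb m γ (fun j p => μ p.2 * Φ j p) := by
  refine ⟨fun j => (hμ.comp contDiff_snd).mul (h.smooth j), ?_⟩
  have := (jetBdd_momentum hμ hb (fun t : J × (E N × E N) => t.2.2)).bilin
    (ContinuousLinearMap.mul ℝ ℝ) h.jets
  simpa only [one_mul, ContinuousLinearMap.mul_apply', shift] using this

end Symbols

/-! ### Localised pieces of the phase -/

section Terms

open scoped RealInnerProductSpace

variable {N : ℕ} {g V χ : E N → ℝ} {ε b : ℝ}

/-- The cut-off in the cosine, equal to `0` on `t ≤ 1/4` and to `1` on `3/8 ≤ t`. -/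
def cosCut (t : ℝ) : ℝ := Real.smoothTransition (8 * t - 2)

theorem contDiff_cosCut : ContDiff ℝ ∞ cosCut :=
  Real.smoothTransition.contDiff.comp (by fun_prop)

theorem cosCut_eq_zero {t : ℝ} (h : t ≤ 1 / 4) : cosCut t = 0 :=
  Real.smoothTransition.zero_of_nonpos (by linarith)

theorem cosCut_eq_one {t : ℝ} (h : 3 / 8 ≤ t) : cosCut t = 1 :=
  Real.smoothTransition.one_of_one_le (by linarith)

theorem cosAngle_smul {c : ℝ} (hc : 0 < c) (x w : E N) : cosAngle (c • x) w = cosAngle x w := by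
  simp only [cosAngle, dot, real_inner_smul_left, norm_smul, Real.norm_of_nonneg hc.le]
  rw [mul_assoc, mul_div_mul_left _ _ hc.ne']

theorem contDiffAt_cosAngle {y : E N × E N} (h1 : y.1 ≠ 0) (h2 : y.2 ≠ 0) :
    ContDiffAt ℝ ∞ (fun y : E N × E N => cosAngle y.1 y.2) y := by
  unfold cosAngle dot
  refine ContDiffAt.div (contDiffAt_fst.inner ℝ contDiffAt_snd)
    ((contDiffAt_fst.norm ℝ h1).mul (contDiffAt_snd.norm ℝ h2)) ?_
  exact mul_ne_zero (norm_ne_zero_iff.2 h1) (norm_ne_zero_iff.2 h2)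

/-- A piece of the phase, localised in velocity by `μ`, in direction and far out. -/
def phaseTerm (χ : E N → ℝ) (w : E N → E N) (μ : E N → ℝ) (ψ : E N × E N → ℝ) (R : ℝ)
    (p : E N × E N) : ℝ :=
  μ p.2 * (χ (R⁻¹ • p.1) * (cosCut (cosAngle p.1 (w p.2)) * ψ p))

theorem norm_gt_of_div_bracket {x : E N} (h : 1 ≤ ‖x‖) :
    (bracket x)⁻¹ • x ∈ Metric.closedBall (0 : E N) 1 ∩ {y | 1 / 2 ≤ ‖y‖} := by
  have hb := bracket_pos x
  have h1 := bracket_le x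
  have h2 := norm_le_bracket x
  rw [Set.mem_inter_iff, mem_closedBall_zero_iff, Set.mem_ofPred_eq, norm_smul, norm_inv,
    Real.norm_of_nonneg hb.le]
  constructor
  · rwa [inv_mul_le_iff₀ hb, mul_one]
  · rw [le_inv_mul_iff₀ hb]
    linarith

theorem phaseTerm_eq_zero_of_lt {w : E N → E N} {μ : E N → ℝ} {ψ : E N × E N → ℝ} {R : ℝ}
    (hχ0 : ∀ x, ‖x‖ ≤ 1 → χ x = 0) (hR : 1 ≤ R) {p : E N × E N} (hp : ‖p.1‖ ≤ R) :
    phaseTerm χ w μ ψ R p = 0 := by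
  rw [phaseTerm, hχ0, zero_mul, mul_zero]
  rw [norm_smul, Real.norm_of_nonneg (by positivity), inv_mul_le_iff₀ (by linarith)]
  linarith

theorem cosCut_eq_zero_of_inner_le {x w : E N} (h : ⟪x, w⟫ ≤ ‖x‖ * ‖w‖ / 4) :
    cosCut (cosAngle x w) = 0 := by
  refine cosCut_eq_zero ?_
  rw [cosAngle, dot]
  rcases (mul_nonneg (norm_nonneg x) (norm_nonneg w)).eq_or_lt with h0 | h0
  · rw [← h0]
    simp
  · rw [div_le_iff₀ h0]
    linarith

theorem phaseTerm_eventuallyEq_zero {w : E N → E N} (hw : Continuous w) {μ : E N → ℝ}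
    (hμ : ∀ ξ, μ ξ ≠ 0 → 2 * b ≤ ‖w ξ‖) {ψ : E N × E N → ℝ} (hχ0 : ∀ x, ‖x‖ ≤ 1 → χ x = 0)
    {R : ℝ} (hR : 1 ≤ R) {p : E N × E N}
    (hp : ¬(2 * b ≤ ‖w p.2‖ ∧ R ≤ ‖p.1‖ ∧ ‖p.1‖ * ‖w p.2‖ / 4 ≤ ⟪p.1, w p.2⟫)) :
    phaseTerm χ w μ ψ R =ᶠ[nhds p] fun _ => 0 := by
  have hc : IsClosed {p : E N × E N | 2 * b ≤ ‖w p.2‖ ∧ R ≤ ‖p.1‖ ∧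
      ‖p.1‖ * ‖w p.2‖ / 4 ≤ ⟪p.1, w p.2⟫} := by
    have h1 : IsClosed {p : E N × E N | 2 * b ≤ ‖w p.2‖} :=
      isClosed_le (by fun_prop) (by fun_prop)
    have h2 : IsClosed {p : E N × E N | R ≤ ‖p.1‖} := isClosed_le (by fun_prop) (by fun_prop)
    have h3 : IsClosed {p : E N × E N | ‖p.1‖ * ‖w p.2‖ / 4 ≤ ⟪p.1, w p.2⟫} :=
      isClosed_le (by fun_prop) (by fun_prop)
    exact h1.inter (h2.inter h3)
  filter_upwards [hc.isOpen_compl.mem_nhds hp] with y hy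
  rw [Set.mem_compl_iff, Set.mem_ofPred_eq, not_and_or, not_and_or, not_le, not_le, not_le] at hy
  rcases hy with hy | hy | hy
  · rw [phaseTerm, by_contra (fun h => (not_le.2 hy) (hμ _ h)), zero_mul]
  · exact phaseTerm_eq_zero_of_lt hχ0 hR hy.le
  · rw [phaseTerm, cosCut_eq_zero_of_inner_le hy.le, zero_mul, mul_zero, mul_zero]

/-- Only points with `‖x‖ ≥ R`, `‖v‖ ≥ 2b` and cosine at least `1 / 4` matter, and these lie in the
domain of `ψ`. The cosine is homogeneous of degree zero in `x`, so it may be taken at `x / ⟨x⟩` and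
`v`, which range over compact sets avoiding zero. All bounds are uniform in `R`. -/
theorem symb_phaseTerm (h : ScatteringHyp χ g V ε) (hb : 0 < b) {ψ : E N × E N → ℝ}
    (hψ : IsPhase g V ε b ψ) {μ : E N → ℝ} (hμs : ContDiff ℝ ∞ μ)
    (hμb : ∀ n, ∃ C, ∀ ξ, ‖iteratedFDeriv ℝ n μ ξ‖ ≤ C)
    (hμ : ∀ ξ, μ ξ ≠ 0 → 2 * b ≤ ‖gradient g ξ‖) :
    Symb (fun _ : {R : ℝ // 1 ≤ R} => 1) (1 - ε)
      (fun R => phaseTerm χ (gradient g) μ ψ (R : ℝ)) := by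
  set w := gradient g with hw
  have hws : ContDiff ℝ ∞ w := contDiff_gradient h.g_smooth
  set S : Set ({R : ℝ // 1 ≤ R} × (E N × E N)) :=
    {t | 2 * b ≤ ‖w t.2.2‖ ∧ t.1.1 ≤ ‖t.2.1‖ ∧
      ‖t.2.1‖ * ‖w t.2.2‖ / 4 ≤ ⟪t.2.1, w t.2.2⟫} with hS
  have hSΩ : ∀ t ∈ S, t.2 ∈ outRegion w b := fun t ht => by
    refine ⟨by linarith [ht.1], ?_⟩
    have h1 := ht.2.2
    have h2 := mul_nonneg (norm_nonneg t.2.1) (norm_nonneg (w t.2.2))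
    linarith
  have hjets : JetBdd (fun t : {R : ℝ // 1 ≤ R} × (E N × E N) => 1 * bracket t.2.1 ^ (1 - ε))
      (fun t δ => phaseTerm χ w μ ψ t.1 (shift t.2 δ)) := by
    refine JetBdd.of_subset S (fun t => by have := bracket_pos t.2.1; positivity) ?_ ?_
    · have j1 := jetBdd_momentum hμs hμb (fun t : S => t.1.2.2)
      have j2 := ((jetBdd_cutoff_scale h.χ_smooth h.χ_one).reindex
        (fun t : S => (t.1.1, t.1.2.1))).comp_right (D := 1)
        (fun _ => ContinuousLinearMap.fst ℝ (E N) (E N))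
        (fun _ => ContinuousLinearMap.norm_fst_le ℝ (E N) (E N))
      have j4 := hψ.jets.reindex (fun t : S => (⟨t.1.2, hSΩ t.1 t.2⟩ : outRegion w b))
      obtain ⟨M, hM⟩ := h.gradient_bdd 0
      simp only [norm_iteratedFDeriv_zero] at hM
      have j3 : JetBdd (fun _ : S => 1) (fun t (δ : E N × E N) =>
          cosCut (cosAngle ((bracket t.1.2.1)⁻¹ • t.1.2.1 + δ.1) (w (t.1.2.2 + δ.2)))) := by
        have hc1 : IsCompact (Metric.closedBall (0 : E N) 1 ∩ {y | 1 / 2 ≤ ‖y‖}) :=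
          (isCompact_closedBall 0 1).inter_right (isClosed_le (by fun_prop) (by fun_prop))
        have hc2 : IsCompact (Metric.closedBall (0 : E N) M ∩ {y | 2 * b ≤ ‖y‖}) :=
          (isCompact_closedBall 0 M).inter_right (isClosed_le (by fun_prop) (by fun_prop))
        have hn : ∀ t : S, 1 ≤ ‖t.1.2.1‖ := fun t => t.1.1.2.trans t.2.2.1
        refine JetBdd.comp_compact (K := fun y : E N × E N => cosCut (cosAngle y.1 y.2))
          (G := fun (t : S) (δ : E N × E N) =>
            ((bracket t.1.2.1)⁻¹ • t.1.2.1 + δ.1, w (t.1.2.2 + δ.2)))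
          (hc1.prod hc2) ?_ (JetBdd.prodMk (JetBdd.add (JetBdd.const fun t => ?_)
            (JetBdd.single contDiffAt_fst)) (jetBdd_momentum hws h.gradient_bdd _)) fun t => ?_
        · rintro ⟨y, u⟩ ⟨hy, hu⟩
          refine contDiff_cosCut.contDiffAt.comp _ (contDiffAt_cosAngle ?_ ?_)
          · exact norm_pos_iff.1 (by linarith [show 1 / 2 ≤ ‖y‖ from hy.2])
          · exact norm_pos_iff.1 (by linarith [show 2 * b ≤ ‖u‖ from hu.2])
        · simpa using (norm_gt_of_div_bracket (hn t)).1
        · refine ⟨?_, ?_⟩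
          · simpa only [Prod.fst_zero, add_zero] using norm_gt_of_div_bracket (hn t)
          · simp only [Prod.snd_zero, add_zero]
            exact ⟨by simpa using hM t.1.2.2, t.2.1⟩
      have j := j1.bilin (ContinuousLinearMap.mul ℝ ℝ)
        (j2.bilin (ContinuousLinearMap.mul ℝ ℝ) (j3.bilin (ContinuousLinearMap.mul ℝ ℝ) j4))
      refine (j.mono zero_le_one (m₂ := fun t : S => 1 * bracket t.1.2.1 ^ (1 - ε))
        fun t => by simp).of_eventuallyEq fun t => Filter.Eventually.of_forall fun δ => ?_
      have hbp := bracket_pos t.1.2.1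
      have e1 : t.1.2.1 + bracket t.1.2.1 • δ.1 =
          bracket t.1.2.1 • ((bracket t.1.2.1)⁻¹ • t.1.2.1 + δ.1) := by
        rw [smul_add, smul_smul, mul_inv_cancel₀ hbp.ne', one_smul]
      simp only [phaseTerm, shift, ContinuousLinearMap.mul_apply', ContinuousLinearMap.coe_fst']
      congr 3
      rw [e1, cosAngle_smul hbp]
    · intro t ht
      have := phaseTerm_eventuallyEq_zero (ψ := ψ) hws.continuous hμ h.χ_zero t.1.2 ht
      have hsh : Filter.Tendsto (shift t.2) (nhds 0) (nhds t.2) := by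
        simpa [shift_zero] using (contDiff_shift t.2).continuous.tendsto 0
      exact hsh.eventually this
  exact ⟨fun R => contDiff_iff_contDiffAt.2 fun p => contDiffAt_of_shift (hjets.smooth (R, p)),
    hjets⟩

/-- The derivatives of a symbol of order at most `-ε` that vanishes near the origin are small. -/
theorem Symb.exists_small {Φ : {R : ℝ // 1 ≤ R} → E N × E N → ℝ} (hε : 0 < ε)
    (h : Symb (fun _ => 1) (-ε) Φ) (h0 : ∀ (R : {R : ℝ // 1 ≤ R}) p, ‖p.1‖ < (R : ℝ) → Φ R p = 0) {c : ℝ} (hc : 0 < c) :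
    ∃ R₀ : ℝ, ∀ R, R₀ ≤ (R : {R : ℝ // 1 ≤ R}) → ∀ p, |Φ R p| ≤ c := by
  obtain ⟨C, hC, hb⟩ := h.le_bound
  obtain ⟨R₀, hR₀⟩ := exists_le_of_rpow_neg (N := N) hε C hc
  refine ⟨R₀, fun R hR p => ?_⟩
  rcases lt_or_ge ‖p.1‖ R with h1 | h1
  · rw [h0 R p h1, abs_zero]
    exact hc.le
  · refine (hb R p).trans ?_
    rw [one_mul]
    exact hR₀ p.1 (hR.trans h1)

end Terms

/-! ### Time reversal and dyadic gluing in velocity -/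

section Gluing

open scoped RealInnerProductSpace

variable {N : ℕ} {g V χ : E N → ℝ} {ε b : ℝ} {w : E N → E N} {μ : E N → ℝ}
  {ψ ψ' : E N × E N → ℝ} {R : ℝ}

theorem gradient_fun_neg (g : E N → ℝ) : gradient (fun ξ => -g ξ) = fun ξ => -gradient g ξ := by
  ext1 ξ
  rw [← gradCLM_fderiv, ← gradCLM_fderiv]
  simp only [fderiv_fun_neg, map_neg]

/-- The pair `(-g, -V)` generates the time-reversed flow and has the same eikonal equation, so its
outgoing theory is the incoming theory of `(g, V)`. -/
theorem ScatteringHyp.neg (h : ScatteringHyp χ g V ε) :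
    ScatteringHyp χ (fun ξ => -g ξ) (fun x => -V x) ε where
  ε_pos := h.ε_pos
  ε_lt := h.ε_lt
  χ_smooth := h.χ_smooth
  χ_zero := h.χ_zero
  χ_one := h.χ_one
  g_smooth := h.g_smooth.neg
  g_bdd n := by
    obtain ⟨C, hC⟩ := h.g_bdd n
    exact ⟨C, fun ξ => by
      rw [show (fun y => -g y) = -g from rfl, iteratedFDeriv_neg_apply, norm_neg]
      exact hC ξ⟩
  V_smooth := h.V_smooth.neg
  V_decay n := by
    obtain ⟨C, hC⟩ := h.V_decay n
    exact ⟨C, fun ξ => by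
      rw [show (fun y => -V y) = -V from rfl, iteratedFDeriv_neg_apply, norm_neg]
      exact hC ξ⟩

/-- Boundedness of all derivatives is inherited by compositions. -/
theorem exists_iteratedFDeriv_comp_le {F F' : Type*} [NormedAddCommGroup F] [NormedSpace ℝ F]
    [NormedAddCommGroup F'] [NormedSpace ℝ F'] {K : F → F'} {w : E N → F} (hK : ContDiff ℝ ∞ K)
    (hKb : ∀ n, ∃ C, ∀ y, ‖iteratedFDeriv ℝ n K y‖ ≤ C) (hw : ContDiff ℝ ∞ w)
    (hwb : ∀ n, ∃ C, ∀ ξ, ‖iteratedFDeriv ℝ n w ξ‖ ≤ C) (n : ℕ) :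
    ∃ C, ∀ ξ, ‖iteratedFDeriv ℝ n (fun ξ => K (w ξ)) ξ‖ ≤ C := by
  have h1 : JetBdd (fun _ : E N => 1) (fun ξ (u : E N) => w (ξ + u)) := by
    refine ⟨fun j => ContDiff.contDiffAt (hw.comp (by fun_prop)), fun n => ?_⟩
    obtain ⟨C, hC⟩ := hwb n
    refine ⟨C, (norm_nonneg _).trans (hC 0), fun j => ?_⟩
    rw [iteratedFDeriv_comp_add_left]
    simpa using hC (j + 0)
  obtain ⟨C, -, hC⟩ := (h1.comp (fun _ => hK.contDiffAt) fun n =>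
    (hKb n).imp fun C hC ξ => hC _).bound n
  refine ⟨C, fun ξ => ?_⟩
  have := hC ξ
  rw [iteratedFDeriv_comp_add_left (f := fun y => K (w y))] at this
  simpa using this

theorem ScatteringHyp.velocityCut_bdd (h : ScatteringHyp χ g V ε) (c : ℝ) (n : ℕ) :
    ∃ C, ∀ ξ, ‖iteratedFDeriv ℝ n (fun ξ => χ (c • gradient g ξ)) ξ‖ ≤ C := by
  refine exists_iteratedFDeriv_comp_le (K := fun y => χ (c • y))
    (h.χ_smooth.comp (by fun_prop)) (fun n => ?_) (contDiff_gradient h.g_smooth) h.gradient_bdd n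
  obtain ⟨C, hC⟩ := exists_iteratedFDeriv_cutoff_le h.χ_smooth h.χ_one n
  refine ⟨|c| ^ n * C, fun y => ?_⟩
  have := iteratedFDeriv_comp_add_smul h.χ_smooth 0 c n y
  simp only [zero_add] at this
  rw [this, norm_smul, norm_pow, Real.norm_eq_abs]
  exact mul_le_mul_of_nonneg_left (hC _) (by positivity)

theorem ScatteringHyp.contDiff_velocityCut (h : ScatteringHyp χ g V ε) (c : ℝ) :
    ContDiff ℝ ∞ fun ξ => χ (c • gradient g ξ) :=
  h.χ_smooth.comp ((contDiff_gradient h.g_smooth).const_smul c)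

/-- The dyadic cut-offs in velocity. -/
def levelCut (χ : E N → ℝ) (w : E N → E N) : ℕ → E N → ℝ
  | 0, _ => 0
  | k + 1, ξ => χ ((2 : ℝ) ^ k • w ξ)

/-- The dyadic partition of unity in velocity. -/
def levelPart (χ : E N → ℝ) (w : E N → E N) (k : ℕ) (ξ : E N) : ℝ :=
  levelCut χ w (k + 1) ξ - levelCut χ w k ξ

theorem levelPart_ne_zero (hχ0 : ∀ x, ‖x‖ ≤ 1 → χ x = 0) {k : ℕ} {ξ : E N}
    (h : levelPart χ w k ξ ≠ 0) : ((2 : ℝ) ^ k)⁻¹ ≤ ‖w ξ‖ := by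
  by_contra! hlt
  refine h ?_
  have h1 : ∀ j, j ≤ k → ‖(2 : ℝ) ^ j • w ξ‖ ≤ 1 := fun j hj => by
    rw [norm_smul, Real.norm_of_nonneg (by positivity)]
    calc (2 : ℝ) ^ j * ‖w ξ‖ ≤ 2 ^ k * (2 ^ k)⁻¹ :=
          mul_le_mul (pow_le_pow_right₀ one_le_two hj) hlt.le (norm_nonneg _) (by positivity)
      _ = 1 := mul_inv_cancel₀ (by positivity)
  rw [levelPart, levelCut, hχ0 _ (h1 k le_rfl)]
  cases k with
  | zero => simp [levelCut]
  | succ k => rw [levelCut, hχ0 _ (h1 k (by omega)), sub_zero]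

theorem levelCut_eq_one (hχ1 : ∀ x, 2 ≤ ‖x‖ → χ x = 1) {n k : ℕ} {ξ : E N}
    (h : 4 ≤ 2 ^ n * ‖w ξ‖) (hn : 1 ≤ n) (hk : n ≤ k) : levelCut χ w k ξ = 1 := by
  obtain ⟨j, rfl⟩ : ∃ j, k = j + 1 := ⟨k - 1, by omega⟩
  rw [levelCut, hχ1]
  rw [norm_smul, Real.norm_of_nonneg (by positivity)]
  have h1 : (2 : ℝ) ^ n ≤ 2 ^ (j + 1) := pow_le_pow_right₀ one_le_two hk
  have h2 := mul_le_mul_of_nonneg_right h1 (norm_nonneg (w ξ))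
  rw [pow_succ] at h2
  linarith

theorem levelPart_eq_zero (hχ1 : ∀ x, 2 ≤ ‖x‖ → χ x = 1) {n k : ℕ} {ξ : E N}
    (h : 4 ≤ 2 ^ n * ‖w ξ‖) (hn : 1 ≤ n) (hk : n ≤ k) : levelPart χ w k ξ = 0 := by
  rw [levelPart, levelCut_eq_one hχ1 h hn hk, levelCut_eq_one hχ1 h hn (by omega), sub_self]

theorem sum_levelPart (hχ1 : ∀ x, 2 ≤ ‖x‖ → χ x = 1) {n : ℕ} {ξ : E N}
    (h : 4 ≤ 2 ^ n * ‖w ξ‖) (hn : 1 ≤ n) : ∑ k ∈ Finset.range n, levelPart χ w k ξ = 1 := by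
  simp only [levelPart]
  rw [Finset.sum_range_sub fun k => levelCut χ w k ξ, levelCut_eq_one hχ1 h hn le_rfl]
  simp [levelCut]

theorem levelPart_add {ζ : E N} (h : ∀ ξ, w (ξ + ζ) = w ξ) (k : ℕ) (ξ : E N) :
    levelPart χ w k (ξ + ζ) = levelPart χ w k ξ := by
  cases k <;> simp [levelPart, levelCut, h]

theorem ScatteringHyp.levelCut_smooth (h : ScatteringHyp χ g V ε) (k : ℕ) :
    ContDiff ℝ ∞ (levelCut χ (gradient g) k) ∧
      ∀ n, ∃ C, ∀ ξ, ‖iteratedFDeriv ℝ n (levelCut χ (gradient g) k) ξ‖ ≤ C := by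
  cases k with
  | zero => exact ⟨contDiff_const, fun n => ⟨0, fun ξ => by
      rw [show levelCut χ (gradient g) 0 = fun _ => 0 from rfl, iteratedFDeriv_fun_zero]; simp⟩⟩
  | succ k => exact ⟨h.contDiff_velocityCut _, h.velocityCut_bdd _⟩

theorem ScatteringHyp.levelPart_smooth (h : ScatteringHyp χ g V ε) (k : ℕ) :
    ContDiff ℝ ∞ (levelPart χ (gradient g) k) ∧
      ∀ n, ∃ C, ∀ ξ, ‖iteratedFDeriv ℝ n (levelPart χ (gradient g) k) ξ‖ ≤ C := by
  obtain ⟨h1, h2⟩ := h.levelCut_smooth k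
  obtain ⟨h3, h4⟩ := h.levelCut_smooth (k + 1)
  refine ⟨h3.sub h1, fun n => ?_⟩
  obtain ⟨C, hC⟩ := h2 n
  obtain ⟨C', hC'⟩ := h4 n
  refine ⟨C' + C, fun ξ => ?_⟩
  rw [show levelPart χ (gradient g) k =
    levelCut χ (gradient g) (k + 1) - levelCut χ (gradient g) k from rfl,
    iteratedFDeriv_sub_apply (h3.of_le (by exact_mod_cast le_top)).contDiffAt
      (h1.of_le (by exact_mod_cast le_top)).contDiffAt]
  exact (norm_sub_le _ _).trans (add_le_add (hC' ξ) (hC ξ))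

/-- A piece of the correction of the phase, with its outgoing and its incoming part. -/
def phasePiece (χ : E N → ℝ) (w : E N → E N) (μ : E N → ℝ) (ψ ψ' : E N × E N → ℝ) (R : ℝ)
    (p : E N × E N) : ℝ :=
  phaseTerm χ w μ ψ R p + phaseTerm χ (fun ξ => -w ξ) μ ψ' R p

/-- Time reversal exchanges the outgoing and incoming parts; it transfers the eikonal equation from
the outgoing to the incoming region. -/
theorem phasePiece_swap (p : E N × E N) :
    phasePiece χ (fun ξ => -w ξ) μ ψ' ψ R p = phasePiece χ w μ ψ ψ' R p := by
  simp only [phasePiece, neg_neg]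
  rw [add_comm]

theorem phasePiece_of_zero {p : E N × E N} (h : μ p.2 = 0) : phasePiece χ w μ ψ ψ' R p = 0 := by
  simp [phasePiece, phaseTerm, h]

theorem cosAngle_neg (x u : E N) : cosAngle x (-u) = -cosAngle x u := by
  simp [cosAngle, dot, neg_div]

theorem inner_pos_of_cosAngle {x u : E N} (h : 0 < cosAngle x u) : 0 < ⟪x, u⟫ := by
  by_contra! hle
  have := div_nonpos_of_nonpos_of_nonneg hle (mul_nonneg (norm_nonneg x) (norm_nonneg u))
  rw [cosAngle, dot] at h
  linarith

theorem phasePiece_eventuallyEq (hχ1 : ∀ x, 2 ≤ ‖x‖ → χ x = 1) (hR : 1 ≤ R) {p : E N × E N}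
    (hx : 2 * R < ‖p.1‖) (hcos : 3 / 8 < cosAngle p.1 (w p.2)) :
    (fun y => phasePiece χ w μ ψ ψ' R (y, p.2)) =ᶠ[nhds p.1] fun y => μ p.2 * ψ (y, p.2) := by
  have hx0 : p.1 ≠ 0 := norm_pos_iff.1 (by linarith)
  have hw0 : w p.2 ≠ 0 := by
    rintro h0
    rw [h0] at hcos
    simp [cosAngle, dot] at hcos
    linarith
  have hc : ContinuousAt (fun y => cosAngle y (w p.2)) p.1 := by
    have := (contDiffAt_cosAngle (y := (p.1, w p.2)) hx0 hw0).continuousAt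
    exact ContinuousAt.comp (f := fun y : E N => (y, w p.2)) (x := p.1) this (by fun_prop)
  filter_upwards [hc.eventually (lt_mem_nhds hcos),
    (isOpen_lt continuous_const continuous_norm).mem_nhds hx] with y hy hy2
  rw [phasePiece, phaseTerm, phaseTerm, cosCut_eq_one hy.le, cosAngle_neg,
    cosCut_eq_zero (by linarith), hχ1]
  · ring
  · rw [norm_smul, Real.norm_of_nonneg (by positivity), le_inv_mul_iff₀ (by linarith)]
    linarith [show 2 * R < ‖y‖ from hy2]

theorem phaseTerm_periodic {ζ : E N} (hζ : ∀ ξ, w (ξ + ζ) = w ξ)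
    (hμζ : ∀ ξ, μ (ξ + ζ) = μ ξ) (hb : 0 < b) (hμ : ∀ ξ, μ ξ ≠ 0 → 2 * b ≤ ‖w ξ‖)
    (hψ : ∀ p ∈ outRegion w b, ψ (p.1, p.2 + ζ) = ψ p) (p : E N × E N) :
    phaseTerm χ w μ ψ R (p.1, p.2 + ζ) = phaseTerm χ w μ ψ R p := by
  simp only [phaseTerm, hζ, hμζ]
  by_cases h1 : μ p.2 = 0
  · simp [h1]
  by_cases h2 : ⟪p.1, w p.2⟫ ≤ ‖p.1‖ * ‖w p.2‖ / 4
  · simp [cosCut_eq_zero_of_inner_le h2]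
  · rw [hψ p ⟨by linarith [hμ _ h1], ?_⟩]
    have := mul_nonneg (norm_nonneg p.1) (norm_nonneg (w p.2))
    linarith

theorem dX_eq_fderiv {Φ : E N × E N → ℝ} (h : ContDiff ℝ ∞ Φ) (a : E N) (p : E N × E N) :
    dX a Φ p = fderiv ℝ (fun y => Φ (y, p.2)) p.1 a := by
  have h1 := ((h.differentiable (by simp)) p).hasFDerivAt.comp (f := fun x : E N => (x, p.2)) p.1
    (hasFDerivAt_prodMk_left p.1 p.2)
  rw [show (fun x => Φ (x, p.2)) = Φ ∘ fun x => (x, p.2) from rfl, h1.fderiv]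
  simp [dX]

theorem dX_mul_momentum {Φ : E N × E N → ℝ} (h : ContDiff ℝ ∞ Φ) (hμ : ContDiff ℝ ∞ μ) (a : E N)
    (p : E N × E N) : dX a (fun p => μ p.2 * Φ p) p = μ p.2 * dX a Φ p := by
  have h1 := (((hμ.differentiable (by simp)) p.2).hasFDerivAt.comp (f := Prod.snd) p
    hasFDerivAt_snd).mul ((h.differentiable (by simp)) p).hasFDerivAt
  simp only [dX]
  rw [show (fun p : E N × E N => μ p.2 * Φ p) = (μ ∘ Prod.snd) * Φ from rfl, h1.fderiv]
  simp

theorem dXi_mul_momentum {Φ : E N × E N → ℝ} (h : ContDiff ℝ ∞ Φ) (hμ : ContDiff ℝ ∞ μ) (a : E N)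
    (p : E N × E N) :
    dXi a (fun p => μ p.2 * Φ p) p = fderiv ℝ μ p.2 a * Φ p + μ p.2 * dXi a Φ p := by
  have h1 := (((hμ.differentiable (by simp)) p.2).hasFDerivAt.comp (f := Prod.snd) p
    hasFDerivAt_snd).mul ((h.differentiable (by simp)) p).hasFDerivAt
  simp only [dXi]
  rw [show (fun p : E N × E N => μ p.2 * Φ p) = (μ ∘ Prod.snd) * Φ from rfl, h1.fderiv]
  simp
  ring

/-- Each piece exists with derivatives as small as one likes. -/
theorem ScatteringHyp.exists_piece (h : ScatteringHyp χ g V ε) (k : ℕ) {c : ℝ} (hc : 0 < c) :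
    ∃ (ψ ψ' : E N × E N → ℝ) (R : ℝ), 1 ≤ R ∧
      IsPhase g V ε ((2 : ℝ) ^ (k + 1))⁻¹ ψ ∧
      IsPhase (fun ξ => -g ξ) (fun x => -V x) ε ((2 : ℝ) ^ (k + 1))⁻¹ ψ' ∧
      Symb (fun _ : Unit => 1) (1 - ε)
        (fun _ => phasePiece χ (gradient g) (levelPart χ (gradient g) k) ψ ψ' R) ∧
      ∀ p i j, |dX (EuclideanSpace.single i 1)
          (phasePiece χ (gradient g) (levelPart χ (gradient g) k) ψ ψ' R) p| ≤ c ∧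
        |dX (EuclideanSpace.single i 1) (dXi (EuclideanSpace.single j 1)
          (phasePiece χ (gradient g) (levelPart χ (gradient g) k) ψ ψ' R)) p| ≤ c := by
  have hb : (0 : ℝ) < ((2 : ℝ) ^ (k + 1))⁻¹ := by positivity
  have hb1 : ((2 : ℝ) ^ (k + 1))⁻¹ ≤ 1 := inv_le_one_of_one_le₀ (one_le_pow₀ one_le_two)
  obtain ⟨ψ, hψ⟩ := h.exists_isPhase hb hb1
  obtain ⟨ψ', hψ'⟩ := h.neg.exists_isPhase hb hb1
  obtain ⟨hμ1, hμ2⟩ := h.levelPart_smooth k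
  set μ := levelPart χ (gradient g) k with hμdef
  have hμ : ∀ ξ, μ ξ ≠ 0 → 2 * ((2 : ℝ) ^ (k + 1))⁻¹ ≤ ‖gradient g ξ‖ := fun ξ hξ => by
    refine le_of_eq_of_le ?_ (levelPart_ne_zero h.χ_zero hξ)
    rw [pow_succ]
    field_simp
  have s1 := symb_phaseTerm h hb hψ hμ1 hμ2 hμ
  have s2 := symb_phaseTerm h.neg hb hψ' hμ1 hμ2 (by
    intro ξ hξ
    rw [gradient_fun_neg, norm_neg]
    exact hμ ξ hξ)
  rw [gradient_fun_neg] at s2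
  have s : Symb (fun _ : {R : ℝ // 1 ≤ R} => 1) (1 - ε)
    (fun R => phasePiece χ (gradient g) μ ψ ψ' R) := s1.add s2
  have hz : ∀ (R : {R : ℝ // 1 ≤ R}) (p : E N × E N), ‖p.1‖ < (R : ℝ) →
      phasePiece χ (gradient g) μ ψ ψ' R =ᶠ[nhds p] fun _ => 0 := fun R p hp => by
    have ho : IsOpen {p : E N × E N | ‖p.1‖ < (R : ℝ)} := isOpen_lt (by fun_prop) (by fun_prop)
    filter_upwards [ho.mem_nhds hp] with y hy
    rw [phasePiece, phaseTerm_eq_zero_of_lt h.χ_zero R.2 (le_of_lt hy),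
      phaseTerm_eq_zero_of_lt h.χ_zero R.2 (le_of_lt hy), add_zero]
  have hdz : ∀ {Φ : E N × E N → ℝ} {p : E N × E N}, Φ =ᶠ[nhds p] (fun _ => 0) →
      ∀ u, (fun q => fderiv ℝ Φ q u) =ᶠ[nhds p] fun _ => 0 := fun hΦ u => by
    filter_upwards [hΦ.fderiv (𝕜 := ℝ)] with y hy
    rw [hy]
    simp
  have hd1 : ∀ i : Fin N, ∃ R₀ : ℝ, ∀ R, R₀ ≤ (R : {R : ℝ // 1 ≤ R}) → ∀ p,
      |dX (EuclideanSpace.single i 1) (phasePiece χ (gradient g) μ ψ ψ' R) p| ≤ c := fun i => by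
    refine Symb.exists_small h.ε_pos ?_ (fun R p hp => (hdz (hz R p hp) _).eq_of_nhds) hc
    have := s.dX (EuclideanSpace.single i 1)
    rwa [show 1 - ε - 1 = -ε by ring] at this
  have hd2 : ∀ i j : Fin N, ∃ R₀ : ℝ, ∀ R, R₀ ≤ (R : {R : ℝ // 1 ≤ R}) → ∀ p,
      |dX (EuclideanSpace.single i 1) (dXi (EuclideanSpace.single j 1)
        (phasePiece χ (gradient g) μ ψ ψ' R)) p| ≤ c := fun i j => by
    refine Symb.exists_small h.ε_pos ?_
      (fun R p hp => (hdz (hdz (hz R p hp) _) _).eq_of_nhds) hc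
    have := (s.dXi (EuclideanSpace.single j 1)).dX (EuclideanSpace.single i 1)
    rwa [show 1 - ε - 1 = -ε by ring] at this
  choose R₁ hR₁ using hd1
  choose R₂ hR₂ using hd2
  -- There are finitely many directional thresholds, and this sum dominates each of them.
  set R : ℝ := 1 + ∑ i, |R₁ i| + ∑ i, ∑ j, |R₂ i j| with hRdef
  have n1 : 0 ≤ ∑ i, |R₁ i| := Finset.sum_nonneg fun i _ => abs_nonneg _
  have n2 : 0 ≤ ∑ i, ∑ j, |R₂ i j| :=
    Finset.sum_nonneg fun i _ => Finset.sum_nonneg fun j _ => abs_nonneg _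
  have hR : 1 ≤ R := by linarith
  refine ⟨ψ, ψ', R, hR, hψ, hψ', s.reindex (fun _ : Unit => ⟨R, hR⟩), fun p i j =>
    ⟨hR₁ i ⟨R, hR⟩ ?_ p, hR₂ i j ⟨R, hR⟩ ?_ p⟩⟩
  · have := Finset.single_le_sum (f := fun i => |R₁ i|) (fun _ _ => abs_nonneg _)
      (Finset.mem_univ i)
    have h2 := le_abs_self (R₁ i)
    show R₁ i ≤ R
    linarith
  · have h3 := Finset.single_le_sum (f := fun j => |R₂ i j|) (fun _ _ => abs_nonneg _)
      (Finset.mem_univ j)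
    have h4 := Finset.single_le_sum (f := fun i => ∑ j, |R₂ i j|)
      (fun _ _ => Finset.sum_nonneg fun j _ => abs_nonneg _) (Finset.mem_univ i)
    have h2 := le_abs_self (R₂ i j)
    show R₂ i j ≤ R
    linarith

/-- The eikonal equation of a locally finite sum of pieces in the outgoing region. -/
theorem ScatteringHyp.eikonal_sum (h : ScatteringHyp χ g V ε) {μ : ℕ → E N → ℝ}
    {ψ ψ' : ℕ → E N × E N → ℝ} {R : ℕ → ℝ} (hR : ∀ k, 1 ≤ R k)
    (hψ : ∀ k, IsPhase g V ε ((2 : ℝ) ^ (k + 1))⁻¹ (ψ k))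
    (hμ : ∀ k ξ, μ k ξ ≠ 0 → ((2 : ℝ) ^ k)⁻¹ ≤ ‖gradient g ξ‖) {n : ℕ} :
    ∃ R₀ : ℝ, ∀ p : E N × E N, R₀ ≤ ‖p.1‖ → 4 ≤ 2 ^ n * ‖gradient g p.2‖ →
      ∑ k ∈ Finset.range n, μ k p.2 = 1 → 3 / 8 < cosAngle p.1 (gradient g p.2) →
      g (p.2 + gradient (fun y => ∑ k ∈ Finset.range n,
        phasePiece χ (gradient g) (μ k) (ψ k) (ψ' k) (R k) (y, p.2)) p.1) + V p.1 = g p.2 := by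
  have hws : ContDiff ℝ ∞ (gradient g) := contDiff_gradient h.g_smooth
  have hb : ∀ k : ℕ, (0 : ℝ) < ((2 : ℝ) ^ (k + 1))⁻¹ := fun k => by positivity
  have hb1 : ∀ k : ℕ, ((2 : ℝ) ^ (k + 1))⁻¹ ≤ 1 := fun k =>
    inv_le_one_of_one_le₀ (one_le_pow₀ one_le_two)
  -- Every piece is compared with the `n`-th one, whose region admits the smallest velocities among
  -- those that occur. All active pieces then have the gradient `q` of `ψ n`, and the partition of
  -- unity sums them to `q`.
  have hgr := fun k => h.gradient_eq (hb k) (hb1 k) (hψ k) (hψ n)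
  choose R₁ hR₁ using hgr
  obtain ⟨R₂, hR₂⟩ := (hψ n).eikonal
  refine ⟨|R₂| + ∑ k ∈ Finset.range n, (|R₁ k| + 2 * R k + 1), fun p hx hv hsum hcos => ?_⟩
  have hterm : ∀ k, 0 ≤ |R₁ k| + 2 * R k + 1 := fun k => by
    have := hR k
    positivity
  have hn0 : 0 ≤ ∑ k ∈ Finset.range n, (|R₁ k| + 2 * R k + 1) :=
    Finset.sum_nonneg fun k _ => hterm k
  have hxk : ∀ k ∈ Finset.range n, R₁ k ≤ ‖p.1‖ ∧ 2 * R k < ‖p.1‖ := fun k hk => by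
    have h1 := Finset.single_le_sum (f := fun k => |R₁ k| + 2 * R k + 1) (fun k _ => hterm k) hk
    have h2 := le_abs_self (R₁ k)
    have h3 := hR k
    have h4 := abs_nonneg R₂
    have h5 := abs_nonneg (R₁ k)
    constructor <;> linarith
  have hin := inner_pos_of_cosAngle (lt_trans (by norm_num) hcos)
  have hmem : ∀ k : ℕ, ((2 : ℝ) ^ k)⁻¹ ≤ ‖gradient g p.2‖ →
      p ∈ outRegion (gradient g) ((2 : ℝ) ^ (k + 1))⁻¹ := fun k hk => by
    refine ⟨lt_of_lt_of_le ?_ hk, by linarith [hb k]⟩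
    exact inv_strictAnti₀ (by positivity) (pow_lt_pow_right₀ one_lt_two (Nat.lt_succ_self k))
  have hpn : p ∈ outRegion (gradient g) ((2 : ℝ) ^ (n + 1))⁻¹ := by
    refine hmem n ?_
    rw [inv_le_iff_one_le_mul₀' (by positivity)]
    linarith
  have hdiff : ∀ k, p ∈ outRegion (gradient g) ((2 : ℝ) ^ (k + 1))⁻¹ →
      DifferentiableAt ℝ (fun y => ψ k (y, p.2)) p.1 := fun k hk => by
    have := ((hψ k).smooth.contDiffAt
      ((isOpen_outRegion hws.continuous).mem_nhds hk)).differentiableAt (by simp)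
    exact DifferentiableAt.comp (f := fun y : E N => (y, p.2)) p.1 this (by fun_prop)
  set q := gradient (fun y => ψ n (y, p.2)) p.1 with hq
  have hk : ∀ k ∈ Finset.range n, HasFDerivAt
      (fun y => phasePiece χ (gradient g) (μ k) (ψ k) (ψ' k) (R k) (y, p.2))
      (μ k p.2 • innerSL ℝ q) p.1 := by
    intro k hk
    obtain ⟨hk1, hk2⟩ := hxk k hk
    by_cases h0 : μ k p.2 = 0
    · rw [h0, zero_smul]
      refine (hasFDerivAt_const (0 : ℝ) p.1).congr_of_eventuallyEq
        (Filter.Eventually.of_forall fun y => ?_)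
      exact phasePiece_of_zero h0
    · have hpk := hmem k (hμ k p.2 h0)
      have hg1 := (hdiff k hpk).hasGradientAt
      rw [hR₁ k p hpk hpn hk1] at hg1
      have := hg1.hasFDerivAt.const_mul (μ k p.2)
      exact this.congr_of_eventuallyEq (phasePiece_eventuallyEq h.χ_one (hR k) hk2 hcos)
  have hs := HasFDerivAt.fun_sum hk
  rw [← Finset.sum_smul, hsum, one_smul] at hs
  have hgs : HasGradientAt (fun y => ∑ k ∈ Finset.range n,
      phasePiece χ (gradient g) (μ k) (ψ k) (ψ' k) (R k) (y, p.2)) q p.1 := hs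
  rw [hgs.gradient]
  exact hR₂ p hpn (by linarith [le_abs_self R₂])

/-- A correction `G` of the free phase `x · ξ`, such that the sum solves the eikonal equation in
the outgoing and the incoming regions. -/
structure IsCorrection (χ g V : E N → ℝ) (ε c : ℝ) (G : E N × E N → ℝ) : Prop where
  smooth : ContDiffOn ℝ ∞ G {p | gradient g p.2 ≠ 0}
  periodic : ∀ ζ, (∀ ξ, gradient g (ξ + ζ) = gradient g ξ) → ∀ p, G (p.1, p.2 + ζ) = G p
  symb : ∀ a : ℝ, 0 < a → Symb (fun _ : Unit => 1) (1 - ε)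
    (fun _ p => χ (a⁻¹ • gradient g p.2) * G p)
  eikonal : ∀ a : ℝ, 0 < a → ∃ R : ℝ, ∀ p : E N × E N, R ≤ ‖p.1‖ → a ≤ ‖gradient g p.2‖ →
    3 / 8 < |cosAngle p.1 (gradient g p.2)| →
    g (p.2 + gradient (fun y => G (y, p.2)) p.1) + V p.1 = g p.2
  small : ∀ a : ℝ, 0 < a → ∀ p i j, |dX (EuclideanSpace.single i 1) (dXi (EuclideanSpace.single j 1)
    (fun p => χ (a⁻¹ • gradient g p.2) * G p)) p| ≤ c

/-- The sum over dyadic levels is locally finite where `v ≠ 0`, and only finitely many levels meet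
the support of `χ(v / a)`. The delicate point is smallness uniform in `a`: differentiating `χ(v /
a)` costs `a⁻¹`, and on level `k` this happens only where `2 ^ (-k) ≤ ‖v‖ ≤ 2a`, so the cost is of
order `2 ^ k`. -/
theorem ScatteringHyp.exists_isCorrection (h : ScatteringHyp χ g V ε) {c : ℝ} (hc : 0 < c) :
    ∃ G, IsCorrection χ g V ε c G := by
  set w := gradient g with hw
  have hws : ContDiff ℝ ∞ w := contDiff_gradient h.g_smooth
  obtain ⟨C₀, hC₀⟩ := exists_iteratedFDeriv_cutoff_le h.χ_smooth h.χ_one 0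
  obtain ⟨C₁, hC₁⟩ := exists_iteratedFDeriv_cutoff_le h.χ_smooth h.χ_one 1
  obtain ⟨M, hM⟩ := h.gradient_bdd 1
  simp only [norm_iteratedFDeriv_zero, norm_iteratedFDeriv_one] at hC₀ hC₁ hM
  have hC₀0 : 0 ≤ C₀ := (norm_nonneg _).trans (hC₀ 0)
  have hC₁0 : 0 ≤ C₁ := (norm_nonneg _).trans (hC₁ 0)
  have hM0 : 0 ≤ M := (norm_nonneg _).trans (hM 0)
  -- Level `k` is made as small as `(c / D) 4 ^ (-k)`. One factor `2 ^ (-k)` pays for the derivative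
  -- of the velocity cut-off, the other sums to at most `2`, and `D` makes the total at most `c`.
  set D : ℝ := 2 * (2 * C₁ * M + C₀) + 1 with hD
  have hD0 : 0 < D := by positivity
  have hck : ∀ k : ℕ, 0 < c / D * (1 / 4) ^ k := fun k => by positivity
  choose ψ ψ' R hR hψ hψ' hsymb hsmall using fun k => h.exists_piece k (hck k)
  set μ := levelPart χ w with hμ
  set P : ℕ → E N × E N → ℝ := fun k => phasePiece χ w (μ k) (ψ k) (ψ' k) (R k) with hP
  have hPs : ∀ k, ContDiff ℝ ∞ (P k) := fun k => (hsymb k).smooth ()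
  have hsum : ∀ {n : ℕ} {p : E N × E N}, 1 ≤ n → 4 ≤ 2 ^ n * ‖w p.2‖ →
      ∑' k, P k p = ∑ k ∈ Finset.range n, P k p := fun {n p} hn hp =>
    tsum_eq_sum fun k hk => phasePiece_of_zero
      (levelPart_eq_zero h.χ_one hp hn (by simpa using hk))
  have hlevel : ∀ a : ℝ, 0 < a → ∃ n : ℕ, 1 ≤ n ∧ 4 ≤ 2 ^ n * a := fun a ha => by
    obtain ⟨n, hn⟩ := pow_unbounded_of_one_lt (4 / a) (one_lt_two (α := ℝ))
    refine ⟨n + 1, by omega, ?_⟩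
    rw [div_lt_iff₀ ha] at hn
    have : (2 : ℝ) ^ n * a ≤ 2 ^ (n + 1) * a :=
      mul_le_mul_of_nonneg_right (pow_le_pow_right₀ one_le_two (by omega)) ha.le
    linarith
  have hcut : ∀ {a : ℝ} {n : ℕ}, 0 < a → 1 ≤ n → 4 ≤ 2 ^ n * a →
      (fun p : E N × E N => χ (a⁻¹ • w p.2) * ∑' k, P k p) =
        fun p => ∑ k ∈ Finset.range n, χ (a⁻¹ • w p.2) * P k p := by
    intro a n ha hn hna
    ext1 p
    rcases le_or_gt ‖w p.2‖ a with hp | hp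
    · have : χ (a⁻¹ • w p.2) = 0 := h.χ_zero _ (by
        rw [norm_smul, Real.norm_of_nonneg (by positivity), inv_mul_le_iff₀ ha]
        linarith)
      simp [this]
    · rw [hsum hn (hna.trans (mul_le_mul_of_nonneg_left hp.le (by positivity))), Finset.mul_sum]
  refine ⟨fun p => ∑' k, P k p, ?_, ?_, ?_, ?_, ?_⟩
  · intro p hp
    have hp0 : 0 < ‖w p.2‖ := norm_pos_iff.2 hp
    obtain ⟨n, hn, hna⟩ := hlevel (‖w p.2‖ / 2) (by linarith)
    have ho : IsOpen {p' : E N × E N | ‖w p.2‖ / 2 < ‖w p'.2‖} :=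
      isOpen_lt (by fun_prop) (by have := hws.continuous; fun_prop)
    refine ContDiffAt.contDiffWithinAt (ContDiffAt.congr_of_eventuallyEq
      (f := fun p => ∑ k ∈ Finset.range n, P k p)
      (ContDiff.contDiffAt (ContDiff.sum fun k _ => hPs k)) ?_)
    filter_upwards [ho.mem_nhds (show ‖w p.2‖ / 2 < ‖w p.2‖ by linarith)] with y hy
    exact hsum hn (hna.trans (mul_le_mul_of_nonneg_left (le_of_lt hy) (by positivity)))
  · intro ζ hζ p
    refine tsum_congr fun k => ?_
    have hb : (0 : ℝ) < ((2 : ℝ) ^ (k + 1))⁻¹ := by positivity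
    have hμk : ∀ ξ, μ k ξ ≠ 0 → 2 * ((2 : ℝ) ^ (k + 1))⁻¹ ≤ ‖w ξ‖ := fun ξ hξ => by
      refine le_of_eq_of_le ?_ (levelPart_ne_zero h.χ_zero hξ)
      rw [pow_succ]
      field_simp
    refine congrArg₂ (· + ·) ?_ ?_
    · exact phaseTerm_periodic hζ (levelPart_add hζ k) hb hμk
        (fun p hp => (hψ k).periodic p hp ζ hζ) p
    · refine phaseTerm_periodic (w := fun ξ => -w ξ) (fun ξ => neg_inj.2 (hζ ξ)) (levelPart_add hζ k) hb
        (fun ξ hξ => by rw [norm_neg]; exact hμk ξ hξ) (fun p hp => ?_) p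
      refine (hψ' k).periodic p (by rw [gradient_fun_neg]; exact hp) ζ fun ξ => ?_
      rw [gradient_fun_neg]
      exact congrArg _ (hζ ξ)
  · intro a ha
    obtain ⟨n, hn, hna⟩ := hlevel a ha
    rw [hcut ha hn hna]
    refine Symb.sum (Φ := fun k _ p => χ (a⁻¹ • w p.2) * P k p) _ (fun _ => zero_le_one)
      fun k _ => ?_
    exact (hsymb k).mul_momentum (h.contDiff_velocityCut _) (h.velocityCut_bdd _)
  · intro a ha
    obtain ⟨n, hn, hna⟩ := hlevel a ha
    obtain ⟨R₁, hR₁⟩ := h.eikonal_sum (ψ' := ψ') (n := n) hR hψ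
      (fun k ξ hξ => levelPart_ne_zero h.χ_zero hξ)
    -- The incoming case is the outgoing case of the negated data, with the roles of `ψ` and `ψ'`
    -- exchanged.
    obtain ⟨R₂, hR₂⟩ := h.neg.eikonal_sum (μ := μ) (ψ' := ψ) (n := n) hR hψ' (by
      intro k ξ hξ
      rw [gradient_fun_neg, norm_neg]
      exact levelPart_ne_zero h.χ_zero hξ)
    rw [gradient_fun_neg] at hR₂
    refine ⟨max R₁ R₂, fun p hx hv hcos => ?_⟩
    have hv' : 4 ≤ 2 ^ n * ‖w p.2‖ := hna.trans (mul_le_mul_of_nonneg_left hv (by positivity))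
    have hone := sum_levelPart h.χ_one hv' hn
    have he : (fun y => ∑' k, P k (y, p.2)) = fun y => ∑ k ∈ Finset.range n, P k (y, p.2) := by
      ext1 y
      exact hsum hn hv'
    rw [he]
    rcases lt_abs.1 hcos with hcos | hcos
    · exact hR₁ p ((le_max_left _ _).trans hx) hv' hone hcos
    · have := hR₂ p ((le_max_right _ _).trans hx) (by simpa using hv') hone
        (by rw [cosAngle_neg]; exact hcos)
      simp only [phasePiece_swap] at this
      linarith
  · intro a ha p i j
    obtain ⟨n, hn, hna⟩ := hlevel a ha
    rw [hcut ha hn hna]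
    set χa : E N → ℝ := fun ξ => χ (a⁻¹ • w ξ) with hχa
    have hχas : ContDiff ℝ ∞ χa := h.contDiff_velocityCut _
    set ei : E N := EuclideanSpace.single i 1
    set ej : E N := EuclideanSpace.single j 1 with hej
    have hnj : ‖ej‖ = 1 := by simp [hej]
    have hdχ : ContDiff ℝ ∞ fun ξ => fderiv ℝ χa ξ ej :=
      (hχas.fderiv_right (m := ∞) (by simp)).clm_apply contDiff_const
    have e1 : dXi ej (fun p : E N × E N => ∑ k ∈ Finset.range n, χ (a⁻¹ • w p.2) * P k p) =
        fun p => ∑ k ∈ Finset.range n, (fderiv ℝ χa p.2 ej * P k p + χa p.2 * dXi ej (P k) p) := by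
      ext1 p
      have d0 : ∀ k, DifferentiableAt ℝ (fun p : E N × E N => χ (a⁻¹ • w p.2) * P k p) p :=
        fun k => ((hχas.comp contDiff_snd).mul (hPs k)).differentiable (by simp) p
      rw [dXi, fderiv_fun_sum fun k _ => d0 k, sum_apply]
      exact Finset.sum_congr rfl fun k _ => dXi_mul_momentum (hPs k) hχas ej p
    have e2 : dX ei (fun p => ∑ k ∈ Finset.range n,
        (fderiv ℝ χa p.2 ej * P k p + χa p.2 * dXi ej (P k) p)) p =
        ∑ k ∈ Finset.range n, (fderiv ℝ χa p.2 ej * dX ei (P k) p +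
          χa p.2 * dX ei (dXi ej (P k)) p) := by
      have d1 : ∀ k, DifferentiableAt ℝ (fun p : E N × E N => fderiv ℝ χa p.2 ej * P k p) p :=
        fun k => ((hdχ.comp contDiff_snd).mul (hPs k)).differentiable (by simp) p
      have d2 : ∀ k, DifferentiableAt ℝ (fun p : E N × E N => χa p.2 * dXi ej (P k) p) p :=
        fun k => ((hχas.comp contDiff_snd).mul (contDiff_dXi (hPs k) ej)).differentiable (by simp) p
      rw [dX, fderiv_fun_sum fun k _ => (d1 k).fun_add (d2 k), sum_apply]
      refine Finset.sum_congr rfl fun k _ => ?_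
      rw [fderiv_fun_add (d1 k) (d2 k), add_apply]
      exact congrArg₂ (· + ·) (dX_mul_momentum (hPs k) hdχ ei p)
        (dX_mul_momentum (contDiff_dXi (hPs k) ej) hχas ei p)
    rw [e1, e2]
    have hdχ1 : |fderiv ℝ χa p.2 ej| ≤ C₁ * (a⁻¹ * M) := by
      have d : HasFDerivAt χa ((fderiv ℝ χ (a⁻¹ • w p.2)).comp (a⁻¹ • fderiv ℝ w p.2)) p.2 :=
        (h.χ_smooth.differentiable (by simp) _).hasFDerivAt.comp p.2
          ((hws.differentiable (by simp) p.2).hasFDerivAt.fun_const_smul a⁻¹)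
      rw [d.fderiv, ← Real.norm_eq_abs]
      refine (ContinuousLinearMap.le_of_opNorm_le _ (c := C₁ * (a⁻¹ * M)) ?_ ej).trans_eq
        (by rw [hnj, mul_one])
      refine (ContinuousLinearMap.opNorm_comp_le _ _).trans ?_
      refine mul_le_mul (hC₁ _) ?_ (ContinuousLinearMap.opNorm_nonneg _) hC₁0
      rw [norm_smul, Real.norm_of_nonneg (by positivity)]
      exact mul_le_mul_of_nonneg_left (hM _) (by positivity)
    have hdχ2 : 2 * a < ‖w p.2‖ → fderiv ℝ χa p.2 ej = 0 := fun hlt => by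
      have he : χa =ᶠ[nhds p.2] fun _ => 1 := by
        have ho : IsOpen {ξ : E N | 2 * a < ‖w ξ‖} :=
          isOpen_lt (by fun_prop) (by have := hws.continuous; fun_prop)
        filter_upwards [ho.mem_nhds hlt] with ξ hξ
        refine h.χ_one _ ?_
        rw [norm_smul, Real.norm_of_nonneg (by positivity), le_inv_mul_iff₀ ha]
        linarith [show 2 * a < ‖w ξ‖ from hξ]
      rw [he.fderiv_eq]
      simp
    have hterm : ∀ k ∈ Finset.range n, |fderiv ℝ χa p.2 ej * dX ei (P k) p +
        χa p.2 * dX ei (dXi ej (P k)) p| ≤ (2 * C₁ * M + C₀) * (c / D) * (1 / 2) ^ k := by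
      intro k _
      obtain ⟨b1, b2⟩ := hsmall k p i j
      have h4 : (1 / 4 : ℝ) ^ k = (1 / 2) ^ k * (1 / 2) ^ k := by
        rw [← mul_pow]; norm_num
      have hle1 : (1 / 2 : ℝ) ^ k ≤ 1 := pow_le_one₀ (by norm_num) (by norm_num)
      have hq0 : 0 ≤ (1 / 2 : ℝ) ^ k := by positivity
      have hcD : 0 ≤ c / D := by positivity
      have t1 : |fderiv ℝ χa p.2 ej * dX ei (P k) p| ≤ 2 * C₁ * M * (c / D) * (1 / 2) ^ k := by
        rw [abs_mul]
        by_cases h0 : μ k p.2 = 0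
        · have : dX ei (P k) p = 0 := by
            rw [dX_eq_fderiv (hPs k),
              show (fun y => P k (y, p.2)) = fun _ => 0 from
                funext fun y => phasePiece_of_zero h0]
            simp
          rw [this, abs_zero, mul_zero]
          positivity
        · rcases lt_or_ge (2 * a) ‖w p.2‖ with hlt | hge
          · rw [hdχ2 hlt, abs_zero, zero_mul]
            positivity
          · have h5 := (levelPart_ne_zero h.χ_zero h0).trans hge
            -- Here both the derivative of the cut-off and the level are active, so `2 ^ (-k) ≤ ‖v‖
            -- ≤ 2a`.
            have h6 : a⁻¹ ≤ 2 * 2 ^ k := by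
              rw [inv_le_iff_one_le_mul₀' ha]
              rw [inv_le_iff_one_le_mul₀' (by positivity)] at h5
              linarith
            have h7 : (2 : ℝ) ^ k * (1 / 2) ^ k = 1 := by rw [← mul_pow]; norm_num
            calc _ ≤ C₁ * (2 * 2 ^ k * M) * (c / D * (1 / 4) ^ k) := by
                  refine mul_le_mul (hdχ1.trans ?_) b1 (abs_nonneg _) (by positivity)
                  gcongr
              _ = 2 * C₁ * M * (c / D) * (1 / 2) ^ k * (2 ^ k * (1 / 2) ^ k) := by
                  rw [h4]; ring
              _ = _ := by rw [h7, mul_one]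
      have t2 : |χa p.2 * dX ei (dXi ej (P k)) p| ≤ C₀ * (c / D) * (1 / 2) ^ k := by
        rw [abs_mul]
        calc _ ≤ C₀ * (c / D * (1 / 4) ^ k) :=
              mul_le_mul (hC₀ _) b2 (abs_nonneg _) hC₀0
          _ ≤ C₀ * (c / D * (1 / 2) ^ k) := by
              rw [h4]
              gcongr
              exact mul_le_of_le_one_left hq0 hle1
          _ = _ := by ring
      refine (abs_add_le _ _).trans ((add_le_add t1 t2).trans_eq ?_)
      ring
    refine (Finset.abs_sum_le_sum_abs _ _).trans ((Finset.sum_le_sum hterm).trans ?_)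
    rw [← Finset.mul_sum]
    have hgeo : ∑ k ∈ Finset.range n, (1 / 2 : ℝ) ^ k ≤ 2 := sum_geometric_two_le n
    have hA : 0 ≤ (2 * C₁ * M + C₀) * (c / D) := by positivity
    refine (mul_le_mul_of_nonneg_left hgeo hA).trans ?_
    rw [mul_div_assoc', div_mul_eq_mul_div, div_le_iff₀ hD0]
    nlinarith

end Gluing

/-! ### Lattice series and the free symbol -/

section Lattice

variable {N : ℕ}

theorem summable_pi_prod {φ : ℤ → ℝ} (h0 : ∀ k, 0 ≤ φ k) (hs : Summable φ) (n : ℕ) :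
    Summable fun z : Fin n → ℤ => ∏ j, φ (z j) := by
  induction n with
  | zero => exact (hasSum_fintype _).summable
  | succ n ih =>
    have h1 : Summable fun p : ℤ × (Fin n → ℤ) => φ p.1 * ∏ j, φ (p.2 j) :=
      Summable.mul_of_nonneg (f := φ) (g := fun z : Fin n → ℤ => ∏ j, φ (z j)) hs ih h0
        fun z => Finset.prod_nonneg fun j _ => h0 _
    refine (Equiv.summable_iff (f := fun z : Fin (n + 1) → ℤ => ∏ j, φ (z j))
      (Fin.consEquiv fun _ : Fin (n + 1) => ℤ)).1 (h1.congr fun p => ?_)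
    simp only [Function.comp_apply, Fin.consEquiv_apply, Fin.prod_univ_succ, Fin.cons_zero,
      Fin.cons_succ]

theorem summable_int_bracket : Summable fun k : ℤ => (1 + (k : ℝ) ^ 2)⁻¹ := by
  refine (Real.summable_one_div_int_pow.2 one_lt_two).of_norm_bounded_eventually ?_
  filter_upwards [(Set.finite_singleton (0 : ℤ)).compl_mem_cofinite] with k hk
  have h1 : (0 : ℝ) < (k : ℝ) ^ 2 := by
    have : (k : ℝ) ≠ 0 := by exact_mod_cast hk
    positivity
  rw [Real.norm_of_nonneg (by positivity), one_div]
  exact inv_anti₀ h1 (by linarith)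

theorem norm_sq_lat (z : Lattice N) : ‖lat z‖ ^ 2 = ∑ j, (z j : ℝ) ^ 2 := by
  rw [EuclideanSpace.norm_sq_eq]
  simp [lat]

/-- Comparison with a product of one-dimensional series: each factor `1 + z_j ^ 2` is at most `⟨z⟩ ^
2`. -/
theorem summable_lattice_bracket :
    Summable fun z : Lattice N => (bracket (lat z) ^ (2 * N))⁻¹ := by
  refine Summable.of_nonneg_of_le (fun z => by have := bracket_pos (lat z); positivity) (fun z => ?_)
    (summable_pi_prod (fun k => by positivity) summable_int_bracket N)
  rw [Finset.prod_inv_distrib]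
  refine inv_anti₀ (Finset.prod_pos fun j _ => by positivity) ?_
  rw [pow_mul, bracket_sq, norm_sq_lat]
  calc ∏ j, (1 + (z j : ℝ) ^ 2) ≤ ∏ _j : Fin N, (1 + ∑ j, (z j : ℝ) ^ 2) :=
        Finset.prod_le_prod (fun j _ => by positivity) fun j _ => add_le_add_right
          (Finset.single_le_sum (f := fun j => (z j : ℝ) ^ 2) (fun _ _ => sq_nonneg _)
            (Finset.mem_univ j)) 1
    _ = _ := by simp

variable {f : Lattice N → ℂ}

theorem IsHoppingFunction.summable (hf : IsHoppingFunction f) (d : ℕ) :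
    Summable fun z => bracket (lat z) ^ d * ‖f z‖ := by
  obtain ⟨C, hC⟩ := hf.rapid (d + 2 * N)
  refine Summable.of_nonneg_of_le (fun z => by have := bracket_pos (lat z); positivity) (fun z => ?_)
    (summable_lattice_bracket.mul_left C)
  have hb := bracket_pos (lat z)
  have h1 := hC z
  rw [← div_eq_mul_inv, le_div_iff₀ (by positivity)]
  refine le_trans (le_of_eq ?_) h1
  rw [pow_add]
  ring

theorem IsHoppingFunction.summable_norm (hf : IsHoppingFunction f) : Summable fun z => ‖f z‖ := by
  simpa using hf.summable 0

variable {X : Type*} [NormedAddCommGroup X] [NormedSpace ℝ X]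

section Series

variable {A : Lattice N → X → ℂ}

theorem norm_iteratedFDeriv_const_mul {A : X → ℂ} (hA : ContDiff ℝ ∞ A) (c : ℂ) (n : ℕ) (x : X) :
    ‖iteratedFDeriv ℝ n (fun x => c * A x) x‖ = ‖c‖ * ‖iteratedFDeriv ℝ n A x‖ := by
  rw [show (fun x => c * A x) = c • A from rfl,
    iteratedFDeriv_const_smul_apply (hA.of_le (by exact_mod_cast le_top)).contDiffAt, norm_smul]

/-- A series with rapidly decreasing coefficients and polynomially bounded derivatives. -/
theorem contDiff_hopSeries (hf : IsHoppingFunction f) (hA : ∀ z, ContDiff ℝ ∞ (A z))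
    (hb : ∀ n : ℕ, ∃ (C : ℝ) (d : ℕ), ∀ z x, ‖iteratedFDeriv ℝ n (A z) x‖ ≤ C * bracket (lat z) ^ d) :
    ContDiff ℝ ∞ fun x => ∑' z, f z * A z x := by
  choose C d hC using hb
  refine contDiff_tsum (N := ⊤) (v := fun n z => C n * (bracket (lat z) ^ d n * ‖f z‖))
    (fun z => contDiff_const.mul (hA z)) (fun n _ => (hf.summable (d n)).mul_left _)
    fun n z x _ => ?_
  rw [norm_iteratedFDeriv_const_mul (hA z)]
  refine (mul_le_mul_of_nonneg_left (hC n z x) (norm_nonneg _)).trans_eq ?_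
  ring

/-- The bounds `hb`, uniform in `x`, only justify differentiating term by term. The estimate itself
uses the sharper bound `hB` at the given point. -/
theorem norm_iteratedFDeriv_hopSeries_le (hf : IsHoppingFunction f) (hA : ∀ z, ContDiff ℝ ∞ (A z))
    (hb : ∀ n : ℕ, ∃ (C : ℝ) (d : ℕ), ∀ z x, ‖iteratedFDeriv ℝ n (A z) x‖ ≤ C * bracket (lat z) ^ d)
    {n d : ℕ} {x : X} {B : ℝ} (hB : ∀ z, ‖iteratedFDeriv ℝ n (A z) x‖ ≤ B * bracket (lat z) ^ d) :
    ‖iteratedFDeriv ℝ n (fun x => ∑' z, f z * A z x) x‖ ≤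
      (∑' z, bracket (lat z) ^ d * ‖f z‖) * B := by
  choose C' d' hC using hb
  rw [iteratedFDeriv_tsum_apply (N := ⊤)
    (v := fun n z => C' n * (bracket (lat z) ^ d' n * ‖f z‖))
    (fun z => contDiff_const.mul (hA z)) (fun n _ => (hf.summable (d' n)).mul_left _)
    (fun n z x _ => by
      rw [norm_iteratedFDeriv_const_mul (hA z)]
      refine (mul_le_mul_of_nonneg_left (hC n z x) (norm_nonneg _)).trans_eq ?_
      ring) le_top]
  refine tsum_of_norm_bounded ((hf.summable d).hasSum.mul_right B) fun z => ?_
  rw [norm_iteratedFDeriv_const_mul (hA z)]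
  refine (mul_le_mul_of_nonneg_left (hB z) (norm_nonneg _)).trans_eq ?_
  ring

end Series

/-- The function `t ↦ e^{it}`. -/
def cis (t : ℝ) : ℂ := Complex.exp (Complex.I * t)

theorem contDiff_cis : ContDiff ℝ ∞ cis :=
  Complex.contDiff_exp.comp (contDiff_const.mul Complex.ofRealCLM.contDiff)

theorem hasDerivAt_cis (t : ℝ) : HasDerivAt cis (Complex.I * cis t) t := by
  have h1 : HasDerivAt (fun t : ℝ => Complex.I * (t : ℂ)) (Complex.I * 1) t :=
    (Complex.ofRealCLM.hasDerivAt (x := t)).const_mul Complex.I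
  refine h1.cexp.congr_deriv ?_
  rw [cis]
  ring

theorem norm_cis (t : ℝ) : ‖cis t‖ = 1 := by
  rw [cis, mul_comm, Complex.norm_exp_ofReal_mul_I]

theorem cis_add (s t : ℝ) : cis (s + t) = cis s * cis t := by
  rw [cis, cis, cis, ← Complex.exp_add]
  push_cast
  rw [mul_add]

theorem cis_zero : cis 0 = 1 := by simp [cis]

theorem norm_iteratedFDeriv_cis_le (n : ℕ) (t : ℝ) : ‖iteratedFDeriv ℝ n cis t‖ ≤ 1 := by
  rw [norm_iteratedFDeriv_eq_norm_iteratedDeriv]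
  have : iteratedDeriv n cis = fun t => Complex.I ^ n * cis t := by
    induction n with
    | zero => simp
    | succ n ih =>
      rw [iteratedDeriv_succ, ih]
      ext1 t
      rw [((hasDerivAt_cis t).const_mul _).deriv]
      ring
  rw [this, norm_mul, norm_pow, Complex.norm_I, one_pow, one_mul, norm_cis]

/-- The character `ξ ↦ e^{-iz·ξ}`. -/
def latChar (z : Lattice N) (ξ : E N) : ℂ := cis (-dot (lat z) ξ)

theorem latChar_eq (z : Lattice N) (ξ : E N) :
    latChar z ξ = Complex.exp (-(Complex.I * (dot (lat z) ξ : ℝ))) := by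
  rw [latChar, cis]
  push_cast
  rw [mul_neg]

theorem contDiff_latChar (z : Lattice N) : ContDiff ℝ ∞ (latChar z) := by
  unfold latChar dot
  exact contDiff_cis.comp (contDiff_const.inner ℝ contDiff_id).neg

theorem norm_latChar (z : Lattice N) (ξ : E N) : ‖latChar z ξ‖ = 1 := norm_cis _

theorem norm_iteratedFDeriv_latChar_le (z : Lattice N) (n : ℕ) (ξ : E N) :
    ‖iteratedFDeriv ℝ n (latChar z) ξ‖ ≤ bracket (lat z) ^ n := by
  have e : latChar z = fun ξ => cis ((-innerSL ℝ (lat z)) ξ) := by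
    ext1 ξ
    simp [latChar, dot]
  rw [e]
  refine (norm_iteratedFDeriv_comp_clm_le _ contDiff_cis.contDiffAt n).trans ?_
  calc _ ≤ 1 * ‖-innerSL ℝ (lat z)‖ ^ n :=
        mul_le_mul_of_nonneg_right (norm_iteratedFDeriv_cis_le n _) (by positivity)
    _ ≤ _ := by
      rw [one_mul, norm_neg, innerSL_apply_norm]
      exact pow_le_pow_left₀ (norm_nonneg _) (norm_le_bracket _) n

theorem exists_iteratedFDeriv_latChar_le (n : ℕ) : ∃ (C : ℝ) (d : ℕ), ∀ (z : Lattice N) ξ,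
    ‖iteratedFDeriv ℝ n (latChar z) ξ‖ ≤ C * bracket (lat z) ^ d :=
  ⟨1, n, fun z ξ => by rw [one_mul]; exact norm_iteratedFDeriv_latChar_le z n ξ⟩

theorem h0_eq_series (hf : IsHoppingFunction f) (ξ : E N) :
    ((h0 f ξ : ℝ) : ℂ) = ∑' z, f z * latChar z ξ := by
  rw [h0_ofReal hf]
  exact tsum_congr fun z => by rw [latChar_eq, mul_comm]

theorem h0_eq_re (hf : IsHoppingFunction f) :
    h0 f = fun ξ => Complex.reCLM (∑' z, f z * latChar z ξ) := by
  ext1 ξ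
  rw [← h0_eq_series hf]
  simp

theorem contDiff_h0 (hf : IsHoppingFunction f) : ContDiff ℝ ∞ (h0 f) := by
  rw [h0_eq_re hf]
  exact Complex.reCLM.contDiff.comp
    (contDiff_hopSeries hf contDiff_latChar exists_iteratedFDeriv_latChar_le)

theorem exists_iteratedFDeriv_h0_le (hf : IsHoppingFunction f) (n : ℕ) :
    ∃ C, ∀ ξ, ‖iteratedFDeriv ℝ n (h0 f) ξ‖ ≤ C := by
  refine ⟨‖Complex.reCLM‖ * ((∑' z, bracket (lat z) ^ n * ‖f z‖) * 1), fun ξ => ?_⟩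
  have hs := contDiff_hopSeries hf contDiff_latChar exists_iteratedFDeriv_latChar_le
  rw [h0_eq_re hf]
  refine (Complex.reCLM.norm_iteratedFDeriv_comp_left (N := ∞) hs.contDiffAt
    (by exact_mod_cast le_top)).trans (mul_le_mul_of_nonneg_left ?_ (norm_nonneg _))
  exact norm_iteratedFDeriv_hopSeries_le hf contDiff_latChar exists_iteratedFDeriv_latChar_le
    fun z => by rw [one_mul]; exact norm_iteratedFDeriv_latChar_le z n ξ

theorem cis_add_two_pi (t : ℝ) (k : ℤ) : cis (t + 2 * Real.pi * k) = cis t := by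
  rw [cis, cis]
  push_cast
  rw [mul_add, show Complex.I * (2 * Real.pi * k) = k * (2 * Real.pi * Complex.I) by ring,
    Complex.exp_periodic.int_mul k |> fun h => h _]

theorem dot_lat (z m : Lattice N) : dot (lat z) (lat m) = ((∑ j, z j * m j : ℤ) : ℝ) := by
  simp [dot, lat, PiLp.inner_apply, mul_comm]

theorem latChar_periodic (z m : Lattice N) (ξ : E N) :
    latChar z (ξ + (2 * Real.pi) • lat m) = latChar z ξ := by
  rw [latChar, latChar]
  have : -dot (lat z) (ξ + (2 * Real.pi) • lat m) =
      -dot (lat z) ξ + 2 * Real.pi * ((-∑ j, z j * m j : ℤ) : ℝ) := by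
    push_cast
    have h := dot_lat z m
    push_cast at h
    rw [← h]
    simp only [dot, inner_add_right, real_inner_smul_right]
    ring
  rw [this, cis_add_two_pi]

theorem h0_periodic (hf : IsHoppingFunction f) (m : Lattice N) (ξ : E N) :
    h0 f (ξ + (2 * Real.pi) • lat m) = h0 f ξ := by
  rw [h0_eq_re hf]
  simp only [latChar_periodic]

theorem gradient_periodic {g : E N → ℝ} {ζ : E N} (h : ∀ ξ, g (ξ + ζ) = g ξ) (ξ : E N) :
    gradient g (ξ + ζ) = gradient g ξ := by
  rw [← gradCLM_fderiv]
  simp only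
  rw [← fderiv_comp_add_right]
  simp only [h]

theorem scatteringHyp {ε : ℝ} {V χ : E N → ℝ} (hf : IsHoppingFunction f) (hε0 : 0 < ε) (hε1 : ε < 1)
    (hV : IsLongRange ε V) (hχ : ContDiff ℝ ∞ χ) (hχ0 : ∀ x, ‖x‖ ≤ 1 → χ x = 0)
    (hχ1 : ∀ x, 2 ≤ ‖x‖ → χ x = 1) : ScatteringHyp χ (h0 f) V ε where
  ε_pos := hε0
  ε_lt := hε1
  χ_smooth := hχ
  χ_zero := hχ0
  χ_one := hχ1
  g_smooth := contDiff_h0 hf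
  g_bdd := exists_iteratedFDeriv_h0_le hf
  V_smooth := hV.smooth
  V_decay := hV.iteratedFDeriv_le

end Lattice

/-! ### Fourier series and the commutation identity -/

section Fourier

variable {N : ℕ}

theorem integral_cis_mul_int (k : ℤ) :
    ∫ t in Set.Ico (-Real.pi) Real.pi, cis (k * t) = if k = 0 then ((2 * Real.pi : ℝ) : ℂ) else 0 := by
  have hpi := Real.pi_pos
  rw [integral_Ico_eq_integral_Ioc, ← intervalIntegral.integral_of_le (by linarith)]
  split_ifs with h
  · subst h
    simp only [Int.cast_zero, zero_mul, cis_zero]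
    rw [intervalIntegral.integral_const, sub_neg_eq_add, ← two_mul, Complex.real_smul, mul_one]
  · have hc : (Complex.I * k : ℂ) ≠ 0 := mul_ne_zero Complex.I_ne_zero (by exact_mod_cast h)
    have e : ∀ t : ℝ, cis (k * t) = Complex.exp (Complex.I * k * t) := fun t => by
      rw [cis]
      push_cast
      rw [mul_assoc]
    simp only [e]
    rw [integral_exp_mul_complex hc, ← e, ← e]
    have h2 : cis (k * Real.pi) = cis (k * (-Real.pi)) := by
      rw [← cis_add_two_pi (k * (-Real.pi)) k]
      congr 1
      ring
    rw [h2, sub_self, zero_div]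

theorem cis_sum {ι : Type*} (s : Finset ι) (t : ι → ℝ) : cis (∑ i ∈ s, t i) = ∏ i ∈ s, cis (t i) := by
  simp only [cis]
  push_cast
  rw [Finset.mul_sum, Complex.exp_sum]

theorem integral_cis_dot (z : Lattice N) :
    ∫ ξ, cis (dot (lat z) ξ) ∂(torusMeasure N) =
      if z = 0 then (((2 * Real.pi) ^ N : ℝ) : ℂ) else 0 := by
  have e : (WithLp.toLp 2 : (Fin N → ℝ) → E N) ⁻¹' cell N =
      Set.univ.pi fun _ => Set.Ico (-Real.pi) Real.pi := by
    ext ξ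
    simp [cell, Set.mem_pi]
  have h1 := (PiLp.volume_preserving_toLp (Fin N)).setIntegral_preimage_emb
    (MeasurableEquiv.toLp 2 (Fin N → ℝ)).measurableEmbedding
    (fun ξ : E N => cis (dot (lat z) ξ)) (cell N)
  rw [torusMeasure, ← h1, e, volume_pi, Measure.restrict_pi_pi]
  have h2 : ∀ ξ : Fin N → ℝ, cis (dot (lat z) (WithLp.toLp 2 ξ)) = ∏ j, cis (z j * ξ j) := by
    intro ξ
    rw [← cis_sum]
    congr 1
    simp [dot, lat, PiLp.inner_apply, mul_comm]
  simp only [h2]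
  rw [integral_fintype_prod_eq_prod (fun (j : Fin N) (t : ℝ) => cis (z j * t))]
  simp only [integral_cis_mul_int]
  split_ifs with h
  · subst h
    simp
  · obtain ⟨j, hj⟩ := Function.ne_iff.1 h
    exact Finset.prod_eq_zero (Finset.mem_univ j) (if_neg hj)

theorem coeFn_char (y : Lattice N) : char y =ᵐ[torusMeasure N] latChar y := by
  refine (memLp_char y).coeFn_toLp.trans (Filter.Eventually.of_forall fun ξ => ?_)
  rw [latChar_eq]

theorem star_cis (t : ℝ) : star (cis t) = cis (-t) := by
  simp only [cis, RCLike.star_def, ← Complex.exp_conj, map_mul, Complex.conj_I, Complex.conj_ofReal]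
  push_cast
  ring_nf

theorem lat_sub (y z : Lattice N) : lat (y - z) = lat y - lat z := by
  ext j
  simp [lat]

theorem lat_add (y z : Lattice N) : lat (y + z) = lat y + lat z := by
  ext j
  simp [lat]

theorem inner_char (y z : Lattice N) :
    inner ℂ (char y) (char z) = if y = z then (((2 * Real.pi) ^ N : ℝ) : ℂ) else 0 := by
  rw [L2.inner_def]
  simp only [← sub_eq_zero (a := y)]
  rw [← integral_cis_dot]
  refine integral_congr_ae ?_
  filter_upwards [coeFn_char y, coeFn_char z] with ξ h1 h2
  rw [h1, h2, RCLike.inner_apply, ← RCLike.star_def, latChar, latChar, star_cis, ← cis_add]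
  congr 1
  simp only [lat_sub, dot, inner_sub_left]
  ring

/-- Summation of Fourier series as a bounded operator from `ℓ²` to `L²`. -/
theorem exists_fourierCLM : ∃ L : lp (fun _ : Lattice N => ℂ) 2 →L[ℂ] Lp ℂ 2 (torusMeasure N),
    ∀ u, HasSum (fun y => u y • char y) (L u) := by
  have hp : (0 : ℝ) < (2 * Real.pi) ^ N := by positivity
  -- Every character has norm `s` in `L²`, so dividing by `s` gives an orthonormal family and
  -- multiplying the isometry by `s` restores the series.
  set s : ℝ := Real.sqrt ((2 * Real.pi) ^ N) with hs
  have hs0 : s ≠ 0 := (Real.sqrt_pos.2 hp).ne'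
  have hs2 : s * s = (2 * Real.pi) ^ N := Real.mul_self_sqrt hp.le
  have ho : Orthonormal ℂ fun y : Lattice N => ((s⁻¹ : ℝ) : ℂ) • char y := by
    rw [orthonormal_iff_ite]
    intro y z
    rw [inner_smul_left, inner_smul_right, inner_char, Complex.conj_ofReal]
    split_ifs
    · rw [← hs2]
      push_cast
      field_simp [show (s : ℂ) ≠ 0 by exact_mod_cast hs0]
    · simp
  refine ⟨(s : ℂ) • ho.orthogonalFamily.linearIsometry.toContinuousLinearMap, fun u => ?_⟩
  have h1 := (ho.orthogonalFamily.hasSum_linearIsometry u).const_smul (s : ℂ)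
  refine h1.congr_fun fun y => ?_
  rw [LinearIsometry.toSpanSingleton_apply, smul_smul, smul_smul]
  congr 1
  push_cast
  field_simp [show (s : ℂ) ≠ 0 by exact_mod_cast hs0]

/-- Integration against a bounded continuous function, on `L²(𝕋^N)`. -/
theorem exists_integralCLM {b : E N → ℂ} (hb : Continuous b) {C : ℝ} (hC : ∀ ξ, ‖b ξ‖ ≤ C) :
    ∃ Λ : Lp ℂ 2 (torusMeasure N) →L[ℂ] ℂ, ∀ W, Λ W = ∫ ξ, b ξ * W ξ ∂(torusMeasure N) := by
  have hm : MemLp (fun ξ => star (b ξ)) 2 (torusMeasure N) :=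
    MemLp.of_bound hb.star.aestronglyMeasurable C (Filter.Eventually.of_forall fun ξ => by
      rw [norm_star]
      exact hC ξ)
  refine ⟨innerSL ℂ (hm.toLp _), fun W => ?_⟩
  rw [innerSL_apply_apply, L2.inner_def]
  refine integral_congr_ae ?_
  filter_upwards [hm.coeFn_toLp] with ξ h1
  rw [h1, RCLike.inner_apply, ← RCLike.star_def, star_star, mul_comm]

theorem integrable_mul_L2 {b : E N → ℂ} (hb : Continuous b) {C : ℝ} (hC : ∀ ξ, ‖b ξ‖ ≤ C)
    (W : Lp ℂ 2 (torusMeasure N)) : Integrable (fun ξ => b ξ * W ξ) (torusMeasure N) :=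
  ((Lp.memLp W).integrable (by norm_num)).bdd_mul (c := C) hb.aestronglyMeasurable
    (Filter.Eventually.of_forall hC)

/-- A translate of a square-summable sequence. -/
theorem exists_translate_lp (u : lp (fun _ : Lattice N => ℂ) 2) (z : Lattice N) :
    ∃ v : lp (fun _ : Lattice N => ℂ) 2, (∀ y, v y = u (y - z)) ∧ ‖v‖ = ‖u‖ := by
  have h2 : (0 : ℝ) < (2 : ENNReal).toReal := by norm_num
  have hm : Memℓp (fun y => u (y - z)) 2 := by
    refine memℓp_gen ?_
    exact (Equiv.subRight z).summable_iff.2 (lp.memℓp u |>.summable h2)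
  refine ⟨⟨fun y => u (y - z), hm⟩, fun y => rfl, ?_⟩
  rw [lp.norm_eq_tsum_rpow h2, lp.norm_eq_tsum_rpow h2]
  congr 1
  exact (Equiv.subRight z).tsum_eq fun y => ‖u y‖ ^ (2 : ENNReal).toReal

theorem fourierSum_eq {L : lp (fun _ : Lattice N => ℂ) 2 →L[ℂ] Lp ℂ 2 (torusMeasure N)}
    (hL : ∀ u, HasSum (fun y => u y • char y) (L u)) (u : lp (fun _ : Lattice N => ℂ) 2) :
    fourierSum (fun y => u y) = L u := (hL u).tsum_eq

theorem continuous_latChar (z : Lattice N) : Continuous (latChar z) := (contDiff_latChar z).continuous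

/-- Translating a sequence by `z` multiplies its Fourier series by the character of `z`. The
identity is tested against bounded continuous functions, where both sides are continuous functionals
and can be compared term by term. -/
theorem integral_translate_fourier
    {L : lp (fun _ : Lattice N => ℂ) 2 →L[ℂ] Lp ℂ 2 (torusMeasure N)}
    (hL : ∀ u, HasSum (fun y => u y • char y) (L u)) {b : E N → ℂ} (hb : Continuous b) {C : ℝ}
    (hC : ∀ ξ, ‖b ξ‖ ≤ C) (u v : lp (fun _ : Lattice N => ℂ) 2) (z : Lattice N)
    (hv : ∀ y, v y = u (y - z)) :
    ∫ ξ, b ξ * L v ξ ∂(torusMeasure N) = ∫ ξ, b ξ * latChar z ξ * L u ξ ∂(torusMeasure N) := by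
  have hbz : Continuous fun ξ => b ξ * latChar z ξ := hb.mul (continuous_latChar z)
  have hCz : ∀ ξ, ‖b ξ * latChar z ξ‖ ≤ C := fun ξ => by
    rw [norm_mul, norm_latChar, mul_one]
    exact hC ξ
  obtain ⟨Λ, hΛ⟩ := exists_integralCLM hb hC
  obtain ⟨Λz, hΛz⟩ := exists_integralCLM hbz hCz
  have h1 : HasSum (fun y => v y • Λ (char y)) (Λ (L v)) := by
    simpa using Λ.hasSum (hL v)
  have h2 : HasSum (fun y => u y • Λz (char y)) (Λz (L u)) := by
    simpa using Λz.hasSum (hL u)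
  rw [← hΛ, ← hΛz]
  have h3 := (Equiv.addRight z).hasSum_iff.2 h1
  refine h3.unique (h2.congr_fun fun y => ?_)
  simp only [Function.comp_apply, Equiv.coe_addRight, hv, add_sub_cancel_right]
  congr 1
  rw [hΛ, hΛz]
  refine integral_congr_ae ?_
  filter_upwards [coeFn_char y, coeFn_char (y + z)] with ξ e1 e2
  rw [e1, e2, mul_assoc]
  congr 1
  rw [latChar, latChar, latChar, ← cis_add]
  congr 1
  simp only [lat_add, dot, inner_add_left]
  ring

variable {f : Lattice N → ℂ}

theorem IsHoppingFunction.summable_mul (hf : IsHoppingFunction f) {w : Lattice N → ℂ} {B : ℝ}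
    (hB : ∀ z, ‖w z‖ ≤ B) : Summable fun z => f z * w z :=
  (hf.summable_norm.mul_right B).of_norm_bounded fun z => by
    rw [norm_mul]
    exact mul_le_mul_of_nonneg_left (hB z) (norm_nonneg _)

theorem IsHoppingFunction.norm_tsum_mul_le (hf : IsHoppingFunction f) {w : Lattice N → ℂ} {B : ℝ}
    (hB : ∀ z, ‖w z‖ ≤ B) : ‖∑' z, f z * w z‖ ≤ (∑' z, ‖f z‖) * B :=
  tsum_of_norm_bounded (hf.summable_norm.hasSum.mul_right B) fun z => by
    rw [norm_mul]
    exact mul_le_mul_of_nonneg_left (hB z) (norm_nonneg _)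

theorem IsHoppingFunction.continuous_tsum_mul (hf : IsHoppingFunction f)
    {w : Lattice N → E N → ℂ} (hw : ∀ z, Continuous (w z)) {B : ℝ} (hB : ∀ z ξ, ‖w z ξ‖ ≤ B) :
    Continuous fun ξ => ∑' z, f z * w z ξ :=
  continuous_tsum (fun z => continuous_const.mul (hw z)) (hf.summable_norm.mul_right B)
    fun z ξ => by
      rw [norm_mul]
      exact mul_le_mul_of_nonneg_left (hB z ξ) (norm_nonneg _)

/-- Integration of a series with summable coefficients, bounded terms. -/
theorem IsHoppingFunction.tsum_mul_integral (hf : IsHoppingFunction f)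
    {w : Lattice N → E N → ℂ} (hw : ∀ z, Continuous (w z)) {B : ℝ} (hB : ∀ z ξ, ‖w z ξ‖ ≤ B)
    (U : Lp ℂ 2 (torusMeasure N)) :
    ∑' z, f z * ∫ ξ, w z ξ * U ξ ∂(torusMeasure N) =
      ∫ ξ, (∑' z, f z * w z ξ) * U ξ ∂(torusMeasure N) := by
  have hU : Integrable (fun ξ => U ξ) (torusMeasure N) := (Lp.memLp U).integrable (by norm_num)
  have h1 : ∀ z, Integrable (fun ξ => f z * (w z ξ * U ξ)) (torusMeasure N) := fun z =>
    (integrable_mul_L2 (hw z) (hB z) U).const_mul _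
  have h2 : Summable fun z => ∫ ξ, ‖f z * (w z ξ * U ξ)‖ ∂(torusMeasure N) := by
    refine Summable.of_nonneg_of_le (fun z => integral_nonneg fun ξ => norm_nonneg _) (fun z => ?_)
      (hf.summable_norm.mul_right (B * ∫ ξ, ‖U ξ‖ ∂(torusMeasure N)))
    rw [← integral_const_mul, ← integral_const_mul]
    refine integral_mono (h1 z).norm ((hU.norm.const_mul B).const_mul _) fun ξ => ?_
    simp only [norm_mul]
    gcongr
    exact hB z ξ
  have h3 := integral_tsum_of_summable_integral_norm h1 h2
  simp only [integral_const_mul] at h3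
  rw [h3]
  refine integral_congr_ae (Filter.Eventually.of_forall fun ξ => ?_)
  simp only [← mul_assoc]
  rw [tsum_mul_right]

/-- The Fourier series turns `H₀` into multiplication by `h₀`. Since translations are isometries and
`f` is summable, `H₀ u` is a norm-convergent sum of translates of `u`, and the continuous summation
operator may be applied to each of them. -/
theorem integral_fourierSum_freeOp (hf : IsHoppingFunction f) {b : E N → ℂ} (hb : Continuous b)
    {C : ℝ} (hC : ∀ ξ, ‖b ξ‖ ≤ C) {u : Lattice N → ℂ} (hu : Memℓp u 2) :
    ∫ ξ, b ξ * fourierSum (freeOp f u) ξ ∂(torusMeasure N) =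
      ∫ ξ, b ξ * (h0 f ξ : ℂ) * fourierSum u ξ ∂(torusMeasure N) := by
  obtain ⟨L, hL⟩ := exists_fourierCLM (N := N)
  obtain ⟨u, rfl⟩ : ∃ v : lp (fun _ : Lattice N => ℂ) 2, u = fun y => v y := ⟨⟨u, hu⟩, rfl⟩
  choose τ hτ hτn using exists_translate_lp u
  have hs : Summable fun z => f z • τ z :=
    (hf.summable_norm.mul_right ‖u‖).of_norm_bounded fun z => by rw [norm_smul, hτn]
  have e : freeOp f (fun y => u y) = fun y => (∑' z, f z • τ z : lp (fun _ : Lattice N => ℂ) 2) y := by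
    ext1 y
    have := (lp.evalCLM ℂ (fun _ : Lattice N => ℂ) 2 y).map_tsum hs
    refine Eq.trans ?_ this.symm
    refine tsum_congr fun z => ?_
    rw [map_smul]
    exact congrArg (f z * ·) (hτ z y).symm
  rw [e, fourierSum_eq hL, fourierSum_eq hL, L.map_tsum hs]
  obtain ⟨Λ, hΛ⟩ := exists_integralCLM hb hC
  have hs' : Summable fun z => L (f z • τ z) := L.summable hs
  rw [← hΛ, Λ.map_tsum hs']
  have hC0 : ∀ z ξ, ‖b ξ * latChar z ξ‖ ≤ C := fun z ξ => by
    rw [norm_mul, norm_latChar, mul_one]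
    exact hC ξ
  have e1 : ∀ z, Λ (L (f z • τ z)) =
      f z * ∫ ξ, b ξ * latChar z ξ * L u ξ ∂(torusMeasure N) := fun z => by
    rw [map_smul, map_smul, hΛ, integral_translate_fourier hL hb hC u (τ z) z (hτ z), smul_eq_mul]
  rw [tsum_congr e1, hf.tsum_mul_integral (w := fun z ξ => b ξ * latChar z ξ) (fun z => hb.mul (continuous_latChar z)) hC0]
  refine integral_congr_ae (Filter.Eventually.of_forall fun ξ => ?_)
  beta_reduce
  rw [h0_eq_series hf, ← tsum_mul_left]
  congr 1
  exact tsum_congr fun z => by ring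

variable {ϕ : E N → E N → ℝ} {V : E N → ℝ}

theorem oscOp_eq_cis (ϕ : E N → E N → ℝ) (s : E N → E N → ℂ) (u : Lattice N → ℂ) (x : Lattice N) :
    oscOp ϕ s u x = (((2 * Real.pi) ^ N)⁻¹ : ℝ) *
      ∫ ξ, cis (ϕ (lat x) ξ) * s (lat x) ξ * fourierSum u ξ ∂(torusMeasure N) := rfl

theorem norm_oscOp_le (ϕ : E N → E N → ℝ) (u : Lattice N → ℂ) (x : Lattice N) :
    ‖oscOp ϕ (fun _ _ => 1) u x‖ ≤
      ((2 * Real.pi) ^ N)⁻¹ * ∫ ξ, ‖fourierSum u ξ‖ ∂(torusMeasure N) := by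
  rw [oscOp_eq_cis, norm_mul, Complex.norm_real, Real.norm_of_nonneg (by positivity)]
  refine mul_le_mul_of_nonneg_left ((norm_integral_le_integral_norm _).trans_eq ?_) (by positivity)
  simp only [norm_mul, norm_cis, one_mul, norm_one]

theorem summable_freeOp_oscOp (hf : IsHoppingFunction f) (ϕ : E N → E N → ℝ) (u : Lattice N → ℂ)
    (x : Lattice N) : Summable fun y => f y * oscOp ϕ (fun _ _ => 1) u (x - y) :=
  hf.summable_mul fun z => norm_oscOp_le ϕ u (x - z)

theorem cis_mul_tsum (x ξ : E N) :
    cis (ϕ x ξ) * ∑' z, f z * Complex.exp (Complex.I * ((ϕ (x - lat z) ξ - ϕ x ξ : ℝ) : ℂ)) =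
      ∑' z, f z * cis (ϕ (x - lat z) ξ) := by
  rw [← tsum_mul_left]
  refine tsum_congr fun z => ?_
  change cis _ * (f z * cis (ϕ (x - lat z) ξ - ϕ x ξ)) = _
  rw [mul_left_comm, ← cis_add]
  congr 2
  ring

/-- The commutation identity for an oscillatory integral operator. -/
theorem fullOp_oscOp_sub (hf : IsHoppingFunction f) (hϕ : ∀ x, Continuous (ϕ x))
    {u : Lattice N → ℂ} (hu : Memℓp u 2) (x : Lattice N) :
    fullOp f V (oscOp ϕ (fun _ _ => 1) u) x - oscOp ϕ (fun _ _ => 1) (freeOp f u) x =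
      oscOp ϕ (symbol f V ϕ) u x := by
  have hc : ∀ x, Continuous fun ξ => cis (ϕ x ξ) := fun x => contDiff_cis.continuous.comp (hϕ x)
  set U := fourierSum u
  have hh : Continuous (h0 f) := (contDiff_h0 hf).continuous
  obtain ⟨H, hH⟩ := exists_iteratedFDeriv_h0_le hf 0
  simp only [norm_iteratedFDeriv_zero] at hH
  have hS : Continuous fun ξ => ∑' z, f z * cis (ϕ (lat x - lat z) ξ) :=
    hf.continuous_tsum_mul (fun z => hc _) fun z ξ => (norm_cis _).le
  have i1 := integrable_mul_L2 hS (fun ξ => hf.norm_tsum_mul_le fun z => (norm_cis _).le) U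
  have i2 := integrable_mul_L2 (hc (lat x)) (fun ξ => (norm_cis _).le) U
  have i3 := integrable_mul_L2 (b := fun ξ => cis (ϕ (lat x) ξ) * (h0 f ξ : ℂ)) (C := H)
    ((hc (lat x)).mul (Complex.continuous_ofReal.comp hh)) (fun ξ => by
      rw [norm_mul, norm_cis, one_mul, Complex.norm_real]
      exact hH ξ) U
  have e1 : freeOp f (oscOp ϕ (fun _ _ => 1) u) x = (((2 * Real.pi) ^ N)⁻¹ : ℝ) *
      ∫ ξ, (∑' z, f z * cis (ϕ (lat x - lat z) ξ)) * U ξ ∂(torusMeasure N) := by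
    rw [← hf.tsum_mul_integral (fun z => hc _) fun z ξ => (norm_cis _).le, ← tsum_mul_left, freeOp]
    refine tsum_congr fun z => ?_
    rw [oscOp_eq_cis, lat_sub]
    simp only [mul_one]
    ring
  have e2 : oscOp ϕ (fun _ _ => 1) (freeOp f u) x = (((2 * Real.pi) ^ N)⁻¹ : ℝ) *
      ∫ ξ, cis (ϕ (lat x) ξ) * (h0 f ξ : ℂ) * U ξ ∂(torusMeasure N) := by
    rw [oscOp_eq_cis]
    simp only [mul_one]
    rw [integral_fourierSum_freeOp hf (hc _) (fun ξ => (norm_cis _).le) hu]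
  have e3 : ∀ ξ, cis (ϕ (lat x) ξ) * symbol f V ϕ (lat x) ξ * U ξ =
      (∑' z, f z * cis (ϕ (lat x - lat z) ξ)) * U ξ + V (lat x) * (cis (ϕ (lat x) ξ) * U ξ)
        - cis (ϕ (lat x) ξ) * (h0 f ξ : ℂ) * U ξ := fun ξ => by
    rw [symbol, mul_sub, mul_add, cis_mul_tsum]
    ring
  rw [fullOp, e1, e2, oscOp_eq_cis ϕ (fun _ _ => 1) u, oscOp_eq_cis ϕ (symbol f V ϕ)]
  simp only [mul_one]
  have e4 := (integral_sub (i1.add (i2.const_mul (V (lat x) : ℂ))) i3).trans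
    (congrArg (· - _) (integral_add i1 (i2.const_mul (V (lat x) : ℂ))))
  rw [integral_congr_ae (Filter.Eventually.of_forall e3)]
  refine Eq.trans ?_ (congrArg (_ * ·) e4.symm)
  rw [integral_const_mul]
  ring

theorem symbol_eq_fullOp (x : Lattice N) (ξ : E N) :
    symbol f V ϕ (lat x) ξ =
      Complex.exp (-(Complex.I * (ϕ (lat x) ξ : ℝ))) *
        fullOp f V (fun y => Complex.exp (Complex.I * (ϕ (lat y) ξ : ℝ))) x - (h0 f ξ : ℂ) := by
  have e : Complex.exp (-(Complex.I * (ϕ (lat x) ξ : ℝ))) = cis (-ϕ (lat x) ξ) := by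
    rw [cis]
    push_cast
    ring_nf
  have e1 : cis (-ϕ (lat x) ξ) * cis (ϕ (lat x) ξ) = 1 := by
    rw [← cis_add, neg_add_cancel, cis_zero]
  rw [e, fullOp, freeOp]
  have e2 : ∑' z, f z * Complex.exp (Complex.I * (ϕ (lat (x - z)) ξ : ℝ)) =
      cis (ϕ (lat x) ξ) *
        ∑' z, f z * Complex.exp (Complex.I * ((ϕ (lat x - lat z) ξ - ϕ (lat x) ξ : ℝ) : ℂ)) := by
    rw [cis_mul_tsum]
    exact tsum_congr fun z => by rw [lat_sub]; rfl
  change _ = cis (-ϕ (lat x) ξ) * (_ + (V (lat x) : ℂ) * cis (ϕ (lat x) ξ)) - _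
  rw [e2, mul_add, ← mul_assoc, e1, one_mul, mul_left_comm, e1, mul_one, symbol]

end Fourier

/-! ### Increments of symbols under lattice translations -/

section Translation

variable {N : ℕ} {J : Type*}

/-- The direction varies with the index, so its norm is kept in the weight: later it is a lattice
vector, and the growth in that vector must be tracked. -/
theorem Symb.dX_family {m : J → ℝ} {γ : ℝ} {Φ : J → E N × E N → ℝ} (h : Symb m γ Φ) (a : J → E N) :
    Symb (fun j => ‖a j‖ * m j) (γ - 1) (fun j => LatticeScattering.dX (a j) (Φ j)) := by
  refine ⟨fun j => contDiff_dX (h.smooth j) (a j), ?_⟩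
  have h1 := (h.jets.fderiv.clm (w := fun t => ‖a t.1‖)
    (fun t => ContinuousLinearMap.apply ℝ ℝ (a t.1, (0 : E N))) fun t => by
      refine ContinuousLinearMap.opNorm_le_bound _ (norm_nonneg _) fun A => ?_
      rw [ContinuousLinearMap.apply_apply, mul_comm]
      refine (A.le_opNorm _).trans_eq ?_
      simp [Prod.norm_def]).smul_weight (fun t => (bracket t.2.1)⁻¹)
  have h2 : (fun t : J × (E N × E N) => |(bracket t.2.1)⁻¹| * (‖a t.1‖ * (m t.1 * bracket t.2.1 ^ γ))) =
      fun t => ‖a t.1‖ * m t.1 * bracket t.2.1 ^ (γ - 1) := by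
    ext1 t
    have := bracket_pos t.2.1
    rw [abs_of_pos (by positivity), Real.rpow_sub_one this.ne']
    field_simp
  rw [h2] at h1
  refine h1.of_eventuallyEq fun t => Filter.Eventually.of_forall fun δ => ?_
  have hb := bracket_pos t.2.1
  simp only [ContinuousLinearMap.apply_apply]
  rw [fderiv_comp_shift (h.smooth t.1)]
  have : (bracket t.2.1 • a t.1, (0 : E N)) = bracket t.2.1 • (a t.1, (0 : E N)) := by simp
  rw [this, map_smul, smul_smul, inv_mul_cancel₀ hb.ne', one_smul]
  rfl

theorem Symb.norm_iteratedFDeriv_snd_le {m : J → ℝ} {γ : ℝ} {Φ : J → E N × E N → ℝ}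
    (h : Symb m γ Φ) (n : ℕ) : ∃ C, 0 ≤ C ∧ ∀ j x ξ,
      ‖iteratedFDeriv ℝ n (fun η => Φ j (x, η)) ξ‖ ≤ C * (m j * bracket x ^ γ) := by
  obtain ⟨C, hC, hb⟩ := (h.jets.comp_right (D := 1)
    (fun _ => ContinuousLinearMap.inr ℝ (E N) (E N))
    (fun _ => ContinuousLinearMap.norm_inr_le_one ℝ (E N) (E N))).bound n
  refine ⟨C, hC, fun j x ξ => ?_⟩
  have h1 := hb (j, x, ξ)
  simp only [shift, ContinuousLinearMap.inr_apply, smul_zero, add_zero] at h1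
  rw [iteratedFDeriv_comp_add_left (f := fun η => Φ j (x, η))] at h1
  simpa using h1

/-- Peetre's inequality raised to the power `s`; the restriction `s ≤ 2` allows one fixed power of
`⟨z⟩`. -/
theorem bracket_rpow_translate {s : ℝ} (hs : 0 ≤ s) (hs2 : s ≤ 2) (x : E N) {z w : E N}
    (hw : ‖w‖ ≤ ‖z‖) : bracket (x - w) ^ (-s) ≤ 4 * bracket z ^ 2 * bracket x ^ (-s) := by
  have hx := bracket_pos x
  have hxw := bracket_pos (x - w)
  have hz := one_le_bracket z
  have h1 : bracket x ≤ 2 * bracket z * bracket (x - w) := by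
    refine (bracket_le_mul x w).trans ?_
    nlinarith [bracket_mono hw]
  have h2 : bracket x ^ s ≤ (2 * bracket z) ^ (2 : ℝ) * bracket (x - w) ^ s := by
    refine (Real.rpow_le_rpow hx.le h1 hs).trans ?_
    rw [Real.mul_rpow (by linarith) hxw.le]
    exact mul_le_mul_of_nonneg_right (Real.rpow_le_rpow_of_exponent_le (by linarith) hs2)
      (Real.rpow_nonneg hxw.le _)
  rw [Real.rpow_two] at h2
  have p1 := Real.rpow_pos_of_pos hx s
  have p2 := Real.rpow_pos_of_pos hxw s
  rw [Real.rpow_neg hx.le, Real.rpow_neg hxw.le, ← div_eq_mul_inv, le_div_iff₀ p1,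
    inv_mul_le_iff₀ p2]
  linarith

theorem hasDerivAt_translate {Φ : E N × E N → ℝ} (h : ContDiff ℝ ∞ Φ) (x z η : E N) (σ : ℝ) :
    HasDerivAt (fun σ : ℝ => Φ (x - σ • z, η)) (dX (-z) Φ (x - σ • z, η)) σ := by
  have h1 : HasDerivAt (fun σ : ℝ => (x - σ • z, η)) ((-z, 0) : E N × E N) σ := by
    refine HasDerivAt.prodMk ?_ (hasDerivAt_const _ _)
    simpa using ((hasDerivAt_id σ).smul_const z).const_sub x
  exact ((h.differentiable (by simp)) (x - σ • z, η)).hasFDerivAt.comp_hasDerivAt σ h1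

theorem contDiff_segment_slice {Φ : E N × E N → ℝ} (h : ContDiff ℝ ∞ Φ) (x z : E N) :
    ContDiff ℝ ∞ (fun p : ℝ × E N => Φ (x - p.1 • z, p.2)) :=
  h.comp (by fun_prop)

theorem sub_eq_integral_dX {Φ : E N × E N → ℝ} (h : ContDiff ℝ ∞ Φ) (x z η : E N) :
    Φ (x - z, η) - Φ (x, η) = ∫ σ in (0 : ℝ)..1, dX (-z) Φ (x - σ • z, η) := by
  rw [intervalIntegral.integral_eq_sub_of_hasDerivAt
    (fun σ _ => hasDerivAt_translate h x z η σ)]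
  · simp
  · exact Continuous.intervalIntegrable ((contDiff_dX h (-z)).continuous.comp (by fun_prop)) _ _

theorem norm_smul_le_of_mem_Icc (z : E N) {σ : ℝ} (hσ : σ ∈ Set.Icc (0 : ℝ) 1) : ‖σ • z‖ ≤ ‖z‖ := by
  rw [norm_smul, Real.norm_of_nonneg hσ.1]
  exact mul_le_of_le_one_left (norm_nonneg _) hσ.2

/-- The increment is the integral of `dX (-z)` along the segment. It gains one order in `x`, at a
polynomial cost in `z` from comparing brackets along the segment. -/
theorem Symb.norm_iteratedFDeriv_translate_le {m : J → ℝ} {κ : ℝ} {Φ : J → E N × E N → ℝ}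
    (h : Symb m κ Φ) (hm : ∀ j, 0 ≤ m j) (h1 : κ ≤ 1) (h2 : -1 ≤ κ) (n : ℕ) :
    ∃ C, 0 ≤ C ∧ ∀ j z x ξ,
      ‖iteratedFDeriv ℝ n (fun η => Φ j (x - z, η) - Φ j (x, η)) ξ‖ ≤
        C * (m j * bracket z ^ 3 * bracket x ^ (κ - 1)) := by
  obtain ⟨C, hC, hb⟩ := ((h.reindex (fun t : J × E N => t.1)).dX_family
    (fun t => -t.2)).norm_iteratedFDeriv_snd_le n
  refine ⟨4 * C, by positivity, fun j z x ξ => ?_⟩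
  have e : (fun η => Φ j (x - z, η) - Φ j (x, η)) =
      fun η => ∫ σ in (0 : ℝ)..1, LatticeScattering.dX (-z) (Φ j) (x - σ • z, η) := by
    ext1 η
    exact sub_eq_integral_dX (h.smooth j) x z η
  rw [e]
  refine norm_iteratedFDeriv_integral_segment_le isOpen_univ isOpen_univ (fun _ _ _ _ => Set.mem_univ _)
    n (Set.mem_univ ξ) ℝ (fun p => LatticeScattering.dX (-z) (Φ j) (x - p.1 • z, p.2))
    (contDiff_segment_slice (contDiff_dX (h.smooth j) (-z)) x z).contDiffOn fun σ hσ => ?_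
  refine (hb (j, z) (x - σ • z) ξ).trans ?_
  have h3 := bracket_rpow_translate (s := 1 - κ) (by linarith) (by linarith) x
    (norm_smul_le_of_mem_Icc z hσ)
  rw [neg_sub] at h3
  have hz := bracket_pos z
  have hx := Real.rpow_nonneg (bracket_pos x).le (κ - 1)
  have hmj := hm j
  simp only [norm_neg]
  calc C * (‖z‖ * m j * bracket (x - σ • z) ^ (κ - 1))
      ≤ C * (bracket z * m j * (4 * bracket z ^ 2 * bracket x ^ (κ - 1))) := by
        gcongr
        · exact Real.rpow_nonneg (bracket_pos _).le _
        · exact norm_le_bracket z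
    _ = _ := by ring

/-- The Taylor remainder is the integral of increments of `dX (-z)`, a symbol of order `κ - 1`, so
the first-order estimate applies once more and gains a second order. -/
theorem Symb.norm_iteratedFDeriv_translate_sub_le {m : J → ℝ} {κ : ℝ} {Φ : J → E N × E N → ℝ}
    (h : Symb m κ Φ) (hm : ∀ j, 0 ≤ m j) (h1 : κ ≤ 1) (h2 : 0 ≤ κ) (n : ℕ) :
    ∃ C, 0 ≤ C ∧ ∀ j z x ξ,
      ‖iteratedFDeriv ℝ n (fun η => Φ j (x - z, η) - Φ j (x, η)
        - LatticeScattering.dX (-z) (Φ j) (x, η)) ξ‖ ≤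
        C * (m j * bracket z ^ 4 * bracket x ^ (κ - 2)) := by
  obtain ⟨C, hC, hb⟩ := ((h.reindex (fun t : J × E N => t.1)).dX_family
    (fun t => -t.2)).norm_iteratedFDeriv_translate_le
      (fun t => mul_nonneg (norm_nonneg _) (hm t.1)) (by linarith) (by linarith) n
  refine ⟨C, hC, fun j z x ξ => ?_⟩
  have hd := contDiff_dX (h.smooth j) (-z)
  have e : (fun η => Φ j (x - z, η) - Φ j (x, η) - LatticeScattering.dX (-z) (Φ j) (x, η)) =
      fun η => ∫ σ in (0 : ℝ)..1, (LatticeScattering.dX (-z) (Φ j) (x - σ • z, η) -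
        LatticeScattering.dX (-z) (Φ j) (x, η)) := by
    ext1 η
    have hi : IntervalIntegrable (fun σ : ℝ => LatticeScattering.dX (-z) (Φ j) (x - σ • z, η))
        volume 0 1 := Continuous.intervalIntegrable (hd.continuous.comp (by fun_prop)) _ _
    rw [intervalIntegral.integral_sub hi intervalIntegrable_const,
      sub_eq_integral_dX (h.smooth j) x z η]
    simp
  rw [e]
  refine norm_iteratedFDeriv_integral_segment_le isOpen_univ isOpen_univ (fun _ _ _ _ => Set.mem_univ _)
    n (Set.mem_univ ξ) ℝ (fun p => LatticeScattering.dX (-z) (Φ j) (x - p.1 • z, p.2) -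
      LatticeScattering.dX (-z) (Φ j) (x, p.2))
    ((contDiff_segment_slice hd x z).sub (hd.comp (by fun_prop))).contDiffOn fun σ hσ => ?_
  refine (hb (j, z) (σ • z) x ξ).trans ?_
  have hz := bracket_pos z
  have hz' := bracket_pos (σ • z)
  have hx := Real.rpow_nonneg (bracket_pos x).le (κ - 2)
  have hmj := hm j
  simp only [norm_neg, show κ - 1 - 1 = κ - 2 by ring]
  calc C * (‖z‖ * m j * bracket (σ • z) ^ 3 * bracket x ^ (κ - 2))
      ≤ C * (bracket z * m j * bracket z ^ 3 * bracket x ^ (κ - 2)) := by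
        gcongr
        · exact norm_le_bracket z
        · exact bracket_mono (norm_smul_le_of_mem_Icc z hσ)
    _ = _ := by ring

/-- In the variable `u = w (η - ξ)` the derivatives of order at least one of both exponents are
bounded uniformly, so `JetBdd.comp_sub` applies. Returning to `η` costs the factor `w ^ n`. -/
theorem exists_iteratedFDeriv_cis_sub_le {F₁ F₂ : J → E N → ℝ} (hs₁ : ∀ j, ContDiff ℝ ∞ (F₁ j))
    (hs₂ : ∀ j, ContDiff ℝ ∞ (F₂ j)) {w m : J → ℝ} {ξ : J → E N} (hw : ∀ j, 1 ≤ w j)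
    (h₁ : ∀ n, 1 ≤ n → ∃ C, 0 ≤ C ∧ ∀ j, ‖iteratedFDeriv ℝ n (F₁ j) (ξ j)‖ ≤ C * w j)
    (h₂ : ∀ n, 1 ≤ n → ∃ C, 0 ≤ C ∧ ∀ j, ‖iteratedFDeriv ℝ n (F₂ j) (ξ j)‖ ≤ C * w j)
    (hD : ∀ n, ∃ C, 0 ≤ C ∧ ∀ j, ‖iteratedFDeriv ℝ n (fun η => F₁ j η - F₂ j η) (ξ j)‖ ≤ C * m j)
    (n : ℕ) : ∃ C, 0 ≤ C ∧ ∀ j,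
      ‖iteratedFDeriv ℝ n (fun η => cis (F₁ j η) - cis (F₂ j η)) (ξ j)‖ ≤ C * (w j ^ n * m j) := by
  have hs : ∀ {F' : Type} [NormedAddCommGroup F'] [NormedSpace ℝ F'] {F : E N → F'} (j),
      ContDiff ℝ ∞ F → ContDiff ℝ ∞ fun u => F (ξ j + (w j)⁻¹ • u) := fun j hF =>
    hF.comp (by fun_prop)
  have hw0 : ∀ j, 0 < w j := fun j => zero_lt_one.trans_le (hw j)
  have hscale : ∀ F : J → E N → ℝ, (∀ j, ContDiff ℝ ∞ (F j)) →
      (∀ n, 1 ≤ n → ∃ C, 0 ≤ C ∧ ∀ j, ‖iteratedFDeriv ℝ n (F j) (ξ j)‖ ≤ C * w j) →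
      ∀ n, 1 ≤ n → ∃ C, ∀ j, ‖iteratedFDeriv ℝ n (fun u => F j (ξ j + (w j)⁻¹ • u)) 0‖ ≤ C := by
    intro F hF hb n hn
    obtain ⟨C, hC0, hC⟩ := hb n hn
    refine ⟨C, fun j => ?_⟩
    have hj := hw0 j
    rw [iteratedFDeriv_comp_add_smul (hF j), norm_smul, norm_pow, norm_inv,
      Real.norm_of_nonneg hj.le, smul_zero, add_zero]
    have h3 : (w j)⁻¹ ^ n ≤ (w j)⁻¹ := by
      have := pow_le_pow_of_le_one (inv_nonneg.2 hj.le) (inv_le_one_of_one_le₀ (hw j)) hn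
      rwa [pow_one] at this
    calc (w j)⁻¹ ^ n * ‖iteratedFDeriv ℝ n (F j) (ξ j)‖ ≤ (w j)⁻¹ * (C * w j) := by
          gcongr
          exact hC j
      _ = C := by field_simp
  have hD' : JetBdd m (fun j u => F₁ j (ξ j + (w j)⁻¹ • u) - F₂ j (ξ j + (w j)⁻¹ • u)) := by
    refine ⟨fun j => ((hs j (hs₁ j)).sub (hs j (hs₂ j))).contDiffAt, fun n => ?_⟩
    obtain ⟨C, hC0, hC⟩ := hD n
    refine ⟨C, hC0, fun j => ?_⟩
    have hj := hw0 j
    rw [iteratedFDeriv_comp_add_smul (f := fun η => F₁ j η - F₂ j η) ((hs₁ j).sub (hs₂ j)),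
      norm_smul, norm_pow, norm_inv, Real.norm_of_nonneg hj.le, smul_zero, add_zero]
    exact (mul_le_of_le_one_left (norm_nonneg _) (pow_le_one₀ (inv_nonneg.2 hj.le)
      (inv_le_one_of_one_le₀ (hw j)))).trans (hC j)
  obtain ⟨C, hC0, hC⟩ := (JetBdd.comp_sub (fun j => (hs j (hs₁ j)).contDiffAt)
    (fun j => (hs j (hs₂ j)).contDiffAt) (hscale F₁ hs₁ h₁) (hscale F₂ hs₂ h₂) hD' contDiff_cis
    fun n => ⟨1, norm_iteratedFDeriv_cis_le n⟩).bound n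
  refine ⟨C, hC0, fun j => ?_⟩
  have h3 := hC j
  have hj := hw0 j
  rw [iteratedFDeriv_comp_add_smul (f := fun η => cis (F₁ j η) - cis (F₂ j η))
    ((contDiff_cis.comp (hs₁ j)).sub (contDiff_cis.comp (hs₂ j))), norm_smul, norm_pow, norm_inv,
    Real.norm_of_nonneg hj.le, smul_zero, add_zero, inv_pow, inv_mul_le_iff₀ (by positivity)] at h3
  linarith

theorem norm_iteratedFDeriv_clm_le {F' : Type*} [NormedAddCommGroup F'] [NormedSpace ℝ F']
    (L : E N →L[ℝ] F') {n : ℕ} (hn : 1 ≤ n) (ξ : E N) : ‖iteratedFDeriv ℝ n L ξ‖ ≤ ‖L‖ := by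
  obtain ⟨n, rfl⟩ := Nat.exists_eq_add_of_le' hn
  rw [← norm_iteratedFDeriv_fderiv, show fderiv ℝ L = fun _ => L from funext fun _ => L.fderiv]
  rcases Nat.eq_zero_or_pos n with rfl | hn
  · simp
  · rw [iteratedFDeriv_const_of_ne hn.ne']
    simp

theorem norm_iteratedFDeriv_listDeriv_le {F : Type*} [NormedAddCommGroup F] [NormedSpace ℝ F]
    (l : List (Fin N)) {g : E N → F} (hg : ContDiff ℝ ∞ g) (n : ℕ) (x : E N) :
    ‖iteratedFDeriv ℝ n (listDeriv l g) x‖ ≤ ‖iteratedFDeriv ℝ (n + l.length) g x‖ := by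
  induction l generalizing n with
  | nil => rfl
  | cons j l ih =>
    have h1 := contDiff_listDeriv hg l
    have h2 : listDeriv (j :: l) g = fun x =>
        ContinuousLinearMap.apply ℝ F (EuclideanSpace.single j (1 : ℝ)) (fderiv ℝ (listDeriv l g) x) := rfl
    rw [h2]
    have h3 := (ContinuousLinearMap.apply ℝ F
      (EuclideanSpace.single j (1 : ℝ))).norm_iteratedFDeriv_comp_left (N := ∞) (n := n) (x := x)
      (h1.fderiv_right (m := ∞) (by simp)).contDiffAt (by exact_mod_cast le_top)
    refine h3.trans ?_
    rw [norm_iteratedFDeriv_fderiv]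
    have h4 : ‖ContinuousLinearMap.apply ℝ F (EuclideanSpace.single j (1 : ℝ) : E N)‖ ≤ 1 := by
      refine ContinuousLinearMap.opNorm_le_bound _ zero_le_one fun A => ?_
      rw [ContinuousLinearMap.apply_apply, one_mul]
      refine (A.le_opNorm _).trans_eq ?_
      simp
    refine (mul_le_of_le_one_left (norm_nonneg _) h4).trans ((ih (n + 1)).trans_eq ?_)
    rw [List.length_cons, show n + 1 + l.length = n + (l.length + 1) by omega]

/-- A multi-index derivative is bounded by the full derivative of the same order. -/
theorem exists_norm_multiDeriv_le {F : Type*} [NormedAddCommGroup F] [NormedSpace ℝ F]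
    (β : Fin N → ℕ) : ∃ n, ∀ g : E N → F, ContDiff ℝ ∞ g → ∀ x,
      ‖multiDeriv β g x‖ ≤ ‖iteratedFDeriv ℝ n g x‖ := by
  refine ⟨((List.finRange N).flatMap fun j => List.replicate (β j) j).length, fun g hg x => ?_⟩
  rw [multiDeriv_eq_listDeriv]
  have := norm_iteratedFDeriv_listDeriv_le
    ((List.finRange N).flatMap fun j => List.replicate (β j) j) hg 0 x
  rwa [norm_iteratedFDeriv_zero, zero_add] at this

end Translation

/-! ### The symbol as a lattice series -/

section SymbolSeries

variable {N : ℕ} {f : Lattice N → ℂ} {V : E N → ℝ} {ε : ℝ} {γ : E N × E N → ℝ}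

theorem norm_iteratedFDeriv_add_le {X F : Type*} [NormedAddCommGroup X] [NormedSpace ℝ X]
    [NormedAddCommGroup F] [NormedSpace ℝ F] {A B : X → F} (hA : ContDiff ℝ ∞ A)
    (hB : ContDiff ℝ ∞ B) (n : ℕ) (x : X) :
    ‖iteratedFDeriv ℝ n (fun x => A x + B x) x‖ ≤
      ‖iteratedFDeriv ℝ n A x‖ + ‖iteratedFDeriv ℝ n B x‖ := by
  rw [show (fun x => A x + B x) = A + B from rfl,
    iteratedFDeriv_add_apply (hA.of_le (by exact_mod_cast le_top)).contDiffAt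
      (hB.of_le (by exact_mod_cast le_top)).contDiffAt]
  exact norm_add_le _ _

theorem contDiff_neg_dot (z : E N) : ContDiff ℝ ∞ (fun η : E N => -dot z η) := by
  unfold dot
  exact (contDiff_const.inner ℝ contDiff_id).neg

theorem norm_iteratedFDeriv_neg_dot_le (z : E N) {n : ℕ} (hn : 1 ≤ n) (ξ : E N) :
    ‖iteratedFDeriv ℝ n (fun η : E N => -dot z η) ξ‖ ≤ bracket z := by
  have e : (fun η : E N => -dot z η) = (-innerSL ℝ z : E N →L[ℝ] ℝ) := by
    ext1 η
    simp [dot]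
  rw [e]
  refine (norm_iteratedFDeriv_clm_le _ hn ξ).trans ?_
  rw [norm_neg, innerSL_apply_norm]
  exact norm_le_bracket z

/-- The increment of the phase `x·ξ + γ` under a lattice translation. -/
def phaseStep (γ : E N × E N → ℝ) (z x η : E N) : ℝ := γ (x - z, η) - γ (x, η) + -dot z η

/-- The linearized increment of the phase `x·ξ + γ` under a lattice translation. -/
def linearStep (γ : E N × E N → ℝ) (z x η : E N) : ℝ := dX (-z) γ (x, η) + -dot z η

theorem contDiff_slice {γ : E N × E N → ℝ} (hγ : ContDiff ℝ ∞ γ) (x : E N) :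
    ContDiff ℝ ∞ (fun η => γ (x, η)) := hγ.comp (by fun_prop)

theorem contDiff_phaseStep (hγ : ContDiff ℝ ∞ γ) (z x : E N) : ContDiff ℝ ∞ (phaseStep γ z x) :=
  ((contDiff_slice hγ _).sub (contDiff_slice hγ _)).add (contDiff_neg_dot z)

theorem contDiff_linearStep (hγ : ContDiff ℝ ∞ γ) (z x : E N) : ContDiff ℝ ∞ (linearStep γ z x) :=
  (contDiff_slice (contDiff_dX hγ _) _).add (contDiff_neg_dot z)

theorem bracket_rpow_le_one (x : E N) {s : ℝ} (hs : s ≤ 0) : bracket x ^ s ≤ 1 :=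
  Real.rpow_le_one_of_one_le_of_nonpos (one_le_bracket x) hs

theorem exists_phaseStep_le (hε0 : 0 < ε) (hε1 : ε < 1)
    (hγ : Symb (fun _ : Unit => 1) (1 - ε) (fun _ => γ)) {n : ℕ} (hn : 1 ≤ n) :
    ∃ C, 0 ≤ C ∧ ∀ z x ξ, ‖iteratedFDeriv ℝ n (phaseStep γ z x) ξ‖ ≤ C * bracket z ^ 3 := by
  obtain ⟨C, hC0, hC⟩ := hγ.norm_iteratedFDeriv_translate_le (fun _ => zero_le_one) (by linarith)
    (by linarith) n
  refine ⟨C + 1, by positivity, fun z x ξ => ?_⟩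
  have hs := hγ.smooth ()
  refine (norm_iteratedFDeriv_add_le ((contDiff_slice hs _).sub (contDiff_slice hs _))
    (contDiff_neg_dot z) n ξ).trans ?_
  have h1 := hC () z x ξ
  have h2 := norm_iteratedFDeriv_neg_dot_le z hn ξ
  have hz := one_le_bracket z
  have h3 : bracket z ≤ bracket z ^ 3 := le_self_pow₀ hz (by norm_num)
  have h4 := bracket_rpow_le_one x (s := 1 - ε - 1) (by linarith)
  have h5 : C * (1 * bracket z ^ 3 * bracket x ^ (1 - ε - 1)) ≤ C * (1 * bracket z ^ 3 * 1) := by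
    gcongr
  linarith

theorem exists_linearStep_le (hε0 : 0 < ε)
    (hγ : Symb (fun _ : Unit => 1) (1 - ε) (fun _ => γ)) {n : ℕ} (hn : 1 ≤ n) :
    ∃ C, 0 ≤ C ∧ ∀ z x ξ, ‖iteratedFDeriv ℝ n (linearStep γ z x) ξ‖ ≤ C * bracket z ^ 3 := by
  obtain ⟨C, hC0, hC⟩ := ((hγ.reindex (fun _ : E N => ())).dX_family
    (fun z => -z)).norm_iteratedFDeriv_snd_le n
  refine ⟨C + 1, by positivity, fun z x ξ => ?_⟩
  have hs := hγ.smooth ()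
  refine (norm_iteratedFDeriv_add_le (contDiff_slice (contDiff_dX hs _) _)
    (contDiff_neg_dot z) n ξ).trans ?_
  have h1 := hC z x ξ
  have h2 := norm_iteratedFDeriv_neg_dot_le z hn ξ
  have hz := one_le_bracket z
  have h3 : bracket z ≤ bracket z ^ 3 := le_self_pow₀ hz (by norm_num)
  have h4 := bracket_rpow_le_one x (s := 1 - ε - 1) (by linarith)
  have h5 : C * (‖-z‖ * 1 * bracket x ^ (1 - ε - 1)) ≤ C * (bracket z ^ 3 * 1 * 1) := by
    rw [norm_neg]
    have := (norm_le_bracket z).trans h3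
    have := Real.rpow_nonneg (bracket_pos x).le (1 - ε - 1)
    gcongr
  linarith

/-- The exponents differ by an increment of `γ`, which is of order `-ε` in `x` and polynomial in
`z`. -/
theorem exists_cis_phaseStep_sub_latChar_le (hε0 : 0 < ε) (hε1 : ε < 1)
    (hγ : Symb (fun _ : Unit => 1) (1 - ε) (fun _ => γ)) (n : ℕ) :
    ∃ (C : ℝ) (d : ℕ), 0 ≤ C ∧ ∀ (z : Lattice N) (x ξ : E N),
      ‖iteratedFDeriv ℝ n (fun η => cis (phaseStep γ (lat z) x η) - latChar z η) ξ‖ ≤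
        C * bracket x ^ (-ε) * bracket (lat z) ^ d := by
  have hs := hγ.smooth ()
  obtain ⟨C, hC0, hC⟩ := exists_iteratedFDeriv_cis_sub_le (J := Lattice N × E N × E N)
    (F₁ := fun t => phaseStep γ (lat t.1) t.2.1) (F₂ := fun t η => -dot (lat t.1) η)
    (w := fun t => bracket (lat t.1) ^ 3) (ξ := fun t => t.2.2)
    (m := fun t => 1 * bracket (lat t.1) ^ 3 * bracket t.2.1 ^ (1 - ε - 1))
    (fun t => contDiff_phaseStep hs _ _) (fun t => contDiff_neg_dot _)
    (fun t => one_le_pow₀ (one_le_bracket _))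
    (fun n hn => by
      obtain ⟨C, hC0, hC⟩ := exists_phaseStep_le hε0 hε1 hγ hn
      exact ⟨C, hC0, fun t => hC _ _ _⟩)
    (fun n hn => ⟨1, zero_le_one, fun t => (norm_iteratedFDeriv_neg_dot_le _ hn _).trans (by
      rw [one_mul]
      exact le_self_pow₀ (one_le_bracket _) (by norm_num))⟩)
    (fun n => by
      obtain ⟨C, hC0, hC⟩ := hγ.norm_iteratedFDeriv_translate_le (fun _ => zero_le_one)
        (by linarith) (by linarith) n
      refine ⟨C, hC0, fun t => ?_⟩
      simp only [phaseStep, add_sub_cancel_right]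
      exact hC () (lat t.1) t.2.1 t.2.2) n
  refine ⟨C, 3 * n + 3, hC0, fun z x ξ => (hC (z, x, ξ)).trans_eq ?_⟩
  simp only
  rw [show 1 - ε - 1 = -ε by ring]
  ring

/-- The exponents differ by the second-order remainder of `γ`, of order `-1 - ε` in `x`. -/
theorem exists_cis_phaseStep_sub_linearStep_le (hε0 : 0 < ε) (hε1 : ε < 1)
    (hγ : Symb (fun _ : Unit => 1) (1 - ε) (fun _ => γ)) (n : ℕ) :
    ∃ (C : ℝ) (d : ℕ), 0 ≤ C ∧ ∀ (z : Lattice N) (x ξ : E N),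
      ‖iteratedFDeriv ℝ n (fun η => cis (phaseStep γ (lat z) x η) -
        cis (linearStep γ (lat z) x η)) ξ‖ ≤ C * bracket x ^ (-1 - ε) * bracket (lat z) ^ d := by
  have hs := hγ.smooth ()
  obtain ⟨C, hC0, hC⟩ := exists_iteratedFDeriv_cis_sub_le (J := Lattice N × E N × E N)
    (F₁ := fun t => phaseStep γ (lat t.1) t.2.1) (F₂ := fun t => linearStep γ (lat t.1) t.2.1)
    (w := fun t => bracket (lat t.1) ^ 3) (ξ := fun t => t.2.2)
    (m := fun t => 1 * bracket (lat t.1) ^ 4 * bracket t.2.1 ^ (1 - ε - 2))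
    (fun t => contDiff_phaseStep hs _ _) (fun t => contDiff_linearStep hs _ _)
    (fun t => one_le_pow₀ (one_le_bracket _))
    (fun n hn => by
      obtain ⟨C, hC0, hC⟩ := exists_phaseStep_le hε0 hε1 hγ hn
      exact ⟨C, hC0, fun t => hC _ _ _⟩)
    (fun n hn => by
      obtain ⟨C, hC0, hC⟩ := exists_linearStep_le hε0 hγ hn
      exact ⟨C, hC0, fun t => hC _ _ _⟩)
    (fun n => by
      obtain ⟨C, hC0, hC⟩ := hγ.norm_iteratedFDeriv_translate_sub_le (fun _ => zero_le_one)
        (by linarith) (by linarith) n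
      refine ⟨C, hC0, fun t => ?_⟩
      simp only [phaseStep, linearStep, add_sub_add_right_eq_sub]
      exact hC () (lat t.1) t.2.1 t.2.2) n
  refine ⟨C, 3 * n + 4, hC0, fun z x ξ => (hC (z, x, ξ)).trans_eq ?_⟩
  simp only
  rw [show 1 - ε - 2 = -1 - ε by ring]
  ring

theorem symbol_eq_tsum_phaseStep {ϕ : E N → E N → ℝ} (hϕ : ∀ x ξ, ϕ x ξ = γ (x, ξ) + dot x ξ)
    (x ξ : E N) :
    symbol f V ϕ x ξ = (∑' z, f z * cis (phaseStep γ (lat z) x ξ)) + (V x : ℂ) - (h0 f ξ : ℂ) := by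
  rw [symbol]
  congr 2
  refine tsum_congr fun z => ?_
  rw [cis]
  congr 4
  rw [hϕ, hϕ, phaseStep]
  simp only [dot, inner_sub_left]
  ring

/-- Expanding `h₀` as a series cancels the free part of every term and leaves only small
differences. -/
theorem symbol_eq_tsum_sub_latChar (hf : IsHoppingFunction f) {ϕ : E N → E N → ℝ}
    (hϕ : ∀ x ξ, ϕ x ξ = γ (x, ξ) + dot x ξ) (x ξ : E N) :
    symbol f V ϕ x ξ =
      (∑' z, f z * (cis (phaseStep γ (lat z) x ξ) - latChar z ξ)) + (V x : ℂ) := by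
  rw [symbol_eq_tsum_phaseStep hϕ, h0_eq_series hf]
  simp only [mul_sub]
  rw [(hf.summable_mul fun z => (norm_cis _).le).tsum_sub
    (hf.summable_mul fun z => (norm_latChar z ξ).le)]
  ring

theorem contDiff_symbol (hf : IsHoppingFunction f) (hε0 : 0 < ε) (hε1 : ε < 1)
    (hγ : Symb (fun _ : Unit => 1) (1 - ε) (fun _ => γ)) {ϕ : E N → E N → ℝ}
    (hϕ : ∀ x ξ, ϕ x ξ = γ (x, ξ) + dot x ξ) (x : E N) : ContDiff ℝ ∞ (symbol f V ϕ x) := by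
  rw [show symbol f V ϕ x = _ from funext fun ξ => symbol_eq_tsum_sub_latChar hf hϕ x ξ]
  refine (contDiff_hopSeries hf (fun z => (contDiff_cis.comp
    (contDiff_phaseStep (hγ.smooth ()) _ x)).sub (contDiff_latChar z)) fun n => ?_).add contDiff_const
  obtain ⟨C, d, -, hC⟩ := exists_cis_phaseStep_sub_latChar_le hε0 hε1 hγ n
  exact ⟨C * bracket x ^ (-ε), d, fun z ξ => hC z x ξ⟩

theorem norm_iteratedFDeriv_const_le {X F : Type*} [NormedAddCommGroup X] [NormedSpace ℝ X]
    [NormedAddCommGroup F] [NormedSpace ℝ F] (c : F) (n : ℕ) (x : X) :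
    ‖iteratedFDeriv ℝ n (fun _ : X => c) x‖ ≤ ‖c‖ := by
  rcases Nat.eq_zero_or_pos n with rfl | hn
  · simp
  · rw [iteratedFDeriv_const_of_ne hn.ne']
    simp

theorem exists_iteratedFDeriv_symbol_le (hf : IsHoppingFunction f) (hε0 : 0 < ε) (hε1 : ε < 1)
    (hV : IsLongRange ε V) (hγ : Symb (fun _ : Unit => 1) (1 - ε) (fun _ => γ)) {ϕ : E N → E N → ℝ}
    (hϕ : ∀ x ξ, ϕ x ξ = γ (x, ξ) + dot x ξ) (n : ℕ) :
    ∃ C, 0 ≤ C ∧ ∀ x ξ, ‖iteratedFDeriv ℝ n (symbol f V ϕ x) ξ‖ ≤ C * bracket x ^ (-ε) := by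
  obtain ⟨C, d, hC0, hC⟩ := exists_cis_phaseStep_sub_latChar_le hε0 hε1 hγ n
  obtain ⟨D, hD⟩ := hV.iteratedFDeriv_le 0
  simp only [norm_iteratedFDeriv_zero, Nat.cast_zero, neg_zero, zero_sub] at hD
  have hS : 0 ≤ ∑' z, bracket (lat z) ^ d * ‖f z‖ :=
    tsum_nonneg fun z => mul_nonneg (pow_nonneg (bracket_pos _).le _) (norm_nonneg _)
  refine ⟨(∑' z, bracket (lat z) ^ d * ‖f z‖) * C + |D|, by positivity, fun x ξ => ?_⟩
  have hA : ∀ z, ContDiff ℝ ∞ fun η => cis (phaseStep γ (lat z) x η) - latChar z η := fun z =>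
    (contDiff_cis.comp (contDiff_phaseStep (hγ.smooth ()) _ x)).sub (contDiff_latChar z)
  have hb : ∀ n : ℕ, ∃ (C : ℝ) (d : ℕ), ∀ (z : Lattice N) ξ, ‖iteratedFDeriv ℝ n
      (fun η => cis (phaseStep γ (lat z) x η) - latChar z η) ξ‖ ≤ C * bracket (lat z) ^ d := fun n => by
    obtain ⟨C, d, -, hC⟩ := exists_cis_phaseStep_sub_latChar_le hε0 hε1 hγ n
    exact ⟨C * bracket x ^ (-ε), d, fun z ξ => hC z x ξ⟩
  rw [show symbol f V ϕ x = _ from funext fun ξ => symbol_eq_tsum_sub_latChar hf hϕ x ξ]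
  refine (norm_iteratedFDeriv_add_le (contDiff_hopSeries hf hA hb) contDiff_const n ξ).trans ?_
  rw [add_mul, mul_assoc]
  refine add_le_add (norm_iteratedFDeriv_hopSeries_le hf hA hb fun z => hC z x ξ) ?_
  refine (norm_iteratedFDeriv_const_le _ n ξ).trans ?_
  rw [Complex.norm_real]
  exact (hD x).trans (mul_le_mul_of_nonneg_right (le_abs_self D)
    (Real.rpow_nonneg (bracket_pos x).le _))

theorem linearStep_eq (hγ : ContDiff ℝ ∞ γ) (z x ξ : E N) :
    linearStep γ z x ξ = -dot z (ξ + gradient (fun y => γ (y, ξ)) x) := by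
  have hs : ContDiff ℝ ∞ fun y => γ (y, ξ) := hγ.comp (by fun_prop)
  rw [linearStep, dX_eq_fderiv hγ, dot, dot, inner_add_right, map_neg,
    (hasGradientAt_of_contDiff hs x).hasFDerivAt.fderiv, InnerProductSpace.toDual_apply_apply,
    real_inner_comm]
  ring

/-- The linearised exponent is `-z · (ξ + ∇_x γ)`, so its series sums to `h₀` at the gradient of the
phase. What remains besides the small differences is the error in the eikonal equation. -/
theorem symbol_eq_tsum_sub_linearStep (hf : IsHoppingFunction f) (hγ : ContDiff ℝ ∞ γ)
    {ϕ : E N → E N → ℝ} (hϕ : ∀ x ξ, ϕ x ξ = γ (x, ξ) + dot x ξ) (x ξ : E N) :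
    symbol f V ϕ x ξ =
      (∑' z, f z * (cis (phaseStep γ (lat z) x ξ) - cis (linearStep γ (lat z) x ξ))) +
        ((h0 f (ξ + gradient (fun y => γ (y, ξ)) x) + V x - h0 f ξ : ℝ) : ℂ) := by
  rw [symbol_eq_tsum_phaseStep hϕ]
  push_cast
  rw [h0_eq_series hf (ξ + gradient (fun y => γ (y, ξ)) x)]
  simp only [mul_sub]
  rw [(hf.summable_mul fun z => (norm_cis _).le).tsum_sub (hf.summable_mul fun z => (norm_cis _).le)]
  simp only [linearStep_eq hγ, latChar]
  ring

end SymbolSeries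

/-! ### The remainder in the outgoing and incoming regions -/

section Remainder

variable {N : ℕ} {f : Lattice N → ℂ} {χ : E N → ℝ} {g V : E N → ℝ} {ε c : ℝ}
  {G : E N × E N → ℝ}

/-- The sphere of radius `2` is reached by continuity along rays. It matters because the symbol
estimate includes the points with `‖v‖ = 2a`, in every neighbourhood of which the cut-off may differ
from `1`. -/
theorem iteratedFDeriv_cutoff_eq_zero_of_le (hχ : ContDiff ℝ ∞ χ) (hχ1 : ∀ x, 2 ≤ ‖x‖ → χ x = 1)
    {n : ℕ} (hn : 1 ≤ n) {x : E N} (hx : 2 ≤ ‖x‖) : iteratedFDeriv ℝ n χ x = 0 := by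
  have hc : Continuous fun t : ℝ => iteratedFDeriv ℝ n χ (t • x) :=
    (hχ.continuous_iteratedFDeriv (by exact_mod_cast le_top)).comp (by fun_prop)
  have h1 : Set.EqOn (fun t : ℝ => iteratedFDeriv ℝ n χ (t • x)) (fun _ => 0) (Set.Ioi 1) := by
    intro t ht
    refine iteratedFDeriv_cutoff_eq_zero hχ1 hn ?_
    have ht' : 1 < t := ht
    rw [norm_smul, Real.norm_of_nonneg (by linarith)]
    nlinarith
  have h2 := h1.closure hc continuous_const
  rw [closure_Ioi] at h2
  simpa using h2 (Set.mem_Ici.2 le_rfl)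

/-- The gradient in position of a function of position and momentum. -/
def gradX (G : E N × E N → ℝ) (p : E N × E N) : E N := gradient (fun y => G (y, p.2)) p.1

theorem contDiffAt_gradX {p : E N × E N} (h : ContDiffAt ℝ ∞ G p) : ContDiffAt ℝ ∞ (gradX G) p := by
  have h1 : ∀ᶠ q in nhds p, gradX G q =
      gradCLM ((fderiv ℝ G q).comp (ContinuousLinearMap.inl ℝ (E N) (E N))) := by
    filter_upwards [(h.of_le (m := 1) (by exact_mod_cast le_top)).eventually (by simp)] with q hq
    have h2 := (hq.differentiableAt (by simp)).hasFDerivAt.comp (f := fun x : E N => (x, q.2)) q.1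
      (hasFDerivAt_prodMk_left q.1 q.2)
    rw [gradX, ← h2.fderiv]
    rfl
  refine ContDiffAt.congr_of_eventuallyEq ?_ h1
  exact gradCLM.contDiff.contDiffAt.comp p ((h.fderiv_right (m := ∞) (by simp)).clm_comp contDiffAt_const)

theorem iteratedFDeriv_eq_zero_of_jet {F : Type*} [NormedAddCommGroup F] [NormedSpace ℝ F]
    {e : E N → F} {ξ : E N} (h : JetBdd (fun _ : Unit => 0) (fun _ u => e (ξ + u))) (n : ℕ) :
    iteratedFDeriv ℝ n e ξ = 0 := by
  obtain ⟨C, -, hC⟩ := h.bound n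
  have h1 := hC ()
  rw [iteratedFDeriv_comp_add_left, mul_zero, add_zero] at h1
  exact norm_le_zero_iff.1 h1

/-- The function by which the cut-off correction violates the eikonal equation has no jet at the
points of the incoming and outgoing regions. -/
theorem ScatteringHyp.iteratedFDeriv_eikonal_eq_zero (h : ScatteringHyp χ g V ε)
    (hG : IsCorrection χ g V ε c G) {a R : ℝ} (ha : 0 < a)
    (hR : ∀ p : E N × E N, R ≤ ‖p.1‖ → a ≤ ‖gradient g p.2‖ →
      3 / 8 < |cosAngle p.1 (gradient g p.2)| →
      g (p.2 + gradient (fun y => G (y, p.2)) p.1) + V p.1 = g p.2)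
    {x ξ : E N} (hx1 : 1 ≤ ‖x‖) (hx : R ≤ ‖x‖) (hξ : 2 * a ≤ ‖gradient g ξ‖)
    (hcos : 1 / 2 ≤ |cosAngle x (gradient g ξ)|) (n : ℕ) :
    iteratedFDeriv ℝ n (fun η => g (η + gradient
      (fun y => χ (a⁻¹ • gradient g η) * G (y, η)) x) + V x - g η) ξ = 0 := by
  have hgs := h.g_smooth
  have hv : ContDiff ℝ ∞ (gradient g) := contDiff_gradient hgs
  have hvc := hv.continuous
  have hsh : ContDiff ℝ ∞ fun u : E N => ξ + u := by fun_prop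
  have hv0 : gradient g ξ ≠ 0 := norm_pos_iff.1 (by linarith)
  have hx0 : x ≠ 0 := norm_pos_iff.1 (by linarith)
  have hopen : IsOpen {p : E N × E N | gradient g p.2 ≠ 0} :=
    isOpen_ne_fun (hvc.comp continuous_snd) continuous_const
  have hGat : ∀ p : E N × E N, gradient g p.2 ≠ 0 → ContDiffAt ℝ ∞ G p := fun p hp =>
    hG.smooth.contDiffAt (hopen.mem_nhds hp)
  have hT : Filter.Tendsto (fun u : E N => ξ + u) (nhds 0) (nhds ξ) := by
    simpa using hsh.continuous.tendsto (0 : E N)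
  have hgrad : ContDiffAt ℝ ∞ (fun u => gradX G (x, ξ + u)) 0 := by
    refine ContDiffAt.comp (0 : E N) (g := gradX G) (f := fun u => (x, ξ + u)) ?_
      (contDiff_const.prodMk hsh).contDiffAt
    refine contDiffAt_gradX (hGat _ ?_)
    simpa using hv0
  have hγ : ContDiff ℝ ∞ fun p : E N × E N => χ (a⁻¹ • gradient g p.2) * G p := (hG.symb a ha).smooth ()
  have hgradγ : ContDiffAt ℝ ∞
      (fun u => gradX (fun p => χ (a⁻¹ • gradient g p.2) * G p) (x, ξ + u)) 0 :=
    ContDiffAt.comp (0 : E N) (g := gradX _) (f := fun u => (x, ξ + u))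
      (contDiffAt_gradX hγ.contDiffAt) (contDiff_const.prodMk hsh).contDiffAt
  have hev0 : ∀ᶠ η in nhds ξ, gradient g η ≠ 0 :=
    (isOpen_ne_fun hvc continuous_const).mem_nhds hv0
  -- A jet bound with weight zero says that all derivatives at the point vanish: the cut-off agrees
  -- with `1` to infinite order there.
  have hcut : JetBdd (fun _ : Unit => (0 : ℝ)) fun _ u => χ (a⁻¹ • gradient g (ξ + u)) - 1 := by
    have hw : ContDiff ℝ ∞ fun u => a⁻¹ • gradient g (ξ + u) := (hv.comp hsh).const_smul a⁻¹
    refine JetBdd.comp' (K := fun _ y => χ y - 1) (G := fun _ u => a⁻¹ • gradient g (ξ + u))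
      (fun _ => hw.contDiffAt) (fun n _ => ⟨_, fun _ => le_rfl⟩)
      (fun _ => (h.χ_smooth.sub contDiff_const).contDiffAt) (fun n => ⟨0, le_rfl, fun _ => ?_⟩)
      fun _ => le_rfl
    have h2 : 2 ≤ ‖a⁻¹ • gradient g (ξ + 0)‖ := by
      rw [add_zero, norm_smul, norm_inv, Real.norm_of_nonneg ha.le, inv_mul_eq_div, le_div_iff₀ ha]
      exact hξ
    rw [zero_mul, norm_le_zero_iff]
    rcases Nat.eq_zero_or_pos n with rfl | hn
    · have h3 := h.χ_one _ h2
      rw [add_zero] at h3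
      ext
      simp [h3]
    · have h3 := iteratedFDeriv_sub_apply (x := a⁻¹ • gradient g (ξ + 0)) (i := n)
        (h.χ_smooth.of_le (m := n) (by exact_mod_cast le_top)).contDiffAt
        (contDiff_const (c := (1 : ℝ))).contDiffAt
      refine h3.trans ?_
      rw [iteratedFDeriv_cutoff_eq_zero_of_le h.χ_smooth h.χ_one hn h2,
        iteratedFDeriv_const_of_ne hn.ne']
      simp
  have hdiff : JetBdd (fun _ : Unit => (0 : ℝ)) fun _ u =>
      (ξ + u + gradX (fun p => χ (a⁻¹ • gradient g p.2) * G p) (x, ξ + u)) -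
        (ξ + u + gradX G (x, ξ + u)) := by
    have h1 := hcut.bilin (ContinuousLinearMap.lsmul ℝ ℝ (E := E N)) (JetBdd.single (J := Unit) hgrad)
    simp only [mul_one, ContinuousLinearMap.lsmul_apply] at h1
    refine h1.of_eventuallyEq fun _ => ?_
    filter_upwards [hT.eventually hev0] with u hu
    have h2 : gradX (fun p => χ (a⁻¹ • gradient g p.2) * G p) (x, ξ + u) =
        χ (a⁻¹ • gradient g (ξ + u)) • gradX G (x, ξ + u) := by
      have hd : DifferentiableAt ℝ (fun y => G (y, ξ + u)) x :=
        ((hGat (x, ξ + u) hu).comp x (f := fun y : E N => (y, ξ + u))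
          (contDiff_id.prodMk contDiff_const).contDiffAt).differentiableAt (by simp)
      rw [gradX, gradX, ← gradCLM_fderiv, ← gradCLM_fderiv]
      simp only
      rw [fderiv_const_mul hd, map_smul]
      rfl
    rw [add_sub_add_left_eq_sub, h2, sub_smul, one_smul]
  -- Consequently `g` at the gradient of the cut-off phase and at that of the full phase agree to
  -- infinite order.
  have hcomp := JetBdd.comp_sub (fun _ : Unit => hsh.contDiffAt.add hgradγ)
    (fun _ : Unit => hsh.contDiffAt.add hgrad) (fun n _ => ⟨_, fun _ => le_rfl⟩)
    (fun n _ => ⟨_, fun _ => le_rfl⟩) hdiff hgs h.g_bdd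
  refine iteratedFDeriv_eq_zero_of_jet (hcomp.of_eventuallyEq fun _ => ?_) n
  -- The full phase solves the eikonal equation on a neighbourhood of `ξ`, thanks to the room
  -- between `a` and `2a` and between `3 / 8` and `1 / 2`.
  have hev1 : ∀ᶠ η in nhds ξ, a < ‖gradient g η‖ :=
    hvc.norm.continuousAt.eventually (lt_mem_nhds (by linarith))
  have hev2 : ∀ᶠ η in nhds ξ, 3 / 8 < |cosAngle x (gradient g η)| := by
    have hcc : ContinuousAt (fun η => |cosAngle x (gradient g η)|) ξ :=
      ((contDiffAt_cosAngle (y := (x, gradient g ξ)) hx0 hv0).continuousAt.comp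
        (f := fun η => (x, gradient g η)) (by fun_prop)).abs
    exact hcc.eventually (lt_mem_nhds (by linarith))
  filter_upwards [hT.eventually hev1, hT.eventually hev2] with u h1 h2
  have h3 := hR (x, ξ + u) hx h1.le h2
  simp only [gradX]
  simp only at h3
  linarith

/-- Far out, the eikonal error has vanishing derivatives and only the second-order differences
contribute. On the bounded remaining set of positions the weaker estimate suffices. -/
theorem ScatteringHyp.exists_iteratedFDeriv_symbol_le (hf : IsHoppingFunction f)
    (h : ScatteringHyp χ (h0 f) V ε) (hV : IsLongRange ε V)
    (hG : IsCorrection χ (h0 f) V ε c G) {a : ℝ} (ha : 0 < a) {ϕ : E N → E N → ℝ}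
    (hϕ : ∀ x ξ, ϕ x ξ = χ (a⁻¹ • gradient (h0 f) ξ) * G (x, ξ) + dot x ξ) (n : ℕ) :
    ∃ C, ∀ x ξ, 1 ≤ ‖x‖ → 2 * a ≤ ‖gradient (h0 f) ξ‖ →
      1 / 2 ≤ |cosAngle x (gradient (h0 f) ξ)| →
      ‖iteratedFDeriv ℝ n (symbol f V ϕ x) ξ‖ ≤ C * bracket x ^ (-1 - ε) := by
  have hε0 := h.ε_pos
  have hε1 := h.ε_lt
  have hγ := hG.symb a ha
  have hγs := hγ.smooth ()
  obtain ⟨R, hR⟩ := hG.eikonal a ha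
  obtain ⟨C₁, hC₁0, hC₁⟩ := LatticeScattering.exists_iteratedFDeriv_symbol_le hf hε0 hε1 hV hγ hϕ n
  obtain ⟨C₂, d, hC₂0, hC₂⟩ := exists_cis_phaseStep_sub_linearStep_le hε0 hε1 hγ n
  have hS : 0 ≤ ∑' z, bracket (lat z) ^ d * ‖f z‖ :=
    tsum_nonneg fun z => mul_nonneg (pow_nonneg (bracket_pos _).le _) (norm_nonneg _)
  refine ⟨(∑' z, bracket (lat z) ^ d * ‖f z‖) * C₂ + C₁ * (1 + |R|), fun x ξ hx1 hξ hcos => ?_⟩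
  have hb := bracket_pos x
  have hp := Real.rpow_nonneg hb.le (-1 - ε)
  rw [add_mul]
  by_cases hx : R ≤ ‖x‖
  · refine le_add_of_le_of_nonneg ?_ (by positivity)
    set γ : E N × E N → ℝ := fun p => χ (a⁻¹ • gradient (h0 f) p.2) * G p with hγd
    have hA : ∀ z : Lattice N, ContDiff ℝ ∞ fun η => cis (phaseStep γ (lat z) x η) -
        cis (linearStep γ (lat z) x η) := fun z =>
      (contDiff_cis.comp (contDiff_phaseStep hγs _ x)).sub
        (contDiff_cis.comp (contDiff_linearStep hγs _ x))
    have hb : ∀ n : ℕ, ∃ (C : ℝ) (d : ℕ), ∀ (z : Lattice N) ξ, ‖iteratedFDeriv ℝ n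
        (fun η => cis (phaseStep γ (lat z) x η) - cis (linearStep γ (lat z) x η)) ξ‖ ≤
          C * bracket (lat z) ^ d := fun n => by
      obtain ⟨C, d, -, hC⟩ := exists_cis_phaseStep_sub_linearStep_le hε0 hε1 hγ n
      exact ⟨C * bracket x ^ (-1 - ε), d, fun z ξ => hC z x ξ⟩
    have he : ContDiff ℝ ∞ fun η => h0 f (η + gradient (fun y => γ (y, η)) x) + V x - h0 f η := by
      have h1 : ContDiff ℝ ∞ fun η => gradX γ (x, η) := contDiff_iff_contDiffAt.2 fun η =>
        (contDiffAt_gradX hγs.contDiffAt).comp η (contDiff_const.prodMk contDiff_id).contDiffAt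
      exact ((h.g_smooth.comp (contDiff_id.add h1)).add contDiff_const).sub h.g_smooth
    rw [show symbol f V ϕ x = _ from funext fun ξ => symbol_eq_tsum_sub_linearStep hf hγs hϕ x ξ]
    refine (norm_iteratedFDeriv_add_le (contDiff_hopSeries hf hA hb)
      (Complex.ofRealCLM.contDiff.comp he) n ξ).trans ?_
    have h0 : ‖iteratedFDeriv ℝ n (fun η => Complex.ofRealCLM
        (h0 f (η + gradient (fun y => γ (y, η)) x) + V x - h0 f η)) ξ‖ ≤ 0 := by
      refine (Complex.ofRealCLM.norm_iteratedFDeriv_comp_left (N := ∞) (n := n) (x := ξ) he.contDiffAt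
        (by exact_mod_cast le_top)).trans ?_
      rw [h.iteratedFDeriv_eikonal_eq_zero hG ha hR hx1 hx hξ hcos n, norm_zero, mul_zero]
    rw [mul_assoc]
    exact (add_le_add (norm_iteratedFDeriv_hopSeries_le hf hA hb fun z => hC₂ z x ξ) h0).trans_eq
      (add_zero _)
  -- Here `⟨x⟩ ≤ 1 + |R|`, so the missing power of `⟨x⟩` is a constant.
  · refine le_add_of_nonneg_of_le (by positivity) ((hC₁ x ξ).trans ?_)
    rw [mul_assoc]
    refine mul_le_mul_of_nonneg_left ?_ hC₁0
    rw [show -ε = -1 - ε + 1 by ring, Real.rpow_add_one hb.ne', mul_comm]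
    refine mul_le_mul_of_nonneg_right ?_ hp
    have h1 := bracket_le x
    have h2 := le_abs_self R
    linarith

end Remainder

/-! ### Mixed derivatives and the mixed Hessian -/

section MixedDerivatives

variable {N : ℕ} {γ : E N × E N → ℝ} {κ : ℝ}

theorem Symb.exists_listDeriv_snd (h : Symb (fun _ : Unit => 1) κ (fun _ => γ)) (l : List (Fin N)) :
    ∃ Ψ, Symb (fun _ : Unit => 1) κ (fun _ => Ψ) ∧
      ∀ x, listDeriv l (fun ξ => γ (x, ξ)) = fun ξ => Ψ (x, ξ) := by
  induction l with
  | nil => exact ⟨γ, h, fun x => rfl⟩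
  | cons j l ih =>
    obtain ⟨Ψ, hΨ, e⟩ := ih
    refine ⟨_, hΨ.dXi (EuclideanSpace.single j 1), fun x => ?_⟩
    change partialDeriv j (listDeriv l fun ξ => γ (x, ξ)) = _
    rw [e]
    exact funext fun ξ => partialDeriv_snd (hΨ.smooth ()) j x ξ

theorem Symb.exists_listDeriv_fst (h : Symb (fun _ : Unit => 1) κ (fun _ => γ)) (l : List (Fin N)) :
    ∃ Ψ, Symb (fun _ : Unit => 1) (κ - l.length) (fun _ => Ψ) ∧
      ∀ ξ, listDeriv l (fun x => γ (x, ξ)) = fun x => Ψ (x, ξ) := by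
  induction l with
  | nil => exact ⟨γ, by simpa using h, fun x => rfl⟩
  | cons j l ih =>
    obtain ⟨Ψ, hΨ, e⟩ := ih
    refine ⟨LatticeScattering.dX (EuclideanSpace.single j 1) Ψ, ?_, fun ξ => ?_⟩
    · have h1 := hΨ.dX (EuclideanSpace.single j 1)
      rw [List.length_cons]
      push_cast
      rwa [← sub_sub]
    · change partialDeriv j (listDeriv l fun x => γ (x, ξ)) = _
      rw [e]
      exact funext fun x => partialDeriv_fst (hΨ.smooth ()) j x ξ

theorem length_flatMap_replicate (α : Fin N → ℕ) :
    ((List.finRange N).flatMap fun j => List.replicate (α j) j).length = ∑ j, α j := by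
  simp [List.length_flatMap, Fin.sum_univ_def]

theorem Symb.exists_mixedDeriv_le (h : Symb (fun _ : Unit => 1) κ (fun _ => γ)) (α β : Fin N → ℕ) :
    ∃ C : ℝ, ∀ x ξ, |mixedDeriv α β (fun x ξ => γ (x, ξ)) x ξ| ≤
      C * bracket x ^ (κ - ((∑ j, α j : ℕ) : ℝ)) := by
  obtain ⟨Ψ, hΨ, e⟩ := h.exists_listDeriv_snd
    ((List.finRange N).flatMap fun j => List.replicate (β j) j)
  obtain ⟨Θ, hΘ, e'⟩ := hΨ.exists_listDeriv_fst
    ((List.finRange N).flatMap fun j => List.replicate (α j) j)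
  obtain ⟨C, -, hC⟩ := hΘ.le_bound
  refine ⟨C, fun x ξ => ?_⟩
  have h1 := hC () (x, ξ)
  rw [one_mul, length_flatMap_replicate] at h1
  rw [mixedDeriv]
  simp only [multiDeriv_eq_listDeriv]
  simp only [e]
  rw [e']
  exact h1

theorem mixedHessian_sub_one_apply (hγ : ContDiff ℝ ∞ γ) {ϕ : E N → E N → ℝ}
    (hϕ : ∀ x ξ, ϕ x ξ = γ (x, ξ) + dot x ξ) (x ξ : E N) (j k : Fin N) :
    (mixedHessian ϕ x ξ - 1) j k =
      dX (EuclideanSpace.single j 1) (dXi (EuclideanSpace.single k 1) γ) (x, ξ) := by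
  have h1 : (fun x => partialDeriv k (ϕ x) ξ) =
      fun x => dXi (EuclideanSpace.single k 1) γ (x, ξ) + EuclideanSpace.proj (𝕜 := ℝ) k x := by
    ext1 x
    rw [← partialDeriv_snd hγ, show ϕ x = fun ξ => γ (x, ξ) + innerSL ℝ x ξ from funext (hϕ x),
      partialDeriv, fderiv_fun_add ((contDiff_slice hγ x).differentiable (by simp) ξ)
        (innerSL ℝ x).differentiableAt, ContinuousLinearMap.fderiv]
    simp [partialDeriv, innerSL_apply_apply, EuclideanSpace.inner_single_right]
  have hd := contDiff_dXi hγ (EuclideanSpace.single k 1)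
  have h2 : ContDiff ℝ ∞ fun x => dXi (EuclideanSpace.single k 1) γ (x, ξ) := hd.comp (by fun_prop)
  rw [Matrix.sub_apply, mixedHessian, Matrix.of_apply, h1, ← partialDeriv_fst hd, partialDeriv,
    fderiv_fun_add (h2.differentiable (by simp) x)
      (EuclideanSpace.proj (𝕜 := ℝ) k).differentiableAt, ContinuousLinearMap.fderiv]
  simp [partialDeriv, Matrix.one_apply, eq_comm]

theorem hsNorm_le {M : Matrix (Fin N) (Fin N) ℝ} {c : ℝ} (hc : 0 ≤ c) (h : ∀ j k, |M j k| ≤ c) :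
    hsNorm M ≤ N * c := by
  rw [hsNorm, Real.sqrt_le_left (by positivity)]
  calc ∑ j, ∑ k, (M j k) ^ 2 ≤ ∑ _j : Fin N, ∑ _k : Fin N, c ^ 2 :=
        Finset.sum_le_sum fun j _ => Finset.sum_le_sum fun k _ => by
          rw [← sq_abs]
          exact pow_le_pow_left₀ (abs_nonneg _) (h j k) 2
    _ = _ := by
        simp
        ring

theorem cutPhase_correction (f : Lattice N → ℂ) (χ : E N → ℝ) (G : E N × E N → ℝ) (a : ℝ)
    (x ξ : E N) : cutPhase f χ (fun x ξ => dot x ξ + G (x, ξ)) a x ξ =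
      χ (a⁻¹ • gradient (h0 f) ξ) * G (x, ξ) + dot x ξ := by
  rw [cutPhase, velocity]
  ring

theorem contDiff_dot : ContDiff ℝ ∞ fun p : E N × E N => dot p.1 p.2 := by
  unfold dot
  exact contDiff_fst.inner ℝ contDiff_snd

theorem gradient_dot_add {G : E N → ℝ} {x : E N} (hG : DifferentiableAt ℝ G x) (ξ : E N) :
    gradient (fun y => dot y ξ + G y) x = ξ + gradient G x := by
  have h1 : (fun y : E N => dot y ξ + G y) = fun y => innerSL ℝ ξ y + G y := by
    ext1 y
    simp [dot, real_inner_comm]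
  rw [h1]
  refine HasGradientAt.gradient ?_
  rw [hasGradientAt_iff_hasFDerivAt, map_add]
  exact (innerSL ℝ ξ).hasFDerivAt.fun_add hG.hasGradientAt.hasFDerivAt

end MixedDerivatives

end LatticeScattering

end

/-! ### Assembly of the proposition -/

open LatticeScattering in
theorem proposition2p1 (N : ℕ) (hN : 1 ≤ N) (f : Lattice N → ℂ) (hf : FreeAssumption f)
    (ε : ℝ) (hε0 : 0 < ε) (hε1 : ε < 1) (V : E N → ℝ) (hV : IsLongRange ε V)
    (χ : E N → ℝ) (hχ : ContDiff ℝ ∞ χ) (hχ0 : ∀ x, ‖x‖ ≤ 1 → χ x = 0)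
    (hχ1 : ∀ x, 2 ≤ ‖x‖ → χ x = 1) :
    ∃ φ : E N → E N → ℝ,
      ContDiffOn ℝ ∞ (fun p : E N × E N => φ p.1 p.2) {p | velocity f p.2 ≠ 0} ∧
      ∀ a : ℝ, 0 < a →
        -- the eikonal equation in the outgoing and incoming regions
        (∃ R : ℝ, ∀ x ξ : E N, R ≤ ‖x‖ → a ≤ ‖velocity f ξ‖ →
          1 / 2 ≤ |cosAngle x (velocity f ξ)| →
          h0 f (gradient (fun x' => φ x' ξ) x) + V x = h0 f ξ) ∧
        -- smoothness and quasi-periodicity of the cut-off phase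
        ContDiff ℝ ∞ (fun p : E N × E N => cutPhase f χ φ a p.1 p.2) ∧
        (∀ (x ξ : E N) (m : Lattice N),
          cutPhase f χ φ a x (ξ + (2 * Real.pi) • lat m) =
            cutPhase f χ φ a x ξ + 2 * Real.pi * dot x (lat m)) ∧
        -- estimates of the cut-off phase
        (∀ α β : Fin N → ℕ, ∃ C : ℝ, ∀ x ξ : E N,
          |mixedDeriv α β (fun x' ξ' => cutPhase f χ φ a x' ξ' - dot x' ξ') x ξ| ≤
            C * bracket x ^ (1 - ε - ((∑ j, α j : ℕ) : ℝ))) ∧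
        (∀ x ξ : E N, hsNorm (mixedHessian (cutPhase f χ φ a) x ξ - 1) < 1 / 2) ∧
        -- the operator `H J_a - J_a H_0` and its symbol
        (∀ u : Lattice N → ℂ, Memℓp u 2 → ∀ x : Lattice N,
          Summable (fun y => f y * oscOp (cutPhase f χ φ a) (fun _ _ => 1) u (x - y)) ∧
          fullOp f V (oscOp (cutPhase f χ φ a) (fun _ _ => 1) u) x
              - oscOp (cutPhase f χ φ a) (fun _ _ => 1) (freeOp f u) x =
            oscOp (cutPhase f χ φ a) (symbol f V (cutPhase f χ φ a)) u x) ∧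
        (∀ (x : Lattice N) (ξ : E N),
          symbol f V (cutPhase f χ φ a) (lat x) ξ =
            Complex.exp (-(Complex.I * (cutPhase f χ φ a (lat x) ξ : ℝ))) *
              fullOp f V
                (fun y => Complex.exp (Complex.I * (cutPhase f χ φ a (lat y) ξ : ℝ))) x
              - (h0 f ξ : ℂ)) ∧
        -- smoothness and decay of the symbol
        (∀ x : E N, ContDiff ℝ ∞ (symbol f V (cutPhase f χ φ a) x)) ∧
        (∀ β : Fin N → ℕ, ∃ C : ℝ, ∀ x ξ : E N, 1 ≤ ‖x‖ → a ≤ ‖velocity f ξ‖ →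
          (2 * a ≤ ‖velocity f ξ‖ → 1 / 2 ≤ |cosAngle x (velocity f ξ)| →
            ‖multiDeriv β (symbol f V (cutPhase f χ φ a) x) ξ‖ ≤ C * bracket x ^ (-1 - ε)) ∧
          ‖multiDeriv β (symbol f V (cutPhase f χ φ a) x) ξ‖ ≤ C * bracket x ^ (-ε)) := by
  have hh := hf.hopping
  have h := scatteringHyp hh hε0 hε1 hV hχ hχ0 hχ1
  have hN' : (0 : ℝ) < N := by exact_mod_cast hN
  -- Entries of size at most `1 / (4 * N)` give a Hilbert-Schmidt norm at most `1 / 4`.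
  obtain ⟨G, hG⟩ := h.exists_isCorrection (c := 1 / (4 * N)) (by positivity)
  have hopen : IsOpen {p : E N × E N | gradient (h0 f) p.2 ≠ 0} :=
    isOpen_ne_fun ((contDiff_gradient h.g_smooth).continuous.comp continuous_snd) continuous_const
  refine ⟨fun x ξ => dot x ξ + G (x, ξ), contDiff_dot.contDiffOn.add hG.smooth, fun a ha => ?_⟩
  have hϕ := cutPhase_correction f χ G a
  have hγ := hG.symb a ha
  have hγs := hγ.smooth ()
  have hsm : ContDiff ℝ ∞ fun p : E N × E N =>
      cutPhase f χ (fun x ξ => dot x ξ + G (x, ξ)) a p.1 p.2 := by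
    simp only [hϕ]
    exact hγs.add contDiff_dot
  refine ⟨?_, hsm, fun x ξ m => ?_, fun α β => ?_, fun x ξ => ?_, fun u hu x =>
    ⟨summable_freeOp_oscOp hh _ u x, fullOp_oscOp_sub hh (fun x => ?_) hu x⟩,
    fun x ξ => symbol_eq_fullOp x ξ, fun x => contDiff_symbol hh hε0 hε1 hγ hϕ x, fun β => ?_⟩
  · obtain ⟨R, hR⟩ := hG.eikonal a ha
    refine ⟨R, fun x ξ hx hξ hcos => ?_⟩
    have hv : gradient (h0 f) ξ ≠ 0 := norm_pos_iff.1 (ha.trans_le hξ)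
    have hd : DifferentiableAt ℝ (fun y => G (y, ξ)) x :=
      ((hG.smooth.contDiffAt (hopen.mem_nhds (x := (x, ξ)) hv)).comp x (f := fun y : E N => (y, ξ))
        (contDiff_id.prodMk contDiff_const).contDiffAt).differentiableAt (by simp)
    rw [gradient_dot_add hd]
    -- The correction solves the eikonal equation already for cosines above `3 / 8`, which is less
    -- than `1 / 2`.
    exact hR (x, ξ) hx hξ (lt_of_lt_of_le (by norm_num) hcos)
  · have hp := gradient_periodic (h0_periodic hh m)
    have h1 := hG.periodic _ hp (x, ξ)
    simp only at h1
    rw [hϕ, hϕ, hp, h1]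
    simp only [dot, inner_add_right, real_inner_smul_right]
    ring
  · obtain ⟨C, hC⟩ := hγ.exists_mixedDeriv_le α β
    refine ⟨C, fun x ξ => ?_⟩
    simp only [hϕ, add_sub_cancel_right]
    exact hC x ξ
  · refine (hsNorm_le (c := 1 / (4 * N)) (by positivity) fun j k => ?_).trans_lt ?_
    · rw [mixedHessian_sub_one_apply hγs hϕ]
      exact hG.small a ha (x, ξ) j k
    · rw [show (N : ℝ) * (1 / (4 * N)) = 1 / 4 by field_simp]
      norm_num
  · exact (hsm.comp (contDiff_const.prodMk contDiff_id : ContDiff ℝ ∞ fun ξ : E N => (x, ξ))).continuous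
  · obtain ⟨n, hn⟩ := exists_norm_multiDeriv_le (F := ℂ) β
    obtain ⟨C₁, hC₁⟩ := h.exists_iteratedFDeriv_symbol_le hh hV hG ha hϕ n
    obtain ⟨C₂, hC₂0, hC₂⟩ := exists_iteratedFDeriv_symbol_le hh hε0 hε1 hV hγ hϕ n
    refine ⟨|C₁| + C₂, fun x ξ hx _ => ⟨fun hξ hcos => ?_, ?_⟩⟩
    all_goals
      refine (hn _ (contDiff_symbol hh hε0 hε1 hγ hϕ x) ξ).trans ?_
      have hb := bracket_pos x
    · refine (hC₁ x ξ hx hξ hcos).trans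
        (mul_le_mul_of_nonneg_right ?_ (Real.rpow_nonneg hb.le _))
      linarith [le_abs_self C₁]
    · refine (hC₂ x ξ).trans (mul_le_mul_of_nonneg_right ?_ (Real.rpow_nonneg hb.le _))
      linarith [abs_nonneg C₁]
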